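/- By an algebraic space we mean a sheaf of sets on the big étale site of schemes whose diagonal is representable by schemes and which admits an étale surjective morphism from a scheme; $|X|$ denotes the underlying topological space of an algebraic space $X$ (equivalence classes of field-valued points), and $\mathcal{O}_X$ its structure sheaf on the small étale site. Let $i_1 : Y \hookrightarrow X_1$ and $i_2 : Y \hookrightarrow X_2$ be closed immersions of algebraic spaces. Then there exist an algebraic space $W$ and morphisms $a : X_1 \to W$, $b : X_2 \to W$ such that the square $$\begin{array}{ccc} Y & \xrightarrow{\;i_2\;} & X_2 \\ {\scriptstyle i_1}\downarrow & & \downarrow{\scriptstyle b} \\ X_1 & \xrightarrow{\;a\;} & W \end{array}$$ is a pushout square in the category of algebraic spaces, i.e. $W = X_1 \amalg_Y X_2$. Moreover: 1. the square is cartesian; 2. $a$ and $b$ are closed immersions (hence so is $c := a \circ i_1 = b \circ i_2 : Y \to W$); 3. the pushout is topological: the induced square of topological spaces $|Y|, |X_1|, |X_2|, |W|$ is a pushout square in the category of topological spaces, i.e. $|W| = |X_1| \amalg_{|Y|} |X_2|$; 4. the sequence $$0 \longrightarrow \mathcal{O}_W \longrightarrow a_*\mathcal{O}_{X_1} \oplus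 b_*\mathcal{O}_{X_2} \longrightarrow c_*\mathcal{O}_Y \longrightarrow 0$$ of sheaves of abelian groups on the small étale site of $W$, with maps $s \mapsto (s|_{X_1}, s|_{X_2})$ and $(s,t) \mapsto s|_Y - t|_Y$, is exact. -/

import Mathlib

open CategoryTheory Limits Opposite AlgebraicGeometry

universe u

namespace AlgebraicSpace

noncomputable section

/-- An algebraic space: a sheaf of sets on the big étale site of schemes whose diagonal is
representable by schemes and which admits an étale surjective morphism from a scheme. -/
structure IsAlgebraicSpace (F : Scheme.{u}ᵒᵖ ⥤ Type u) : Prop where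
  isSheaf : Presheaf.IsSheaf Scheme.etaleTopology.{u} F
  representable_diag : yoneda.relativelyRepresentable (Limits.diag F)
  exists_atlas : ∃ (U : Scheme.{u}) (p : yoneda.obj U ⟶ F),
    MorphismProperty.presheaf @Etale.{u} p ∧ MorphismProperty.presheaf @Surjective.{u} p

/-- The category of algebraic spaces, a full subcategory of the category of presheaves of sets on
schemes. -/
abbrev AlgSp : Type (u + 1) :=
  ObjectProperty.FullSubcategory (fun F : Scheme.{u}ᵒᵖ ⥤ Type u => IsAlgebraicSpace F)

/-- A closed immersion of algebraic spaces: a morphism representable by schemes whose base change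
to any scheme is a closed immersion of schemes. -/
def IsClosedImm {X Y : AlgSp.{u}} (f : X ⟶ Y) : Prop :=
  MorphismProperty.presheaf @IsClosedImmersion.{u} f.hom

/-! ### The underlying topological space -/

/-- A field-valued point `Spec K ⟶ F`, given as an element of `F(Spec K)`. -/
structure FieldPoint (F : Scheme.{u}ᵒᵖ ⥤ Type u) : Type (u + 1) where
  K : Type u
  [field : Field K]
  pt : F.obj (op (Spec (CommRingCat.of K)))

attribute [instance] FieldPoint.field

/-- Restriction of an element of `F(Spec K)` along `Spec L ⟶ Spec K`. -/
def extend (F : Scheme.{u}ᵒᵖ ⥤ Type u) {K L : Type u} [Field K] [Field L] (φ : K →+* L)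
    (x : F.obj (op (Spec (CommRingCat.of K)))) : F.obj (op (Spec (CommRingCat.of L))) :=
  F.map (Spec.map (CommRingCat.ofHom φ)).op x

lemma extend_extend (F : Scheme.{u}ᵒᵖ ⥤ Type u) {K L M : Type u} [Field K] [Field L] [Field M]
    (φ : K →+* L) (ψ : L →+* M) (x : F.obj (op (Spec (CommRingCat.of K)))) :
    extend F ψ (extend F φ x) = extend F (ψ.comp φ) x := by
  simp only [extend, CommRingCat.ofHom_comp, Spec.map_comp, op_comp, Functor.map_comp_apply]

/-- Any two extensions of a field have a common extension. -/
lemma exists_common_extension {K L M : Type u} [Field K] [Field L] [Field M]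
    (φ : K →+* L) (ψ : K →+* M) :
    ∃ (Ω : Type u) (_ : Field Ω) (α : L →+* Ω) (β : M →+* Ω), α.comp φ = β.comp ψ := by
  let := φ.toAlgebra
  let := ψ.toAlgebra
  obtain ⟨m, hm⟩ := Ideal.exists_maximal (TensorProduct K L M)
  let : Field (TensorProduct K L M ⧸ m) := Ideal.Quotient.field m
  refine ⟨TensorProduct K L M ⧸ m, inferInstance,
    (Ideal.Quotient.mk m).comp Algebra.TensorProduct.includeLeftRingHom,
    (Ideal.Quotient.mk m).comp Algebra.TensorProduct.includeRight.toRingHom, ?_⟩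
  rw [RingHom.comp_assoc, RingHom.comp_assoc]
  congr 1
  exact Algebra.TensorProduct.includeLeftRingHom_comp_algebraMap

/-- Two field-valued points are equivalent if they agree over a common field extension. -/
def FieldPoint.setoid (F : Scheme.{u}ᵒᵖ ⥤ Type u) : Setoid (FieldPoint F) where
  r x y := ∃ (Ω : Type u) (_ : Field Ω) (α : x.K →+* Ω) (β : y.K →+* Ω),
    extend F α x.pt = extend F β y.pt
  iseqv :=
    { refl := fun x => ⟨x.K, inferInstance, RingHom.id _, RingHom.id _, rfl⟩
      symm := fun ⟨Ω, _, α, β, h⟩ => ⟨Ω, inferInstance, β, α, h.symm⟩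
      trans := by
        rintro x y z ⟨Ω, _, α, β, h⟩ ⟨Ω', _, α', β', h'⟩
        obtain ⟨Λ, _, γ, δ, e⟩ := exists_common_extension β α'
        refine ⟨Λ, inferInstance, γ.comp α, δ.comp β', ?_⟩
        rw [← extend_extend, h, extend_extend, e, ← extend_extend, h', extend_extend] }

/-- The set of points of `F`. -/
def Points (F : Scheme.{u}ᵒᵖ ⥤ Type u) : Type (u + 1) :=
  Quotient (FieldPoint.setoid F)

/-- The map `|T| → |F|` on points induced by a scheme `T` and a morphism `T ⟶ F`, given as
`t ∈ F(T)`. -/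
def Points.ofScheme {F : Scheme.{u}ᵒᵖ ⥤ Type u} {T : Scheme.{u}} (t : F.obj (op T)) (x : T) :
    Points F :=
  Quotient.mk (FieldPoint.setoid F)
    { K := T.residueField x
      pt := F.map (T.fromSpecResidueField x).op t }

/-- The topology on `|F|`: a set is open iff its preimage under `|T| → |F|` is open for every
morphism `T ⟶ F` from a scheme. When `F` is an algebraic space it is enough to test this on one
étale surjective morphism from a scheme. -/
instance (F : Scheme.{u}ᵒᵖ ⥤ Type u) : TopologicalSpace (Points F) where
  IsOpen s := ∀ (T : Scheme.{u}) (t : F.obj (op T)), IsOpen (Points.ofScheme t ⁻¹' s)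
  isOpen_univ := fun _ _ => isOpen_univ
  isOpen_inter := fun _ _ hs ht T t => (hs T t).inter (ht T t)
  isOpen_sUnion := fun S hS T t => by
    rw [Set.preimage_sUnion]
    exact isOpen_biUnion fun s hs => hS s hs T t

/-- The map on points induced by a morphism. -/
def Points.map {F G : Scheme.{u}ᵒᵖ ⥤ Type u} (f : F ⟶ G) : Points F → Points G :=
  Quotient.map'
    (fun x => { K := x.K, pt := f.app _ x.pt }) (by
      rintro x y ⟨Ω, _, α, β, h⟩
      refine ⟨Ω, inferInstance, α, β, ?_⟩
      have := congrArg (f.app _) h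
      simpa only [extend, NatTrans.naturality_apply] using this)

lemma Points.map_ofScheme {F G : Scheme.{u}ᵒᵖ ⥤ Type u} (f : F ⟶ G) {T : Scheme.{u}}
    (t : F.obj (op T)) (x : T) :
    Points.map f (Points.ofScheme t x) = Points.ofScheme (f.app _ t) x := by
  simp only [Points.map, Points.ofScheme, Quotient.map'_mk, NatTrans.naturality_apply]
  rfl

lemma Points.continuous_map {F G : Scheme.{u}ᵒᵖ ⥤ Type u} (f : F ⟶ G) :
    Continuous (Points.map f) := by
  refine ⟨fun s hs T t => ?_⟩
  have := hs T (f.app _ t)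
  have e : Points.map f ∘ Points.ofScheme t = Points.ofScheme (f.app _ t) :=
    funext (Points.map_ofScheme f t)
  rwa [← Set.preimage_comp, e]

/-- The functor sending an algebraic space `X` to its underlying topological space `|X|`. -/
def topSpace : AlgSp.{u} ⥤ TopCat.{u + 1} where
  obj X := TopCat.of (Points X.obj)
  map f := TopCat.ofHom ⟨Points.map f.hom, Points.continuous_map f.hom⟩
  map_id X := by
    ext x
    induction x using Quotient.inductionOn
    rfl
  map_comp f g := by
    ext x
    induction x using Quotient.inductionOn
    rfl

/-! ### The small étale site -/

/-- An object of the small étale site of `X`: a scheme with an étale morphism to `X`. -/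
structure SmallEtale (X : Scheme.{u}ᵒᵖ ⥤ Type u) : Type (u + 1) where
  left : Scheme.{u}
  hom : yoneda.obj left ⟶ X
  etale : MorphismProperty.presheaf @Etale.{u} hom

namespace SmallEtale

variable {X W : Scheme.{u}ᵒᵖ ⥤ Type u}

/-- A morphism of the small étale site of `X`: a morphism of schemes over `X`. -/
@[ext]
structure Hom (U V : SmallEtale X) : Type u where
  left : U.left ⟶ V.left
  w : yoneda.map left ≫ V.hom = U.hom

instance : Category (SmallEtale X) where
  Hom := Hom
  id U := ⟨𝟙 _, by simp⟩
  comp f g := ⟨f.left ≫ g.left, by rw [Functor.map_comp, Category.assoc, g.w, f.w]⟩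

@[ext]
lemma hom_ext {U V : SmallEtale X} {f g : U ⟶ V} (h : f.left = g.left) : f = g :=
  Hom.ext h

@[simp]
lemma id_left (U : SmallEtale X) : (𝟙 U : U ⟶ U).left = 𝟙 U.left := rfl

@[simp]
lemma comp_left {U V T : SmallEtale X} (f : U ⟶ V) (g : V ⟶ T) :
    (f ≫ g).left = f.left ≫ g.left := rfl

/-- The functor sending an étale morphism `U ⟶ X` to the scheme `U`. -/
@[simps]
def toScheme (X : Scheme.{u}ᵒᵖ ⥤ Type u) : SmallEtale X ⥤ Scheme.{u} where
  obj U := U.left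
  map f := f.left

/-- Every morphism of the small étale site is étale. -/
lemma etale_left {U V : SmallEtale X} (f : U ⟶ V) : Etale f.left := by
  have hV := V.etale
  have hU := U.etale
  let s : U.left ⟶ hV.rep.pullback U.hom :=
    hV.rep.lift (yoneda.map f.left) (𝟙 _) (by simpa using f.w)
  have hs : s ≫ hV.rep.snd U.hom = 𝟙 _ := hV.rep.lift_snd _ _ _
  have hs' : s ≫ hV.rep.fst' U.hom = f.left := by
    apply yoneda.map_injective
    rw [Functor.map_comp, hV.rep.map_fst']
    exact hV.rep.lift_fst _ _ _
  have h1 : Etale (hV.rep.snd U.hom) := hV.property_snd U.hom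
  have h2 : Etale s := by
    have : Etale (s ≫ hV.rep.snd U.hom) := by rw [hs]; infer_instance
    exact MorphismProperty.of_postcomp (W := @Etale) (W' := @Etale) _ _ h1 this
  have h3 : Etale (hV.rep.fst' U.hom) :=
    hU.property V.hom (yoneda.map (hV.rep.snd U.hom)) (hV.rep.fst' U.hom)
      (hV.rep.isPullback' U.hom).flip
  rw [← hs']
  infer_instance

/-- The fibre product in the small étale site. -/
def fiberProduct {U V T : SmallEtale X} (f : U ⟶ T) (g : V ⟶ T) : SmallEtale X where
  left := pullback f.left g.left
  hom := yoneda.map (pullback.fst f.left g.left) ≫ U.hom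
  etale := by
    have := etale_left g
    have h : MorphismProperty.presheaf @Etale.{u}
        (yoneda.map (pullback.fst f.left g.left)) :=
      MorphismProperty.relative_map (P := @Etale) (F := yoneda) (inferInstance)
    have hE : MorphismProperty.IsMultiplicative @Etale.{u} := inferInstance
    have := hE.toIsStableUnderComposition
    have := MorphismProperty.relative_isStableUnderComposition (F := yoneda) (P := @Etale.{u})
    exact this.comp_mem _ _ h U.etale

/-- The first projection of the fibre product. -/
def fiberProductFst {U V T : SmallEtale X} (f : U ⟶ T) (g : V ⟶ T) : fiberProduct f g ⟶ U :=
  ⟨pullback.fst f.left g.left, rfl⟩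

/-- The second projection of the fibre product. -/
def fiberProductSnd {U V T : SmallEtale X} (f : U ⟶ T) (g : V ⟶ T) : fiberProduct f g ⟶ V :=
  ⟨pullback.snd f.left g.left, by
    change yoneda.map (pullback.snd f.left g.left) ≫ V.hom =
      yoneda.map (pullback.fst f.left g.left) ≫ U.hom
    rw [← f.w, ← g.w, ← Functor.map_comp_assoc, ← Functor.map_comp_assoc, pullback.condition]⟩

lemma fiberProduct_condition {U V T : SmallEtale X} (f : U ⟶ T) (g : V ⟶ T) :
    fiberProductFst f g ≫ f = fiberProductSnd f g ≫ g :=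
  hom_ext pullback.condition

/-- The étale topology on the small étale site: a sieve on `U` is covering iff its members are
jointly surjective onto `U`. -/
def topology (X : Scheme.{u}ᵒᵖ ⥤ Type u) : GrothendieckTopology (SmallEtale X) where
  sieves U := {S | ∀ x : U.left, ∃ (V : SmallEtale X) (f : V ⟶ U) (y : V.left),
    S f ∧ f.left y = x}
  top_mem' U x := ⟨U, 𝟙 U, x, trivial, rfl⟩
  pullback_stable' U V S g hS x := by
    obtain ⟨T, f, y, hf, hy⟩ := hS (g.left x)
    obtain ⟨z, hz, -⟩ := Scheme.Pullback.exists_preimage_pullback (f := g.left) (g := f.left) x y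
      hy.symm
    refine ⟨fiberProduct g f, fiberProductFst g f, z, ?_, hz⟩
    change S (fiberProductFst g f ≫ g)
    rw [fiberProduct_condition]
    exact S.downward_closed hf _
  transitive' U S hS R hR x := by
    obtain ⟨V, f, y, hf, rfl⟩ := hS x
    obtain ⟨T, g, z, hg, rfl⟩ := hR hf y
    exact ⟨T, g ≫ f, z, hg, by simp⟩

lemma coverPreserving_toScheme :
    CoverPreserving (topology X) Scheme.etaleTopology (toScheme X) where
  cover_preserve {U S} hS := by
    refine (Scheme.mem_grothendieckTopology_iff (P := @Etale)).2 ?_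
    choose V f y hf hy using hS
    have he (x) : Etale (f x).left := etale_left (f x)
    refine ⟨Scheme.Cover.mkOfCovers (P := @Etale) U.left (fun x => (V x).left)
      (fun x => (f x).left) (fun x => ⟨x, y x, hy x⟩) he, ?_⟩
    rintro _ _ ⟨x⟩
    exact ⟨V x, f x, 𝟙 _, hf x, (Category.id_comp _).symm⟩

instance : (toScheme X).IsContinuous (topology X) Scheme.etaleTopology := by
  refine Functor.isContinuous_of_coverPreserving ⟨?_⟩ coverPreserving_toScheme
  intro ℱ Z T x hx Y₁ Y₂ A f₁ f₂ g₁ g₂ hg₁ hg₂ h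
  let l : A ⟶ (toScheme X).obj (fiberProduct g₁ g₂) := pullback.lift f₁ f₂ h
  have h1 : l ≫ (toScheme X).map (fiberProductFst g₁ g₂) = f₁ := pullback.lift_fst _ _ _
  have h2 : l ≫ (toScheme X).map (fiberProductSnd g₁ g₂) = f₂ := pullback.lift_snd _ _ _
  have := congrArg (ℱ.obj.map l.op) (hx _ _ hg₁ hg₂ (fiberProduct_condition g₁ g₂))
  rw [← h1, ← h2]
  simpa only [op_comp, Functor.map_comp_apply] using! this

end SmallEtale

/-! ### Structure sheaves and direct images -/

/-- The presheaf `U ↦ Γ(U, 𝒪_U)` of abelian groups on the category of schemes. -/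
def globalSections : Scheme.{u}ᵒᵖ ⥤ AddCommGrpCat.{u} :=
  Scheme.Γ ⋙ forget₂ CommRingCat RingCat ⋙ forget₂ RingCat AddCommGrpCat

lemma isSheaf_globalSections :
    Presheaf.IsSheaf Scheme.etaleTopology.{u} globalSections.{u} := by
  have : Scheme.etaleTopology.{u}.Subcanonical :=
    .of_le (Scheme.etaleTopology_le_proetaleTopology)
  let e : yoneda.obj (Spec (CommRingCat.of (MvPolynomial PUnit.{u + 1} (ULift.{u} ℤ)))) ≅
      globalSections.{u} ⋙ forget AddCommGrpCat.{u} :=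
    NatIso.ofComponents
      (fun T => ((AffineSpace.toSpecMvPolyIntEquiv PUnit.{u + 1} (X := T.unop)).trans
        (Equiv.funUnique PUnit.{u + 1} _)).toIso) (by
          intro S T f
          ext g
          change (f.unop ≫ g).appTop _ = f.unop.appTop (g.appTop _)
          simp
          rfl)
  have h : Presheaf.IsSheaf Scheme.etaleTopology.{u}
      (globalSections.{u} ⋙ forget AddCommGrpCat.{u}) := by
    rw [← Presheaf.isSheaf_of_iso_iff e, isSheaf_iff_isSheaf_of_type]
    exact GrothendieckTopology.Subcanonical.isSheaf_of_isRepresentable _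
  exact Presheaf.isSheaf_of_isSheaf_comp _ _ (forget AddCommGrpCat.{u}) h

/-- The structure sheaf `U ↦ Γ(U, 𝒪_U)` on the small étale site of `X`, as a sheaf of abelian
groups. -/
def structureSheaf (X : Scheme.{u}ᵒᵖ ⥤ Type u) :
    Sheaf (SmallEtale.topology X) AddCommGrpCat.{u} :=
  ((SmallEtale.toScheme X).sheafPushforwardContinuous _ _ Scheme.etaleTopology).obj
    ⟨globalSections, isSheaf_globalSections⟩

section

variable {X Y W : Scheme.{u}ᵒᵖ ⥤ Type u}

/-- The morphism `V ×_W X ⟶ V' ×_W X` induced by a morphism `V ⟶ V'`. -/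
def baseChangeMap {f : X ⟶ W} (hf : yoneda.relativelyRepresentable f)
    {V V' : SmallEtale W} (g : V ⟶ V') : hf.pullback V.hom ⟶ hf.pullback V'.hom :=
  hf.lift (hf.fst V.hom) (hf.snd V.hom ≫ g.left) (by
    rw [hf.w, Functor.map_comp, Category.assoc, g.w])

lemma baseChangeMap_fst {f : X ⟶ W} (hf : yoneda.relativelyRepresentable f)
    {V V' : SmallEtale W} (g : V ⟶ V') :
    yoneda.map (baseChangeMap hf g) ≫ hf.fst V'.hom = hf.fst V.hom :=
  hf.lift_fst _ _ _

lemma baseChangeMap_snd {f : X ⟶ W} (hf : yoneda.relativelyRepresentable f)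
    {V V' : SmallEtale W} (g : V ⟶ V') :
    baseChangeMap hf g ≫ hf.snd V'.hom = hf.snd V.hom ≫ g.left :=
  hf.lift_snd _ _ _

/-- Base change `V ↦ V ×_W X` of the small étale sites along a morphism `f : X ⟶ W` representable
by schemes. -/
def baseChange {f : X ⟶ W} (hf : yoneda.relativelyRepresentable f) :
    SmallEtale W ⥤ SmallEtale X where
  obj V :=
    { left := hf.pullback V.hom
      hom := hf.fst V.hom
      etale := (MorphismProperty.relative_isStableUnderBaseChange _).of_isPullback
        (hf.isPullback V.hom).flip V.etale }
  map g := ⟨baseChangeMap hf g, baseChangeMap_fst hf g⟩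
  map_id V := by
    apply SmallEtale.hom_ext
    apply hf.hom_ext <;> simp [baseChangeMap_fst, baseChangeMap_snd]
  map_comp g h := by
    apply SmallEtale.hom_ext
    apply hf.hom_ext
    · change yoneda.map (baseChangeMap hf (g ≫ h)) ≫ _ =
        yoneda.map (baseChangeMap hf g ≫ baseChangeMap hf h) ≫ _
      rw [Functor.map_comp, Category.assoc, baseChangeMap_fst, baseChangeMap_fst,
        baseChangeMap_fst]
    · change baseChangeMap hf (g ≫ h) ≫ _ = (baseChangeMap hf g ≫ baseChangeMap hf h) ≫ _
      rw [Category.assoc, baseChangeMap_snd, baseChangeMap_snd, ← Category.assoc,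
        baseChangeMap_snd, Category.assoc, SmallEtale.comp_left]

lemma baseChange_coverPreserving {f : X ⟶ W} (hf : yoneda.relativelyRepresentable f) :
    CoverPreserving (SmallEtale.topology W) (SmallEtale.topology X) (baseChange hf) where
  cover_preserve {V S} hS := by
    intro z
    obtain ⟨T, g, t, hg, ht⟩ := hS (hf.snd V.hom z)
    have sq : IsPullback (baseChangeMap hf g) (hf.snd T.hom) (hf.snd V.hom) g.left := by
      apply IsPullback.of_map yoneda (baseChangeMap_snd hf g)
      have h : IsPullback (hf.fst T.hom) (yoneda.map (hf.snd T.hom)) f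
          (yoneda.map g.left ≫ V.hom) := by
        rw [g.w]
        exact hf.isPullback T.hom
      rw [← baseChangeMap_fst hf g] at h
      refine (IsPullback.of_bot h.flip ?_ (hf.isPullback V.hom).flip).flip
      rw [← Functor.map_comp, ← Functor.map_comp, baseChangeMap_snd]
    obtain ⟨y, hy, -⟩ := Scheme.Pullback.exists_preimage_pullback z t ht.symm
    refine ⟨(baseChange hf).obj T, (baseChange hf).map g, sq.isoPullback.inv y,
      ⟨T, g, 𝟙 _, hg, (Category.id_comp _).symm⟩, ?_⟩
    have e : (sq.isoPullback.inv ≫ baseChangeMap hf g) y =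
        pullback.fst (hf.snd V.hom) g.left y := by
      rw [sq.isoPullback_inv_fst]
    exact ((Scheme.Hom.comp_apply _ _ y).symm.trans e).trans hy

instance baseChange_isContinuous {f : X ⟶ W} (hf : yoneda.relativelyRepresentable f) :
    (baseChange hf).IsContinuous (SmallEtale.topology W) (SmallEtale.topology X) := by
  refine Functor.isContinuous_of_coverPreserving ⟨?_⟩ (baseChange_coverPreserving hf)
  intro ℱ Z T x hx Y₁ Y₂ A f₁ f₂ g₁ g₂ hg₁ hg₂ h
  obtain ⟨m₁, hm₁⟩ : ∃ m : A.left ⟶ hf.pullback Y₁.hom, m = f₁.left := ⟨_, rfl⟩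
  obtain ⟨m₂, hm₂⟩ : ∃ m : A.left ⟶ hf.pullback Y₂.hom, m = f₂.left := ⟨_, rfl⟩
  have e₁ : yoneda.map m₁ ≫ hf.fst Y₁.hom = A.hom := hm₁ ▸ f₁.w
  have h' : (m₁ ≫ hf.snd Y₁.hom) ≫ g₁.left = (m₂ ≫ hf.snd Y₂.hom) ≫ g₂.left := by
    have h₀ : m₁ ≫ baseChangeMap hf g₁ = m₂ ≫ baseChangeMap hf g₂ := by
      rw [hm₁, hm₂]
      exact congrArg SmallEtale.Hom.left h
    rw [Category.assoc, Category.assoc, ← baseChangeMap_snd, ← baseChangeMap_snd,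
      reassoc_of% h₀]
  let l₀ : A.left ⟶ pullback g₁.left g₂.left :=
    pullback.lift (m₁ ≫ hf.snd Y₁.hom) (m₂ ≫ hf.snd Y₂.hom) h'
  have hl₀ : A.hom ≫ f = yoneda.map l₀ ≫ (SmallEtale.fiberProduct g₁ g₂).hom := by
    change _ = yoneda.map l₀ ≫ yoneda.map (pullback.fst g₁.left g₂.left) ≫ Y₁.hom
    rw [← Functor.map_comp_assoc, pullback.lift_fst, Functor.map_comp, Category.assoc, ← hf.w,
      reassoc_of% e₁]
  let m : A.left ⟶ hf.pullback (SmallEtale.fiberProduct g₁ g₂).hom := hf.lift A.hom l₀ hl₀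
  have hm : m ≫ hf.snd (SmallEtale.fiberProduct g₁ g₂).hom = l₀ := hf.lift_snd _ _ _
  let l : A ⟶ (baseChange hf).obj (SmallEtale.fiberProduct g₁ g₂) := ⟨m, hf.lift_fst _ _ _⟩
  have key {B : SmallEtale W} (p : SmallEtale.fiberProduct g₁ g₂ ⟶ B)
      (q : A ⟶ (baseChange hf).obj B) (r : A.left ⟶ hf.pullback B.hom) (hr : r = q.left)
      (hpq : l₀ ≫ p.left = r ≫ hf.snd B.hom) :
      l ≫ (baseChange hf).map p = q := by
    apply SmallEtale.hom_ext
    rw [← hr]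
    apply hf.hom_ext
    · rw [hr]
      exact (l ≫ (baseChange hf).map p).w.trans q.w.symm
    · change (m ≫ baseChangeMap hf p) ≫ hf.snd B.hom = _
      rw [Category.assoc, baseChangeMap_snd, reassoc_of% hm]
      exact hpq
  have h1 : l ≫ (baseChange hf).map (SmallEtale.fiberProductFst g₁ g₂) = f₁ :=
    key _ _ m₁ hm₁ (pullback.lift_fst _ _ _)
  have h2 : l ≫ (baseChange hf).map (SmallEtale.fiberProductSnd g₁ g₂) = f₂ :=
    key _ _ m₂ hm₂ (pullback.lift_snd _ _ _)
  have := congrArg (ℱ.obj.map l.op) (hx _ _ hg₁ hg₂ (SmallEtale.fiberProduct_condition g₁ g₂))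
  rw [← h1, ← h2]
  simpa only [op_comp, Functor.map_comp_apply] using! this

lemma globalSections_square {A B C D : Scheme.{u}} {p : A ⟶ B} {q : B ⟶ D} {r : A ⟶ C} {s : C ⟶ D}
    (h : p ≫ q = r ≫ s) :
    globalSections.map q.op ≫ globalSections.map p.op =
      globalSections.map s.op ≫ globalSections.map r.op := by
  rw [← Functor.map_comp, ← Functor.map_comp, ← op_comp, ← op_comp, h]

/-- The direct image functor `f_*`, `(f_* G)(V) = G(V ×_W X)`, on abelian sheaves for the small
étale sites, for a morphism `f : X ⟶ W` representable by schemes. -/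
def pushforward {f : X ⟶ W} (hf : yoneda.relativelyRepresentable f) :
    Sheaf (SmallEtale.topology X) AddCommGrpCat.{u} ⥤
      Sheaf (SmallEtale.topology W) AddCommGrpCat.{u} :=
  (baseChange hf).sheafPushforwardContinuous _ _ _

/-- The canonical map `𝒪_W ⟶ f_* 𝒪_X`, restricting functions from `V` to `V ×_W X`. -/
def comorphism {f : X ⟶ W} (hf : yoneda.relativelyRepresentable f) :
    structureSheaf W ⟶ (pushforward hf).obj (structureSheaf X) where
  hom :=
    { app := fun V => globalSections.map (hf.snd V.unop.hom).op
      naturality := fun _ _ g => globalSections_square (baseChangeMap_snd hf g.unop).symm }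

/-- For `c = g ≫ f`, the morphism `V ×_W Y ⟶ V ×_W X` induced by `g : Y ⟶ X`. -/
def pullbackMap {f : X ⟶ W} (hf : yoneda.relativelyRepresentable f) (g : Y ⟶ X)
    {c : Y ⟶ W} (hc : yoneda.relativelyRepresentable c) (e : g ≫ f = c) (V : SmallEtale W) :
    hc.pullback V.hom ⟶ hf.pullback V.hom :=
  hf.lift (hc.fst V.hom ≫ g) (hc.snd V.hom) (by rw [Category.assoc, e, hc.w])

lemma pullbackMap_fst {f : X ⟶ W} (hf : yoneda.relativelyRepresentable f) (g : Y ⟶ X)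
    {c : Y ⟶ W} (hc : yoneda.relativelyRepresentable c) (e : g ≫ f = c) (V : SmallEtale W) :
    yoneda.map (pullbackMap hf g hc e V) ≫ hf.fst V.hom = hc.fst V.hom ≫ g :=
  hf.lift_fst _ _ _

lemma pullbackMap_snd {f : X ⟶ W} (hf : yoneda.relativelyRepresentable f) (g : Y ⟶ X)
    {c : Y ⟶ W} (hc : yoneda.relativelyRepresentable c) (e : g ≫ f = c) (V : SmallEtale W) :
    pullbackMap hf g hc e V ≫ hf.snd V.hom = hc.snd V.hom :=
  hf.lift_snd _ _ _

lemma pullbackMap_naturality {f : X ⟶ W} (hf : yoneda.relativelyRepresentable f) (g : Y ⟶ X)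
    {c : Y ⟶ W} (hc : yoneda.relativelyRepresentable c) (e : g ≫ f = c) {V V' : SmallEtale W}
    (h : V ⟶ V') :
    pullbackMap hf g hc e V ≫ baseChangeMap hf h =
      baseChangeMap hc h ≫ pullbackMap hf g hc e V' := by
  apply hf.hom_ext
  · rw [Functor.map_comp, Functor.map_comp, Category.assoc, Category.assoc, baseChangeMap_fst,
      pullbackMap_fst, pullbackMap_fst, ← Category.assoc, baseChangeMap_fst]
  · rw [Category.assoc, Category.assoc, baseChangeMap_snd, pullbackMap_snd, baseChangeMap_snd,
      ← Category.assoc, pullbackMap_snd]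

/-- For `c = g ≫ f`, the canonical map `f_* 𝒪_X ⟶ c_* 𝒪_Y`, restricting functions from
`V ×_W X` to `V ×_W Y`. -/
def pushforwardComorphism {f : X ⟶ W} (hf : yoneda.relativelyRepresentable f) (g : Y ⟶ X)
    {c : Y ⟶ W} (hc : yoneda.relativelyRepresentable c) (e : g ≫ f = c) :
    (pushforward hf).obj (structureSheaf X) ⟶ (pushforward hc).obj (structureSheaf Y) where
  hom :=
    { app := fun V => globalSections.map (pullbackMap hf g hc e V.unop).op
      naturality := fun _ _ h =>
        globalSections_square (pullbackMap_naturality hf g hc e h.unop) }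

lemma comorphism_comp {f : X ⟶ W} (hf : yoneda.relativelyRepresentable f) (g : Y ⟶ X)
    {c : Y ⟶ W} (hc : yoneda.relativelyRepresentable c) (e : g ≫ f = c) :
    comorphism hf ≫ pushforwardComorphism hf g hc e = comorphism hc := by
  ext V : 3
  refine (globalSections.map_comp _ _).symm.trans ?_
  exact congrArg (fun q => globalSections.map (Quiver.Hom.op q)) (pullbackMap_snd hf g hc e V.unop)

end

instance {C : Type (u + 1)} [Category.{u} C] (J : GrothendieckTopology C) :
    HasBinaryBiproducts (Sheaf J AddCommGrpCat.{u}) :=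
  HasBinaryBiproducts.of_hasBinaryProducts

/-- For a commutative square of algebraic spaces `i₁ ≫ a = i₂ ≫ b` with diagonal `c : Y ⟶ W`, all
of whose maps to `W` are representable by schemes, the sequence
`𝒪_W ⟶ a_* 𝒪_{X₁} ⊕ b_* 𝒪_{X₂} ⟶ c_* 𝒪_Y` of abelian sheaves on the small étale site of `W`;
the maps are `s ↦ (s|_{X₁}, s|_{X₂})` and `(s, t) ↦ s|_Y - t|_Y`. -/
def gluingSequence {Y X₁ X₂ W : AlgSp.{u}} (i₁ : Y ⟶ X₁) (i₂ : Y ⟶ X₂) (a : X₁ ⟶ W) (b : X₂ ⟶ W)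
    (c : Y ⟶ W) (ha : yoneda.relativelyRepresentable a.hom)
    (hb : yoneda.relativelyRepresentable b.hom) (hc : yoneda.relativelyRepresentable c.hom)
    (ea : i₁ ≫ a = c) (eb : i₂ ≫ b = c) :
    ShortComplex (Sheaf (SmallEtale.topology W.obj) AddCommGrpCat.{u}) where
  X₁ := structureSheaf W.obj
  X₂ := (pushforward ha).obj (structureSheaf X₁.obj) ⊞ (pushforward hb).obj (structureSheaf X₂.obj)
  X₃ := (pushforward hc).obj (structureSheaf Y.obj)
  f := biprod.lift (comorphism ha) (comorphism hb)
  g := biprod.desc (pushforwardComorphism ha i₁.hom hc (congrArg (·.hom) ea))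
    (-pushforwardComorphism hb i₂.hom hc (congrArg (·.hom) eb))
  zero := by simp [comorphism_comp]

end

end AlgebraicSpace

open AlgebraicSpace

open CategoryTheory Limits Opposite AlgebraicGeometry

namespace AlgebraicSpace

/-! ### Pointwise reasoning with presheaves -/

section Presheaf

variable {F G H K X : Scheme.{u}ᵒᵖ ⥤ Type u}

/-! The pushout is built étale locally, where it is affine. Two affine schemes sharing a closed
subscheme have as pushout the spectrum of the fibre product of their rings. This is recorded as
`IsGlued`: an affine `U` with closed pieces `U₁` and `U₂` meeting in `U₀`, such that a function on
`U` vanishing on both pieces is zero. The algebraic engine is `etale_of_etale_quotients`. Let A → A₁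
and A → A₂ be surjective with kernels satisfying I₁ ∩ I₂ = 0; then an A-algebra is étale as soon as
its base changes to A₁ and A₂ are. For flatness, every ideal of A is an extension of an A-submodule
of A₁ by an A-submodule of A₂. For unramifiedness and finiteness, I₁I₂ = 0 is enough.

A `Chart` is a glued affine scheme whose pieces are étale over X₁ and X₂ and restrict to the same
étale piece over Y. Charts cover X₁ and X₂ (`exists_chart_of_atlas`), because étale schemes over Y
extend locally to étale schemes over X₁ and X₂ (`exists_etale_lift`). A morphism of charts is
cartesian over each piece, hence étale by the engine. The space W is the étale sheaf quotient of all
charts, two sections being identified when they lift to a common chart. A small covering family of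
charts bounds the size of W.

The main difficulty is that W is an algebraic space. The fibre product over W of two charts is
covered by open subsheaves, each represented by a chart, coming from compatible affine opens of U₁
×_{X₁} U₁' and U₂ ×_{X₂} U₂'. So it is a scheme étale over both charts
(`Chart.exists_isPullback_quotient`). A fibre product T ×_W T' of arbitrary schemes is then a
subsheaf of T × T' that is, étale locally, a scheme locally of finite type. Such a subsheaf is
representable (`isRepresentable_of_etale_local`): monomorphisms locally of finite type from
quasi-compact schemes to affine ones have quasi-affine source by Zariski's Main Theorem, and
quasi-affine schemes descend.

The remaining claims are local on charts. The preimages of X₁ and X₂ in a chart are its two pieces,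
so the maps to W are closed immersions and the square is cartesian. A glued affine scheme has the
universal property against every algebraic space Z (`IsGlued.exists_algebraicSpace_desc`):
uniqueness holds because the equalizer of two sections is étale over U by the engine, and existence
by lifting étale locally to an affine open of an atlas of Z. The topology is that of two closed
subsets covering |W|. The exact sequence is the fibre product description of functions on a glued
scheme. -/

lemma map_app_yoneda {U T T' : Scheme.{u}} (p : yoneda.obj U ⟶ X) (g : T' ⟶ T) (t : T ⟶ U) :
    X.map g.op (p.app (op T) t) = p.app (op T') (g ≫ t) :=
  (NatTrans.naturality_apply p g.op t).symm

lemma map_map {T T' T'' : Scheme.{u}} (g : T' ⟶ T) (h : T'' ⟶ T') (x : X.obj (op T)) :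
    X.map h.op (X.map g.op x) = X.map (h ≫ g).op x := by
  rw [op_comp, Functor.map_comp_apply]

lemma map_app (f : F ⟶ G) {T T' : Scheme.{u}} (g : T' ⟶ T) (x : F.obj (op T)) :
    G.map g.op (f.app _ x) = f.app _ (F.map g.op x) :=
  (NatTrans.naturality_apply f g.op x).symm

lemma yonedaEquiv_symm_app {U T : Scheme.{u}} (x : X.obj (op U)) (t : T ⟶ U) :
    (yonedaEquiv.symm x).app (op T) t = X.map t.op x := rfl

lemma hom_ext_yoneda_obj {U : Scheme.{u}} {p q : yoneda.obj U ⟶ X}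
    (h : p.app (op U) (𝟙 U) = q.app (op U) (𝟙 U)) : p = q :=
  yonedaEquiv.injective h

lemma comp_app_apply' (f : F ⟶ G) (g : G ⟶ H) {T : Scheme.{u}ᵒᵖ} (x : F.obj T) :
    (f ≫ g).app T x = g.app T (f.app T x) := rfl

lemma yoneda_map_comp_app {U V T : Scheme.{u}} (f : U ⟶ V) (p : yoneda.obj V ⟶ X) (t : T ⟶ U) :
    (yoneda.map f ≫ p).app (op T) t = p.app (op T) (t ≫ f) := rfl

/-- Limits of presheaves are computed objectwise, so a cartesian square amounts to unique existence
of sections. Cartesian squares of sheaves are handled in this form below. -/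
lemma isPullback_iff_forall {f₁ : F ⟶ G} {f₂ : F ⟶ H} {g₁ : G ⟶ K} {g₂ : H ⟶ K} :
    IsPullback f₁ f₂ g₁ g₂ ↔ f₁ ≫ g₁ = f₂ ≫ g₂ ∧
      (∀ (T : Scheme.{u}) (x y : F.obj (op T)), f₁.app _ x = f₁.app _ y →
        f₂.app _ x = f₂.app _ y → x = y) ∧
      ∀ (T : Scheme.{u}) (x : G.obj (op T)) (y : H.obj (op T)), g₁.app _ x = g₂.app _ y →
        ∃ z : F.obj (op T), f₁.app _ z = x ∧ f₂.app _ z = y := by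
  constructor
  · intro h
    have h' (T : Scheme.{u}) := (Types.isPullback_iff _ _ _ _).1 (h.map ((evaluation _ _).obj (op T)))
    exact ⟨h.w, fun T x y h₁ h₂ => (h' T).2.1 x y ⟨h₁, h₂⟩, fun T x y e => (h' T).2.2 x y e⟩
  · rintro ⟨h₁, h₂, h₃⟩
    refine IsPullback.of_forall_isPullback_app fun T => (Types.isPullback_iff _ _ _ _).2 ⟨?_, ?_, ?_⟩
    · rw [← NatTrans.comp_app, h₁, NatTrans.comp_app]
    · rintro x y ⟨e₁, e₂⟩
      exact h₂ T.unop x y e₁ e₂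
    · intro x y e
      exact h₃ T.unop x y e

lemma mono_iff_forall {f : F ⟶ G} :
    Mono f ↔ ∀ (T : Scheme.{u}) (x y : F.obj (op T)), f.app _ x = f.app _ y → x = y := by
  rw [NatTrans.mono_iff_mono_app]
  simp_rw [CategoryTheory.mono_iff_injective]
  exact ⟨fun h T x y e => h (op T) e, fun h T x y e => h T.unop x y e⟩

/-- A pullback square of presheaves with two representable corners, on points. -/
lemma IsPullback.exists_hom {U V : Scheme.{u}} {f₁ : yoneda.obj U ⟶ F} {f₂ : U ⟶ V} {g₁ : F ⟶ G}
    {g₂ : yoneda.obj V ⟶ G} (h : IsPullback f₁ (yoneda.map f₂) g₁ g₂) {T : Scheme.{u}}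
    (x : F.obj (op T)) (t : T ⟶ V) (e : g₁.app _ x = g₂.app _ t) :
    ∃ s : T ⟶ U, f₁.app _ s = x ∧ s ≫ f₂ = t :=
  (isPullback_iff_forall.1 h).2.2 T x t e

lemma IsPullback.hom_eq {U V : Scheme.{u}} {f₁ : yoneda.obj U ⟶ F} {f₂ : U ⟶ V} {g₁ : F ⟶ G}
    {g₂ : yoneda.obj V ⟶ G} (h : IsPullback f₁ (yoneda.map f₂) g₁ g₂) {T : Scheme.{u}}
    {s t : T ⟶ U} (e₁ : f₁.app (op T) s = f₁.app (op T) t) (e₂ : s ≫ f₂ = t ≫ f₂) : s = t :=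
  (isPullback_iff_forall.1 h).2.1 T s t e₁ e₂

lemma IsPullback.app_eq {U V : Scheme.{u}} {f₁ : yoneda.obj U ⟶ F} {f₂ : U ⟶ V} {g₁ : F ⟶ G}
    {g₂ : yoneda.obj V ⟶ G} (h : IsPullback f₁ (yoneda.map f₂) g₁ g₂) {T : Scheme.{u}}
    (s : T ⟶ U) : g₁.app _ (f₁.app _ s) = g₂.app (op T) (s ≫ f₂) :=
  ConcreteCategory.congr_hom (NatTrans.congr_app h.w (op T)) (s : (yoneda.obj U).obj (op T))

end Presheaf

/-! ### Étale sheaves -/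

section Sheaf

/-- One neighbourhood for each point already gives a cover indexed by the points of `T`, so covering
conditions can be checked at a single point. -/
lemma mem_etaleTopology_iff {T : Scheme.{u}} {S : Sieve T} :
    S ∈ Scheme.etaleTopology T ↔ ∀ x : T, ∃ (V : Scheme.{u}) (f : V ⟶ T) (y : V),
      Etale f ∧ S f ∧ f y = x := by
  refine (Scheme.mem_grothendieckTopology_iff (P := @Etale)).trans ?_
  constructor
  · rintro ⟨𝒰, h𝒰⟩ x
    obtain ⟨i, y, hy⟩ := ((Scheme.ofArrows_mem_precoverage_iff _).1 𝒰.mem₀).1 x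
    exact ⟨𝒰.X i, 𝒰.f i, y, inferInstance, h𝒰 _ _ ⟨i⟩, hy⟩
  · intro h
    choose V f y he hf hy using h
    refine ⟨Scheme.Cover.mkOfCovers (P := @Etale) T V f (fun x => ⟨x, y x, hy x⟩) he, ?_⟩
    rintro _ _ ⟨x⟩
    exact hf x

instance : Scheme.etaleTopology.{u}.Subcanonical :=
  .of_le (Scheme.etaleTopology_le_proetaleTopology)

lemma isSheaf_yoneda (U : Scheme.{u}) :
    Presheaf.IsSheaf Scheme.etaleTopology.{u} (yoneda.obj U) := by
  rw [isSheaf_iff_isSheaf_of_type]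
  exact GrothendieckTopology.Subcanonical.isSheaf_of_isRepresentable _

variable {F : Scheme.{u}ᵒᵖ ⥤ Type u} (hF : Presheaf.IsSheaf Scheme.etaleTopology.{u} F)

include hF

/-- Sections of an étale sheaf that agree étale locally are equal. -/
lemma sheaf_ext {T : Scheme.{u}} {x y : F.obj (op T)}
    (h : ∀ t : T, ∃ (V : Scheme.{u}) (f : V ⟶ T) (v : V), Etale f ∧ f v = t ∧
      F.map f.op x = F.map f.op y) : x = y := by
  rw [isSheaf_iff_isSheaf_of_type] at hF
  let S : Sieve T :=
    { arrows := fun V f => F.map f.op x = F.map f.op y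
      downward_closed := by
        intro V V' f e g
        rw [← map_map, e, map_map] }
  have hS : S ∈ Scheme.etaleTopology T := mem_etaleTopology_iff.2 fun t => by
    obtain ⟨V, f, v, h₁, h₂, h₃⟩ := h t
    exact ⟨V, f, v, h₁, h₃, h₂⟩
  exact (hF S hS).isSeparatedFor.ext fun V f hf => hf

/-- Étale local sections of a sheaf that are characterized uniquely glue. -/
lemma exists_glue {T : Scheme.{u}} (P : ∀ {V : Scheme.{u}} (_ : V ⟶ T), F.obj (op V) → Prop)
    (hres : ∀ {V V' : Scheme.{u}} (f : V ⟶ T) (g : V' ⟶ V) (x : F.obj (op V)), P f x →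
      P (g ≫ f) (F.map g.op x))
    (huniq : ∀ {V : Scheme.{u}} (f : V ⟶ T) (x y : F.obj (op V)), P f x → P f y → x = y)
    (hloc : ∀ t : T, ∃ (V : Scheme.{u}) (f : V ⟶ T) (v : V), Etale f ∧ f v = t ∧ ∃ x, P f x) :
    ∃ x : F.obj (op T), ∀ {V : Scheme.{u}} (f : V ⟶ T) (y : F.obj (op V)), P f y →
      F.map f.op x = y := by
  have hF' := hF
  rw [isSheaf_iff_isSheaf_of_type] at hF
  let S : Sieve T :=
    { arrows := fun V f => ∃ x, P f x
      downward_closed := by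
        rintro V V' f ⟨x, hx⟩ g
        exact ⟨_, hres f g x hx⟩ }
  have hS : S ∈ Scheme.etaleTopology T := mem_etaleTopology_iff.2 fun t => by
    obtain ⟨V, f, v, h₁, h₂, h₃⟩ := hloc t
    exact ⟨V, f, v, h₁, h₃, h₂⟩
  -- Arbitrary choices are harmless: on a common refinement both restrictions satisfy `P`, and
  -- uniqueness makes the family compatible.
  let s : Presieve.FamilyOfElements F S.arrows := fun V f hf => hf.choose
  have hs {V} (f : V ⟶ T) (hf : S f) : P f (s f hf) := hf.choose_spec
  have hc : s.Compatible := by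
    intro V₁ V₂ Z g₁ g₂ f₁ f₂ h₁ h₂ e
    apply huniq (g₁ ≫ f₁) _ _ (hres _ _ _ (hs f₁ h₁))
    rw [e]
    exact hres _ _ _ (hs f₂ h₂)
  refine ⟨(hF S hS).amalgamate s hc, fun {V} f y hy => ?_⟩
  rw [(hF S hS).valid_glue hc f ⟨y, hy⟩]
  exact huniq f _ _ (hs f _) hy

end Sheaf

end AlgebraicSpace

namespace AlgebraicSpace

/-! ### Étaleness over a ring glued from two quotients -/

section GluedAlgebra

open TensorProduct

variable {A : Type*} [CommRing A]

/-- Since A → A₁ is surjective, an A-submodule of A₁ is an ideal J of A₁, and J ⊗_A M = J ⊗_{A₁} (A₁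
⊗_A M). So flatness of the base change over A₁ suffices. -/
lemma rTensor_injective_of_flat_baseChange {A₁ : Type*} [CommRing A₁] [Algebra A A₁]
    (hs : Function.Surjective (algebraMap A A₁)) {M : Type*} [AddCommGroup M] [Module A M]
    [Module.Flat A₁ (A₁ ⊗[A] M)] {N : Type*} [AddCommGroup N] [Module A N] (f : N →ₗ[A] A₁)
    (hf : Function.Injective f) : Function.Injective (f.rTensor M) := by
  let J : Ideal A₁ :=
    { carrier := Set.range f
      add_mem' := by
        rintro _ _ ⟨x, rfl⟩ ⟨y, rfl⟩
        exact ⟨x + y, map_add f x y⟩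
      zero_mem' := ⟨0, map_zero f⟩
      smul_mem' := by
        rintro c _ ⟨x, rfl⟩
        obtain ⟨a, rfl⟩ := hs c
        exact ⟨a • x, by rw [map_smul, Algebra.smul_def, smul_eq_mul]⟩ }
  let g : N →ₗ[A] J :=
    { toFun := fun x => ⟨f x, ⟨x, rfl⟩⟩
      map_add' := fun x y => Subtype.ext (map_add f x y)
      map_smul' := fun a x => Subtype.ext (map_smul f a x) }
  have hg : Function.Bijective g :=
    ⟨fun x y e => hf (congrArg Subtype.val e), fun ⟨_, x, rfl⟩ => ⟨x, rfl⟩⟩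
  let e := LinearEquiv.ofBijective g hg
  let j : J →ₗ[A] A₁ := J.subtype.restrictScalars A
  have hj : Function.Injective (j.rTensor M) := by
    let c₁ := AlgebraTensorModule.cancelBaseChange A A₁ A₁ J M
    let c₂ := AlgebraTensorModule.cancelBaseChange A A₁ A₁ A₁ M
    have hc : (j.rTensor M) ∘ c₁ = c₂ ∘ (J.subtype.rTensor (A₁ ⊗[A] M)) := by
      funext x
      induction x with
      | zero => simp
      | add x y hx hy => simp only [Function.comp_apply, map_add] at hx hy ⊢; rw [hx, hy]
      | tmul x y =>
        induction y with
        | zero => simp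
        | add y z hy hz =>
          simp only [Function.comp_apply, map_add, tmul_add] at hy hz ⊢
          rw [hy, hz]
        | tmul a m => simp [c₁, c₂, j]
    have h₁ : Function.Injective ((j.rTensor M) ∘ c₁) := by
      rw [hc]
      exact c₂.injective.comp
        (Module.Flat.rTensor_preserves_injective_linearMap _ J.injective_subtype)
    exact (Function.Injective.of_comp_iff' _ c₁.bijective).1 h₁
  have : f.rTensor M = (j.rTensor M) ∘ₗ (e.rTensor M : N ⊗[A] M →ₗ[A] J ⊗[A] M) := by
    ext x m
    rfl
  rw [this]
  exact hj.comp (e.rTensor M).injective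

/-- Flatness over a ring can be checked on two quotients whose kernels intersect trivially. -/
lemma flat_of_flat_baseChange {A₁ A₂ : Type*} [CommRing A₁] [CommRing A₂] [Algebra A A₁]
    [Algebra A A₂] (hs₁ : Function.Surjective (algebraMap A A₁))
    (hs₂ : Function.Surjective (algebraMap A A₂))
    (hinj : ∀ a : A, algebraMap A A₁ a = 0 → algebraMap A A₂ a = 0 → a = 0)
    (M : Type*) [AddCommGroup M] [Module A M]
    [Module.Flat A₁ (A₁ ⊗[A] M)] [Module.Flat A₂ (A₂ ⊗[A] M)] : Module.Flat A M := by
  rw [Module.Flat.iff_rTensor_injective']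
  intro J
  rw [injective_iff_map_eq_zero]
  intro x hx
  -- The ideal `J` is an extension of its image in `A₁` by the kernel of `f₁`, which embeds in `A₂`
  -- by `hinj`. An element of J ⊗ M dying in M vanishes over the image, hence comes from the kernel
  -- part, and there it vanishes by comparison with `A₂`.
  let f₁ : J →ₗ[A] A₁ := Algebra.linearMap A A₁ ∘ₗ J.subtype
  let f₂ : LinearMap.ker f₁ →ₗ[A] A₂ :=
    Algebra.linearMap A A₂ ∘ₗ J.subtype ∘ₗ (LinearMap.ker f₁).subtype
  have hf₂ : Function.Injective f₂ := by
    rw [injective_iff_map_eq_zero]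
    rintro ⟨y, hy⟩ h
    exact Subtype.ext (Subtype.ext (hinj y hy h))
  have h₁ : f₁.rangeRestrict.rTensor M x = 0 := by
    have hi : Function.Injective ((LinearMap.range f₁).subtype.rTensor M) :=
      rTensor_injective_of_flat_baseChange hs₁ _ (LinearMap.range f₁).injective_subtype
    apply hi
    rw [map_zero, ← LinearMap.comp_apply, ← LinearMap.rTensor_comp]
    change (Algebra.linearMap A A₁ ∘ₗ J.subtype).rTensor M x = 0
    rw [LinearMap.rTensor_comp, LinearMap.comp_apply, hx, map_zero]
  have hex := rTensor_exact M (f := (LinearMap.ker f₁).subtype) (g := f₁.rangeRestrict) (by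
    intro y
    rw [← LinearMap.mem_ker, LinearMap.ker_rangeRestrict, ← SetLike.mem_coe]
    simp) f₁.surjective_rangeRestrict
  obtain ⟨y, rfl⟩ := (hex x).1 h₁
  have h₂ : f₂.rTensor M y = 0 := by
    change (Algebra.linearMap A A₂ ∘ₗ J.subtype ∘ₗ (LinearMap.ker f₁).subtype).rTensor M y = 0
    rw [LinearMap.rTensor_comp, LinearMap.rTensor_comp, LinearMap.comp_apply,
      LinearMap.comp_apply, hx, map_zero]
  rw [(injective_iff_map_eq_zero _).1 (rTensor_injective_of_flat_baseChange hs₂ f₂ hf₂) y h₂,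
    map_zero]

variable {B : Type*} [CommRing B] [Algebra A B]

section Quotient

variable {A₁ B₁ : Type*} [CommRing A₁] [CommRing B₁] [Algebra A A₁] [Algebra A B₁] [Algebra B B₁]
  [Algebra A₁ B₁] [IsScalarTower A B B₁] [IsScalarTower A A₁ B₁]

lemma algebraMap_surjective_of_isPushout [Algebra.IsPushout A A₁ B B₁]
    (hs : Function.Surjective (algebraMap A A₁)) : Function.Surjective (algebraMap B B₁) := by
  intro b
  obtain ⟨x, rfl⟩ := (Algebra.IsPushout.equiv A A₁ B B₁).surjective b
  induction x with
  | zero => exact ⟨0, by simp⟩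
  | add x y hx hy =>
    obtain ⟨x', hx⟩ := hx
    obtain ⟨y', hy⟩ := hy
    exact ⟨x' + y', by rw [map_add, map_add, hx, hy]⟩
  | tmul a b =>
    obtain ⟨a, rfl⟩ := hs a
    refine ⟨a • b, ?_⟩
    rw [Algebra.IsPushout.equiv_tmul, Algebra.smul_def, map_mul,
      ← IsScalarTower.algebraMap_apply, ← IsScalarTower.algebraMap_apply]

/-- Right exactness of the tensor product: the kernel of B → A₁ ⊗ B is the image of I ⊗ B, which is
IB. -/
lemma ker_algebraMap_of_isPushout [Algebra.IsPushout A A₁ B B₁]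
    (hs : Function.Surjective (algebraMap A A₁)) :
    RingHom.ker (algebraMap B B₁) = (RingHom.ker (algebraMap A A₁)).map (algebraMap A B) := by
  apply le_antisymm
  · intro b hb
    have h₁ : (Algebra.linearMap A A₁).rTensor B (1 ⊗ₜ b) = 0 := by
      apply (Algebra.IsPushout.equiv A A₁ B B₁).injective
      rw [map_zero]
      simpa [Algebra.IsPushout.equiv_tmul] using hb
    have hex := rTensor_exact B (f := (LinearMap.ker (Algebra.linearMap A A₁)).subtype)
      (g := Algebra.linearMap A A₁) (LinearMap.exact_subtype_ker_map _) hs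
    obtain ⟨y, hy⟩ := (hex _).1 h₁
    have key : ∀ y : (LinearMap.ker (Algebra.linearMap A A₁)) ⊗[A] B,
        TensorProduct.lid A B ((LinearMap.ker (Algebra.linearMap A A₁)).subtype.rTensor B y) ∈
          (RingHom.ker (algebraMap A A₁)).map (algebraMap A B) := by
      intro y
      induction y with
      | zero => simp
      | add x y hx hy => rw [map_add, map_add]; exact Ideal.add_mem _ hx hy
      | tmul a b =>
        rw [LinearMap.rTensor_tmul, TensorProduct.lid_tmul, Algebra.smul_def]
        exact Ideal.mul_mem_right _ _ (Ideal.mem_map_of_mem _ a.2)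
    have := key y
    rwa [hy, TensorProduct.lid_tmul, one_smul] at this
  · rw [Ideal.map_le_iff_le_comap]
    intro a ha
    rw [Ideal.mem_comap, RingHom.mem_ker, ← IsScalarTower.algebraMap_apply,
      IsScalarTower.algebraMap_apply A A₁ B₁, (RingHom.mem_ker).1 ha, map_zero]

/-- For `B` flat over `A`, presented by `P ↠ B` with kernel `K`, one has `K ∩ I P = I K`. -/
lemma mem_smul_ker_of_flat [Module.Flat A B] {P : Type*} [CommRing P] [Algebra A P] (f : P →ₐ[A] B)
    (hf : Function.Surjective f) (I : Ideal A) {x : P} (hx : x ∈ I.map (algebraMap A P))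
    (hfx : f x = 0) : x ∈ I.map (algebraMap A P) * RingHom.ker f := by
  have hx' : x ∈ I • (Submodule.span A (Set.range (id : P → P))) := by
    rw [Set.range_id, Submodule.span_univ]
    have : x ∈ (I.map (algebraMap A P)).restrictScalars A := hx
    rwa [← Ideal.smul_top_eq_map] at this
  obtain ⟨a, ha, rfl⟩ := (Submodule.mem_ideal_smul_span_iff_exists_sum _ _ _).1 hx'
  have h₀ : ∑ i : a.support, a i • f i.1 = 0 := by
    rw [Finset.sum_coe_sort a.support (fun i => a i • f i)]
    simpa [Finsupp.sum] using hfx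
  -- Equational criterion of flatness: the relation ∑ aᵢ f(pᵢ) = 0 is trivial, so f(pᵢ) = ∑ cᵢⱼ yⱼ
  -- with ∑ᵢ aᵢ cᵢⱼ = 0. Lifting yⱼ to qⱼ gives x = ∑ aᵢ (pᵢ - ∑ cᵢⱼ qⱼ), where each bracket lies in
  -- the kernel.
  obtain ⟨k, c, y, h₁, h₂⟩ :=
    Module.Flat.isTrivialRelation_of_sum_smul_eq_zero (R := A) (M := B)
      (f := fun i : a.support => a i) (x := fun i => f i.1) h₀
  choose q hq using fun j => hf (y j)
  have h₃ : (a.sum fun i c => c • id i) = ∑ i : a.support, a i • (i.1 - ∑ j, c i j • q j) := by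
    simp_rw [smul_sub, Finset.sum_sub_distrib, Finset.smul_sum]
    rw [Finset.sum_comm, Finsupp.sum, ← Finset.sum_coe_sort]
    simp_rw [smul_smul, ← Finset.sum_smul, h₂]
    simp
  rw [h₃]
  refine Ideal.sum_mem _ fun i _ => ?_
  rw [Algebra.smul_def]
  refine Ideal.mul_mem_mul (Ideal.mem_map_of_mem _ (ha i)) ?_
  rw [RingHom.mem_ker, map_sub, map_sum]
  simp_rw [map_smul, hq]
  exact sub_eq_zero.2 (h₁ i)

/-- Differentials commute with base change, so B₁ ⊗ Ω_{B/A} = Ω_{B₁/A₁} = 0, and right exactness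
turns this into Ω = IΩ. -/
lemma kaehler_eq_smul_top [Algebra.IsPushout A A₁ B B₁] [Algebra.FormallyUnramified A₁ B₁]
    (hs : Function.Surjective (algebraMap A A₁)) :
    (⊤ : Submodule B (KaehlerDifferential A B)) ≤
      RingHom.ker (algebraMap B B₁) • (⊤ : Submodule B (KaehlerDifferential A B)) := by
  intro ω _
  have e := KaehlerDifferential.tensorKaehlerEquiv A A₁ B B₁
  have hsub : Subsingleton (B₁ ⊗[B] KaehlerDifferential A B) := e.toEquiv.subsingleton
  have hsB := algebraMap_surjective_of_isPushout (A := A) (A₁ := A₁) (B := B) (B₁ := B₁) hs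
  have hex := rTensor_exact (KaehlerDifferential A B)
      (f := (LinearMap.ker (Algebra.linearMap B B₁)).subtype)
      (g := Algebra.linearMap B B₁) (LinearMap.exact_subtype_ker_map _) hsB
  obtain ⟨y, hy⟩ := (hex (1 ⊗ₜ ω)).1 (Subsingleton.elim _ _)
  have key : ∀ y : (LinearMap.ker (Algebra.linearMap B B₁)) ⊗[B] KaehlerDifferential A B,
      TensorProduct.lid B _ ((LinearMap.ker (Algebra.linearMap B B₁)).subtype.rTensor _ y) ∈
        RingHom.ker (algebraMap B B₁) • (⊤ : Submodule B (KaehlerDifferential A B)) := by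
    intro y
    induction y with
    | zero => simp
    | add x y hx hy => rw [map_add, map_add]; exact Submodule.add_mem _ hx hy
    | tmul a b =>
      rw [LinearMap.rTensor_tmul, TensorProduct.lid_tmul]
      exact Submodule.smul_mem_smul a.2 trivial
  have := key y
  rwa [hy, TensorProduct.lid_tmul, one_smul] at this

/-- Both the finitely many generators of B₁ and their coefficients in A₁ lift, so a finitely
generated subalgebra of B already fills B modulo the kernel. -/
lemma exists_adjoin_finset_surjective [Algebra.IsPushout A A₁ B B₁]
    [Algebra.FiniteType A₁ B₁] (hs : Function.Surjective (algebraMap A A₁)) :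
    ∃ s : Finset B, ∀ b : B, ∃ c ∈ Algebra.adjoin A (s : Set B),
      b - c ∈ RingHom.ker (algebraMap B B₁) := by
  classical
  have hsB := algebraMap_surjective_of_isPushout (A := A) (A₁ := A₁) (B := B) (B₁ := B₁) hs
  obtain ⟨t, ht⟩ := Algebra.FiniteType.out (R := A₁) (A := B₁)
  choose r hr using hsB
  refine ⟨t.image r, fun b => ?_⟩
  have hb : algebraMap B B₁ b ∈ Algebra.adjoin A₁ (t : Set B₁) := ht ▸ trivial
  suffices ∀ y ∈ Algebra.adjoin A₁ (t : Set B₁),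
      ∃ c ∈ Algebra.adjoin A (((t.image r : Finset B)) : Set B), algebraMap B B₁ c = y by
    obtain ⟨c, hc, e⟩ := this _ hb
    exact ⟨c, hc, by rw [RingHom.mem_ker, map_sub, e, sub_self]⟩
  intro y hy
  induction hy using Algebra.adjoin_induction with
  | mem x hx =>
    exact ⟨r x, Algebra.subset_adjoin (by simpa using ⟨x, hx, rfl⟩), hr x⟩
  | algebraMap a =>
    obtain ⟨a, rfl⟩ := hs a
    exact ⟨algebraMap A B a, Subalgebra.algebraMap_mem _ _, by
      rw [← IsScalarTower.algebraMap_apply, ← IsScalarTower.algebraMap_apply]⟩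
  | add x y _ _ hx hy =>
    obtain ⟨c, hc, rfl⟩ := hx
    obtain ⟨d, hd, rfl⟩ := hy
    exact ⟨c + d, add_mem hc hd, map_add _ _ _⟩
  | mul x y _ _ hx hy =>
    obtain ⟨c, hc, rfl⟩ := hx
    obtain ⟨d, hd, rfl⟩ := hy
    exact ⟨c * d, mul_mem hc hd, map_mul _ _ _⟩

/-- Finitely many generators of the kernel of A₁[X] → B₁ lift into the kernel of `f`, because the
kernel of B → B₁ is IB. After subtracting a combination of the lifts, an element of the kernel of
`f` also lies in I·A[X], and by flatness (`mem_smul_ker_of_flat`) it lies in I times that kernel. -/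
lemma exists_fg_ker_le_sup [Algebra.IsPushout A A₁ B B₁] [Module.Flat A B]
    (hs : Function.Surjective (algebraMap A A₁)) [Algebra.FinitePresentation A₁ B₁] {n : ℕ}
    (f : MvPolynomial (Fin n) A →ₐ[A] B) (hf : Function.Surjective f) :
    ∃ K' : Ideal (MvPolynomial (Fin n) A), K'.FG ∧ K' ≤ RingHom.ker f ∧
      RingHom.ker f ≤ K' ⊔ (RingHom.ker (algebraMap A A₁)).map
        (algebraMap A (MvPolynomial (Fin n) A)) * RingHom.ker f := by
  classical
  let φ : MvPolynomial (Fin n) A₁ →ₐ[A₁] B₁ :=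
    MvPolynomial.aeval fun i => algebraMap B B₁ (f (.X i))
  have hφ (p : MvPolynomial (Fin n) A) :
      φ (MvPolynomial.map (algebraMap A A₁) p) = algebraMap B B₁ (f p) := by
    have : (φ.toRingHom.comp (MvPolynomial.map (algebraMap A A₁))) =
        (algebraMap B B₁).comp f.toRingHom := by
      apply MvPolynomial.ringHom_ext
      · intro a
        change φ (MvPolynomial.map _ (MvPolynomial.C a)) = algebraMap B B₁ (f (MvPolynomial.C a))
        rw [MvPolynomial.map_C, ← MvPolynomial.algebraMap_eq, ← MvPolynomial.algebraMap_eq,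
          AlgHom.commutes, AlgHom.commutes, ← IsScalarTower.algebraMap_apply,
          ← IsScalarTower.algebraMap_apply]
      · intro i
        simp [φ]
    exact congr($this p)
  have hsB := algebraMap_surjective_of_isPushout (A := A) (A₁ := A₁) (B := B) (B₁ := B₁) hs
  have hφs : Function.Surjective φ := by
    intro b
    obtain ⟨b, rfl⟩ := hsB b
    obtain ⟨p, rfl⟩ := hf b
    exact ⟨_, hφ p⟩
  have hm : Function.Surjective (MvPolynomial.map (σ := Fin n) (algebraMap A A₁)) :=
    MvPolynomial.map_surjective _ hs
  have hlift : ∀ q ∈ RingHom.ker φ, ∃ p ∈ RingHom.ker f,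
      MvPolynomial.map (algebraMap A A₁) p = q := by
    intro q hq
    obtain ⟨p, rfl⟩ := hm q
    have h₁ : f p ∈ (RingHom.ker (algebraMap A A₁)).map (algebraMap A B) := by
      rw [← ker_algebraMap_of_isPushout (B₁ := B₁) hs, RingHom.mem_ker, ← hφ]
      exact hq
    have h₂ : (RingHom.ker (algebraMap A A₁)).map (algebraMap A B) =
        ((RingHom.ker (algebraMap A A₁)).map
          (algebraMap A (MvPolynomial (Fin n) A))).map f.toRingHom := by
      rw [Ideal.map_map]
      congr 1
      exact f.comp_algebraMap.symm
    rw [h₂, Ideal.mem_map_iff_of_surjective f.toRingHom hf] at h₁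
    obtain ⟨p', hp', e⟩ := h₁
    refine ⟨p - p', ?_, ?_⟩
    · rw [RingHom.mem_ker, map_sub, sub_eq_zero]
      exact e.symm
    · rw [map_sub, sub_eq_self, ← RingHom.mem_ker, MvPolynomial.ker_map]
      exact hp'
  obtain ⟨t, ht⟩ := Algebra.FinitePresentation.ker_fg_of_mvPolynomial φ hφs
  choose! r hr₁ hr₂ using hlift
  have htk (q) (hq : q ∈ t) : q ∈ RingHom.ker φ := by
    have : q ∈ RingHom.ker φ.toRingHom := ht ▸ Submodule.subset_span hq
    exact this
  refine ⟨Ideal.span (t.image r : Finset _), ⟨_, rfl⟩, ?_, ?_⟩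
  · rw [Ideal.span_le]
    intro x hx
    obtain ⟨q, hq, rfl⟩ := Finset.mem_image.1 (Finset.mem_coe.1 hx)
    exact hr₁ q (htk q hq)
  · intro p hp
    have hp' : MvPolynomial.map (algebraMap A A₁) p ∈ RingHom.ker φ.toRingHom := by
      change φ _ = 0
      rw [hφ, (RingHom.mem_ker).1 hp, map_zero]
    have hmap : (Ideal.span ((t.image r : Finset _) : Set (MvPolynomial (Fin n) A))).map
        (MvPolynomial.map (algebraMap A A₁)) = RingHom.ker φ.toRingHom := by
      rw [Ideal.map_span, ← ht]
      congr 1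
      ext q
      simp only [Finset.coe_image, Set.mem_image, Finset.mem_coe, exists_exists_and_eq_and]
      constructor
      · rintro ⟨q, hq, rfl⟩
        rwa [hr₂ q (htk q hq)]
      · intro hq
        exact ⟨q, hq, hr₂ q (htk q hq)⟩
    rw [← hmap, Ideal.mem_map_iff_of_surjective _ hm] at hp'
    obtain ⟨p', hp', e⟩ := hp'
    have hp'f : f p' = 0 := by
      have : Ideal.span ((t.image r : Finset _) : Set (MvPolynomial (Fin n) A)) ≤
          RingHom.ker f := by
        rw [Ideal.span_le]
        intro x hx
        obtain ⟨q, hq, rfl⟩ := Finset.mem_image.1 (Finset.mem_coe.1 hx)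
        exact hr₁ q (htk q hq)
      exact this hp'
    rw [← add_sub_cancel p' p]
    refine Ideal.add_mem _ (Ideal.mem_sup_left hp') (Ideal.mem_sup_right ?_)
    apply mem_smul_ker_of_flat f hf
    · have : p - p' ∈ RingHom.ker (MvPolynomial.map (σ := Fin n) (algebraMap A A₁)) := by
        rw [RingHom.mem_ker, map_sub, e, sub_self]
      rwa [MvPolynomial.ker_map] at this
    · rw [map_sub, hp'f, (RingHom.mem_ker).1 hp, sub_self]

end Quotient

variable {A₁ B₁ A₂ B₂ : Type*} [CommRing A₁] [CommRing B₁] [Algebra A A₁] [Algebra A B₁]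
  [Algebra B B₁] [Algebra A₁ B₁] [IsScalarTower A B B₁] [IsScalarTower A A₁ B₁]
  [CommRing A₂] [CommRing B₂] [Algebra A A₂] [Algebra A B₂]
  [Algebra B B₂] [Algebra A₂ B₂] [IsScalarTower A B B₂] [IsScalarTower A A₂ B₂]

lemma ker_mul_ker_eq_bot
    (hinj : ∀ a : A, algebraMap A A₁ a = 0 → algebraMap A A₂ a = 0 → a = 0) :
    RingHom.ker (algebraMap A A₁) * RingHom.ker (algebraMap A A₂) = ⊥ := by
  rw [eq_bot_iff]
  exact Ideal.mul_le_inf.trans fun a ha => hinj a ha.1 ha.2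

/-- The kernels are I₁B and I₂B. Before B is known to be flat their intersection is out of reach,
but the vanishing of the product passes to any algebra. -/
lemma ker_mul_ker_eq_bot_of_isPushout [Algebra.IsPushout A A₁ B B₁] [Algebra.IsPushout A A₂ B B₂]
    (hs₁ : Function.Surjective (algebraMap A A₁)) (hs₂ : Function.Surjective (algebraMap A A₂))
    (hinj : ∀ a : A, algebraMap A A₁ a = 0 → algebraMap A A₂ a = 0 → a = 0) :
    RingHom.ker (algebraMap B B₁) * RingHom.ker (algebraMap B B₂) = ⊥ := by
  rw [ker_algebraMap_of_isPushout (A := A) (A₁ := A₁) (B := B) (B₁ := B₁) hs₁,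
    ker_algebraMap_of_isPushout (A := A) (A₁ := A₂) (B := B) (B₁ := B₂) hs₂, ← Ideal.map_mul,
    ker_mul_ker_eq_bot hinj, Ideal.map_bot]

/-- Each base change gives Ω = IᵢΩ, hence Ω = I₁I₂Ω = 0. -/
lemma formallyUnramified_of_quotients [Algebra.IsPushout A A₁ B B₁] [Algebra.IsPushout A A₂ B B₂]
    (hs₁ : Function.Surjective (algebraMap A A₁)) (hs₂ : Function.Surjective (algebraMap A A₂))
    (hinj : ∀ a : A, algebraMap A A₁ a = 0 → algebraMap A A₂ a = 0 → a = 0)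
    [Algebra.FormallyUnramified A₁ B₁] [Algebra.FormallyUnramified A₂ B₂] :
    Algebra.FormallyUnramified A B := by
  have hzero : RingHom.ker (algebraMap B B₁) * RingHom.ker (algebraMap B B₂) = ⊥ :=
    ker_mul_ker_eq_bot_of_isPushout hs₁ hs₂ hinj
  refine ⟨⟨fun x y => ?_⟩⟩
  have h : (⊤ : Submodule B (KaehlerDifferential A B)) ≤ ⊥ := by
    calc _ ≤ RingHom.ker (algebraMap B B₁) • (⊤ : Submodule B (KaehlerDifferential A B)) :=
          kaehler_eq_smul_top (A₁ := A₁) hs₁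
      _ ≤ RingHom.ker (algebraMap B B₁) • (RingHom.ker (algebraMap B B₂) • ⊤) :=
          Submodule.smul_mono le_rfl (kaehler_eq_smul_top (A₁ := A₂) hs₂)
      _ = ⊥ := by rw [← Submodule.mul_smul, hzero, Submodule.bot_smul]
  rw [(Submodule.mem_bot B).1 (h (x := x) trivial), (Submodule.mem_bot B).1 (h (x := y) trivial)]

/-- Modulo I₁B every element is generated by `s₁`. An element a·n with a in I₁ equals a·c for some c
generated by `s₂`, since n - c lies in I₂B and I₁I₂ = 0. -/
lemma finiteType_of_quotients [Algebra.IsPushout A A₁ B B₁] [Algebra.IsPushout A A₂ B B₂]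
    (hs₁ : Function.Surjective (algebraMap A A₁)) (hs₂ : Function.Surjective (algebraMap A A₂))
    (hinj : ∀ a : A, algebraMap A A₁ a = 0 → algebraMap A A₂ a = 0 → a = 0)
    [Algebra.FiniteType A₁ B₁] [Algebra.FiniteType A₂ B₂] : Algebra.FiniteType A B := by
  classical
  have hk₁ := ker_algebraMap_of_isPushout (A := A) (A₁ := A₁) (B := B) (B₁ := B₁) hs₁
  have hzero : RingHom.ker (algebraMap B B₁) * RingHom.ker (algebraMap B B₂) = ⊥ :=
    ker_mul_ker_eq_bot_of_isPushout hs₁ hs₂ hinj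
  obtain ⟨s₁, h₁⟩ := exists_adjoin_finset_surjective (A := A) (A₁ := A₁) (B := B) (B₁ := B₁) hs₁
  obtain ⟨s₂, h₂⟩ := exists_adjoin_finset_surjective (A := A) (A₁ := A₂) (B := B) (B₁ := B₂) hs₂
  refine ⟨⟨s₁ ∪ s₂, eq_top_iff.2 fun b _ => ?_⟩⟩
  have hle₁ : Algebra.adjoin A (s₁ : Set B) ≤ Algebra.adjoin A ((s₁ ∪ s₂ : Finset B) : Set B) :=
    Algebra.adjoin_mono (by simp)
  have hle₂ : Algebra.adjoin A (s₂ : Set B) ≤ Algebra.adjoin A ((s₁ ∪ s₂ : Finset B) : Set B) :=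
    Algebra.adjoin_mono (by simp)
  have key : ∀ x ∈ RingHom.ker (algebraMap B B₁),
      x ∈ Algebra.adjoin A ((s₁ ∪ s₂ : Finset B) : Set B) := by
    intro x hx
    rw [hk₁] at hx
    have hx' : x ∈ (RingHom.ker (algebraMap A A₁)) • (⊤ : Submodule A B) := by
      rw [Ideal.smul_top_eq_map]; exact hx
    refine Submodule.smul_induction_on hx' (fun a ha n _ => ?_) fun x y hx hy => add_mem hx hy
    obtain ⟨c, hc, hn⟩ := h₂ n
    have : a • n = a • c := by
      rw [← sub_eq_zero, ← smul_sub, Algebra.smul_def]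
      have := Ideal.mul_mem_mul (hk₁ ▸ Ideal.mem_map_of_mem (algebraMap A B) ha) hn
      rwa [hzero] at this
    rw [this]
    exact Subalgebra.smul_mem _ (hle₂ hc) a
  obtain ⟨c, hc, hb⟩ := h₁ b
  rw [← sub_add_cancel b c]
  exact add_mem (key _ hb) (hle₁ hc)

/-- Substituting the second bound into the first leaves the term J₁J₂K, which is zero. This takes
the place of Nakayama's lemma. -/
lemma ideal_eq_sup_of_le {P : Type*} [CommRing P] {K K₁ K₂ J₁ J₂ : Ideal P} (hJ : J₁ * J₂ = ⊥)
    (h₁ : K₁ ≤ K) (h₂ : K₂ ≤ K) (h₁' : K ≤ K₁ ⊔ J₁ * K) (h₂' : K ≤ K₂ ⊔ J₂ * K) : K = K₁ ⊔ K₂ := by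
  refine le_antisymm (h₁'.trans (sup_le le_sup_left ?_)) (sup_le h₁ h₂)
  calc J₁ * K ≤ J₁ * (K₂ ⊔ J₂ * K) := Ideal.mul_mono le_rfl h₂'
    _ = J₁ * K₂ := by rw [Ideal.mul_sup, ← mul_assoc, hJ, Ideal.bot_mul, sup_bot_eq]
    _ ≤ K₂ := Ideal.mul_le_right
    _ ≤ K₁ ⊔ K₂ := le_sup_right

/-- Each quotient yields a finitely generated part of the ideal of relations, up to Iᵢ times that
ideal. As I₁I₂ = 0, the two parts together generate it. -/
lemma finitePresentation_of_quotients [Algebra.IsPushout A A₁ B B₁] [Algebra.IsPushout A A₂ B B₂]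
    (hs₁ : Function.Surjective (algebraMap A A₁)) (hs₂ : Function.Surjective (algebraMap A A₂))
    (hinj : ∀ a : A, algebraMap A A₁ a = 0 → algebraMap A A₂ a = 0 → a = 0)
    [Module.Flat A B] [Algebra.FinitePresentation A₁ B₁] [Algebra.FinitePresentation A₂ B₂] :
    Algebra.FinitePresentation A B := by
  have hft : Algebra.FiniteType A B :=
    finiteType_of_quotients (A₁ := A₁) (B₁ := B₁) (A₂ := A₂) (B₂ := B₂) hs₁ hs₂ hinj
  obtain ⟨n, f, hf⟩ := Algebra.FiniteType.iff_quotient_mvPolynomial''.1 hft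
  obtain ⟨K₁, hfg₁, hle₁, hK₁⟩ := exists_fg_ker_le_sup (B₁ := B₁) hs₁ f hf
  obtain ⟨K₂, hfg₂, hle₂, hK₂⟩ := exists_fg_ker_le_sup (B₁ := B₂) hs₂ f hf
  refine Algebra.FinitePresentation.of_surjective hf ?_
  have hJ : (RingHom.ker (algebraMap A A₁)).map (algebraMap A (MvPolynomial (Fin n) A)) *
      (RingHom.ker (algebraMap A A₂)).map (algebraMap A (MvPolynomial (Fin n) A)) = ⊥ := by
    rw [← Ideal.map_mul, ker_mul_ker_eq_bot hinj, Ideal.map_bot]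
  have hK : RingHom.ker f.toRingHom = K₁ ⊔ K₂ := ideal_eq_sup_of_le hJ hle₁ hle₂ hK₁ hK₂
  rw [hK]
  exact Submodule.FG.sup hfg₁ hfg₂

/-- Étaleness over a ring can be checked on two quotients whose kernels intersect trivially. -/
theorem etale_of_etale_quotients [Algebra.IsPushout A A₁ B B₁] [Algebra.IsPushout A A₂ B B₂]
    (hs₁ : Function.Surjective (algebraMap A A₁)) (hs₂ : Function.Surjective (algebraMap A A₂))
    (hinj : ∀ a : A, algebraMap A A₁ a = 0 → algebraMap A A₂ a = 0 → a = 0)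
    [Algebra.Etale A₁ B₁] [Algebra.Etale A₂ B₂] : Algebra.Etale A B := by
  have : Module.Flat A₁ (A₁ ⊗[A] B) :=
    .of_linearEquiv (Algebra.IsPushout.equiv A A₁ B B₁).toLinearEquiv
  have : Module.Flat A₂ (A₂ ⊗[A] B) :=
    .of_linearEquiv (Algebra.IsPushout.equiv A A₂ B B₂).toLinearEquiv
  have : Module.Flat A B := flat_of_flat_baseChange hs₁ hs₂ hinj B
  have : Algebra.FormallyUnramified A B :=
    formallyUnramified_of_quotients (A₁ := A₁) (B₁ := B₁) (A₂ := A₂) (B₂ := B₂) hs₁ hs₂ hinj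
  have : Algebra.FinitePresentation A B :=
    finitePresentation_of_quotients (A₁ := A₁) (B₁ := B₁) (A₂ := A₂) (B₂ := B₂) hs₁ hs₂ hinj
  exact Algebra.Etale.of_formallyUnramified_of_flat

end GluedAlgebra

end AlgebraicSpace

namespace AlgebraicSpace

/-! ### Affine schemes glued from two closed subschemes -/

section RingSquares

variable {A A₁ B B₁ : CommRingCat.{u}} {f : A ⟶ A₁} {g : A ⟶ B} {g' : A₁ ⟶ B₁} {f' : B ⟶ B₁}

/-- With `f` surjective, the pushout is B modulo the ideal generated by the image of its kernel.
Thus only an inclusion of ideals has to be checked. -/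
lemma isPushout_of_ker_le (w : f ≫ g' = g ≫ f') (hf : Function.Surjective f)
    (hf' : Function.Surjective f')
    (hk : ∀ b : B, f' b = 0 → b ∈ (RingHom.ker f.hom).map g.hom) : IsPushout f g g' f' := by
  refine ⟨⟨w⟩, ⟨PushoutCocone.IsColimit.mk _ (fun s => CommRingCat.ofHom
    (RingHom.liftOfSurjective f'.hom hf' ⟨s.inr.hom, ?_⟩)) ?_ ?_ ?_⟩⟩
  · intro b hb
    have h : (RingHom.ker f.hom).map g.hom ≤ RingHom.ker s.inr.hom := by
      rw [Ideal.map_le_iff_le_comap]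
      intro a ha
      have e := ConcreteCategory.congr_hom s.condition a
      have ha' : f a = 0 := ha
      simp only [CommRingCat.comp_apply, ha', map_zero] at e
      exact e.symm
    exact h (hk b hb)
  · intro s
    ext a
    obtain ⟨a, rfl⟩ := hf a
    have e := ConcreteCategory.congr_hom w a
    have e' := ConcreteCategory.congr_hom s.condition a
    simp only [CommRingCat.comp_apply] at e e' ⊢
    rw [e, e']
    exact RingHom.liftOfRightInverse_comp_apply _ _ (Function.rightInverse_surjInv hf')
      ⟨s.inr.hom, _⟩ _
  · intro s
    ext b
    exact RingHom.liftOfRightInverse_comp_apply _ _ (Function.rightInverse_surjInv hf')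
      ⟨s.inr.hom, _⟩ _
  · intro s m h₁ h₂
    ext b
    obtain ⟨b, rfl⟩ := hf' b
    have := ConcreteCategory.congr_hom h₂ b
    simp only [CommRingCat.comp_apply] at this
    rw [this]
    exact (RingHom.liftOfRightInverse_comp_apply _ _ (Function.rightInverse_surjInv hf')
      ⟨s.inr.hom, _⟩ _).symm

lemma surjective_of_isPushout_commRingCat (h : IsPushout f g g' f') (hf : Function.Surjective f) :
    Function.Surjective f' := by
  algebraize [f.hom, g.hom, g'.hom, f'.hom, (f ≫ g').hom]
  have : IsScalarTower A A₁ B₁ := .of_algebraMap_eq' rfl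
  have : IsScalarTower A B B₁ := .of_algebraMap_eq' congr(($(h.w)).hom)
  have : Algebra.IsPushout A A₁ B B₁ := CommRingCat.isPushout_iff_isPushout.1 h
  exact algebraMap_surjective_of_isPushout (A := A) (A₁ := A₁) (B := B) (B₁ := B₁) hf

lemma mem_map_ker_of_isPushout (h : IsPushout f g g' f') (hf : Function.Surjective f) (b : B)
    (hb : f' b = 0) : b ∈ (RingHom.ker f.hom).map g.hom := by
  algebraize [f.hom, g.hom, g'.hom, f'.hom, (f ≫ g').hom]
  have : IsScalarTower A A₁ B₁ := .of_algebraMap_eq' rfl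
  have : IsScalarTower A B B₁ := .of_algebraMap_eq' congr(($(h.w)).hom)
  have : Algebra.IsPushout A A₁ B B₁ := CommRingCat.isPushout_iff_isPushout.1 h
  exact (ker_algebraMap_of_isPushout (A := A) (A₁ := A₁) (B := B) (B₁ := B₁) hf).le hb

end RingSquares

lemma isPullback_of_isPushout_appTop {P X Y Z : Scheme.{u}} {fst : P ⟶ X} {snd : P ⟶ Y} {f : X ⟶ Z}
    {g : Y ⟶ Z} [IsAffine X] [IsAffine Y] [IsAffine Z] [IsAffine P]
    (h : IsPushout f.appTop g.appTop fst.appTop snd.appTop) : IsPullback fst snd f g :=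
  (isPullback_SpecMap_of_isPushout _ _ _ _ h).of_iso (Scheme.isoSpec P).symm (Scheme.isoSpec X).symm
    (Scheme.isoSpec Y).symm (Scheme.isoSpec Z).symm
    (by simp [Scheme.isoSpec_inv_naturality]) (by simp [Scheme.isoSpec_inv_naturality])
    (by simp [Scheme.isoSpec_inv_naturality]) (by simp [Scheme.isoSpec_inv_naturality])

/-- `U` is an affine scheme glued from closed subschemes `U₁` and `U₂` along `U₀ = U₁ ∩ U₂`. -/
structure IsGlued {U₀ U₁ U₂ U : Scheme.{u}} (k₁ : U₀ ⟶ U₁) (k₂ : U₀ ⟶ U₂) (j₁ : U₁ ⟶ U)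
    (j₂ : U₂ ⟶ U) : Prop where
  isAffine : IsAffine U
  closed₁ : IsClosedImmersion j₁
  closed₂ : IsClosedImmersion j₂
  isPullback : IsPullback k₁ k₂ j₁ j₂
  eq_zero : ∀ s : Γ(U, ⊤), j₁.appTop s = 0 → j₂.appTop s = 0 → s = 0

namespace IsGlued

variable {U₀ U₁ U₂ U : Scheme.{u}} {k₁ : U₀ ⟶ U₁} {k₂ : U₀ ⟶ U₂} {j₁ : U₁ ⟶ U} {j₂ : U₂ ⟶ U}

lemma symm (h : IsGlued k₁ k₂ j₁ j₂) : IsGlued k₂ k₁ j₂ j₁ :=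
  ⟨h.isAffine, h.closed₂, h.closed₁, h.isPullback.flip, fun s h₁ h₂ => h.eq_zero s h₂ h₁⟩

lemma isAffine₁ (h : IsGlued k₁ k₂ j₁ j₂) : IsAffine U₁ :=
  have := h.isAffine
  have := h.closed₁
  (IsClosedImmersion.isAffine_surjective_of_isAffine j₁).1

lemma surjective₁ (h : IsGlued k₁ k₂ j₁ j₂) : Function.Surjective j₁.appTop :=
  have := h.isAffine
  have := h.closed₁
  (IsClosedImmersion.isAffine_surjective_of_isAffine j₁).2

lemma closed_k₁ (h : IsGlued k₁ k₂ j₁ j₂) : IsClosedImmersion k₁ :=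
  have := h.closed₂
  MorphismProperty.of_isPullback (P := @IsClosedImmersion) h.isPullback.flip h.closed₂

lemma isAffine₀ (h : IsGlued k₁ k₂ j₁ j₂) : IsAffine U₀ :=
  have := h.isAffine₁
  have := h.closed_k₁
  (IsClosedImmersion.isAffine_surjective_of_isAffine k₁).1

lemma isPushout_appTop (h : IsGlued k₁ k₂ j₁ j₂) :
    IsPushout j₁.appTop j₂.appTop k₁.appTop k₂.appTop :=
  have := h.isAffine
  have := h.isAffine₁
  have := h.symm.isAffine₁
  isPushout_appTop_of_isPullback h.isPullback

lemma appTop_w (h : IsGlued k₁ k₂ j₁ j₂) (s : Γ(U, ⊤)) :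
    k₁.appTop (j₁.appTop s) = k₂.appTop (j₂.appTop s) :=
  ConcreteCategory.congr_hom h.isPushout_appTop.w s

lemma section_ext (h : IsGlued k₁ k₂ j₁ j₂) {s t : Γ(U, ⊤)} (h₁ : j₁.appTop s = j₁.appTop t)
    (h₂ : j₂.appTop s = j₂.appTop t) : s = t := by
  rw [← sub_eq_zero]
  apply h.eq_zero <;> simp [h₁, h₂]

/-- Lift `s₁` to U. Its discrepancy with `s₂` on U₂ vanishes on U₀, whose ideal in U₂ is the image
of the ideal of U₁ in U. So the discrepancy can be removed by a function on U vanishing on U₁.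
Together with `section_ext` this says that Γ(U) is the fibre product of Γ(U₁) and Γ(U₂) over Γ(U₀).
-/
lemma exists_section (h : IsGlued k₁ k₂ j₁ j₂) (s₁ : Γ(U₁, ⊤)) (s₂ : Γ(U₂, ⊤))
    (e : k₁.appTop s₁ = k₂.appTop s₂) : ∃ s : Γ(U, ⊤), j₁.appTop s = s₁ ∧ j₂.appTop s = s₂ := by
  obtain ⟨s, rfl⟩ := h.surjective₁ s₁
  rw [h.appTop_w] at e
  have h₁ := mem_map_ker_of_isPushout h.isPushout_appTop h.surjective₁ (j₂.appTop s - s₂)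
    (by simp [e])
  obtain ⟨d, hd, hd'⟩ := (Ideal.mem_map_iff_of_surjective _ h.symm.surjective₁).1 h₁
  have hd : j₁.appTop d = 0 := hd
  have hd' : j₂.appTop d = j₂.appTop s - s₂ := hd'
  exact ⟨s - d, by simp [hd], by simp [hd']⟩

lemma hom_ext_affine (h : IsGlued k₁ k₂ j₁ j₂) {Z : Scheme.{u}} [IsAffine Z] {f g : U ⟶ Z}
    (h₁ : j₁ ≫ f = j₁ ≫ g) (h₂ : j₂ ≫ f = j₂ ≫ g) : f = g := by
  apply ext_of_isAffine
  ext s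
  apply h.section_ext
  · exact ConcreteCategory.congr_hom congr(($h₁).appTop) s
  · exact ConcreteCategory.congr_hom congr(($h₂).appTop) s

/-- A morphism to an affine scheme is a ring homomorphism out of its functions, and Γ(U) is a fibre
product of rings. -/
lemma exists_desc_affine (h : IsGlued k₁ k₂ j₁ j₂) {Z : Scheme.{u}} [IsAffine Z] (f₁ : U₁ ⟶ Z)
    (f₂ : U₂ ⟶ Z) (w : k₁ ≫ f₁ = k₂ ≫ f₂) : ∃ f : U ⟶ Z, j₁ ≫ f = f₁ ∧ j₂ ≫ f = f₂ := by
  have := h.isAffine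
  have hw (s : Γ(Z, ⊤)) := h.exists_section (f₁.appTop s) (f₂.appTop s)
    (ConcreteCategory.congr_hom congr(($w).appTop) s)
  choose φ hφ₁ hφ₂ using hw
  let ψ : Γ(Z, ⊤) →+* Γ(U, ⊤) :=
    { toFun := φ
      map_one' := h.section_ext (by rw [hφ₁, map_one, map_one]) (by rw [hφ₂, map_one, map_one])
      map_zero' := h.section_ext (by rw [hφ₁, map_zero, map_zero]) (by rw [hφ₂, map_zero, map_zero])
      map_mul' := fun x y => h.section_ext
        (by rw [hφ₁, map_mul, map_mul, hφ₁, hφ₁]) (by rw [hφ₂, map_mul, map_mul, hφ₂, hφ₂])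
      map_add' := fun x y => h.section_ext
        (by rw [hφ₁, map_add, map_add, hφ₁, hφ₁]) (by rw [hφ₂, map_add, map_add, hφ₂, hφ₂]) }
  refine ⟨U.toSpecΓ ≫ Spec.map (CommRingCat.ofHom ψ) ≫ Z.isoSpec.inv, ?_, ?_⟩
  · rw [← Category.assoc, ← Category.assoc, Iso.comp_inv_eq, Category.assoc]
    rw [Scheme.toSpecΓ_naturality_assoc, Scheme.isoSpec_hom, Scheme.toSpecΓ_naturality,
      ← Spec.map_comp]
    congr 2
    ext s
    exact hφ₁ s
  · rw [← Category.assoc, ← Category.assoc, Iso.comp_inv_eq, Category.assoc]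
    rw [Scheme.toSpecΓ_naturality_assoc, Scheme.isoSpec_hom, Scheme.toSpecΓ_naturality,
      ← Spec.map_comp]
    congr 2
    ext s
    exact hφ₂ s

/-- A function whose nonvanishing locus misses both pieces restricts to a nilpotent on each, so a
power of it vanishes on both pieces and is therefore zero. -/
lemma range_union (h : IsGlued k₁ k₂ j₁ j₂) (x : U) : (∃ y, j₁ y = x) ∨ ∃ y, j₂ y = x := by
  have := h.isAffine
  have := h.closed₁
  have := h.closed₂
  have c₁ := j₁.isClosedEmbedding.isClosed_range
  have c₂ := j₂.isClosedEmbedding.isClosed_range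
  by_contra! hx
  have hO : x ∈ (⟨_, (c₁.union c₂).isOpen_compl⟩ : U.Opens) := by
    rintro (⟨y, hy⟩ | ⟨y, hy⟩)
    exacts [hx.1 y hy, hx.2 y hy]
  obtain ⟨f, hf, hxf⟩ := (isAffineOpen_top U).exists_basicOpen_le ⟨x, hO⟩ trivial
  have key {V : Scheme.{u}} (j : V ⟶ U) [IsAffine V] (hj : ∀ y, j y ∉ U.basicOpen f) :
      IsNilpotent (j.appTop f) := by
    have hb : V.basicOpen (j.appTop f) = ⊥ := by
      rw [← Scheme.preimage_basicOpen_top]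
      exact le_bot_iff.1 fun y hy => hj y hy
    have := (Scheme.isNilpotent_iff_basicOpen_eq_bot (X := V) (j.appTop f)).2 hb
    exact this
  have := h.isAffine₁
  have := h.symm.isAffine₁
  obtain ⟨n, hn⟩ := key j₁ fun y hy => hf hy (Or.inl ⟨y, rfl⟩)
  obtain ⟨m, hm⟩ := key j₂ fun y hy => hf hy (Or.inr ⟨y, rfl⟩)
  have hz : f ^ (n + m) = 0 := by
    apply h.eq_zero
    · rw [map_pow, pow_add, hn, zero_mul]
    · rw [map_pow, pow_add, hm, mul_zero]
  have := (Scheme.isNilpotent_iff_basicOpen_eq_bot (X := U) f).1 ⟨_, hz⟩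
  rw [this] at hxf
  exact hxf

/-- Gluing is stable under flat base change to an affine scheme. -/
lemma of_flat (h : IsGlued k₁ k₂ j₁ j₂) {V₀ V₁ V₂ V : Scheme.{u}} [IsAffine V] {f : V ⟶ U} [Flat f]
    {l₁ : V₀ ⟶ V₁} {l₂ : V₀ ⟶ V₂} {m₁ : V₁ ⟶ V} {m₂ : V₂ ⟶ V} {f₁ : V₁ ⟶ U₁} {f₂ : V₂ ⟶ U₂}
    (sq₁ : IsPullback m₁ f₁ f j₁) (sq₂ : IsPullback m₂ f₂ f j₂) (sq₀ : IsPullback l₁ l₂ m₁ m₂) :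
    IsGlued l₁ l₂ m₁ m₂ := by
  have := h.isAffine
  have := h.isAffine₁
  have := h.symm.isAffine₁
  have := h.closed₁
  have := h.closed₂
  refine ⟨inferInstance, MorphismProperty.of_isPullback (P := @IsClosedImmersion) sq₁.flip h.closed₁,
    MorphismProperty.of_isPullback (P := @IsClosedImmersion) sq₂.flip h.closed₂, sq₀, ?_⟩
  intro s hs₁ hs₂
  have hf : f.appTop.hom.Flat := (HasRingHomProperty.iff_of_isAffine (P := @Flat)).1 inferInstance
  have p₁ := isPushout_appTop_of_isPullback sq₁
  have p₂ := isPushout_appTop_of_isPullback sq₂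
  algebraize [f.appTop.hom, j₁.appTop.hom, j₂.appTop.hom, m₁.appTop.hom, m₂.appTop.hom,
    f₁.appTop.hom, f₂.appTop.hom, (f.appTop ≫ m₁.appTop).hom, (f.appTop ≫ m₂.appTop).hom]
  have : IsScalarTower Γ(U, ⊤) Γ(V, ⊤) Γ(V₁, ⊤) := .of_algebraMap_eq' rfl
  have : IsScalarTower Γ(U, ⊤) Γ(V, ⊤) Γ(V₂, ⊤) := .of_algebraMap_eq' rfl
  have : IsScalarTower Γ(U, ⊤) Γ(U₁, ⊤) Γ(V₁, ⊤) := .of_algebraMap_eq' congr(($(p₁.w)).hom)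
  have : IsScalarTower Γ(U, ⊤) Γ(U₂, ⊤) Γ(V₂, ⊤) := .of_algebraMap_eq' congr(($(p₂.w)).hom)
  have q₁ : Algebra.IsPushout Γ(U, ⊤) Γ(V, ⊤) Γ(U₁, ⊤) Γ(V₁, ⊤) :=
    CommRingCat.isPushout_iff_isPushout.1 p₁
  have q₂ : Algebra.IsPushout Γ(U, ⊤) Γ(V, ⊤) Γ(U₂, ⊤) Γ(V₂, ⊤) :=
    CommRingCat.isPushout_iff_isPushout.1 p₂
  -- The condition to transport is injectivity of Γ(U) → Γ(U₁) × Γ(U₂), which flat base change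
  -- preserves.
  let ι : Γ(U, ⊤) →ₗ[Γ(U, ⊤)] Γ(U₁, ⊤) × Γ(U₂, ⊤) :=
    (Algebra.linearMap _ _).prod (Algebra.linearMap _ _)
  have hι : Function.Injective ι := by
    rw [injective_iff_map_eq_zero]
    intro a ha
    exact h.eq_zero a congr(($ha).1) congr(($ha).2)
  have := Module.Flat.lTensor_preserves_injective_linearMap (M := Γ(V, ⊤)) ι hι
  have hz : ι.lTensor Γ(V, ⊤) (TensorProduct.tmul Γ(U, ⊤) s 1) = 0 := by
    apply (TensorProduct.prodRight Γ(U, ⊤) Γ(U, ⊤) Γ(V, ⊤) Γ(U₁, ⊤) Γ(U₂, ⊤)).injective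
    rw [map_zero]
    apply Prod.ext
    · apply (Algebra.IsPushout.equiv Γ(U, ⊤) Γ(V, ⊤) Γ(U₁, ⊤) Γ(V₁, ⊤)).injective
      simpa [ι, Algebra.IsPushout.equiv_tmul] using! hs₁
    · apply (Algebra.IsPushout.equiv Γ(U, ⊤) Γ(V, ⊤) Γ(U₂, ⊤) Γ(V₂, ⊤)).injective
      simpa [ι, Algebra.IsPushout.equiv_tmul] using! hs₂
  have := (injective_iff_map_eq_zero _).1 this _ hz
  simpa using congrArg (TensorProduct.rid Γ(U, ⊤) Γ(V, ⊤)) this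

lemma etale_of_etale_of_isAffine (h : IsGlued k₁ k₂ j₁ j₂) {V₁ V₂ V : Scheme.{u}} [IsAffine V]
    {f : V ⟶ U} {m₁ : V₁ ⟶ V} {m₂ : V₂ ⟶ V} {f₁ : V₁ ⟶ U₁} {f₂ : V₂ ⟶ U₂}
    (sq₁ : IsPullback m₁ f₁ f j₁) (sq₂ : IsPullback m₂ f₂ f j₂) [Etale f₁] [Etale f₂] : Etale f := by
  have := h.isAffine
  have := h.isAffine₁
  have := h.symm.isAffine₁
  have : IsAffine V₁ := .of_isPullback sq₁
  have : IsAffine V₂ := .of_isPullback sq₂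
  have hf₁ : f₁.appTop.hom.Etale := (HasRingHomProperty.iff_of_isAffine (P := @Etale)).1 inferInstance
  have hf₂ : f₂.appTop.hom.Etale := (HasRingHomProperty.iff_of_isAffine (P := @Etale)).1 inferInstance
  rw [HasRingHomProperty.iff_of_isAffine (P := @Etale)]
  have p₁ := isPushout_appTop_of_isPullback sq₁.flip
  have p₂ := isPushout_appTop_of_isPullback sq₂.flip
  have s₁ := h.surjective₁
  have s₂ := h.symm.surjective₁
  have h0 := h.eq_zero
  algebraize [f.appTop.hom, j₁.appTop.hom, j₂.appTop.hom, m₁.appTop.hom, m₂.appTop.hom,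
    f₁.appTop.hom, f₂.appTop.hom, (f.appTop ≫ m₁.appTop).hom, (f.appTop ≫ m₂.appTop).hom]
  have : IsScalarTower Γ(U, ⊤) Γ(V, ⊤) Γ(V₁, ⊤) := .of_algebraMap_eq' rfl
  have : IsScalarTower Γ(U, ⊤) Γ(V, ⊤) Γ(V₂, ⊤) := .of_algebraMap_eq' rfl
  have : IsScalarTower Γ(U, ⊤) Γ(U₁, ⊤) Γ(V₁, ⊤) := .of_algebraMap_eq' congr(($(p₁.w)).hom).symm
  have : IsScalarTower Γ(U, ⊤) Γ(U₂, ⊤) Γ(V₂, ⊤) := .of_algebraMap_eq' congr(($(p₂.w)).hom).symm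
  have q₁ : Algebra.IsPushout Γ(U, ⊤) Γ(U₁, ⊤) Γ(V, ⊤) Γ(V₁, ⊤) :=
    CommRingCat.isPushout_iff_isPushout.1 p₁
  have q₂ : Algebra.IsPushout Γ(U, ⊤) Γ(U₂, ⊤) Γ(V, ⊤) Γ(V₂, ⊤) :=
    CommRingCat.isPushout_iff_isPushout.1 p₂
  exact etale_of_etale_quotients (A := Γ(U, ⊤)) (A₁ := Γ(U₁, ⊤)) (A₂ := Γ(U₂, ⊤)) (B := Γ(V, ⊤))
    (B₁ := Γ(V₁, ⊤)) (B₂ := Γ(V₂, ⊤)) s₁ s₂ h0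

/-- A morphism to a glued affine scheme is étale if it is so over both pieces. -/
lemma etale_of_etale (h : IsGlued k₁ k₂ j₁ j₂) {V₁ V₂ V : Scheme.{u}} {f : V ⟶ U}
    {m₁ : V₁ ⟶ V} {m₂ : V₂ ⟶ V} {f₁ : V₁ ⟶ U₁} {f₂ : V₂ ⟶ U₂}
    (sq₁ : IsPullback m₁ f₁ f j₁) (sq₂ : IsPullback m₂ f₂ f j₂) [Etale f₁] [Etale f₂] : Etale f := by
  have := h.isAffine
  have := h.isAffine₁
  have := h.symm.isAffine₁
  rw [HasRingHomProperty.iff_of_source_openCover (P := @Etale.{u}) V.affineCover]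
  intro i
  have sq₁' := (IsPullback.of_hasPullback (V.affineCover.f i) m₁).paste_vert sq₁
  have sq₂' := (IsPullback.of_hasPullback (V.affineCover.f i) m₂).paste_vert sq₂
  exact (HasRingHomProperty.iff_of_isAffine (P := @Etale.{u})).1
    (etale_of_etale_of_isAffine h sq₁' sq₂')

/-- Compatibility of gluing with base change over both pieces. -/
lemma isPullback_of_isPullback (h : IsGlued k₁ k₂ j₁ j₂) {V₀ V₁ V₂ V : Scheme.{u}}
    {l₁ : V₀ ⟶ V₁} {l₂ : V₀ ⟶ V₂} {m₁ : V₁ ⟶ V} {m₂ : V₂ ⟶ V} (h' : IsGlued l₁ l₂ m₁ m₂)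
    {f₀ : V₀ ⟶ U₀} {f₁ : V₁ ⟶ U₁} {f₂ : V₂ ⟶ U₂} {f : V ⟶ U}
    (sq₂ : IsPullback l₂ f₀ f₂ k₂)
    (w₁ : m₁ ≫ f = f₁ ≫ j₁) (w₂ : m₂ ≫ f = f₂ ≫ j₂) : IsPullback m₁ f₁ f j₁ := by
  have := h.isAffine
  have := h.isAffine₁
  have := h.symm.isAffine₁
  have := h.isAffine₀
  have := h'.isAffine
  have := h'.isAffine₁
  have := h'.symm.isAffine₁
  have := h'.isAffine₀
  apply isPullback_of_isPushout_appTop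
  have e₁ : f.appTop ≫ m₁.appTop = j₁.appTop ≫ f₁.appTop := by
    rw [← Scheme.Hom.comp_appTop, w₁, Scheme.Hom.comp_appTop]
  have e₂ : f.appTop ≫ m₂.appTop = j₂.appTop ≫ f₂.appTop := by
    rw [← Scheme.Hom.comp_appTop, w₂, Scheme.Hom.comp_appTop]
  refine (isPushout_of_ker_le e₁.symm h.surjective₁ h'.surjective₁ ?_).flip
  intro b hb
  have hk₂ : Function.Surjective k₂.appTop :=
    surjective_of_isPushout_commRingCat h.isPushout_appTop h.surjective₁
  -- As `b` vanishes on V₁, its restriction to V₂ vanishes on V₀, hence lies in the ideal generated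
  -- by the kernel of U₂ ← U₀, that is, by the restrictions of functions vanishing on U₁. This
  -- yields `c` in the required ideal agreeing with `b` on V₂. Both vanish on V₁, so they are equal.
  have hb₀ : l₂.appTop (m₂.appTop b) = 0 := by rw [← h'.appTop_w, hb, map_zero]
  have hb₁ := mem_map_ker_of_isPushout (isPushout_appTop_of_isPullback sq₂.flip) hk₂ _ hb₀
  have hsub : (RingHom.ker k₂.appTop.hom).map f₂.appTop.hom ≤
      (((RingHom.ker j₁.appTop.hom).map f.appTop.hom).map m₂.appTop.hom) := by
    rw [Ideal.map_le_iff_le_comap]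
    intro a ha
    have ha' := mem_map_ker_of_isPushout h.isPushout_appTop h.surjective₁ a ha
    obtain ⟨c, hc, rfl⟩ := (Ideal.mem_map_iff_of_surjective _ h.symm.surjective₁).1 ha'
    have e : f₂.appTop.hom (j₂.appTop.hom c) = m₂.appTop.hom (f.appTop.hom c) :=
      (ConcreteCategory.congr_hom e₂ c).symm
    rw [Ideal.mem_comap, e]
    exact Ideal.mem_map_of_mem _ (Ideal.mem_map_of_mem _ hc)
  obtain ⟨c, hc, hc'⟩ := (Ideal.mem_map_iff_of_surjective _ h'.symm.surjective₁).1 (hsub hb₁)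
  have hc₁ : m₁.appTop c = 0 := by
    have : (RingHom.ker j₁.appTop.hom).map f.appTop.hom ≤ RingHom.ker m₁.appTop.hom := by
      rw [Ideal.map_le_iff_le_comap]
      intro a ha
      have ha : j₁.appTop a = 0 := ha
      have e : m₁.appTop.hom (f.appTop.hom a) = f₁.appTop.hom (j₁.appTop a) :=
        ConcreteCategory.congr_hom e₁ a
      rw [Ideal.mem_comap, RingHom.mem_ker, e, ha, map_zero]
    exact this hc
  have : b = c := h'.section_ext (hb.trans hc₁.symm) hc'.symm
  rwa [this]

end IsGlued

/-- Two affine schemes can be glued along a common closed subscheme. -/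
lemma exists_isGlued {V₀ V₁ V₂ : Scheme.{u}} [IsAffine V₁] [IsAffine V₂] (k₁ : V₀ ⟶ V₁)
    (k₂ : V₀ ⟶ V₂) [IsClosedImmersion k₁] [IsClosedImmersion k₂] :
    ∃ (V : Scheme.{u}) (j₁ : V₁ ⟶ V) (j₂ : V₂ ⟶ V), IsGlued k₁ k₂ j₁ j₂ := by
  obtain ⟨_, hs₁⟩ := IsClosedImmersion.isAffine_surjective_of_isAffine k₁
  obtain ⟨-, hs₂⟩ := IsClosedImmersion.isAffine_surjective_of_isAffine k₂
  let R : Subring (Γ(V₁, ⊤) × Γ(V₂, ⊤)) :=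
    RingHom.eqLocus (k₁.appTop.hom.comp (RingHom.fst _ _)) (k₂.appTop.hom.comp (RingHom.snd _ _))
  let B : CommRingCat.{u} := CommRingCat.of R
  let φ₁ : B ⟶ Γ(V₁, ⊤) := CommRingCat.ofHom ((RingHom.fst _ _).comp R.subtype)
  let φ₂ : B ⟶ Γ(V₂, ⊤) := CommRingCat.ofHom ((RingHom.snd _ _).comp R.subtype)
  have hφ₁ : Function.Surjective φ₁ := fun x => by
    obtain ⟨y, hy⟩ := hs₂ (k₁.appTop x)
    exact ⟨⟨(x, y), hy.symm⟩, rfl⟩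
  have hφ₂ : Function.Surjective φ₂ := fun y => by
    obtain ⟨x, hx⟩ := hs₁ (k₂.appTop y)
    exact ⟨⟨(x, y), hx⟩, rfl⟩
  have hpo : IsPushout φ₁ φ₂ k₁.appTop k₂.appTop := by
    refine isPushout_of_ker_le ?_ hφ₁ hs₂ ?_
    · ext x
      exact x.2
    · intro y hy
      have : φ₂ ⟨(0, y), by change k₁.appTop 0 = k₂.appTop y; rw [hy, map_zero]⟩ = y := rfl
      rw [← this]
      exact Ideal.mem_map_of_mem _ rfl
  have c₁ : IsClosedImmersion (Spec.map φ₁) := .spec_of_surjective _ hφ₁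
  have c₂ : IsClosedImmersion (Spec.map φ₂) := .spec_of_surjective _ hφ₂
  refine ⟨Spec B, V₁.isoSpec.hom ≫ Spec.map φ₁, V₂.isoSpec.hom ≫ Spec.map φ₂, inferInstance,
    inferInstance, inferInstance, ?_, ?_⟩
  · exact (isPullback_SpecMap_of_isPushout _ _ _ _ hpo).of_iso (Scheme.isoSpec V₀).symm
      (Scheme.isoSpec V₁).symm (Scheme.isoSpec V₂).symm (Iso.refl _)
      (by simp [Scheme.isoSpec_inv_naturality]) (by simp [Scheme.isoSpec_inv_naturality])
      (by simp) (by simp)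
  · intro s h₁ h₂
    obtain ⟨b, rfl⟩ := (Scheme.ΓSpecIso B).commRingCatIsoToRingEquiv.symm.surjective s
    have key {V : Scheme.{u}} [IsAffine V] (φ : B ⟶ Γ(V, ⊤)) :
        (V.isoSpec.hom ≫ Spec.map φ).appTop ((Scheme.ΓSpecIso B).inv b) = φ b := by
      have e := Scheme.ΓSpecIso_inv_naturality φ
      rw [Scheme.Hom.comp_appTop, ← CommRingCat.comp_apply, ← Category.assoc, ← e]
      simp [Scheme.isoSpec_hom, Scheme.toSpecΓ_appTop]
    have e₁ : φ₁ b = 0 := (key φ₁).symm.trans h₁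
    have e₂ : φ₂ b = 0 := (key φ₂).symm.trans h₂
    have : b = 0 := Subtype.ext (Prod.ext e₁ e₂)
    rw [this, map_zero]

end AlgebraicSpace

namespace AlgebraicSpace

/-! ### Étale covers of presheaves by schemes -/

section Covers

variable {X Z F : Scheme.{u}ᵒᵖ ⥤ Type u}

/-- Every section of `X` lifts étale locally to one of the schemes `U c`. -/
def EtaleCovers {I : Sort*} {U : I → Scheme.{u}} (p : ∀ c, yoneda.obj (U c) ⟶ X) : Prop :=
  ∀ (T : Scheme.{u}) (x : X.obj (op T)) (y : T), ∃ (V : Scheme.{u}) (f : V ⟶ T) (v : V),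
    Etale f ∧ f v = y ∧ ∃ (c : I) (t : V ⟶ U c), (p c).app (op V) t = X.map f.op x

/-- Morphisms to a sheaf may be constructed on an étale cover. -/
lemma EtaleCovers.exists_desc {I : Sort*} {U : I → Scheme.{u}} {p : ∀ c, yoneda.obj (U c) ⟶ X}
    (hp : EtaleCovers p) (hZ : Presheaf.IsSheaf Scheme.etaleTopology.{u} Z)
    (z : ∀ c, yoneda.obj (U c) ⟶ Z)
    (hz : ∀ (c c' : I) (T : Scheme.{u}) (t : T ⟶ U c) (t' : T ⟶ U c'),
      (p c).app (op T) t = (p c').app (op T) t' → (z c).app (op T) t = (z c').app (op T) t') :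
    ∃ h : X ⟶ Z, ∀ c, p c ≫ h = z c := by
  -- The image of `x` is glued from the values of `z` on local lifts of `x`; the hypothesis `hz`
  -- makes these values independent of the lift.
  have key (T : Scheme.{u}) (x : X.obj (op T)) : ∃ y : Z.obj (op T),
      ∀ (V : Scheme.{u}) (f : V ⟶ T) (c : I) (t : V ⟶ U c),
        (p c).app (op V) t = X.map f.op x → Z.map f.op y = (z c).app (op V) t := by
    refine (exists_glue hZ (T := T)
      (fun {V} f y => ∃ (c : I) (t : V ⟶ U c), (p c).app (op V) t = X.map f.op x ∧
        y = (z c).app (op V) t) ?_ ?_ ?_).imp fun y hy V f c t h => hy f _ ⟨c, t, h, rfl⟩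
    · rintro V V' f g _ ⟨c, t, h, rfl⟩
      exact ⟨c, g ≫ t, by rw [← map_app_yoneda, h, map_map], map_app_yoneda _ _ _⟩
    · rintro V f _ _ ⟨c, t, h, rfl⟩ ⟨c', t', h', rfl⟩
      exact hz c c' V t t' (h.trans h'.symm)
    · intro t
      obtain ⟨V, f, v, h₁, h₂, c, s, h₃⟩ := hp T x t
      exact ⟨V, f, v, h₁, h₂, _, c, s, h₃, rfl⟩
  choose φ hφ using key
  refine ⟨⟨fun T => TypeCat.ofHom (φ T.unop), fun T T' g => ?_⟩, fun c => ?_⟩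
  · ext x
    change φ T'.unop (X.map g x) = Z.map g (φ T.unop x)
    apply sheaf_ext hZ
    intro t
    obtain ⟨V, f, v, h₁, h₂, c, s, h₃⟩ := hp _ (X.map g x) t
    refine ⟨V, f, v, h₁, h₂, ?_⟩
    rw [hφ _ _ _ _ _ _ h₃]
    have : (p c).app (op V) s = X.map (f ≫ g.unop).op x := by
      rw [h₃]; exact map_map g.unop f x
    rw [← hφ _ _ _ _ _ _ this]
    exact (map_map g.unop f _).symm
  · apply hom_ext_yoneda_obj
    change φ (U c) ((p c).app (op (U c)) (𝟙 _)) = _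
    have := hφ (U c) ((p c).app (op (U c)) (𝟙 _)) _ (𝟙 _) c (𝟙 _) (by simp)
    simpa using this

lemma EtaleCovers.hom_ext {I : Sort*} {U : I → Scheme.{u}} {p : ∀ c, yoneda.obj (U c) ⟶ X}
    (hp : EtaleCovers p) (hZ : Presheaf.IsSheaf Scheme.etaleTopology.{u} Z) {g h : X ⟶ Z}
    (e : ∀ c, p c ≫ g = p c ≫ h) : g = h := by
  ext T x
  apply sheaf_ext hZ (T := T.unop)
  intro t
  obtain ⟨V, f, v, h₁, h₂, c, s, h₃⟩ := hp _ x t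
  refine ⟨V, f, v, h₁, h₂, ?_⟩
  have := ConcreteCategory.congr_hom (NatTrans.congr_app (e c) (op V))
    (s : (yoneda.obj (U c)).obj (op V))
  rw [comp_app_apply', comp_app_apply', h₃] at this
  exact (map_app g f x).trans (this.trans (map_app h f x).symm)

/-- The étale sheaf image of a morphism from a scheme. -/
def etaleImage {O : Scheme.{u}} (p : yoneda.obj O ⟶ F) : Subfunctor F where
  obj T := {x | ∀ y : T.unop, ∃ (V : Scheme.{u}) (f : V ⟶ T.unop) (v : V), Etale f ∧ f v = y ∧
    ∃ t : V ⟶ O, p.app (op V) t = F.map f.op x}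
  map {T T'} g x hx y := by
    obtain ⟨V, f, v, _, hv, t, ht⟩ := hx (g.unop y)
    obtain ⟨z, hz, -⟩ := Scheme.Pullback.exists_preimage_pullback (f := g.unop) (g := f) y v hv.symm
    refine ⟨pullback g.unop f, pullback.fst _ _, z, inferInstance, hz, pullback.snd _ _ ≫ t, ?_⟩
    rw [← map_app_yoneda, ht, map_map, ← pullback.condition, ← map_map]
    rfl

lemma isSheaf_etaleImage (hF : Presheaf.IsSheaf Scheme.etaleTopology.{u} F) {O : Scheme.{u}}
    (p : yoneda.obj O ⟶ F) : Presheaf.IsSheaf Scheme.etaleTopology.{u} (etaleImage p).toFunctor := by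
  rw [isSheaf_iff_isSheaf_of_type] at hF ⊢
  rw [Subfunctor.isSheaf_iff _ hF]
  intro T x hx y
  obtain ⟨V, f, v, _, hf, hv⟩ := mem_etaleTopology_iff.1 hx y
  obtain ⟨V', f', v', _, hv', t, ht⟩ := hf v
  exact ⟨V', f' ≫ f, v', inferInstance, by rw [Scheme.Hom.comp_apply, hv', hv], t,
    ht.trans (map_map f f' x)⟩

/-- The canonical map from a scheme to the étale image. -/
def toEtaleImage {O : Scheme.{u}} (p : yoneda.obj O ⟶ F) :
    yoneda.obj O ⟶ (etaleImage p).toFunctor where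
  app T := TypeCat.ofHom fun t => ⟨p.app T t, fun y => ⟨T.unop, 𝟙 _, y, inferInstance, rfl, t,
    by simp⟩⟩
  naturality T T' g := by
    ext t
    apply Subtype.ext
    exact NatTrans.naturality_apply p g (t : (yoneda.obj O).obj T)

lemma toEtaleImage_ι {O : Scheme.{u}} (p : yoneda.obj O ⟶ F) :
    toEtaleImage p ≫ (etaleImage p).ι = p := rfl

lemma etaleCovers_toEtaleImage {O : Scheme.{u}} (p : yoneda.obj O ⟶ F) :
    EtaleCovers (I := Unit) (fun _ => toEtaleImage p) := by
  intro T x y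
  obtain ⟨V, f, v, h₁, h₂, t, ht⟩ := x.2 y
  exact ⟨V, f, v, h₁, h₂, (), t, Subtype.ext ht⟩

/-- If the base change of `p` to `Y` is étale then the base change of its étale image is open. -/
lemma isPullback_etaleImage {O R Y : Scheme.{u}} {p : yoneda.obj O ⟶ F} {x : yoneda.obj Y ⟶ F}
    {a : yoneda.obj R ⟶ yoneda.obj O} {r : R ⟶ Y} [Etale r]
    (h : IsPullback a (yoneda.map r) p x) (V : Y.Opens) (hV : (V : Set Y) = Set.range r) :
    ∃ b : yoneda.obj (V : Scheme.{u}) ⟶ (etaleImage p).toFunctor,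
      IsPullback b (yoneda.map V.ι) (etaleImage p).ι x := by
  -- A section over T lifts étale locally to O exactly when T maps into the image of R. For the
  -- converse, the étale neighbourhoods are provided by the pullback of `r` itself.
  have hmem (T : Scheme.{u}) (t : T ⟶ Y) :
      x.app (op T) t ∈ (etaleImage p).obj (op T) ↔ ∀ y, t y ∈ V := by
    constructor
    · intro hx y
      obtain ⟨T', f, v, _, rfl, s, hs⟩ := hx y
      rw [map_app_yoneda] at hs
      obtain ⟨z, -, hz⟩ := IsPullback.exists_hom h s (f ≫ t) hs
      change t (f v) ∈ (V : Set Y)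
      rw [hV, ← Scheme.Hom.comp_apply, ← hz]
      exact ⟨z v, rfl⟩
    · intro ht y
      have := ht y
      change t y ∈ (V : Set Y) at this
      rw [hV] at this
      obtain ⟨z, hz⟩ := this
      obtain ⟨w, hw, -⟩ := Scheme.Pullback.exists_preimage_pullback (f := t) (g := r) y z hz.symm
      refine ⟨pullback t r, pullback.fst _ _, w, inferInstance, hw,
        a.app (op (pullback t r)) (pullback.snd t r), ?_⟩
      refine (IsPullback.app_eq h (pullback.snd t r)).trans ?_
      rw [← pullback.condition]
      exact (map_app_yoneda _ _ _).symm
  let b : yoneda.obj (V : Scheme.{u}) ⟶ (etaleImage p).toFunctor :=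
    { app := fun T => TypeCat.ofHom fun (t : T.unop ⟶ V) => ⟨x.app T (t ≫ V.ι),
        (hmem T.unop (t ≫ V.ι)).2 fun y => (t y).2⟩
      naturality := fun T T' g => by
        ext t
        apply Subtype.ext
        exact NatTrans.naturality_apply x g ((yoneda.map V.ι).app T t) }
  refine ⟨b, isPullback_iff_forall.2 ⟨rfl, fun T s t _ e => ?_, fun T y (t : T ⟶ Y) e => ?_⟩⟩
  · exact (cancel_mono V.ι).1 e
  · have ht : ∀ z, t z ∈ V := (hmem T t).1 (e ▸ y.2)
    let l : T ⟶ V := IsOpenImmersion.lift V.ι t (by rintro _ ⟨z, rfl⟩; simpa using ht z)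
    have hl : l ≫ V.ι = t := IsOpenImmersion.lift_fac _ _ _
    refine ⟨l, Subtype.ext ?_, hl⟩
    change x.app _ (l ≫ V.ι) = _
    rw [hl]
    exact e.symm

end Covers

end AlgebraicSpace

namespace AlgebraicSpace

/-! ### Representability of subsheaves of schemes -/

open TensorProduct in
/-- Flat descent for the equalizer of the two pullbacks of an algebra. -/
lemma isPushout_equalizer {A A' C C₂ C₃ : Type*} [CommRing A] [CommRing A'] [CommRing C]
    [CommRing C₂] [CommRing C₃] [Algebra A A'] [Algebra A C] [Algebra A C₂] [Algebra A C₃]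
    [Algebra A' C] [IsScalarTower A A' C] [Algebra C C₂] [IsScalarTower A C C₂] [Algebra A' C₂]
    [IsScalarTower A A' C₂] [Algebra C₂ C₃] [IsScalarTower A C₂ C₃] [Algebra A' C₃]
    [IsScalarTower A A' C₃] [Module.Flat A A'] [Algebra.IsPushout A A' C C₂]
    [Algebra.IsPushout A A' C₂ C₃] (p₂ : C →ₐ[A] C₂)
    (hm : ∀ a : A', p₂ (algebraMap A' C a) = algebraMap A' C₂ a) (r₁ r₂ : C₂ →ₐ[A] C₃)
    (h₁ : ∀ c : C, r₁ (algebraMap C C₂ c) = algebraMap C₂ C₃ (algebraMap C C₂ c))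
    (h₂ : ∀ c : C, r₂ (algebraMap C C₂ c) = algebraMap C₂ C₃ (p₂ c))
    (s₁ : ∀ a : A', r₁ (algebraMap A' C₂ a) = algebraMap A' C₃ a)
    (s₂ : ∀ a : A', r₂ (algebraMap A' C₂ a) = algebraMap A' C₃ a)
    (h : ∀ c, r₁ (p₂ c) = r₂ (p₂ c)) (hinj : Function.Injective p₂) :
    Algebra.IsPushout A A' (AlgHom.equalizer (IsScalarTower.toAlgHom A C C₂) p₂) C := by
  set B := AlgHom.equalizer (IsScalarTower.toAlgHom A C C₂) p₂
  let φ : A' ⊗[A] B →ₐ[A'] C :=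
    Algebra.TensorProduct.lift (Algebra.ofId A' C) B.val fun _ _ => .all _ _
  let θ := Algebra.IsPushout.equiv A A' C C₂
  let θ₃ := Algebra.IsPushout.equiv A A' C₂ C₃
  have hφ (a : A') (b : B) : φ (a ⊗ₜ b) = algebraMap A' C a * b := by
    simp [φ, Algebra.ofId_apply]
  have hθ (a : A') (c : C) : θ (a ⊗ₜ c) = algebraMap A' C₂ a * algebraMap C C₂ c := by
    simp [θ, Algebra.IsPushout.equiv_tmul]
  have hθ₃ (a : A') (c : C₂) : θ₃ (a ⊗ₜ c) = algebraMap A' C₃ a * algebraMap C₂ C₃ c := by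
    simp [θ₃, Algebra.IsPushout.equiv_tmul]
  have hB (b : B) : algebraMap C C₂ b = p₂ b := b.2
  -- Composed with the injection `p₂`, the map φ becomes the base change of the inclusion B ⊂ C,
  -- under the identification of A' ⊗ C with C₂.
  have key (z : A' ⊗[A] B) : p₂ (φ z) = θ (B.val.toLinearMap.lTensor A' z) := by
    induction z with
    | zero => simp
    | add x y hx hy => simp only [map_add, hx, hy]
    | tmul a b =>
      rw [LinearMap.lTensor_tmul, hφ, map_mul, hm]
      exact ((hθ a b).trans (by rw [hB])).symm
  have k₁ (z : A' ⊗[A] C) :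
      θ₃ ((IsScalarTower.toAlgHom A C C₂).toLinearMap.lTensor A' z) = r₁ (θ z) := by
    induction z with
    | zero => simp
    | add x y hx hy => simp only [map_add, hx, hy]
    | tmul a b =>
      rw [LinearMap.lTensor_tmul, hθ, map_mul, s₁, h₁]
      exact hθ₃ _ _
  have k₂ (z : A' ⊗[A] C) : θ₃ (p₂.toLinearMap.lTensor A' z) = r₂ (θ z) := by
    induction z with
    | zero => simp
    | add x y hx hy => simp only [map_add, hx, hy]
    | tmul a b =>
      rw [LinearMap.lTensor_tmul, hθ, map_mul, s₂, h₂]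
      exact hθ₃ _ _
  have hex : Function.Exact B.val.toLinearMap
      ((IsScalarTower.toAlgHom A C C₂).toLinearMap - p₂.toLinearMap) := by
    intro c
    rw [LinearMap.sub_apply, sub_eq_zero]
    exact ⟨fun hc => ⟨⟨c, hc⟩, rfl⟩, by rintro ⟨b, rfl⟩; exact b.2⟩
  -- By flatness A' ⊗ B is still the equalizer of the two base changed maps. The hypothesis `h`
  -- places p₂(c) in that equalizer for every c, which gives surjectivity of φ.
  have hex' := Module.Flat.lTensor_exact A' hex
  have hbij : Function.Bijective φ := by
    constructor
    · have : Function.Injective (B.val.toLinearMap.lTensor A') :=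
        Module.Flat.lTensor_preserves_injective_linearMap _ Subtype.val_injective
      intro x y e
      apply this
      apply θ.injective
      rw [← key, ← key, e]
    · intro c
      obtain ⟨z, hz⟩ := θ.surjective (p₂ c)
      have : ((IsScalarTower.toAlgHom A C C₂).toLinearMap - p₂.toLinearMap).lTensor A' z = 0 := by
        rw [LinearMap.lTensor_sub, LinearMap.sub_apply, sub_eq_zero]
        apply θ₃.injective
        rw [k₁, k₂, hz, h]
      obtain ⟨w, rfl⟩ := (hex' z).1 this
      exact ⟨w, hinj (by rw [key, hz])⟩
  refine ⟨IsBaseChange.of_equiv (LinearEquiv.ofBijective φ.toLinearMap hbij) fun b => ?_⟩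
  change φ (1 ⊗ₜ b) = b
  rw [hφ, map_one, one_mul]

/-- Global sections of a quasi-compact quasi-separated scheme commute with flat affine base change.
Affineness of `X` is avoided because this is applied to quasi-affine schemes. -/
lemma isPushout_appTop_of_flat {P X Y Z : Scheme.{u}} {fst : P ⟶ X} {snd : P ⟶ Y} {f : X ⟶ Z}
    {g : Y ⟶ Z} [IsAffine Y] [IsAffine Z] [Flat g] [CompactSpace X] [QuasiSeparatedSpace X]
    (h : IsPullback fst snd f g) : IsPushout f.appTop g.appTop fst.appTop snd.appTop := by
  have := (isIso_pushoutSection_iff h (US := ⊤) (UT := ⊤) (UX := ⊤) (UY := ⊤) le_top le_top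
    (by simp)).1 (isIso_pushoutSection_of_isQuasiSeparated_of_flat_right _ _ _ _
      (isAffineOpen_top _) (isAffineOpen_top _) isCompact_univ isQuasiSeparated_univ)
  have e {X Y : Scheme.{u}} (f : X ⟶ Y) : f.appLE ⊤ ⊤ le_top = f.appTop := f.appLE_eq_app
  rwa [e, e, e, e] at this

/-- A subsheaf of a scheme `S` covered by a scheme étale over `S` is an open subscheme. -/
lemma isRepresentable_of_etale {F : Scheme.{u}ᵒᵖ ⥤ Type u}
    (hF : Presheaf.IsSheaf Scheme.etaleTopology.{u} F) {S E : Scheme.{u}} (ι : F ⟶ yoneda.obj S)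
    [Mono ι] (e : yoneda.obj E ⟶ F) (he : EtaleCovers (I := Unit) fun _ => e) (r : E ⟶ S) [Etale r]
    (hr : e ≫ ι = yoneda.map r) : F.IsRepresentable := by
  have hι := mono_iff_forall.1 (inferInstance : Mono ι)
  -- Applied to the identity of S: the étale image of E in S is the open subscheme on the range of
  -- `r`. It remains to identify F with it, which is a gluing argument since `ι` is mono.
  obtain ⟨b, hb⟩ := isPullback_etaleImage (p := yoneda.map r) (x := 𝟙 (yoneda.obj S)) (r := r)
    (a := 𝟙 _) (IsPullback.of_horiz_isIso ⟨by simp⟩)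
    ⟨Set.range r, r.isOpenMap.isOpen_range⟩ rfl
  have : IsIso b := hb.isIso_fst_of_isIso
  let φ : F ⟶ (etaleImage (yoneda.map r)).toFunctor :=
    { app := fun T => TypeCat.ofHom fun x => ⟨ι.app T x, fun y => by
        obtain ⟨V, f, v, h₁, h₂, _, t, ht⟩ := he _ x y
        refine ⟨V, f, v, h₁, h₂, t, ?_⟩
        rw [← hr, comp_app_apply', ht]
        exact (map_app ι f x).symm⟩
      naturality := fun T T' g => by
        ext x
        apply Subtype.ext
        exact NatTrans.naturality_apply ι g x }
  have hφ (T : Scheme.{u}) : Function.Bijective (φ.app (op T)) := by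
    constructor
    · intro x y h
      exact hι T x y (congrArg Subtype.val h)
    · rintro ⟨x, hx⟩
      obtain ⟨y, hy⟩ := exists_glue hF (T := T)
        (fun {V} f y => ι.app (op V) y = (yoneda.obj S).map f.op x)
        (fun f g y h => by rw [← map_app, h, map_map])
        (fun f y z h h' => hι _ _ _ (h.trans h'.symm))
        (fun t => by
          obtain ⟨V, f, v, h₁, h₂, s, hs⟩ := hx t
          refine ⟨V, f, v, h₁, h₂, e.app (op V) s, ?_⟩
          rw [← comp_app_apply', hr, hs])
      refine ⟨y, Subtype.ext ?_⟩
      apply sheaf_ext (isSheaf_yoneda S)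
      intro t
      obtain ⟨V, f, v, h₁, h₂, s, hs⟩ := hx t
      refine ⟨V, f, v, h₁, h₂, ?_⟩
      have e₁ : ι.app (op V) (e.app (op V) s) = (yoneda.obj S).map f.op x := by
        rw [← comp_app_apply', hr, hs]
      refine Eq.trans ?_ e₁
      rw [← hy f _ e₁]
      exact map_app ι f y
  have : IsIso φ := by
    rw [NatTrans.isIso_iff_isIso_app]
    intro T
    exact (isIso_iff_bijective _).2 (hφ T.unop)
  exact ⟨_, ⟨Functor.representableByEquiv.symm (asIso b ≪≫ (asIso φ).symm)⟩⟩

/-- A presheaf covered by representable open subfunctors is representable. -/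
lemma isRepresentable_of_openCover {F : Scheme.{u}ᵒᵖ ⥤ Type u}
    (hF : Presheaf.IsSheaf Scheme.etaleTopology.{u} F) {I : Type u} {X : I → Scheme.{u}}
    (f : ∀ i, yoneda.obj (X i) ⟶ F) (hf : ∀ i, MorphismProperty.presheaf @IsOpenImmersion.{u} (f i))
    (hcov : ∀ (T : Scheme.{u}) (x : F.obj (op T)) (y : T), ∃ (V : Scheme.{u}) (g : V ⟶ T) (v : V),
      g v = y ∧ ∃ i, ∃ t : V ⟶ X i, (f i).app (op V) t = F.map g.op x) : F.IsRepresentable := by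
  have hF' : Presheaf.IsSheaf Scheme.zariskiTopology.{u} F := by
    rw [isSheaf_iff_isSheaf_of_type] at hF ⊢
    exact Presieve.isSheaf_of_le _ Scheme.zariskiTopology_le_etaleTopology hF
  have : Presheaf.IsLocallySurjective Scheme.zariskiTopology (Sigma.desc f) := by
    constructor
    intro T x
    refine (Scheme.mem_grothendieckTopology_iff (P := @IsOpenImmersion)).2 ?_
    have H (y : T) : ∃ i, ∃ z, (hf i).rep.snd (yonedaEquiv.symm x) z = y := by
      obtain ⟨V, g, v, rfl, i, t, ht⟩ := hcov T x y
      obtain ⟨s, -, hs⟩ := IsPullback.exists_hom ((hf i).rep.isPullback (yonedaEquiv.symm x))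
        ((yoneda.obj (X i)).map (𝟙 (op V)) t) g (by simpa [yonedaEquiv_symm_app] using ht)
      exact ⟨i, s v, by rw [← Scheme.Hom.comp_apply, hs]⟩
    choose i z hz using H
    have ho (y : T) : IsOpenImmersion ((hf (i y)).rep.snd (yonedaEquiv.symm x)) :=
      (hf (i y)).property_snd _
    refine ⟨Scheme.Cover.mkOfCovers (P := @IsOpenImmersion) T
      (fun y => (hf (i y)).rep.pullback (yonedaEquiv.symm x))
      (fun y => (hf (i y)).rep.snd (yonedaEquiv.symm x)) (fun y => ⟨y, z y, hz y⟩) ho, ?_⟩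
    rintro _ _ ⟨y⟩
    let s : (yoneda.obj (X (i y))).obj (op ((hf (i y)).rep.pullback (yonedaEquiv.symm x))) :=
      ((hf (i y)).rep.fst (yonedaEquiv.symm x)).app _ (𝟙 _)
    refine ⟨(Sigma.ι (fun i => yoneda.obj (X i)) (i y)).app _ s, ?_⟩
    have e₁ : (Sigma.desc f).app _ ((Sigma.ι (fun i => yoneda.obj (X i)) (i y)).app _ s) =
        (f (i y)).app _ s := by
      rw [← comp_app_apply', Sigma.ι_desc]
    refine e₁.trans ?_
    have := IsPullback.app_eq ((hf (i y)).rep.isPullback (yonedaEquiv.symm x)) (𝟙 _)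
    rw [Category.id_comp] at this
    exact this
  exact Scheme.LocalRepresentability.isRepresentable (F := ⟨F, hF'⟩) (f := f) hf

/-- A morphism with a cartesian square over an étale surjection is an étale cover. -/
lemma etaleCovers_of_isPullback {F : Scheme.{u}ᵒᵖ ⥤ Type u} {T T' E : Scheme.{u}} {f : T' ⟶ T}
    [Etale f] [Surjective f] {ι : F ⟶ yoneda.obj T} {e : yoneda.obj E ⟶ F} {m : E ⟶ T'}
    (h : IsPullback e (yoneda.map m) ι (yoneda.map f)) : EtaleCovers (I := Unit) fun _ => e := by
  intro Y x y
  let t : Y ⟶ T := ι.app (op Y) x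
  obtain ⟨t', ht'⟩ := f.surjective (t y)
  obtain ⟨w, hw, -⟩ := Scheme.Pullback.exists_preimage_pullback (f := t) (g := f) y t' ht'.symm
  obtain ⟨s, hs, -⟩ := IsPullback.exists_hom h (F.map (pullback.fst t f).op x) (pullback.snd t f)
    ((map_app ι _ _).symm.trans (pullback.condition (f := t) (g := f)))
  exact ⟨pullback t f, pullback.fst t f, w, inferInstance, hw, (), s, hs⟩

/-- A monomorphism locally of finite type is injective, hence quasi-finite. Zariski's Main Theorem
then embeds E in its relative normalization, which is affine over T. -/
lemma isQuasiAffine_of_mono {E T : Scheme.{u}} (m : E ⟶ T) [Mono m] [LocallyOfFiniteType m]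
    [IsAffine T] [CompactSpace E] : E.IsQuasiAffine := by
  have : QuasiCompact m := inferInstance
  have : LocallyQuasiFinite m := .of_injective m.injective
  have : IsAffine m.normalization := isAffine_of_isAffineHom m.fromNormalization
  exact .of_isImmersion m.toNormalization

set_option maxHeartbeats 1000000 in
-- Descent of a quasi-affine scheme. Let B be the equalizer of the two pullbacks Γ(E) ⇉ Γ(E ×_F E).
-- Flat descent shows that Γ(E) is the base change of B to Γ(T'), so Spec Γ(E) → Spec B is étale,
-- and E is open in Spec Γ(E). The sheaf F then embeds in Spec B with the étale cover E, so it is an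
-- open subscheme by `isRepresentable_of_etale`.
lemma isRepresentable_of_isAffine {F : Scheme.{u}ᵒᵖ ⥤ Type u}
    (hF : Presheaf.IsSheaf Scheme.etaleTopology.{u} F) {T T' E : Scheme.{u}} [IsAffine T]
    [IsAffine T'] [CompactSpace E] {f : T' ⟶ T} [Etale f] [Surjective f] {ι : F ⟶ yoneda.obj T}
    [Mono ι] {e : yoneda.obj E ⟶ F} {m : E ⟶ T'} [LocallyOfFiniteType m]
    (h : IsPullback e (yoneda.map m) ι (yoneda.map f)) : F.IsRepresentable := by
  have hι := mono_iff_forall.1 (inferInstance : Mono ι)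
  have hcov := etaleCovers_of_isPullback h
  have : Mono m := ⟨fun s t hst => IsPullback.hom_eq h (hι _ _ _ (by
    rw [IsPullback.app_eq h, IsPullback.app_eq h, hst])) hst⟩
  have : E.IsQuasiAffine := isQuasiAffine_of_mono m
  obtain ⟨E₂, q₁, q, sq₂⟩ : ∃ (E₂ : Scheme.{u}) (q₁ : E₂ ⟶ E) (q : E₂ ⟶ T'),
    IsPullback q₁ q (m ≫ f) f := ⟨_, _, _, IsPullback.of_hasPullback _ _⟩
  have hq : q₁ ≫ m ≫ f = q ≫ f := sq₂.w
  -- The projection of E ×_T T' to T' lifts to E, because the section of F carried by the first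
  -- factor has the same image in T. With `q₁` and this lift, `E₂` plays the role of E ×_F E (see
  -- `hE`).
  obtain ⟨p₂, hp₂e, hp₂m⟩ := IsPullback.exists_hom h (e.app (op E₂) q₁) q (by
    rw [IsPullback.app_eq h]
    change (q₁ ≫ m) ≫ f = q ≫ f
    rw [Category.assoc, hq])
  have : IsAffineHom q₁ := MorphismProperty.of_isPullback (P := @IsAffineHom) sq₂.flip inferInstance
  have : E₂.IsQuasiAffine := .of_isAffineHom q₁
  obtain ⟨E₃, Q, s, sq₃⟩ : ∃ (E₃ : Scheme.{u}) (Q : E₃ ⟶ E₂) (s : E₃ ⟶ T'),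
    IsPullback Q s (q₁ ≫ m ≫ f) f := ⟨_, _, _, IsPullback.of_hasPullback _ _⟩
  have hQs : Q ≫ q₁ ≫ m ≫ f = s ≫ f := sq₃.w
  let r₁ : E₃ ⟶ E₂ := sq₂.lift (Q ≫ q₁) s (by
    rw [Category.assoc, hQs])
  let r₂ : E₃ ⟶ E₂ := sq₂.lift (Q ≫ p₂) s (by
    rw [Category.assoc, ← Category.assoc p₂, hp₂m, ← hq, hQs])
  have hr₁ : r₁ ≫ q₁ = Q ≫ q₁ := sq₂.lift_fst _ _ _
  have hr₂ : r₂ ≫ q₁ = Q ≫ p₂ := sq₂.lift_fst _ _ _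
  have hr₁' : r₁ ≫ q = s := sq₂.lift_snd _ _ _
  have hr₂' : r₂ ≫ q = s := sq₂.lift_snd _ _ _
  have he (Y : Scheme.{u}) (t : Y ⟶ E₂) :
      e.app (op Y) (t ≫ p₂) = e.app (op Y) (t ≫ q₁) := by
    rw [← map_app_yoneda, hp₂e, map_app_yoneda]
  have hr : r₁ ≫ p₂ = r₂ ≫ p₂ := by
    apply IsPullback.hom_eq h
    · rw [he, he, hr₁, hr₂, he]
    · rw [Category.assoc, Category.assoc, hp₂m, hr₁', hr₂']
  -- The diagonal splits `p₂`, so `p₂` is injective on functions, as `isPushout_equalizer` requires.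
  let δ : E ⟶ E₂ := sq₂.lift (𝟙 _) m (by simp)
  have hδ₁ : δ ≫ q₁ = 𝟙 _ := sq₂.lift_fst _ _ _
  have hδ₂ : δ ≫ q = m := sq₂.lift_snd _ _ _
  have hδ : δ ≫ p₂ = 𝟙 _ := by
    apply IsPullback.hom_eq h
    · rw [he, hδ₁]
    · rw [Category.assoc, hp₂m, hδ₂, Category.id_comp]
  have hE (Y : Scheme.{u}) (t t' : Y ⟶ E) (ht : e.app (op Y) t = e.app (op Y) t') :
      ∃ l : Y ⟶ E₂, l ≫ q₁ = t ∧ l ≫ p₂ = t' := by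
    have w : t ≫ m ≫ f = (t' ≫ m) ≫ f := by
      have := congrArg (ι.app (op Y)) ht
      rw [IsPullback.app_eq h, IsPullback.app_eq h] at this
      rw [← Category.assoc]
      exact this
    have hl₁ : sq₂.lift t (t' ≫ m) w ≫ q₁ = t := sq₂.lift_fst _ _ _
    have hl₂ : sq₂.lift t (t' ≫ m) w ≫ q = t' ≫ m := sq₂.lift_snd _ _ _
    refine ⟨sq₂.lift t (t' ≫ m) w, hl₁, IsPullback.hom_eq h ?_ ?_⟩
    · rw [he, hl₁, ht]
    · rw [Category.assoc, hp₂m, hl₂]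
  have P₁ := (isPushout_appTop_of_flat sq₂).flip
  have P₂ := (isPushout_appTop_of_flat sq₃).flip
  have hflat : f.appTop.hom.Flat := (HasRingHomProperty.iff_of_isAffine (P := @Flat)).1 inferInstance
  have ha {X Y Z : Scheme.{u}} {a : X ⟶ Y} {b : Y ⟶ Z} {c : X ⟶ Z} (w : a ≫ b = c) (x : Γ(Z, ⊤)) :
      a.appTop (b.appTop x) = c.appTop x := by
    rw [← w, Scheme.Hom.comp_appTop, CommRingCat.comp_apply]
  algebraize [f.appTop.hom, m.appTop.hom, (m ≫ f).appTop.hom, q₁.appTop.hom, q.appTop.hom,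
    (q₁ ≫ m ≫ f).appTop.hom, Q.appTop.hom, s.appTop.hom, (Q ≫ q₁ ≫ m ≫ f).appTop.hom]
  have t₁ : IsScalarTower Γ(T, ⊤) Γ(T', ⊤) Γ(E, ⊤) := .of_algebraMap_eq fun x => (ha rfl x).symm
  have t₂ : IsScalarTower Γ(T, ⊤) Γ(E, ⊤) Γ(E₂, ⊤) :=
    .of_algebraMap_eq fun x => (ha rfl x).symm
  have t₃ : IsScalarTower Γ(T, ⊤) Γ(T', ⊤) Γ(E₂, ⊤) :=
    .of_algebraMap_eq fun x => (ha hq.symm x).symm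
  have t₄ : IsScalarTower Γ(T, ⊤) Γ(E₂, ⊤) Γ(E₃, ⊤) :=
    .of_algebraMap_eq fun x => (ha rfl x).symm
  have t₅ : IsScalarTower Γ(T, ⊤) Γ(T', ⊤) Γ(E₃, ⊤) :=
    .of_algebraMap_eq fun x => (ha hQs.symm x).symm
  have i₁ : Algebra.IsPushout Γ(T, ⊤) Γ(T', ⊤) Γ(E, ⊤) Γ(E₂, ⊤) :=
    CommRingCat.isPushout_iff_isPushout.1 P₁
  have i₂ : Algebra.IsPushout Γ(T, ⊤) Γ(T', ⊤) Γ(E₂, ⊤)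
    Γ(E₃, ⊤) := CommRingCat.isPushout_iff_isPushout.1 P₂
  let p₂' : Γ(E, ⊤) →ₐ[Γ(T, ⊤)] Γ(E₂, ⊤) :=
    { p₂.appTop.hom with
      commutes' := fun x => ha (by rw [← Category.assoc, hp₂m, hq]) x }
  let r₁' : Γ(E₂, ⊤) →ₐ[Γ(T, ⊤)] Γ(E₃, ⊤) :=
    { r₁.appTop.hom with
      commutes' := fun x => ha (by rw [← Category.assoc, hr₁, Category.assoc]) x }
  let r₂' : Γ(E₂, ⊤) →ₐ[Γ(T, ⊤)] Γ(E₃, ⊤) :=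
    { r₂.appTop.hom with
      commutes' := fun x => ha (by
        rw [← Category.assoc, hr₂, Category.assoc, ← Category.assoc p₂, hp₂m, ← hq]) x }
  have i₃ := isPushout_equalizer (A := Γ(T, ⊤)) (A' := Γ(T', ⊤)) p₂' (fun x => ha hp₂m x) r₁' r₂'
    (fun x => (ha hr₁ x).trans (ha rfl x).symm) (fun x => (ha hr₂ x).trans (ha rfl x).symm)
    (fun x => ha hr₁' x) (fun x => ha hr₂' x) (fun x => (ha hr x).trans (ha rfl x).symm)
    (Function.LeftInverse.injective (g := δ.appTop) fun x => (ha hδ x).trans (by simp))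
  set B := AlgHom.equalizer (IsScalarTower.toAlgHom Γ(T, ⊤) Γ(E, ⊤) Γ(E₂, ⊤)) p₂'
  have P₃ := isPullback_SpecMap_of_isPushout _ _ _ _ (CommRingCat.isPushout_iff_isPushout.2 i₃)
  let g : Spec Γ(E, ⊤) ⟶ Spec (CommRingCat.of B) :=
    Spec.map (CommRingCat.ofHom (algebraMap B Γ(E, ⊤)))
  have hg : Etale g := by
    refine MorphismProperty.of_isPullback (P := @Etale) P₃ ?_
    have : Etale (Spec.map f.appTop) := by
      rw [HasRingHomProperty.Spec_iff (P := @Etale)]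
      exact (HasRingHomProperty.iff_of_isAffine (P := @Etale)).1 inferInstance
    exact this
  obtain ⟨ψ, hψ⟩ := hcov.exists_desc (isSheaf_yoneda (Spec (CommRingCat.of B)))
    (fun _ => yoneda.map (E.toSpecΓ ≫ g)) (fun _ _ Y t t' ht => by
      obtain ⟨l, rfl, rfl⟩ := hE Y t t' ht
      change (l ≫ q₁) ≫ E.toSpecΓ ≫ g = (l ≫ p₂) ≫ E.toSpecΓ ≫ g
      have hk (w : Y ⟶ E) : w ≫ E.toSpecΓ ≫ g =
          Y.toSpecΓ ≫ Spec.map (CommRingCat.ofHom (algebraMap B Γ(E, ⊤)) ≫ w.appTop) := by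
        rw [Scheme.toSpecΓ_naturality_assoc, Spec.map_comp]
      have : CommRingCat.ofHom (algebraMap B Γ(E, ⊤)) ≫ q₁.appTop =
          CommRingCat.ofHom (algebraMap B Γ(E, ⊤)) ≫ p₂.appTop := by
        ext b
        exact b.2
      rw [hk, hk, Scheme.Hom.comp_appTop, Scheme.Hom.comp_appTop, reassoc_of% this])
  have hψι : ψ ≫ yoneda.map (Spec.map (CommRingCat.ofHom (algebraMap Γ(T, ⊤) B))) =
      ι ≫ yoneda.map T.toSpecΓ := by
    refine hcov.hom_ext (isSheaf_yoneda _) fun _ => ?_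
    rw [← Category.assoc, hψ (), ← Category.assoc, h.w, ← Functor.map_comp, ← Functor.map_comp,
      ← Functor.map_comp, Category.assoc, ← Spec.map_comp, Scheme.toSpecΓ_naturality]
    rfl
  have : Mono ψ := by
    have : Mono (ψ ≫ yoneda.map (Spec.map (CommRingCat.ofHom (algebraMap Γ(T, ⊤) B)))) := by
      rw [hψι]
      infer_instance
    exact mono_of_mono ψ (yoneda.map (Spec.map (CommRingCat.ofHom (algebraMap Γ(T, ⊤) B))))
  exact isRepresentable_of_etale hF ψ e hcov (E.toSpecΓ ≫ g) (hψ ())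

lemma isPullback_of_comp_mono {F G H K K' : Scheme.{u}ᵒᵖ ⥤ Type u} {f₁ : F ⟶ G} {f₂ : F ⟶ H}
    {g₁ : G ⟶ K} {g₂ : H ⟶ K} (j : K ⟶ K') [Mono j] (h : IsPullback f₁ f₂ (g₁ ≫ j) (g₂ ≫ j)) :
    IsPullback f₁ f₂ g₁ g₂ :=
  ⟨⟨by rw [← cancel_mono j, Category.assoc, Category.assoc, h.w]⟩,
    ⟨PullbackCone.IsLimit.mk _ (fun s => h.lift s.fst s.snd (by
        rw [← Category.assoc, ← Category.assoc, s.condition]))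
      (fun s => h.lift_fst _ _ _) (fun s => h.lift_snd _ _ _)
      fun s m h₁ h₂ => h.hom_ext (by simpa using h₁) (by simpa using h₂)⟩⟩

lemma presheaf_etale_map {U V : Scheme.{u}} (f : U ⟶ V) [Etale f] :
    MorphismProperty.presheaf @Etale.{u} (yoneda.map f) :=
  MorphismProperty.relative_map (P := @Etale) (F := yoneda) inferInstance

lemma presheaf_etale_comp {F G H : Scheme.{u}ᵒᵖ ⥤ Type u} {f : F ⟶ G} {g : G ⟶ H}
    (hf : MorphismProperty.presheaf @Etale.{u} f) (hg : MorphismProperty.presheaf @Etale.{u} g) :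
    MorphismProperty.presheaf @Etale.{u} (f ≫ g) := by
  have hE : MorphismProperty.IsMultiplicative @Etale.{u} := inferInstance
  have := hE.toIsStableUnderComposition
  have := MorphismProperty.relative_isStableUnderComposition (F := yoneda) (P := @Etale.{u})
  exact this.comp_mem _ _ hf hg

/-- The étale image of an affine open of a base change of `F` is an open subscheme of `F`. -/
lemma exists_open_of_isAffineOpen {F : Scheme.{u}ᵒᵖ ⥤ Type u}
    (hF : Presheaf.IsSheaf Scheme.etaleTopology.{u} F) {T T₀ T' E : Scheme.{u}} [IsAffine T₀]
    [IsAffine T'] {j : T₀ ⟶ T} [IsOpenImmersion j] {f : T' ⟶ T₀} [Etale f] [Surjective f]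
    {ι : F ⟶ yoneda.obj T} [Mono ι] {e : yoneda.obj E ⟶ F} {m : E ⟶ T'} [LocallyOfFiniteType m]
    (h : IsPullback e (yoneda.map m) ι (yoneda.map (f ≫ j))) (O : E.Opens) (hO : IsAffineOpen O) :
    ∃ (V : Scheme.{u}) (v : yoneda.obj V ⟶ F), MorphismProperty.presheaf @IsOpenImmersion.{u} v ∧
      ∀ (Y : Scheme.{u}) (t : Y ⟶ O), ∃ s : Y ⟶ V, v.app (op Y) s = e.app (op Y) (t ≫ O.ι) := by
  have : IsAffine O := hO
  have hι := mono_iff_forall.1 (inferInstance : Mono ι)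
  have he : MorphismProperty.presheaf @Etale.{u} e :=
    (MorphismProperty.relative_isStableUnderBaseChange _).of_isPullback h.flip
      (presheaf_etale_map (f ≫ j))
  let p : yoneda.obj (O : Scheme.{u}) ⟶ F := yoneda.map O.ι ≫ e
  have hp : MorphismProperty.presheaf @Etale.{u} p :=
    presheaf_etale_comp (presheaf_etale_map O.ι) he
  obtain ⟨h₀, hh₀⟩ := (etaleCovers_toEtaleImage p).exists_desc (isSheaf_yoneda T₀)
    (fun _ => yoneda.map (O.ι ≫ m ≫ f)) (fun _ _ Y t t' ht => by
      have e₁ := congrArg (ι.app (op Y)) (congrArg Subtype.val ht)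
      have e₂ (t : Y ⟶ O) : ι.app (op Y) (p.app (op Y) t) = ((t ≫ O.ι) ≫ m) ≫ f ≫ j :=
        IsPullback.app_eq h (t ≫ O.ι)
      have e₃ := (e₂ t).symm.trans (e₁.trans (e₂ t'))
      change t ≫ O.ι ≫ m ≫ f = t' ≫ O.ι ≫ m ≫ f
      rw [← cancel_mono j]
      simpa using e₃)
  have hh₀' : h₀ ≫ yoneda.map j = (etaleImage p).ι ≫ ι := by
    refine (etaleCovers_toEtaleImage p).hom_ext (isSheaf_yoneda T) fun _ => ?_
    rw [← Category.assoc, hh₀ (), ← Category.assoc (toEtaleImage p), toEtaleImage_ι, Category.assoc,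
      h.w, ← Functor.map_comp, ← Functor.map_comp]
    simp
  have : Mono h₀ := by
    have : Mono (h₀ ≫ yoneda.map j) := by
      rw [hh₀']
      infer_instance
    exact mono_of_mono h₀ (yoneda.map j)
  -- The affine scheme O ×_{T₀} T' is also O ×_F E. Its image in E, which is the preimage of the
  -- étale image of O, is therefore a quasi-compact open, as the affine case demands.
  obtain ⟨R, a, b, sq⟩ : ∃ (R : Scheme.{u}) (a : R ⟶ O) (b : R ⟶ T'),
    IsPullback a b (O.ι ≫ m ≫ f) f := ⟨_, _, _, IsPullback.of_hasPullback _ _⟩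
  have : IsAffine R := .of_isPullback sq
  obtain ⟨r, hr₁, hr₂⟩ := IsPullback.exists_hom h (p.app (op R) a) b (by
    refine (IsPullback.app_eq h (a ≫ O.ι)).trans ?_
    change ((a ≫ O.ι) ≫ m) ≫ f ≫ j = b ≫ f ≫ j
    rw [← reassoc_of% sq.w]
    simp)
  have hR : IsPullback (yoneda.map a) (yoneda.map r) p e := by
    refine isPullback_iff_forall.2 ⟨hom_ext_yoneda_obj ?_, fun Y s t h₁ h₂ => ?_, fun Y s t hst => ?_⟩
    · change p.app (op R) (𝟙 R ≫ a) = e.app (op R) (𝟙 R ≫ r)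
      rw [Category.id_comp, Category.id_comp, hr₁]
    · refine sq.hom_ext h₁ ?_
      change s ≫ r = t ≫ r at h₂
      rw [← hr₂, ← Category.assoc, h₂, Category.assoc]
    · change Y ⟶ (O : Scheme.{u}) at s
      change Y ⟶ E at t
      have w : s ≫ O.ι ≫ m ≫ f = (t ≫ m) ≫ f := by
        have e₁ := congrArg (ι.app (op Y)) hst
        have e₂ : ι.app (op Y) (p.app (op Y) s) = ((s ≫ O.ι) ≫ m) ≫ f ≫ j :=
          IsPullback.app_eq h (s ≫ O.ι)
        have e₃ : ι.app (op Y) (e.app (op Y) t) = (t ≫ m) ≫ f ≫ j := IsPullback.app_eq h t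
        have e₄ := e₂.symm.trans (e₁.trans e₃)
        rw [← cancel_mono j]
        simpa using e₄
      refine ⟨sq.lift s (t ≫ m) w, sq.lift_fst _ _ _, ?_⟩
      change sq.lift s (t ≫ m) w ≫ r = t
      apply IsPullback.hom_eq h
      · rw [← map_app_yoneda, hr₁, map_app_yoneda, sq.lift_fst, hst]
      · rw [Category.assoc, hr₂, sq.lift_snd]
  have : Etale r := hp.property _ _ _ hR
  obtain ⟨b', hb'⟩ := isPullback_etaleImage hR ⟨Set.range r, r.isOpenMap.isOpen_range⟩ rfl
  have : CompactSpace (⟨Set.range r, r.isOpenMap.isOpen_range⟩ : E.Opens) :=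
    isCompact_iff_compactSpace.1 (isCompact_range r.continuous)
  have hsq := hb'.paste_vert h
  rw [← hh₀', ← Functor.map_comp, yoneda.map_comp f j] at hsq
  have hrep := isRepresentable_of_isAffine (isSheaf_etaleImage hF p) (isPullback_of_comp_mono _ hsq)
  obtain ⟨V, ⟨hV⟩⟩ := hrep
  let w : yoneda.obj V ≅ (etaleImage p).toFunctor := Functor.representableByEquiv hV
  have hopen : MorphismProperty.presheaf @IsOpenImmersion.{u} (etaleImage p).ι := by
    refine MorphismProperty.relative.of_exists fun Y x => ?_
    have := hp.property_snd x
    have ho : IsOpen (Set.range (hp.rep.snd x)) := (hp.rep.snd x).isOpenMap.isOpen_range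
    obtain ⟨c, hc⟩ := isPullback_etaleImage (hp.rep.isPullback x) ⟨_, ho⟩ rfl
    exact ⟨_, c, _, hc, inferInstance⟩
  refine ⟨V, w.hom ≫ (etaleImage p).ι, ?_, fun Y t => ⟨w.inv.app (op Y)
    ((toEtaleImage p).app (op Y) t), ?_⟩⟩
  · have := MorphismProperty.relative_respectsIso (F := yoneda) (P := @IsOpenImmersion.{u})
    exact (MorphismProperty.cancel_left_of_respectsIso (MorphismProperty.presheaf _) w.hom _).2 hopen
  · have : w.hom.app (op Y) (w.inv.app (op Y) ((toEtaleImage p).app (op Y) t)) =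
        (toEtaleImage p).app (op Y) t := by
      rw [← comp_app_apply', w.inv_hom_id]
      rfl
    rw [comp_app_apply', this]
    rfl

/-- A subsheaf of a scheme which is étale locally a scheme locally of finite type is representable. -/
theorem isRepresentable_of_etale_local {F : Scheme.{u}ᵒᵖ ⥤ Type u}
    (hF : Presheaf.IsSheaf Scheme.etaleTopology.{u} F) {T : Scheme.{u}} (ι : F ⟶ yoneda.obj T)
    [Mono ι] (H : ∀ t : T, ∃ (T' E : Scheme.{u}) (f : T' ⟶ T) (e : yoneda.obj E ⟶ F) (m : E ⟶ T')
      (t' : T'), Etale f ∧ f t' = t ∧ LocallyOfFiniteType m ∧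
        IsPullback e (yoneda.map m) ι (yoneda.map f)) : F.IsRepresentable := by
  have H' (t : T) : ∃ (T₀ T' E : Scheme.{u}) (j : T₀ ⟶ T) (f : T' ⟶ T₀) (e : yoneda.obj E ⟶ F)
      (m : E ⟶ T'), IsAffine T₀ ∧ IsAffine T' ∧ IsOpenImmersion j ∧ (∃ y, j y = t) ∧ Etale f ∧
        Surjective f ∧ LocallyOfFiniteType m ∧
        IsPullback e (yoneda.map m) ι (yoneda.map (f ≫ j)) := by
    obtain ⟨T', E, f, e, m, t', _, rfl, _, h⟩ := H t
    obtain ⟨T₁, hT₁, htT₁, -⟩ := exists_isAffineOpen_mem_and_subset (U := ⊤) (x := f t') trivial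
    obtain ⟨T₂, hT₂, htT₂, hT₂'⟩ := exists_isAffineOpen_mem_and_subset (U := f ⁻¹ᵁ T₁) (x := t') htT₁
    have : IsAffine T₁ := hT₁
    have : IsAffine T₂ := hT₂
    have hT₂' : T₂ ≤ f ⁻¹ᵁ T₁ := hT₂'
    let g : (T₂ : Scheme.{u}) ⟶ T₁ := f.resLE T₁ T₂ hT₂'
    have : Etale g := by dsimp only [g, Scheme.Hom.resLE]; infer_instance
    have hg : g ≫ T₁.ι = T₂.ι ≫ f := Scheme.Hom.resLE_comp_ι _ _
    -- Shrinking the target into the image of `g` makes the restricted map surjective, and its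
    -- source stays affine because `g` is a morphism of affine schemes.
    obtain ⟨T₃, hT₃, htT₃, hT₃'⟩ := exists_isAffineOpen_mem_and_subset
      (U := ⟨Set.range g, g.isOpenMap.isOpen_range⟩) (x := g ⟨t', htT₂⟩) ⟨_, rfl⟩
    have hpre : IsAffineOpen (g ⁻¹ᵁ T₃) := hT₃.preimage g
    have hpb := (IsPullback.of_hasPullback m ((g ⁻¹ᵁ T₃).ι ≫ T₂.ι)).map yoneda
    have hw : (g ∣_ T₃) ≫ T₃.ι ≫ T₁.ι = ((g ⁻¹ᵁ T₃).ι ≫ T₂.ι) ≫ f := by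
      rw [morphismRestrict_ι_assoc, hg, Category.assoc]
    refine ⟨T₃, g ⁻¹ᵁ T₃, pullback m ((g ⁻¹ᵁ T₃).ι ≫ T₂.ι), T₃.ι ≫ T₁.ι, g ∣_ T₃,
      yoneda.map (pullback.fst _ _) ≫ e, pullback.snd _ _, hT₃, hpre, inferInstance,
      ⟨⟨_, htT₃⟩, ?_⟩, inferInstance, ⟨?_⟩, inferInstance, ?_⟩
    · change (g ≫ T₁.ι) ⟨t', htT₂⟩ = f t'
      rw [hg]
      rfl
    · intro y
      obtain ⟨z, hz⟩ := hT₃' y.2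
      refine ⟨⟨z, ?_⟩, Subtype.ext ?_⟩
      · change g z ∈ T₃
        rw [hz]
        exact y.2
      · refine Eq.trans ?_ hz
        exact congrArg (fun q : (_ ⟶ (T₁ : Scheme.{u})) => q _) (morphismRestrict_ι g T₃)
    · rw [hw, Functor.map_comp]
      exact hpb.flip.paste_vert h.flip |>.flip
  choose T₀ T' E j f e m h₁ h₂ h₃ h₄ h₅ h₆ h₇ h₈ using H'
  -- The schemes `E t` need not be quasi-compact, so each of their affine opens contributes its own
  -- open subscheme of F.
  have key (t : T) (O : (E t).affineOpens) := exists_open_of_isAffineOpen hF (h₈ t) O.1 O.2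
  choose V v hv hv' using key
  refine isRepresentable_of_openCover hF (I := Σ t : T, (E t).affineOpens) (X := fun i => V i.1 i.2)
    (fun i => v i.1 i.2) (fun i => hv i.1 i.2) ?_
  intro Y x y
  let s : Y ⟶ T := ι.app (op Y) x
  obtain ⟨z, hz⟩ := h₄ (s y)
  obtain ⟨z', hz'⟩ := (f (s y)).surjective z
  obtain ⟨w, hw, -⟩ := Scheme.Pullback.exists_preimage_pullback (f := s) (g := f (s y) ≫ j (s y)) y z'
    (by rw [Scheme.Hom.comp_apply, hz', hz])
  obtain ⟨l, hl, -⟩ := IsPullback.exists_hom (h₈ (s y)) (F.map (pullback.fst s (f (s y) ≫ j (s y))).op x)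
    (pullback.snd s _) ((map_app ι _ _).symm.trans (pullback.condition (f := s)))
  obtain ⟨O, hO, hlO, -⟩ := exists_isAffineOpen_mem_and_subset (U := ⊤) (x := l w) trivial
  have hlO : w ∈ l ⁻¹ᵁ O := hlO
  obtain ⟨r, hr⟩ := hv' (s y) ⟨O, hO⟩ _ (l ∣_ O)
  refine ⟨l ⁻¹ᵁ O, (l ⁻¹ᵁ O).ι ≫ pullback.fst _ _, ⟨w, hlO⟩, ?_, ⟨s y, ⟨O, hO⟩⟩, r, ?_⟩
  · exact (Scheme.Hom.comp_apply _ _ _).trans hw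
  · rw [hr, morphismRestrict_ι, ← map_app_yoneda, hl, map_map]

end AlgebraicSpace

namespace AlgebraicSpace

/-! ### Compatible affine opens and étale lifting -/

lemma app_surjective_of_isAffineOpen {X Y : Scheme.{u}} (f : X ⟶ Y) [IsClosedImmersion f]
    {U : Y.Opens} (hU : IsAffineOpen U) : Function.Surjective (f.app U) := by
  have : IsAffine U := hU
  have h := (IsClosedImmersion.isAffine_surjective_of_isAffine (f ∣_ U)).2
  intro s
  obtain ⟨t, ht⟩ := h ((f ⁻¹ᵁ U).topIso.inv s)
  refine ⟨U.topIso.hom t, ?_⟩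
  have e : U.topIso.hom ≫ f.app U = (f ∣_ U).appTop ≫ (f ⁻¹ᵁ U).topIso.hom := by
    rw [Scheme.Hom.appTop, morphismRestrict_app]
    refine (Scheme.Hom.naturality f _).trans (Eq.trans ?_ (Category.assoc _ _ _).symm)
    congr 1
    exact (X.presheaf.map_comp _ _)
  have := congr($(e).hom t)
  simp only [CommRingCat.hom_comp, RingHom.comp_apply] at this
  rw [this, ht, ← RingHom.comp_apply, ← CommRingCat.hom_comp, Iso.inv_hom_id]
  rfl

/-- Closed subschemes glued along a common closed subscheme have compatible affine neighbourhoods. -/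
lemma exists_compatible_affineOpens {R₀ R₁ R₂ : Scheme.{u}} (k₁ : R₀ ⟶ R₁) (k₂ : R₀ ⟶ R₂)
    [IsClosedImmersion k₁] [IsClosedImmersion k₂] (r : R₁) :
    ∃ (O₁ : R₁.Opens) (O₂ : R₂.Opens), IsAffineOpen O₁ ∧ IsAffineOpen O₂ ∧ r ∈ O₁ ∧
      k₁ ⁻¹ᵁ O₁ = k₂ ⁻¹ᵁ O₂ := by
  by_cases hr : r ∈ Set.range k₁
  · obtain ⟨y, rfl⟩ := hr
    obtain ⟨A₁, hA₁, hy₁, -⟩ := exists_isAffineOpen_mem_and_subset (U := ⊤) (x := k₁ y) trivial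
    obtain ⟨A₂, hA₂, hy₂, -⟩ := exists_isAffineOpen_mem_and_subset (U := ⊤) (x := k₂ y) trivial
    -- The two affine opens induced on R₀ share a common basic open around `y`. The functions
    -- defining it lift to R₁ and R₂ along the closed immersions, and the lifts cut out compatible
    -- affine opens.
    obtain ⟨f, g, hfg, hy⟩ := exists_basicOpen_le_affine_inter (hA₁.preimage k₁)
      (hA₂.preimage k₂) y ⟨hy₁, hy₂⟩
    obtain ⟨f, rfl⟩ := app_surjective_of_isAffineOpen k₁ hA₁ f
    obtain ⟨g, rfl⟩ := app_surjective_of_isAffineOpen k₂ hA₂ g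
    rw [← Scheme.preimage_basicOpen, ← Scheme.preimage_basicOpen] at hfg
    rw [← Scheme.preimage_basicOpen] at hy
    exact ⟨_, _, hA₁.basicOpen f, hA₂.basicOpen g, hy, hfg⟩
  · obtain ⟨A₁, hA₁, hy₁, h⟩ := exists_isAffineOpen_mem_and_subset
      (U := ⟨(Set.range k₁)ᶜ, k₁.isClosedEmbedding.isClosed_range.isOpen_compl⟩) (x := r) hr
    -- Away from R₀ nothing needs to match, so the second open is empty.
    refine ⟨A₁, ⊥, hA₁, isAffineOpen_bot _, hy₁, ?_⟩
    ext y
    simp only [Scheme.Hom.coe_preimage]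
    refine iff_of_false (fun hy => h hy ⟨y, rfl⟩) (fun hy => hy)

open Polynomial in
-- Near q the étale algebra is standard, of the form (S[X]/f)_g with f monic. Lift f to a monic
-- polynomial and g to any polynomial over R, and invert the derivative as well. Over S the
-- derivative was already invertible, so the base change is unchanged.
lemma exists_etale_lift_ring {R S C : CommRingCat.{u}} (φ : R ⟶ S) (ψ : S ⟶ C)
    (hφ : Function.Surjective φ) (hψ : ψ.hom.Etale) (q : PrimeSpectrum C) :
    ∃ (c : C) (P : CommRingCat.{u}) (α : R ⟶ P)
      (β : P ⟶ CommRingCat.of (Localization.Away c)), c ∉ q.asIdeal ∧ α.hom.Etale ∧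
      IsPushout φ α (ψ ≫ CommRingCat.ofHom (algebraMap C (Localization.Away c))) β := by
  algebraize [ψ.hom]
  have : Algebra.IsEtaleAt S q.asIdeal := Algebra.FormallyEtale.comp S C _
  obtain ⟨c, hc, hst⟩ := Algebra.IsEtaleAt.exists_isStandardEtale (R := S) q.asIdeal
  obtain ⟨⟨P⟩⟩ := hst
  have hlift (p : S[X]) : p ∈ Polynomial.lifts φ.hom := by
    rw [Polynomial.mem_lifts]
    exact Polynomial.map_surjective φ.hom hφ p
  obtain ⟨f, hf, -, hfm⟩ := Polynomial.lifts_and_natDegree_eq_and_monic (hlift P.f) P.monic_f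
  obtain ⟨g, hg⟩ := Polynomial.map_surjective φ.hom hφ P.g
  -- The localizing polynomial is f'g; the data `g, 0, 1` record the identity f'·g + f·0 = (f'g)^1,
  -- which certifies that f' becomes invertible.
  let Q : StandardEtalePair R := ⟨f, hfm, derivative f * g, g, 0, 1, by ring⟩
  algebraize [φ.hom]
  let a : R →+* Localization.Away c := (algebraMap S (Localization.Away c)).comp (algebraMap R S)
  let := a.toAlgebra
  have : IsScalarTower R S (Localization.Away c) := .of_algebraMap_eq' rfl
  -- In an S-algebra, a root of f at which g is a unit automatically makes f' a unit, so the two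
  -- pairs represent the same functor.
  have key {D : Type u} [CommRing D] [Algebra S D] [Algebra R D] [IsScalarTower R S D] (x : D) :
      Q.HasMap x ↔ P.HasMap x := by
    have e₁ : aeval x f = aeval x P.f := by
      rw [← hf]
      exact (aeval_map_algebraMap S x f).symm
    have e₂ : aeval x g = aeval x P.g := by
      rw [← hg]
      exact (aeval_map_algebraMap S x g).symm
    have e₃ : aeval x (derivative f) = aeval x (derivative P.f) := by
      rw [← hf, derivative_map]
      exact (aeval_map_algebraMap S x _).symm
    constructor
    · rintro ⟨h₁, h₂⟩
      refine ⟨e₁ ▸ h₁, ?_⟩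
      rw [map_mul, IsUnit.mul_iff] at h₂
      exact e₂ ▸ h₂.2
    · intro h
      refine ⟨e₁ ▸ h.1, ?_⟩
      rw [map_mul, IsUnit.mul_iff, e₂, e₃]
      exact ⟨h.isUnit_derivative_f, h.2⟩
  have hx := (key P.x).2 P.hasMap
  refine ⟨c, CommRingCat.of Q.Ring, CommRingCat.ofHom (algebraMap R Q.Ring),
    CommRingCat.ofHom (Q.lift P.x hx).toRingHom, hc, ?_, ⟨⟨?_⟩, ⟨?_⟩⟩⟩
  · exact RingHom.etale_algebraMap.2 inferInstance
  · ext r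
    exact ((Q.lift P.x hx).commutes r).symm
  have ex {D : CommRingCat.{u}} (l : S ⟶ D) (r : CommRingCat.of Q.Ring ⟶ D)
      (w : φ ≫ l = CommRingCat.ofHom (algebraMap R Q.Ring) ≫ r) :
      ∃ m : CommRingCat.of (Localization.Away c) ⟶ D,
        (ψ ≫ CommRingCat.ofHom (algebraMap C (Localization.Away c))) ≫ m = l ∧
        CommRingCat.ofHom (Q.lift P.x hx).toRingHom ≫ m = r := by
    let := l.hom.toAlgebra
    let := (φ ≫ l).hom.toAlgebra
    have : IsScalarTower R S D := .of_algebraMap_eq' rfl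
    let r' : Q.Ring →ₐ[R] D := { r.hom with commutes' := fun a => congr($(w).hom a).symm }
    have h := (key (r' Q.X)).1 (Q.hasMap_X.map r')
    let m : Localization.Away c →ₐ[S] D := (P.lift _ h).comp P.equivRing.toAlgHom
    have hm : m P.x = r' Q.X := by
      simp [m]
    refine ⟨CommRingCat.ofHom m.toRingHom, ?_, ?_⟩
    · ext a
      exact m.commutes a
    · ext a
      have : (m.restrictScalars R).comp (Q.lift P.x hx) = r' := by
        apply Q.hom_ext
        simp [hm]
      exact congr($this a)
  have uniq {D : CommRingCat.{u}} {m m' : CommRingCat.of (Localization.Away c) ⟶ D}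
      (h₁ : (ψ ≫ CommRingCat.ofHom (algebraMap C (Localization.Away c))) ≫ m =
        (ψ ≫ CommRingCat.ofHom (algebraMap C (Localization.Away c))) ≫ m')
      (h₂ : CommRingCat.ofHom (Q.lift P.x hx).toRingHom ≫ m =
        CommRingCat.ofHom (Q.lift P.x hx).toRingHom ≫ m') : m = m' := by
    let := (m.hom.comp (algebraMap S (Localization.Away c))).toAlgebra
    let n : Localization.Away c →ₐ[S] D := { m.hom with commutes' := fun a => rfl }
    let n' : Localization.Away c →ₐ[S] D :=
      { m'.hom with commutes' := fun a => congr($(h₁).hom a).symm }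
    have e : n = n' := by
      apply P.hom_ext
      have := congr($(h₂).hom Q.X)
      have e : (Q.lift P.x hx) Q.X = P.x := Q.lift_X _ _
      change m.hom ((Q.lift P.x hx) Q.X) = m'.hom ((Q.lift P.x hx) Q.X) at this
      rwa [e] at this
    ext a
    exact congr($e a)
  exact PushoutCocone.IsColimit.mk _ (fun s => (ex s.inl s.inr s.condition).choose)
    (fun s => (ex s.inl s.inr s.condition).choose_spec.1)
    (fun s => (ex s.inl s.inr s.condition).choose_spec.2)
    fun s m h₁ h₂ => uniq (h₁.trans (ex s.inl s.inr s.condition).choose_spec.1.symm)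
      (h₂.trans (ex s.inl s.inr s.condition).choose_spec.2.symm)

lemma exists_etale_lift_of_isAffine {A B E : Scheme.{u}} [IsAffine A] [IsAffine B] [IsAffine E]
    (i : B ⟶ A) [IsClosedImmersion i] (f : E ⟶ B) [Etale f] (b : E) :
    ∃ (V N : Scheme.{u}) (g : V ⟶ A) (m : N ⟶ V) (n : N ⟶ E), Etale g ∧ IsOpenImmersion n ∧
      IsPullback m (n ≫ f) g i ∧ ∃ y, n y = b := by
  obtain ⟨c, P, α, β, hc, hα, sq⟩ := exists_etale_lift_ring i.appTop f.appTop
    (IsClosedImmersion.isAffine_surjective_of_isAffine i).2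
    ((HasRingHomProperty.iff_of_isAffine (P := @Etale)).1 ‹_›) (E.isoSpec.hom b)
  have : Etale (Spec.map α) := (HasRingHomProperty.Spec_iff (P := @Etale)).2 hα
  refine ⟨Spec P, _, Spec.map α ≫ A.isoSpec.inv, Spec.map β,
    Spec.map (CommRingCat.ofHom (algebraMap Γ(E, ⊤) (Localization.Away c))) ≫ E.isoSpec.inv,
    inferInstance, ?_, ?_, ?_⟩
  · have := IsOpenImmersion.of_isLocalization (S := Localization.Away c) c
    infer_instance
  · refine IsPullback.of_iso (isPullback_SpecMap_of_isPushout _ _ _ _ sq.flip) (Iso.refl _) (Iso.refl _)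
      B.isoSpec.symm A.isoSpec.symm (by simp) ?_ (by simp) ?_
    · simp [Scheme.isoSpec_inv_naturality]
    · simp [Scheme.isoSpec_inv_naturality]
  · have : E.isoSpec.hom b ∈ Set.range (PrimeSpectrum.comap
        (algebraMap Γ(E, ⊤) (Localization.Away c))) := by
      rw [PrimeSpectrum.localization_away_comap_range _ c]
      exact hc
    obtain ⟨y, hy⟩ := this
    refine ⟨y, ?_⟩
    refine (congrArg E.isoSpec.inv hy).trans ?_
    rw [← Scheme.Hom.comp_apply, Iso.hom_inv_id]
    rfl

/-- Étale morphisms lift locally along closed immersions. -/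
lemma exists_etale_lift {A B E : Scheme.{u}}
    (i : B ⟶ A) [IsClosedImmersion i] (f : E ⟶ B) [Etale f] (b : E) :
    ∃ (V N : Scheme.{u}) (g : V ⟶ A) (m : N ⟶ V) (n : N ⟶ E), Etale g ∧ IsOpenImmersion n ∧
      IsPullback m (n ≫ f) g i ∧ ∃ y, n y = b := by
  obtain ⟨A', hA', hbA, -⟩ := exists_isAffineOpen_mem_and_subset (U := ⊤) (x := i (f b)) trivial
  obtain ⟨E', hE', hbE, hEA⟩ := exists_isAffineOpen_mem_and_subset (U := f ⁻¹ᵁ i ⁻¹ᵁ A') (x := b) hbA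
  replace hEA : E' ≤ f ⁻¹ᵁ i ⁻¹ᵁ A' := hEA
  have : IsAffine A' := hA'
  have : IsAffine (i ⁻¹ᵁ A') := hA'.preimage i
  have : IsAffine E' := hE'
  obtain ⟨V, N, g, m, n, _, _, sq, y, hy⟩ := exists_etale_lift_of_isAffine (i ∣_ A')
    (f.resLE (i ⁻¹ᵁ A') E' hEA) ⟨b, hbE⟩
  refine ⟨V, N, g ≫ A'.ι, m, n ≫ E'.ι, inferInstance, inferInstance, ?_, y, ?_⟩
  · have := sq.flip.paste_horiz (isPullback_morphismRestrict i A').flip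
    rw [Category.assoc, Scheme.Hom.resLE_comp_ι] at this
    simpa using this.flip
  · rw [Scheme.Hom.comp_apply, hy]
    rfl

end AlgebraicSpace

namespace AlgebraicSpace

/-! ### Charts of the pushout -/

variable {Y X₁ X₂ : Scheme.{u}ᵒᵖ ⥤ Type u}

lemma isPullback_of_cube {C : Type*} [Category C] {U₀ U₁ U₂ U V₀ V₁ V₂ V : C} {k₁ : U₀ ⟶ U₁}
    {k₂ : U₀ ⟶ U₂} {j₁ : U₁ ⟶ U} {j₂ : U₂ ⟶ U} {l₁ : V₀ ⟶ V₁} {l₂ : V₀ ⟶ V₂} {m₁ : V₁ ⟶ V}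
    {m₂ : V₂ ⟶ V} {f₀ : V₀ ⟶ U₀} {f₁ : V₁ ⟶ U₁} {f₂ : V₂ ⟶ U₂} {f : V ⟶ U}
    (w₁ : m₁ ≫ f = f₁ ≫ j₁) (sq₂ : IsPullback m₂ f₂ f j₂) (sq₀ : IsPullback l₁ l₂ m₁ m₂)
    (sq : IsPullback k₁ k₂ j₁ j₂) (h₁ : f₀ ≫ k₁ = l₁ ≫ f₁) (h₂ : f₀ ≫ k₂ = l₂ ≫ f₂) :
    IsPullback f₀ l₁ k₁ f₁ := by
  have := sq₀.flip.paste_horiz sq₂.flip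
  rw [w₁, ← h₂] at this
  exact IsPullback.of_right this h₁ sq.flip

/-- A glued affine scheme `U` whose two pieces are étale over `X₁` and `X₂`, compatibly over `Y`. -/
structure Chart (i₁ : Y ⟶ X₁) (i₂ : Y ⟶ X₂) : Type (u + 1) where
  {U₀ U₁ U₂ U : Scheme.{u}}
  {k₁ : U₀ ⟶ U₁}
  {k₂ : U₀ ⟶ U₂}
  {j₁ : U₁ ⟶ U}
  {j₂ : U₂ ⟶ U}
  glued : IsGlued k₁ k₂ j₁ j₂
  {p₀ : yoneda.obj U₀ ⟶ Y}
  {p₁ : yoneda.obj U₁ ⟶ X₁}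
  {p₂ : yoneda.obj U₂ ⟶ X₂}
  etale₁ : MorphismProperty.presheaf @Etale.{u} p₁
  etale₂ : MorphismProperty.presheaf @Etale.{u} p₂
  sq₁ : IsPullback p₀ (yoneda.map k₁) i₁ p₁
  sq₂ : IsPullback p₀ (yoneda.map k₂) i₂ p₂

namespace Chart

variable {i₁ : Y ⟶ X₁} {i₂ : Y ⟶ X₂}

/-- Interchange of the two pieces. -/
abbrev swap (c : Chart i₁ i₂) : Chart i₂ i₁ :=
  ⟨c.glued.symm, c.etale₂, c.etale₁, c.sq₂, c.sq₁⟩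

/-- A morphism of charts. -/
structure Hom (d c : Chart i₁ i₂) where
  {f : d.U ⟶ c.U}
  {f₁ : d.U₁ ⟶ c.U₁}
  {f₂ : d.U₂ ⟶ c.U₂}
  w₁ : d.j₁ ≫ f = f₁ ≫ c.j₁
  w₂ : d.j₂ ≫ f = f₂ ≫ c.j₂
  e₁ : yoneda.map f₁ ≫ c.p₁ = d.p₁
  e₂ : yoneda.map f₂ ≫ c.p₂ = d.p₂

namespace Hom

/-- The identity. -/
def id (c : Chart i₁ i₂) : Hom c c where
  f := 𝟙 _
  f₁ := 𝟙 _
  f₂ := 𝟙 _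
  w₁ := by simp
  w₂ := by simp
  e₁ := by simp
  e₂ := by simp

variable {e d c : Chart i₁ i₂}

/-- Composition of morphisms of charts. -/
def comp (g : Hom e d) (h : Hom d c) : Hom e c where
  f := g.f ≫ h.f
  f₁ := g.f₁ ≫ h.f₁
  f₂ := g.f₂ ≫ h.f₂
  w₁ := by rw [reassoc_of% g.w₁, h.w₁, Category.assoc]
  w₂ := by rw [reassoc_of% g.w₂, h.w₂, Category.assoc]
  e₁ := by rw [Functor.map_comp, Category.assoc, h.e₁, g.e₁]
  e₂ := by rw [Functor.map_comp, Category.assoc, h.e₂, g.e₂]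

/-- Interchange of the two pieces. -/
abbrev swap (h : Hom d c) : Hom d.swap c.swap where
  f := h.f
  f₁ := h.f₂
  f₂ := h.f₁
  w₁ := h.w₂
  w₂ := h.w₁
  e₁ := h.e₂
  e₂ := h.e₁

lemma etale_f₁ (h : Hom d c) : Etale h.f₁ :=
  SmallEtale.etale_left (U := ⟨_, d.p₁, d.etale₁⟩) (V := ⟨_, c.p₁, c.etale₁⟩) ⟨h.f₁, h.e₁⟩

lemma etale_f₂ (h : Hom d c) : Etale h.f₂ :=
  h.swap.etale_f₁

/-- A map on the common pieces arises twice, from the cartesian square of gluing and from the square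
over Y. The two agree because k₁ is a monomorphism. -/
lemma exists_f₀ (h : Hom d c) : ∃ f₀ : d.U₀ ⟶ c.U₀, f₀ ≫ c.k₁ = d.k₁ ≫ h.f₁ ∧
    f₀ ≫ c.k₂ = d.k₂ ≫ h.f₂ ∧ yoneda.map f₀ ≫ c.p₀ = d.p₀ := by
  have := c.glued.closed₁
  have := c.glued.closed₂
  obtain ⟨f₀, h₁, h₂⟩ : ∃ f₀ : d.U₀ ⟶ c.U₀, f₀ ≫ c.k₁ = d.k₁ ≫ h.f₁ ∧
      f₀ ≫ c.k₂ = d.k₂ ≫ h.f₂ := by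
    refine ⟨c.glued.isPullback.lift (d.k₁ ≫ h.f₁) (d.k₂ ≫ h.f₂) ?_,
      IsPullback.lift_fst _ _ _ _, IsPullback.lift_snd _ _ _ _⟩
    rw [Category.assoc, Category.assoc, ← h.w₁, ← h.w₂, reassoc_of% d.glued.isPullback.w]
  obtain ⟨g₀, h₃, h₄⟩ := IsPullback.exists_hom c.sq₁ (d.p₀.app _ (𝟙 d.U₀)) (d.k₁ ≫ h.f₁) (by
    rw [IsPullback.app_eq d.sq₁, ← h.e₁, yoneda_map_comp_app]
    simp)
  have := c.glued.closed_k₁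
  obtain rfl : f₀ = g₀ := by rw [← cancel_mono c.k₁, h₁, h₄]
  refine ⟨f₀, h₁, h₂, hom_ext_yoneda_obj ?_⟩
  rw [yoneda_map_comp_app, Category.id_comp]
  exact h₃

lemma isPullback_f₀ (h : Hom d c) {f₀ : d.U₀ ⟶ c.U₀} (h₁ : f₀ ≫ c.k₁ = d.k₁ ≫ h.f₁)
    (h₃ : yoneda.map f₀ ≫ c.p₀ = d.p₀) : IsPullback d.k₁ f₀ h.f₁ c.k₁ := by
  apply IsPullback.of_map yoneda h₁.symm
  have : IsPullback (yoneda.map d.k₁) (yoneda.map f₀ ≫ c.p₀) (yoneda.map h.f₁ ≫ c.p₁) i₁ := by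
    rw [h₃, h.e₁]
    exact d.sq₁.flip
  refine IsPullback.of_bot this ?_ c.sq₁.flip
  rw [← Functor.map_comp, ← Functor.map_comp, h₁]

/-- The common piece of a chart is the base change of Y to either piece, so a morphism of charts is
cartesian over U₀ → U₂. The gluing then makes it cartesian over U₁ → U. -/
lemma isPullback₁ (h : Hom d c) : IsPullback d.j₁ h.f₁ h.f c.j₁ := by
  obtain ⟨f₀, h₁, h₂, h₃⟩ := h.exists_f₀
  exact IsGlued.isPullback_of_isPullback c.glued d.glued (h.swap.isPullback_f₀ h₂ h₃) h.w₁ h.w₂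

lemma isPullback₂ (h : Hom d c) : IsPullback d.j₂ h.f₂ h.f c.j₂ :=
  h.swap.isPullback₁

/-- Étaleness holds on each piece and passes to the glued scheme by `IsGlued.etale_of_etale`; this
makes the quotient by common charts an étale one. -/
lemma etale_f (h : Hom d c) : Etale h.f := by
  have := h.etale_f₁
  have := h.etale_f₂
  exact c.glued.etale_of_etale h.isPullback₁ h.isPullback₂

end Hom

/-- A morphism of charts may be constructed on the pieces. -/
lemma exists_hom {d c : Chart i₁ i₂} {f₀ : d.U₀ ⟶ c.U₀} {f₁ : d.U₁ ⟶ c.U₁} {f₂ : d.U₂ ⟶ c.U₂}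
    (h₁ : f₀ ≫ c.k₁ = d.k₁ ≫ f₁) (h₂ : f₀ ≫ c.k₂ = d.k₂ ≫ f₂)
    (e₁ : yoneda.map f₁ ≫ c.p₁ = d.p₁) (e₂ : yoneda.map f₂ ≫ c.p₂ = d.p₂) :
    ∃ h : Hom d c, h.f₁ = f₁ ∧ h.f₂ = f₂ := by
  have := c.glued.isAffine
  obtain ⟨f, h₃, h₄⟩ := d.glued.exists_desc_affine (f₁ ≫ c.j₁) (f₂ ≫ c.j₂) (by
    rw [← reassoc_of% h₁, ← reassoc_of% h₂, c.glued.isPullback.w])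
  exact ⟨⟨h₃, h₄, e₁, e₂⟩, rfl, rfl⟩

section restrict

variable (c : Chart i₁ i₂) {V : Scheme.{u}} [IsAffine V] (g : V ⟶ c.U) [Etale g]

/-- The restriction of a chart along an étale morphism from an affine scheme. -/
noncomputable abbrev restrict : Chart i₁ i₂ :=
  let f₀ : pullback (pullback.fst g c.j₁) (pullback.fst g c.j₂) ⟶ c.U₀ :=
    c.glued.isPullback.lift (pullback.fst _ _ ≫ pullback.snd _ _)
      (pullback.snd _ _ ≫ pullback.snd _ _) (by
        rw [Category.assoc, Category.assoc, ← pullback.condition, ← pullback.condition,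
          pullback.condition_assoc])
  { glued := c.glued.of_flat (IsPullback.of_hasPullback g c.j₁) (IsPullback.of_hasPullback g c.j₂)
      (IsPullback.of_hasPullback _ _)
    p₀ := yoneda.map f₀ ≫ c.p₀
    p₁ := yoneda.map (pullback.snd g c.j₁) ≫ c.p₁
    p₂ := yoneda.map (pullback.snd g c.j₂) ≫ c.p₂
    etale₁ := presheaf_etale_comp (presheaf_etale_map _) c.etale₁
    etale₂ := presheaf_etale_comp (presheaf_etale_map _) c.etale₂
    sq₁ := by
      have h₁ : IsPullback f₀ (pullback.fst (pullback.fst g c.j₁) (pullback.fst g c.j₂)) c.k₁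
          (pullback.snd g c.j₁) :=
        isPullback_of_cube pullback.condition (IsPullback.of_hasPullback g c.j₂)
          (IsPullback.of_hasPullback _ _) c.glued.isPullback (IsPullback.lift_fst _ _ _ _)
          (IsPullback.lift_snd _ _ _ _)
      exact ((h₁.map yoneda).flip.paste_vert c.sq₁.flip).flip
    sq₂ := by
      have h₁ : IsPullback f₀ (pullback.snd (pullback.fst g c.j₁) (pullback.fst g c.j₂)) c.k₂
          (pullback.snd g c.j₂) :=
        isPullback_of_cube pullback.condition (IsPullback.of_hasPullback g c.j₁)
          (IsPullback.of_hasPullback _ _).flip c.glued.isPullback.flip (IsPullback.lift_snd _ _ _ _)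
          (IsPullback.lift_fst _ _ _ _)
      exact ((h₁.map yoneda).flip.paste_vert c.sq₂.flip).flip }

/-- The canonical morphism from a restriction. -/
noncomputable abbrev restrictHom : Hom (c.restrict g) c where
  f := g
  f₁ := pullback.snd g c.j₁
  f₂ := pullback.snd g c.j₂
  w₁ := pullback.condition
  w₂ := pullback.condition
  e₁ := rfl
  e₂ := rfl

end restrict

/-- Charts over a common chart have a fibre product. -/
lemma Hom.exists_common {c d d' : Chart i₁ i₂} (h : Hom d c) (h' : Hom d' c) {T : Scheme.{u}}
    (s : T ⟶ d.U) (s' : T ⟶ d'.U) (w : s ≫ h.f = s' ≫ h'.f) :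
    ∃ (e : Chart i₁ i₂) (g : Hom e d) (g' : Hom e d') (r : T ⟶ e.U),
      r ≫ g.f = s ∧ r ≫ g'.f = s' := by
  have := d.glued.isAffine
  have := d'.glued.isAffine
  have := c.glued.isAffine
  have := h.etale_f
  have := h'.etale_f
  -- Morphisms of charts are étale, so the fibre product of the glued schemes is affine and étale
  -- over `d.U`. Restricting `d` to it gives the common chart.
  let q := pullback.fst h.f h'.f
  let a₁ : pullback q d.j₁ ⟶ d'.U₁ := h'.isPullback₁.lift (pullback.fst _ _ ≫ pullback.snd _ _)
    (pullback.snd _ _ ≫ h.f₁) (by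
      rw [Category.assoc, ← pullback.condition, Category.assoc, ← h.w₁, pullback.condition_assoc])
  let a₂ : pullback q d.j₂ ⟶ d'.U₂ := h'.isPullback₂.lift (pullback.fst _ _ ≫ pullback.snd _ _)
    (pullback.snd _ _ ≫ h.f₂) (by
      rw [Category.assoc, ← pullback.condition, Category.assoc, ← h.w₂, pullback.condition_assoc])
  refine ⟨d.restrict q, d.restrictHom q,
    { f := pullback.snd h.f h'.f
      f₁ := a₁
      f₂ := a₂
      w₁ := (IsPullback.lift_fst _ _ _ _).symm
      w₂ := (IsPullback.lift_fst _ _ _ _).symm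
      e₁ := ?_
      e₂ := ?_ }, pullback.lift s s' w, pullback.lift_fst _ _ _, pullback.lift_snd _ _ _⟩
  · have : a₁ ≫ h'.f₁ = pullback.snd _ _ ≫ h.f₁ := IsPullback.lift_snd _ _ _ _
    rw [← h'.e₁, ← Functor.map_comp_assoc, this, Functor.map_comp, Category.assoc, h.e₁]
  · have : a₂ ≫ h'.f₂ = pullback.snd _ _ ≫ h.f₂ := IsPullback.lift_snd _ _ _ _
    rw [← h'.e₂, ← Functor.map_comp_assoc, this, Functor.map_comp, Category.assoc, h.e₂]

end Chart

lemma exists_isPullback_opens {S R₀ R : Scheme.{u}} (k : R₀ ⟶ R) {O : R.Opens} (s : S ⟶ R₀)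
    [IsOpenImmersion s] (e : Set.range s = k ⁻¹ᵁ O) : ∃ l : S ⟶ O, IsPullback s l k O.ι := by
  have hs : Set.range s = Set.range (k ⁻¹ᵁ O).ι := by rw [e, Scheme.Opens.range_ι]
  refine ⟨(IsOpenImmersion.isoOfRangeEq s (k ⁻¹ᵁ O).ι hs).hom ≫ k ∣_ O, ?_⟩
  exact (isPullback_morphismRestrict k O).flip.of_iso
    (IsOpenImmersion.isoOfRangeEq s (k ⁻¹ᵁ O).ι hs).symm (Iso.refl _) (Iso.refl _) (Iso.refl _)
    (by simp) (by simp) (by simp) (by simp)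

section

variable {i₁ : Y ⟶ X₁} {i₂ : Y ⟶ X₂} {R₀ R₁ R₂ : Scheme.{u}} {k₁ : R₀ ⟶ R₁} {k₂ : R₀ ⟶ R₂}
    {q₀ : yoneda.obj R₀ ⟶ Y} {q₁ : yoneda.obj R₁ ⟶ X₁} {q₂ : yoneda.obj R₂ ⟶ X₂}

/-- Compatible affine opens in schemes étale over `X₁` and `X₂` give a chart. -/
lemma exists_chart_of_isAffineOpen [IsClosedImmersion k₁] [IsClosedImmersion k₂]
    (hq₁ : MorphismProperty.presheaf @Etale.{u} q₁) (hq₂ : MorphismProperty.presheaf @Etale.{u} q₂)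
    (sq₁ : IsPullback q₀ (yoneda.map k₁) i₁ q₁) (sq₂ : IsPullback q₀ (yoneda.map k₂) i₂ q₂)
    {O₁ : R₁.Opens} {O₂ : R₂.Opens} (hO₁ : IsAffineOpen O₁) (hO₂ : IsAffineOpen O₂)
    (hO : k₁ ⁻¹ᵁ O₁ = k₂ ⁻¹ᵁ O₂) :
    ∃ (d : Chart i₁ i₂) (o₀ : d.U₀ ⟶ R₀) (o₁ : d.U₁ ⟶ R₁) (o₂ : d.U₂ ⟶ R₂),
      IsOpenImmersion o₁ ∧ IsOpenImmersion o₂ ∧ Set.range o₁ = O₁ ∧ Set.range o₂ = O₂ ∧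
      o₀ ≫ k₁ = d.k₁ ≫ o₁ ∧ o₀ ≫ k₂ = d.k₂ ≫ o₂ ∧
      yoneda.map o₁ ≫ q₁ = d.p₁ ∧ yoneda.map o₂ ≫ q₂ = d.p₂ := by
  obtain ⟨l₁, h₁⟩ := exists_isPullback_opens (O := O₁) k₁ (k₂ ⁻¹ᵁ O₂).ι
    (by rw [hO, Scheme.Opens.range_ι])
  obtain ⟨l₂, h₂⟩ := exists_isPullback_opens k₂ (k₂ ⁻¹ᵁ O₂).ι (Scheme.Opens.range_ι _)
  have : IsAffine O₁ := hO₁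
  have : IsAffine O₂ := hO₂
  have : IsClosedImmersion l₁ := MorphismProperty.of_isPullback (P := @IsClosedImmersion) h₁ ‹_›
  have : IsClosedImmersion l₂ := MorphismProperty.of_isPullback (P := @IsClosedImmersion) h₂ ‹_›
  obtain ⟨V, j₁, j₂, hV⟩ := exists_isGlued l₁ l₂
  refine ⟨{ glued := hV
            p₀ := yoneda.map (k₂ ⁻¹ᵁ O₂).ι ≫ q₀
            p₁ := yoneda.map O₁.ι ≫ q₁
            p₂ := yoneda.map O₂.ι ≫ q₂
            etale₁ := presheaf_etale_comp (presheaf_etale_map _) hq₁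
            etale₂ := presheaf_etale_comp (presheaf_etale_map _) hq₂
            sq₁ := ((h₁.map yoneda).flip.paste_vert sq₁.flip).flip
            sq₂ := ((h₂.map yoneda).flip.paste_vert sq₂.flip).flip },
    (k₂ ⁻¹ᵁ O₂).ι, O₁.ι, O₂.ι, inferInstance, inferInstance, Scheme.Opens.range_ι _,
    Scheme.Opens.range_ι _, h₁.w, h₂.w, rfl, rfl⟩

lemma exists_chart [IsClosedImmersion k₁] [IsClosedImmersion k₂]
    (hq₁ : MorphismProperty.presheaf @Etale.{u} q₁) (hq₂ : MorphismProperty.presheaf @Etale.{u} q₂)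
    (sq₁ : IsPullback q₀ (yoneda.map k₁) i₁ q₁) (sq₂ : IsPullback q₀ (yoneda.map k₂) i₂ q₂)
    (r : R₁) :
    ∃ (d : Chart i₁ i₂) (o₀ : d.U₀ ⟶ R₀) (o₁ : d.U₁ ⟶ R₁) (o₂ : d.U₂ ⟶ R₂),
      IsOpenImmersion o₁ ∧ r ∈ Set.range o₁ ∧
      o₀ ≫ k₁ = d.k₁ ≫ o₁ ∧ o₀ ≫ k₂ = d.k₂ ≫ o₂ ∧
      yoneda.map o₁ ≫ q₁ = d.p₁ ∧ yoneda.map o₂ ≫ q₂ = d.p₂ := by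
  obtain ⟨O₁, O₂, hO₁, hO₂, hr, hO⟩ := exists_compatible_affineOpens k₁ k₂ r
  obtain ⟨d, o₀, o₁, o₂, h₁, -, h₁', -, h⟩ := exists_chart_of_isAffineOpen hq₁ hq₂ sq₁ sq₂ hO₁ hO₂ hO
  exact ⟨d, o₀, o₁, o₂, h₁, h₁' ▸ hr, h⟩

end

section

variable {i₁ : Y ⟶ X₁} {i₂ : Y ⟶ X₂}

/-- The largest open of `V` meeting a closed subscheme `N` in a given open. -/
lemma exists_isPullback_of_isClosedImmersion {S N V : Scheme.{u}} (m : N ⟶ V) [IsClosedImmersion m]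
    (s : S ⟶ N) [IsOpenImmersion s] : ∃ (P : V.Opens) (l : S ⟶ P), IsPullback s l m P.ι ∧
      ∀ w : V, w ∉ m '' (Set.range s)ᶜ → w ∈ P := by
  let P : V.Opens := ⟨(m '' (Set.range s)ᶜ)ᶜ, (m.isClosedEmbedding.isClosedMap _
    (s.isOpenEmbedding.isOpen_range.isClosed_compl)).isOpen_compl⟩
  obtain ⟨l, hl⟩ := exists_isPullback_opens (O := P) m s (by
    ext x
    change x ∈ Set.range s ↔ m x ∉ m '' (Set.range s)ᶜ
    rw [m.isClosedEmbedding.injective.mem_set_image, Set.mem_compl_iff, not_not])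
  exact ⟨P, l, hl, fun w hw => hw⟩

/-- The parts of V₁ and V₂ over Y are two opens N₁ and N₂ of the same E. Each Vᵢ is shrunk to the
largest open meeting Nᵢ in the overlap; the pieces then share their part over Y, and compatible
affine opens give a chart. The condition on `w` says that it survives the shrinking. -/
lemma exists_chart_of_open {E V₁ V₂ N₁ N₂ : Scheme.{u}} {e : yoneda.obj E ⟶ Y}
    {m₁ : N₁ ⟶ V₁} {m₂ : N₂ ⟶ V₂} [IsClosedImmersion m₁] [IsClosedImmersion m₂]
    {n₁ : N₁ ⟶ E} {n₂ : N₂ ⟶ E} [IsOpenImmersion n₁] [IsOpenImmersion n₂]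
    {r₁ : yoneda.obj V₁ ⟶ X₁} {r₂ : yoneda.obj V₂ ⟶ X₂}
    (hr₁ : MorphismProperty.presheaf @Etale.{u} r₁) (hr₂ : MorphismProperty.presheaf @Etale.{u} r₂)
    (sq₁ : IsPullback (yoneda.map n₁ ≫ e) (yoneda.map m₁) i₁ r₁)
    (sq₂ : IsPullback (yoneda.map n₂ ≫ e) (yoneda.map m₂) i₂ r₂)
    (w : V₁) (hw : ∀ y, m₁ y = w → n₁ y ∈ Set.range n₂) :
    ∃ (d : Chart i₁ i₂) (o : d.U₁ ⟶ V₁), w ∈ Set.range o ∧ yoneda.map o ≫ r₁ = d.p₁ := by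
  let S : E.Opens := n₁.opensRange ⊓ n₂.opensRange
  let s₁ : (S : Scheme.{u}) ⟶ N₁ := IsOpenImmersion.lift n₁ S.ι (by
    rw [Scheme.Opens.range_ι]; exact fun x hx => hx.1)
  let s₂ : (S : Scheme.{u}) ⟶ N₂ := IsOpenImmersion.lift n₂ S.ι (by
    rw [Scheme.Opens.range_ι]; exact fun x hx => hx.2)
  have hs₁ : s₁ ≫ n₁ = S.ι := IsOpenImmersion.lift_fac _ _ _
  have hs₂ : s₂ ≫ n₂ = S.ι := IsOpenImmersion.lift_fac _ _ _
  have : IsOpenImmersion s₁ := by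
    have : IsOpenImmersion (s₁ ≫ n₁) := by rw [hs₁]; infer_instance
    exact IsOpenImmersion.of_comp s₁ n₁
  have : IsOpenImmersion s₂ := by
    have : IsOpenImmersion (s₂ ≫ n₂) := by rw [hs₂]; infer_instance
    exact IsOpenImmersion.of_comp s₂ n₂
  obtain ⟨P₁, l₁, h₁, hP₁⟩ := exists_isPullback_of_isClosedImmersion m₁ s₁
  obtain ⟨P₂, l₂, h₂, -⟩ := exists_isPullback_of_isClosedImmersion m₂ s₂
  have : IsClosedImmersion l₁ := MorphismProperty.of_isPullback (P := @IsClosedImmersion) h₁ ‹_›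
  have : IsClosedImmersion l₂ := MorphismProperty.of_isPullback (P := @IsClosedImmersion) h₂ ‹_›
  have hwP : w ∈ P₁ := by
    apply hP₁
    rintro ⟨y, hy, rfl⟩
    have hyS : n₁ y ∈ Set.range S.ι := by
      rw [Scheme.Opens.range_ι]
      exact ⟨⟨y, rfl⟩, hw y rfl⟩
    obtain ⟨x, hx⟩ := hyS
    refine hy ⟨x, n₁.isOpenEmbedding.injective ?_⟩
    rw [← Scheme.Hom.comp_apply, hs₁, hx]
  obtain ⟨d, o₀, o₁, o₂, h₃, hw, -, -, h, -⟩ := exists_chart (i₁ := i₁) (i₂ := i₂) (k₁ := l₁) (k₂ := l₂)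
    (q₀ := yoneda.map S.ι ≫ e) (q₁ := yoneda.map P₁.ι ≫ r₁) (q₂ := yoneda.map P₂.ι ≫ r₂)
    (presheaf_etale_comp (presheaf_etale_map _) hr₁)
    (presheaf_etale_comp (presheaf_etale_map _) hr₂)
    (by
      rw [← hs₁, Functor.map_comp, Category.assoc]
      exact ((h₁.map yoneda).flip.paste_vert sq₁.flip).flip)
    (by
      rw [← hs₂, Functor.map_comp, Category.assoc]
      exact ((h₂.map yoneda).flip.paste_vert sq₂.flip).flip) ⟨w, hwP⟩
  refine ⟨d, o₁ ≫ P₁.ι, ?_, by rw [Functor.map_comp, Category.assoc, h]⟩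
  obtain ⟨z, hz⟩ := hw
  exact ⟨z, by rw [Scheme.Hom.comp_apply, hz]; rfl⟩

/-- Charts cover `X₁`. -/
lemma exists_chart_of_atlas (hi₁ : MorphismProperty.presheaf @IsClosedImmersion.{u} i₁)
    (hi₂ : MorphismProperty.presheaf @IsClosedImmersion.{u} i₂) {A₁ A₂ : Scheme.{u}}
    {q₁ : yoneda.obj A₁ ⟶ X₁} {q₂ : yoneda.obj A₂ ⟶ X₂}
    (hq₁ : MorphismProperty.presheaf @Etale.{u} q₁) (hq₂ : MorphismProperty.presheaf @Etale.{u} q₂)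
    (hs₂ : MorphismProperty.presheaf @Surjective.{u} q₂) (v : A₁) :
    ∃ (d : Chart i₁ i₂) (o : d.U₁ ⟶ A₁), v ∈ Set.range o ∧ yoneda.map o ≫ q₁ = d.p₁ := by
  obtain ⟨B₁, b₁, β₁, sq₁⟩ : ∃ (B₁ : Scheme.{u}) (b₁ : yoneda.obj B₁ ⟶ Y) (β₁ : B₁ ⟶ A₁),
      IsPullback b₁ (yoneda.map β₁) i₁ q₁ := ⟨_, _, _, hi₁.rep.isPullback q₁⟩
  obtain ⟨B₂, b₂, β₂, sq₂⟩ : ∃ (B₂ : Scheme.{u}) (b₂ : yoneda.obj B₂ ⟶ Y) (β₂ : B₂ ⟶ A₂),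
      IsPullback b₂ (yoneda.map β₂) i₂ q₂ := ⟨_, _, _, hi₂.rep.isPullback q₂⟩
  have : IsClosedImmersion β₁ := hi₁.property _ _ _ sq₁
  have : IsClosedImmersion β₂ := hi₂.property _ _ _ sq₂
  have hb₁ : MorphismProperty.presheaf @Etale.{u} b₁ :=
    (MorphismProperty.relative_isStableUnderBaseChange _).of_isPullback sq₁.flip hq₁
  have hb₂ : MorphismProperty.presheaf @Etale.{u} b₂ :=
    (MorphismProperty.relative_isStableUnderBaseChange _).of_isPullback sq₂.flip hq₂
  have hb₂' : MorphismProperty.presheaf @Surjective.{u} b₂ :=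
    (MorphismProperty.relative_isStableUnderBaseChange _).of_isPullback sq₂.flip hs₂
  -- The two atlases induce different étale covers of Y; their fibre product over Y is a common
  -- refinement.
  obtain ⟨E, f₁, f₂, sqE⟩ : ∃ (E : Scheme.{u}) (f₁ : E ⟶ B₁) (f₂ : E ⟶ B₂),
      IsPullback (yoneda.map f₂) (yoneda.map f₁) b₂ b₁ :=
    ⟨_, _, _, hb₂.rep.isPullback' b₁⟩
  have : Etale f₁ := hb₂.property _ _ _ sqE
  have : Surjective f₁ := hb₂'.property _ _ _ sqE
  have : Etale f₂ := hb₁.property _ _ _ sqE.flip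
  by_cases hv : v ∈ Set.range β₁
  · obtain ⟨y, rfl⟩ := hv
    obtain ⟨z, rfl⟩ := f₁.surjective y
    -- The refinement E lives only over Y. Near `z` it extends to étale schemes over both atlases,
    -- whose parts over Y are opens of E containing `z`.
    obtain ⟨V₁, N₁, g₁, m₁, n₁, _, _, s₁, y₁, hy₁⟩ := exists_etale_lift β₁ f₁ z
    obtain ⟨V₂, N₂, g₂, m₂, n₂, _, _, s₂, y₂, hy₂⟩ := exists_etale_lift β₂ f₂ z
    have : IsClosedImmersion m₁ :=
      MorphismProperty.of_isPullback (P := @IsClosedImmersion) s₁.flip ‹_›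
    have : IsClosedImmersion m₂ :=
      MorphismProperty.of_isPullback (P := @IsClosedImmersion) s₂.flip ‹_›
    obtain ⟨d, o, ⟨w, hw⟩, ho⟩ := exists_chart_of_open (i₁ := i₁) (i₂ := i₂)
      (e := yoneda.map f₁ ≫ b₁) (m₁ := m₁) (m₂ := m₂) (n₁ := n₁) (n₂ := n₂)
      (r₁ := yoneda.map g₁ ≫ q₁) (r₂ := yoneda.map g₂ ≫ q₂)
      (presheaf_etale_comp (presheaf_etale_map _) hq₁)
      (presheaf_etale_comp (presheaf_etale_map _) hq₂)
      (by
        rw [← Functor.map_comp_assoc]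
        exact ((s₁.map yoneda).paste_vert sq₁.flip).flip)
      (by
        rw [← sqE.w, ← Functor.map_comp_assoc]
        exact ((s₂.map yoneda).paste_vert sq₂.flip).flip) (m₁ y₁) (by
        intro y hy
        obtain rfl := m₁.isClosedEmbedding.injective hy
        exact ⟨y₂, hy₂.trans hy₁.symm⟩)
    refine ⟨d, o ≫ g₁, ⟨w, ?_⟩, by rw [Functor.map_comp, Category.assoc, ho]⟩
    rw [Scheme.Hom.comp_apply, hw, ← Scheme.Hom.comp_apply, s₁.w, ← hy₁]
    simp
  -- Off Y the second piece is taken empty; the squares hold because everything over it is empty.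
  · let O : A₁.Opens := ⟨(Set.range β₁)ᶜ, β₁.isClosedEmbedding.isClosed_range.isOpen_compl⟩
    have : IsEmpty (β₁ ⁻¹ᵁ O) := ⟨fun x => x.2 ⟨_, rfl⟩⟩
    have : IsEmpty (β₂ ⁻¹ᵁ ⊥) := ⟨fun x => x.2⟩
    let n₁ : ((β₁ ⁻¹ᵁ O :) : Scheme.{u}) ⟶ E := isInitialOfIsEmpty.to _
    let n₂ : ((β₂ ⁻¹ᵁ ⊥ :) : Scheme.{u}) ⟶ E := isInitialOfIsEmpty.to _
    have s₁ := (isPullback_morphismRestrict β₁ O)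
    have s₂ := (isPullback_morphismRestrict β₂ ⊥)
    have hn₁ : (β₁ ⁻¹ᵁ O).ι = n₁ ≫ f₁ := isInitialOfIsEmpty.hom_ext _ _
    have hn₂ : (β₂ ⁻¹ᵁ ⊥).ι = n₂ ≫ f₂ := isInitialOfIsEmpty.hom_ext _ _
    rw [hn₁] at s₁
    rw [hn₂] at s₂
    obtain ⟨d, o, ⟨w, hw⟩, ho⟩ := exists_chart_of_open (i₁ := i₁) (i₂ := i₂)
      (e := yoneda.map f₁ ≫ b₁) (m₁ := β₁ ∣_ O) (m₂ := β₂ ∣_ ⊥) (n₁ := n₁) (n₂ := n₂)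
      (r₁ := yoneda.map O.ι ≫ q₁) (r₂ := yoneda.map (⊥ : A₂.Opens).ι ≫ q₂)
      (presheaf_etale_comp (presheaf_etale_map _) hq₁)
      (presheaf_etale_comp (presheaf_etale_map _) hq₂)
      (by
        rw [← Functor.map_comp_assoc]
        exact ((s₁.map yoneda).paste_vert sq₁.flip).flip)
      (by
        rw [← sqE.w, ← Functor.map_comp_assoc]
        exact ((s₂.map yoneda).paste_vert sq₂.flip).flip) ⟨v, hv⟩ (by
        intro y
        exact isEmptyElim y)
    refine ⟨d, o ≫ O.ι, ⟨w, ?_⟩, by rw [Functor.map_comp, Category.assoc, ho]⟩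
    rw [Scheme.Hom.comp_apply, hw]
    rfl

end

end AlgebraicSpace

/-! ### Products of charts, common refinements and small covering families -/

namespace AlgebraicSpace

variable {Y X₁ X₂ : Scheme.{u}ᵒᵖ ⥤ Type u} {i₁ : Y ⟶ X₁} {i₂ : Y ⟶ X₂}

namespace Chart

/-- The fibre products over `Y`, `X₁` and `X₂` of the pieces of two charts. -/
structure Product (c c' : Chart i₁ i₂) where
  {R₀ R₁ R₂ : Scheme.{u}}
  {k₁ : R₀ ⟶ R₁}
  {k₂ : R₀ ⟶ R₂}
  {a₀ : R₀ ⟶ c.U₀}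
  {a₁ : R₁ ⟶ c.U₁}
  {a₂ : R₂ ⟶ c.U₂}
  {b₀ : R₀ ⟶ c'.U₀}
  {b₁ : R₁ ⟶ c'.U₁}
  {b₂ : R₂ ⟶ c'.U₂}
  closed₁ : IsClosedImmersion k₁
  closed₂ : IsClosedImmersion k₂
  isPullback₁ : IsPullback (yoneda.map a₁) (yoneda.map b₁) c.p₁ c'.p₁
  isPullback₂ : IsPullback (yoneda.map a₂) (yoneda.map b₂) c.p₂ c'.p₂
  ha₁ : a₀ ≫ c.k₁ = k₁ ≫ a₁
  ha₂ : a₀ ≫ c.k₂ = k₂ ≫ a₂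
  hb₁ : b₀ ≫ c'.k₁ = k₁ ≫ b₁
  hb₂ : b₀ ≫ c'.k₂ = k₂ ≫ b₂
  sq₁ : IsPullback (yoneda.map a₀ ≫ c.p₀) (yoneda.map k₁) i₁ (yoneda.map a₁ ≫ c.p₁)
  sq₂ : IsPullback (yoneda.map a₀ ≫ c.p₀) (yoneda.map k₂) i₂ (yoneda.map a₂ ≫ c.p₂)

/-- Interchange of the two pieces. -/
abbrev Product.swap {c c' : Chart i₁ i₂} (P : Product c c') : Product c.swap c'.swap where
  closed₁ := P.closed₂
  closed₂ := P.closed₁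
  isPullback₁ := P.isPullback₂
  isPullback₂ := P.isPullback₁
  ha₁ := P.ha₂
  ha₂ := P.ha₁
  hb₁ := P.hb₂
  hb₂ := P.hb₁
  sq₁ := P.sq₂
  sq₂ := P.sq₁

lemma etale₀ (c : Chart i₁ i₂) : MorphismProperty.presheaf @Etale.{u} c.p₀ :=
  (MorphismProperty.relative_isStableUnderBaseChange _).of_isPullback c.sq₁.flip c.etale₁

/-- The product over X₁ of the first pieces has as its part over Y the product over Y of the common
pieces. The same R₀ thus serves for both X₁ and X₂. -/
lemma exists_isPullback_product (c c' : Chart i₁ i₂) {R₀ : Scheme.{u}} {a₀ : R₀ ⟶ c.U₀}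
    {b₀ : R₀ ⟶ c'.U₀} (h₀ : IsPullback (yoneda.map a₀) (yoneda.map b₀) c.p₀ c'.p₀) :
    ∃ (R₁ : Scheme.{u}) (k₁ : R₀ ⟶ R₁) (a₁ : R₁ ⟶ c.U₁) (b₁ : R₁ ⟶ c'.U₁),
      IsPullback (yoneda.map a₁) (yoneda.map b₁) c.p₁ c'.p₁ ∧ a₀ ≫ c.k₁ = k₁ ≫ a₁ ∧
      b₀ ≫ c'.k₁ = k₁ ≫ b₁ ∧
      IsPullback (yoneda.map a₀ ≫ c.p₀) (yoneda.map k₁) i₁ (yoneda.map a₁ ≫ c.p₁) := by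
  obtain ⟨R₁, a₁, b₁, h₁⟩ : ∃ (R₁ : Scheme.{u}) (a₁ : R₁ ⟶ c.U₁) (b₁ : R₁ ⟶ c'.U₁),
      IsPullback (yoneda.map a₁) (yoneda.map b₁) c.p₁ c'.p₁ :=
    ⟨_, _, _, c.etale₁.rep.isPullback' c'.p₁⟩
  obtain ⟨k₁, e₁, e₂⟩ := IsPullback.exists_hom h₁ (a₀ ≫ c.k₁) (b₀ ≫ c'.k₁) (by
    rw [← IsPullback.app_eq c.sq₁, ← IsPullback.app_eq c'.sq₁]
    exact congrArg _ (by simpa using! IsPullback.app_eq h₀ (𝟙 R₀)))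
  have e₁' : k₁ ≫ a₁ = a₀ ≫ c.k₁ := e₁
  have := c.glued.closed_k₁
  have := c'.glued.closed_k₁
  refine ⟨R₁, k₁, a₁, b₁, h₁, e₁'.symm, e₂.symm, isPullback_iff_forall.2 ⟨?_, ?_, ?_⟩⟩
  · rw [← Functor.map_comp_assoc, e₁', Functor.map_comp, Category.assoc, Category.assoc, c.sq₁.w]
  · intro T s t _ (e : s ≫ k₁ = t ≫ k₁)
    apply IsPullback.hom_eq h₀
    · change s ≫ a₀ = t ≫ a₀
      rw [← cancel_mono c.k₁, Category.assoc, Category.assoc, ← e₁', reassoc_of% e]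
    · rw [← cancel_mono c'.k₁, Category.assoc, Category.assoc, ← e₂, reassoc_of% e]
  · intro T y (t : T ⟶ R₁) e
    obtain ⟨s, h₂, h₃⟩ := IsPullback.exists_hom c.sq₁ y (t ≫ a₁) e
    obtain ⟨s', h₄, h₅⟩ := IsPullback.exists_hom c'.sq₁ y (t ≫ b₁)
      (e.trans (IsPullback.app_eq h₁ t))
    obtain ⟨r, h₆, h₇⟩ := IsPullback.exists_hom h₀ s s' (h₂.trans h₄.symm)
    replace h₆ : r ≫ a₀ = s := h₆
    refine ⟨r, ?_, ?_⟩
    · refine Eq.trans ?_ h₂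
      rw [← h₆]
      rfl
    · apply IsPullback.hom_eq h₁
      · change (r ≫ k₁) ≫ a₁ = t ≫ a₁
        rw [Category.assoc, e₁', reassoc_of% h₆, h₃]
      · change (r ≫ k₁) ≫ b₁ = t ≫ b₁
        rw [Category.assoc, e₂, reassoc_of% h₇, h₅]

lemma nonempty_product (hi₁ : MorphismProperty.presheaf @IsClosedImmersion.{u} i₁)
    (hi₂ : MorphismProperty.presheaf @IsClosedImmersion.{u} i₂) (c c' : Chart i₁ i₂) :
    Nonempty (Product c c') := by
  obtain ⟨R₀, a₀, b₀, h₀⟩ : ∃ (R₁ : Scheme.{u}) (a₁ : R₁ ⟶ c.U₀) (b₁ : R₁ ⟶ c'.U₀),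
      IsPullback (yoneda.map a₁) (yoneda.map b₁) c.p₀ c'.p₀ :=
    ⟨_, _, _, c.etale₀.rep.isPullback' c'.p₀⟩
  obtain ⟨R₁, k₁, a₁, b₁, h₁, e₁, f₁, s₁⟩ := exists_isPullback_product c c' h₀
  obtain ⟨R₂, k₂, a₂, b₂, h₂, e₂, f₂, s₂⟩ := exists_isPullback_product c.swap c'.swap h₀
  exact ⟨hi₁.property _ _ _ s₁, hi₂.property _ _ _ s₂, h₁, h₂, e₁, e₂, f₁, f₂, s₁, s₂⟩

/-- Compatible affine opens in the product of two charts give a chart over both. -/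
lemma Product.exists_hom {c c' d : Chart i₁ i₂} (P : Product c c') {o₀ : d.U₀ ⟶ P.R₀}
    {o₁ : d.U₁ ⟶ P.R₁} {o₂ : d.U₂ ⟶ P.R₂} (h₁ : o₀ ≫ P.k₁ = d.k₁ ≫ o₁)
    (h₂ : o₀ ≫ P.k₂ = d.k₂ ≫ o₂) (e₁ : yoneda.map o₁ ≫ yoneda.map P.a₁ ≫ c.p₁ = d.p₁)
    (e₂ : yoneda.map o₂ ≫ yoneda.map P.a₂ ≫ c.p₂ = d.p₂) :
    ∃ (h : Hom d c) (h' : Hom d c'), h.f₁ = o₁ ≫ P.a₁ ∧ h.f₂ = o₂ ≫ P.a₂ ∧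
      h'.f₁ = o₁ ≫ P.b₁ ∧ h'.f₂ = o₂ ≫ P.b₂ := by
  obtain ⟨h, h₃, h₄⟩ := Chart.exists_hom (d := d) (c := c) (f₀ := o₀ ≫ P.a₀) (f₁ := o₁ ≫ P.a₁)
    (f₂ := o₂ ≫ P.a₂) (by rw [Category.assoc, P.ha₁, reassoc_of% h₁])
    (by rw [Category.assoc, P.ha₂, reassoc_of% h₂]) (by rw [← e₁, Functor.map_comp, Category.assoc])
    (by rw [← e₂, Functor.map_comp, Category.assoc])
  obtain ⟨h', h₃', h₄'⟩ := Chart.exists_hom (d := d) (c := c') (f₀ := o₀ ≫ P.b₀) (f₁ := o₁ ≫ P.b₁)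
    (f₂ := o₂ ≫ P.b₂) (by rw [Category.assoc, P.hb₁, reassoc_of% h₁])
    (by rw [Category.assoc, P.hb₂, reassoc_of% h₂])
    (by rw [← e₁, P.isPullback₁.w, Functor.map_comp, Category.assoc])
    (by rw [← e₂, P.isPullback₂.w, Functor.map_comp, Category.assoc])
  exact ⟨h, h', h₃, h₄, h₃', h₄'⟩

/-- Two charts have a common refinement around a point over `X₁`. -/
lemma exists_refinement (hi₁ : MorphismProperty.presheaf @IsClosedImmersion.{u} i₁)
    (hi₂ : MorphismProperty.presheaf @IsClosedImmersion.{u} i₂) (c c' : Chart i₁ i₂)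
    {T : Scheme.{u}} (s : T ⟶ c.U₁) (s' : T ⟶ c'.U₁)
    (e : c.p₁.app (op T) s = c'.p₁.app (op T) s') (y : T) :
    ∃ (V : Scheme.{u}) (g : V ⟶ T) (v : V), Etale g ∧ g v = y ∧ ∃ (d : Chart i₁ i₂)
      (h : Hom d c) (h' : Hom d c') (r : V ⟶ d.U₁), r ≫ h.f₁ = g ≫ s ∧ r ≫ h'.f₁ = g ≫ s' := by
  obtain ⟨P⟩ := nonempty_product hi₁ hi₂ c c'
  obtain ⟨t, h₁, h₂⟩ := IsPullback.exists_hom P.isPullback₁ s s' e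
  replace h₁ : t ≫ P.a₁ = s := h₁
  have := P.closed₁
  have := P.closed₂
  have : Etale P.a₁ := c'.etale₁.property _ _ _ P.isPullback₁.flip
  have : Etale P.a₂ := c'.etale₂.property _ _ _ P.isPullback₂.flip
  obtain ⟨d, o₀, o₁, o₂, _, ⟨z, hz⟩, h₃, h₄, h₅, h₆⟩ := exists_chart
    (presheaf_etale_comp (presheaf_etale_map P.a₁) c.etale₁)
    (presheaf_etale_comp (presheaf_etale_map P.a₂) c.etale₂) P.sq₁ P.sq₂ (t y)
  obtain ⟨h, h', h₇, -, h₈, -⟩ := P.exists_hom h₃ h₄ h₅ h₆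
  obtain ⟨v, hv, -⟩ := Scheme.Pullback.exists_preimage_pullback y z hz.symm
  refine ⟨pullback t o₁, pullback.fst _ _, v, inferInstance, hv, d, h, h', pullback.snd _ _, ?_, ?_⟩
  · rw [h₇, ← h₁, pullback.condition_assoc]
  · rw [h₈, ← h₂, pullback.condition_assoc]

/-- There is a small family of charts covering `X₁` and `X₂`. -/
lemma exists_family (hX₁ : IsAlgebraicSpace X₁) (hX₂ : IsAlgebraicSpace X₂)
    (hi₁ : MorphismProperty.presheaf @IsClosedImmersion.{u} i₁)
    (hi₂ : MorphismProperty.presheaf @IsClosedImmersion.{u} i₂) :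
    ∃ (I : Type u) (c : I → Chart i₁ i₂), EtaleCovers (fun k => (c k).p₁) ∧
      EtaleCovers (fun k => (c k).p₂) := by
  obtain ⟨A₁, q₁, hq₁, hs₁⟩ := hX₁.exists_atlas
  obtain ⟨A₂, q₂, hq₂, hs₂⟩ := hX₂.exists_atlas
  choose d₁ o₁ ho₁ h₁ using exists_chart_of_atlas hi₁ hi₂ hq₁ hq₂ hs₂
  choose d₂ o₂ ho₂ h₂ using exists_chart_of_atlas hi₂ hi₁ hq₂ hq₁ hs₁
  have key {X : Scheme.{u}ᵒᵖ ⥤ Type u} {A : Scheme.{u}} {q : yoneda.obj A ⟶ X}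
      (hq : MorphismProperty.presheaf @Etale.{u} q)
      (hs : MorphismProperty.presheaf @Surjective.{u} q) {I : Type u} {U : I → Scheme.{u}}
      {p : ∀ k, yoneda.obj (U k) ⟶ X} (hp : ∀ k, MorphismProperty.presheaf @Etale.{u} (p k))
      (H : ∀ v : A, ∃ (k : I) (o : U k ⟶ A), v ∈ Set.range o ∧ yoneda.map o ≫ q = p k) :
      EtaleCovers p := by
    intro T x y
    obtain ⟨E, f, m, sq⟩ : ∃ (E : Scheme.{u}) (f : E ⟶ A) (m : E ⟶ T),
        IsPullback (yoneda.map f) (yoneda.map m) q (yonedaEquiv.symm x) :=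
      ⟨_, _, _, hq.rep.isPullback' _⟩
    have : Etale m := hq.property _ _ _ sq
    have : Surjective m := hs.property _ _ _ sq
    obtain ⟨z, rfl⟩ := m.surjective y
    obtain ⟨k, o, ⟨w, hw⟩, ho⟩ := H (f z)
    have : Etale o := SmallEtale.etale_left (U := ⟨_, p k, hp k⟩) (V := ⟨_, q, hq⟩) ⟨o, ho⟩
    obtain ⟨v, hv, -⟩ := Scheme.Pullback.exists_preimage_pullback z w hw.symm
    refine ⟨pullback f o, pullback.fst _ _ ≫ m, v, inferInstance, ?_, k, pullback.snd _ _, ?_⟩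
    · rw [Scheme.Hom.comp_apply, hv]
    · rw [← ho, yoneda_map_comp_app, ← pullback.condition]
      have := IsPullback.app_eq sq (pullback.fst f o)
      rw [yonedaEquiv_symm_app] at this
      exact this
  -- One chart for each point of either atlas: the index type stays in `u`, although charts form a
  -- type in `u + 1`.
  refine ⟨A₁ ⊕ A₂, Sum.elim d₁ fun v => (d₂ v).swap, key hq₁ hs₁ (fun k => (Sum.elim d₁ _ k).etale₁)
    fun v => ⟨.inl v, o₁ v, ho₁ v, h₁ v⟩, key hq₂ hs₂ (fun k => (Sum.elim d₁ _ k).etale₂)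
    fun v => ⟨.inr v, o₂ v, ho₂ v, h₂ v⟩⟩

end Chart

end AlgebraicSpace

namespace AlgebraicSpace

variable {Y X₁ X₂ : Scheme.{u}ᵒᵖ ⥤ Type u} {i₁ : Y ⟶ X₁} {i₂ : Y ⟶ X₂}

/-! ### The sheaf quotient of the charts -/

namespace Chart

/-- Two sections of charts agree if they lift to a common chart. -/
def setoid (i₁ : Y ⟶ X₁) (i₂ : Y ⟶ X₂) (T : Scheme.{u}) :
    Setoid (Σ c : Chart i₁ i₂, (T ⟶ c.U)) where
  r x y := ∃ (d : Chart i₁ i₂) (h : Hom d x.1) (h' : Hom d y.1) (s : T ⟶ d.U),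
    s ≫ h.f = x.2 ∧ s ≫ h'.f = y.2
  iseqv :=
    { refl := fun x => ⟨x.1, .id _, .id _, x.2, Category.comp_id _, Category.comp_id _⟩
      symm := fun ⟨d, h, h', s, e, e'⟩ => ⟨d, h', h, s, e', e⟩
      trans := by
        rintro x y z ⟨d, h, h', s, e, e'⟩ ⟨d', g, g', r, w, w'⟩
        obtain ⟨b, a, a', t, h₁, h₂⟩ := h'.exists_common g s r (e'.trans w.symm)
        refine ⟨b, a.comp h, a'.comp g', t, ?_, ?_⟩
        · rw [← e, ← h₁]
          exact (Category.assoc _ _ _).symm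
        · rw [← w', ← h₂]
          exact (Category.assoc _ _ _).symm }

/-- The presheaf quotient of the charts. -/
def quotient (i₁ : Y ⟶ X₁) (i₂ : Y ⟶ X₂) : Scheme.{u}ᵒᵖ ⥤ Type (u + 1) where
  obj T := Quotient (setoid i₁ i₂ T.unop)
  map {T T'} g := TypeCat.ofHom (Quotient.map (fun x => ⟨x.1, g.unop ≫ x.2⟩) (by
    rintro x y ⟨d, h, h', s, e, e'⟩
    exact ⟨d, h, h', g.unop ≫ s, by rw [Category.assoc, e], by rw [Category.assoc, e']⟩))
  map_id T := by
    ext x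
    induction x using Quotient.inductionOn with | h x => ?_
    exact congrArg (Quotient.mk _) (Sigma.ext rfl (heq_of_eq (Category.id_comp _)))
  map_comp {T T' T''} g g' := by
    ext x
    induction x using Quotient.inductionOn with | h x => ?_
    exact congrArg (Quotient.mk _) (Sigma.ext rfl (heq_of_eq (Category.assoc _ _ _)))

/-- The class of a section of a chart. -/
def toQuotient (c : Chart i₁ i₂) {T : Scheme.{u}} (t : T ⟶ c.U) :
    (quotient i₁ i₂).obj (op T) :=
  Quotient.mk (setoid i₁ i₂ T) ⟨c, t⟩

lemma exists_eq_toQuotient {T : Scheme.{u}} (x : (quotient i₁ i₂).obj (op T)) :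
    ∃ (c : Chart i₁ i₂) (t : T ⟶ c.U), c.toQuotient t = x := by
  induction x using Quotient.inductionOn with | h x => exact ⟨x.1, x.2, rfl⟩

lemma toQuotient_eq_iff {c c' : Chart i₁ i₂} {T : Scheme.{u}} {t : T ⟶ c.U} {t' : T ⟶ c'.U} :
    c.toQuotient t = c'.toQuotient t' ↔ ∃ (d : Chart i₁ i₂) (h : Hom d c) (h' : Hom d c')
      (s : T ⟶ d.U), s ≫ h.f = t ∧ s ≫ h'.f = t' :=
  Quotient.eq

lemma map_toQuotient (c : Chart i₁ i₂) {T T' : Scheme.{u}} (g : T' ⟶ T) (t : T ⟶ c.U) :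
    (quotient i₁ i₂).map g.op (c.toQuotient t) = c.toQuotient (g ≫ t) :=
  rfl

/-- A point of U₁ lifts through X₁ to a member of the covering family, and there is a common
refinement `d` there. Since `d` is étale over the whole of c.U, pulling it back along `t` gives an
étale neighbourhood in T, not merely over the first piece. -/
lemma exists_toQuotient_eq_of_mem_range (hi₁ : MorphismProperty.presheaf @IsClosedImmersion.{u} i₁)
    (hi₂ : MorphismProperty.presheaf @IsClosedImmersion.{u} i₂) {I : Type u}
    {b : I → Chart i₁ i₂} (hb : EtaleCovers (fun k => (b k).p₁)) (c : Chart i₁ i₂) {T : Scheme.{u}}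
    (t : T ⟶ c.U) (y : T) (z : c.U₁) (hz : c.j₁ z = t y) :
    ∃ (V : Scheme.{u}) (g : V ⟶ T) (v : V), Etale g ∧ g v = y ∧
      ∃ (k : I) (d : Chart i₁ i₂) (h : Hom d c) (_ : Hom d (b k)) (s : V ⟶ d.U),
        s ≫ h.f = g ≫ t := by
  obtain ⟨V₁, f, v₁, _, rfl, k, t₁, ht₁⟩ := hb _ (c.p₁.app _ (𝟙 c.U₁)) z
  obtain ⟨V₂, g₂, v₂, _, rfl, d, h, h', r, hr, -⟩ := exists_refinement hi₁ hi₂ c (b k) f t₁ (by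
    rw [ht₁, map_app_yoneda, Category.comp_id]) v₁
  have := h.etale_f
  obtain ⟨v, hv, -⟩ := Scheme.Pullback.exists_preimage_pullback (f := t) (g := h.f) y
    (d.j₁ (r v₂)) (by
      rw [← hz, ← Scheme.Hom.comp_apply, ← Scheme.Hom.comp_apply, ← Scheme.Hom.comp_apply,
        ← Scheme.Hom.comp_apply, ← reassoc_of% hr, h.w₁])
  exact ⟨_, pullback.fst t h.f, v, inferInstance, hv, k, d, h, h', pullback.snd _ _,
    pullback.condition.symm⟩

/-- A family of charts covering `X₁` and `X₂` covers the quotient. -/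
lemma exists_toQuotient_eq (hi₁ : MorphismProperty.presheaf @IsClosedImmersion.{u} i₁)
    (hi₂ : MorphismProperty.presheaf @IsClosedImmersion.{u} i₂) {I : Type u}
    {b : I → Chart i₁ i₂} (hb₁ : EtaleCovers (fun k => (b k).p₁))
    (hb₂ : EtaleCovers (fun k => (b k).p₂)) (c : Chart i₁ i₂) {T : Scheme.{u}}
    (t : T ⟶ c.U) (y : T) :
    ∃ (V : Scheme.{u}) (g : V ⟶ T) (v : V), Etale g ∧ g v = y ∧
      ∃ (k : I) (t' : V ⟶ (b k).U), c.toQuotient (g ≫ t) = (b k).toQuotient t' := by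
  obtain ⟨z, hz⟩ | ⟨z, hz⟩ := c.glued.range_union (t y)
  · obtain ⟨V, g, v, h₁, h₂, k, d, h, h', s, hs⟩ :=
      exists_toQuotient_eq_of_mem_range hi₁ hi₂ hb₁ c t y z hz
    exact ⟨V, g, v, h₁, h₂, k, s ≫ h'.f, toQuotient_eq_iff.2 ⟨d, h, h', s, hs, rfl⟩⟩
  · obtain ⟨V, g, v, h₁, h₂, k, d, h, h', s, hs⟩ :=
      exists_toQuotient_eq_of_mem_range (b := fun k => (b k).swap) hi₂ hi₁ hb₂ c.swap t y z hz
    exact ⟨V, g, v, h₁, h₂, k, s ≫ h'.f, toQuotient_eq_iff.2 ⟨d.swap, h.swap, h'.swap, s, hs, rfl⟩⟩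

end Chart

/-- Affine étale schemes over S form an essentially small category; this bounds the number of
sections of the sheafified quotient. -/
lemma exists_small_affineEtale (S : Scheme.{u}) : ∃ (K : Type u) (V : K → Scheme.{u})
    (f : ∀ k, V k ⟶ S), (∀ k, Etale (f k)) ∧ ∀ (V' : Scheme.{u}) (g : V' ⟶ S), IsAffine V' →
      Etale g → ∃ (k : K) (e : V k ≅ V'), e.hom ≫ g = f k := by
  let F := (equivSmallModel.{u} S.AffineEtale).inverse ⋙ Scheme.AffineEtale.Spec S
  refine ⟨SmallModel.{u} S.AffineEtale, fun k => (F.obj k).left, fun k => (F.obj k).hom,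
    fun k => (F.obj k).prop, fun V' g _ _ => ?_⟩
  let A : S.AffineEtale := Scheme.AffineEtale.mk (V'.isoSpec.inv ≫ g)
  let e := (Scheme.AffineEtale.Spec S ⋙ Scheme.Etale.forget S ⋙ Over.forget S).mapIso
    ((equivSmallModel.{u} S.AffineEtale).unitIso.app A)
  have he : e.inv ≫ (V'.isoSpec.inv ≫ g) = _ := Over.w
    ((Scheme.AffineEtale.Spec S ⋙ Scheme.Etale.forget S).map
    ((equivSmallModel.{u} S.AffineEtale).unitIso.app A).inv)
  refine ⟨(equivSmallModel _).functor.obj A, e.symm ≪≫ V'.isoSpec.symm, ?_⟩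
  exact (Category.assoc _ _ _).trans he

/-- The sheaf `W` is the quotient of the charts: the charts cover `W`, and two sections of charts
agree in `W` if and only if they lift étale locally to a common chart. -/
structure IsChartQuotient {W : Scheme.{u}ᵒᵖ ⥤ Type u} (w : ∀ c : Chart i₁ i₂, yoneda.obj c.U ⟶ W) :
    Prop where
  isSheaf : Presheaf.IsSheaf Scheme.etaleTopology.{u} W
  naturality : ∀ {d c : Chart i₁ i₂} (h : d.Hom c), yoneda.map h.f ≫ w c = w d
  covers : EtaleCovers w
  exists_common : ∀ {c c' : Chart i₁ i₂} {T : Scheme.{u}} (t : T ⟶ c.U) (t' : T ⟶ c'.U),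
    (w c).app (op T) t = (w c').app (op T) t' → ∀ y : T,
      ∃ (V : Scheme.{u}) (g : V ⟶ T) (v : V), Etale g ∧ g v = y ∧ ∃ (d : Chart i₁ i₂)
        (h : d.Hom c) (h' : d.Hom c') (s : V ⟶ d.U), s ≫ h.f = g ≫ t ∧ s ≫ h'.f = g ≫ t'

lemma IsChartQuotient.swap {W : Scheme.{u}ᵒᵖ ⥤ Type u} {w : ∀ c : Chart i₁ i₂, yoneda.obj c.U ⟶ W}
    (hw : IsChartQuotient w) : IsChartQuotient (fun c : Chart i₂ i₁ => w c.swap) where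
  isSheaf := hw.isSheaf
  naturality h := hw.naturality h.swap
  covers T x y := by
    obtain ⟨V, f, v, h₁, h₂, c, t, h₃⟩ := hw.covers T x y
    exact ⟨V, f, v, h₁, h₂, c.swap, t, h₃⟩
  exists_common {c c'} _ t t' e y := by
    obtain ⟨V, g, v, h₁, h₂, d, h, h', s, h₃⟩ :=
      hw.exists_common (c := c.swap) (c' := c'.swap) t t' e y
    exact ⟨V, g, v, h₁, h₂, d.swap, h.swap, h'.swap, s, h₃⟩

/-- The quotient of the charts exists. -/
lemma exists_isChartQuotient (hX₁ : IsAlgebraicSpace X₁) (hX₂ : IsAlgebraicSpace X₂)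
    (hi₁ : MorphismProperty.presheaf @IsClosedImmersion.{u} i₁)
    (hi₂ : MorphismProperty.presheaf @IsClosedImmersion.{u} i₂) :
    ∃ (W : Scheme.{u}ᵒᵖ ⥤ Type u) (w : ∀ c : Chart i₁ i₂, yoneda.obj c.U ⟶ W),
      IsChartQuotient w := by
  obtain ⟨I, b, hb₁, hb₂⟩ := Chart.exists_family hX₁ hX₂ hi₁ hi₂
  let J := Scheme.etaleTopology.{u}
  -- Charts form a type in `u + 1`, so the sheafification is carried out there and its values are
  -- shrunk back to `u` afterwards.
  obtain ⟨S, τ, hS, hτ, hτ'⟩ : ∃ (S : Scheme.{u}ᵒᵖ ⥤ Type (u + 1)) (τ : Chart.quotient i₁ i₂ ⟶ S),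
      Presieve.IsSheaf J S ∧ Presheaf.IsLocallyInjective J τ ∧ Presheaf.IsLocallySurjective J τ :=
    ⟨J.sheafify _, J.toSheafify _,
      (isSheaf_iff_isSheaf_of_type _ _).1 (J.sheafify_isSheaf _), inferInstance, inferInstance⟩
  have nat {T T' : Scheme.{u}} (g : T' ⟶ T) (x : (Chart.quotient i₁ i₂).obj (op T)) :
      S.map g.op (τ.app _ x) = τ.app _ ((Chart.quotient i₁ i₂).map g.op x) :=
    (NatTrans.naturality_apply τ g.op x).symm
  have comp {T T' T'' : Scheme.{u}} (g : T' ⟶ T) (h : T'' ⟶ T') (x : S.obj (op T)) :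
      S.map h.op (S.map g.op x) = S.map (h ≫ g).op x := by
    rw [op_comp, Functor.map_comp_apply]
  have cov (T : Scheme.{u}) (x : S.obj (op T)) (y : T) : ∃ (V : Scheme.{u}) (f : V ⟶ T) (v : V),
      IsAffine V ∧ Etale f ∧ f v = y ∧ ∃ (k : I) (t : V ⟶ (b k).U),
        τ.app _ ((b k).toQuotient t) = S.map f.op x := by
    obtain ⟨V, f, v, _, ⟨q, hq⟩, rfl⟩ := mem_etaleTopology_iff.1
      (Presheaf.imageSieve_mem J τ x) y
    obtain ⟨c, t, rfl⟩ := Chart.exists_eq_toQuotient q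
    obtain ⟨V', f', v', _, rfl, k, t', h⟩ := Chart.exists_toQuotient_eq hi₁ hi₂ hb₁ hb₂ c t v
    obtain ⟨O, hO, hvO, -⟩ := exists_isAffineOpen_mem_and_subset (U := ⊤) (x := v') trivial
    refine ⟨O, O.ι ≫ f' ≫ f, ⟨v', hvO⟩, hO, inferInstance, ?_, k, O.ι ≫ t', ?_⟩
    · rfl
    · rw [← Chart.map_toQuotient, ← h, ← comp, ← comp, ← hq, nat, nat]
      rfl
  have sep {T : Scheme.{u}} {x x' : S.obj (op T)} (h : ∀ y : T, ∃ (V : Scheme.{u}) (f : V ⟶ T)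
      (v : V), Etale f ∧ f v = y ∧ S.map f.op x = S.map f.op x') : x = x' := by
    let R : Sieve T :=
      { arrows := fun V f => S.map f.op x = S.map f.op x'
        downward_closed := by
          intro V V' f e g
          rw [← comp, e, comp] }
    refine (hS R (mem_etaleTopology_iff.2 fun t => ?_)).isSeparatedFor.ext fun V f hf => hf
    obtain ⟨V, f, v, h₁, h₂, h₃⟩ := h t
    exact ⟨V, f, v, h₁, h₃, h₂⟩
  -- A section is determined by the set of its lifts to charts of the small family over a small set
  -- of affine étale T-schemes.
  have small (T : Scheme.{u}) : Small.{u} (S.obj (op T)) := by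
    obtain ⟨K, V, f, hf, hK⟩ := exists_small_affineEtale T
    let φ (x : S.obj (op T)) : Set (Σ (m : K × I), (V m.1 ⟶ (b m.2).U)) :=
      {n | τ.app _ ((b n.1.2).toQuotient n.2) = S.map (f n.1.1).op x}
    refine small_of_injective (f := φ) fun x x' h => sep fun y => ?_
    obtain ⟨V', g, v, _, _, hv, k, t, ht⟩ := cov T x y
    obtain ⟨n, e, he⟩ := hK V' g inferInstance inferInstance
    have hmem : (⟨(n, k), e.hom ≫ t⟩ : Σ (m : K × I), (V m.1 ⟶ (b m.2).U)) ∈ φ x := by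
      change τ.app _ ((b k).toQuotient (e.hom ≫ t)) = S.map (f n).op x
      rw [← Chart.map_toQuotient, ← nat, ht, comp, he]
    have hmem' := hmem
    rw [h] at hmem'
    refine ⟨V n, f n, e.inv v, hf n, ?_, hmem.symm.trans hmem'⟩
    rw [← he, ← Scheme.Hom.comp_apply, Iso.inv_hom_id_assoc, hv]
  let W : Scheme.{u}ᵒᵖ ⥤ Type u :=
    { obj := fun T => Shrink.{u} (S.obj T)
      map := fun g => TypeCat.ofHom fun x => equivShrink _ (S.map g ((equivShrink _).symm x))
      map_id := fun T => by
        ext x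
        simp
      map_comp := fun f g => by
        ext x
        simp }
  have mapW {T T' : Scheme.{u}} (g : T' ⟶ T) (x : S.obj (op T)) :
      W.map g.op (equivShrink _ x) = equivShrink _ (S.map g.op x) := by
    simp [W]
  let w (c : Chart i₁ i₂) : yoneda.obj c.U ⟶ W :=
    { app := fun T => TypeCat.ofHom fun t => equivShrink _ (τ.app T (c.toQuotient t))
      naturality := fun T T' g => by
        apply ConcreteCategory.hom_ext
        intro t
        refine Eq.trans ?_ (mapW g.unop _).symm
        exact congrArg _ (nat g.unop (c.toQuotient t)).symm }
  have w_app (c : Chart i₁ i₂) {T : Scheme.{u}} (t : T ⟶ c.U) :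
      (w c).app (op T) t = equivShrink _ (τ.app _ (c.toQuotient t)) := rfl
  refine ⟨W, w, ?_, ?_, ?_, ?_⟩
  · rw [isSheaf_iff_isSheaf_of_type]
    exact Presieve.isSheaf_of_nat_equiv (fun T => equivShrink (S.obj (op T)))
      (fun T T' f x => (mapW f x).symm) hS
  · intro d c h
    apply hom_ext_yoneda_obj
    rw [yoneda_map_comp_app, Category.id_comp, w_app, w_app]
    congr 2
    exact Chart.toQuotient_eq_iff.2 ⟨d, h, .id d, 𝟙 _, Category.id_comp _, Category.id_comp _⟩
  · intro T x y
    obtain ⟨x, rfl⟩ := (equivShrink _).surjective x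
    obtain ⟨V, f, v, _, h₁, h₂, k, t, h₃⟩ := cov T x y
    refine ⟨V, f, v, h₁, h₂, b k, t, ?_⟩
    rw [w_app, mapW, h₃]
  · intro c c' T t t' e y
    rw [w_app, w_app, (equivShrink _).apply_eq_iff_eq] at e
    obtain ⟨V, g, v, h₁, h₂, h₃⟩ := mem_etaleTopology_iff.1
      (Presheaf.equalizerSieve_mem J τ _ _ e) y
    exact ⟨V, g, v, h₁, h₃, Chart.toQuotient_eq_iff.1 h₂⟩

end AlgebraicSpace

namespace AlgebraicSpace

variable {Y X₁ X₂ W : Scheme.{u}ᵒᵖ ⥤ Type u} {i₁ : Y ⟶ X₁} {i₂ : Y ⟶ X₂}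

/-! ### The closed pieces of the quotient -/

lemma Chart.etaleCovers₁ (hX₁ : IsAlgebraicSpace X₁) (hX₂ : IsAlgebraicSpace X₂)
    (hi₁ : MorphismProperty.presheaf @IsClosedImmersion.{u} i₁)
    (hi₂ : MorphismProperty.presheaf @IsClosedImmersion.{u} i₂) :
    EtaleCovers (fun c : Chart i₁ i₂ => c.p₁) := by
  obtain ⟨I, b, hb, -⟩ := Chart.exists_family hX₁ hX₂ hi₁ hi₂
  intro T x y
  obtain ⟨V, f, v, h₁, h₂, k, h⟩ := hb T x y
  exact ⟨V, f, v, h₁, h₂, b k, h⟩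

namespace IsChartQuotient

variable {w : ∀ c : Chart i₁ i₂, yoneda.obj c.U ⟶ W}

lemma app_hom (hw : IsChartQuotient w) {d c : Chart i₁ i₂} (h : d.Hom c) {T : Scheme.{u}}
    (t : T ⟶ d.U) : (w c).app (op T) (t ≫ h.f) = (w d).app (op T) t := by
  rw [← hw.naturality h]
  rfl

/-- The map from the first piece to the quotient. -/
lemma exists_inl (hw : IsChartQuotient w)
    (hi₁ : MorphismProperty.presheaf @IsClosedImmersion.{u} i₁)
    (hi₂ : MorphismProperty.presheaf @IsClosedImmersion.{u} i₂)
    (hc : EtaleCovers (fun c : Chart i₁ i₂ => c.p₁)) :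
    ∃ a : X₁ ⟶ W, ∀ c, c.p₁ ≫ a = yoneda.map c.j₁ ≫ w c := by
  refine hc.exists_desc hw.isSheaf _ fun c c' T s s' e => ?_
  rw [yoneda_map_comp_app, yoneda_map_comp_app]
  refine sheaf_ext hw.isSheaf fun y => ?_
  obtain ⟨V, g, v, h₁, h₂, d, h, h', r, hr, hr'⟩ := Chart.exists_refinement hi₁ hi₂ c c' s s' e y
  refine ⟨V, g, v, h₁, h₂, ?_⟩
  rw [map_app_yoneda, map_app_yoneda, ← reassoc_of% hr, ← reassoc_of% hr', ← h.w₁, ← h'.w₁,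
    ← Category.assoc, ← Category.assoc, hw.app_hom, hw.app_hom]

variable {a : X₁ ⟶ W}

lemma inl_app (ha : ∀ c, c.p₁ ≫ a = yoneda.map c.j₁ ≫ w c) (c : Chart i₁ i₂) {T : Scheme.{u}}
    (s : T ⟶ c.U₁) : a.app _ (c.p₁.app (op T) s) = (w c).app (op T) (s ≫ c.j₁) := by
  rw [← yoneda_map_comp_app, ← ha]
  rfl

/-- The preimage of the first piece in a chart. -/
lemma isPullback_inl (hw : IsChartQuotient w)
    (hX : Presheaf.IsSheaf Scheme.etaleTopology.{u} X₁)
    (hc : EtaleCovers (fun c : Chart i₁ i₂ => c.p₁))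
    (ha : ∀ c, c.p₁ ≫ a = yoneda.map c.j₁ ≫ w c) (c : Chart i₁ i₂) :
    IsPullback c.p₁ (yoneda.map c.j₁) a (w c) := by
  have := c.glued.closed₁
  refine isPullback_iff_forall.2 ⟨ha c, fun T s s' _ h => (cancel_mono c.j₁).1 h, ?_⟩
  intro T x (t : T ⟶ c.U) e
  have loc (y : T) : ∃ (V : Scheme.{u}) (f : V ⟶ T) (v : V), Etale f ∧ f v = y ∧
      ∃ s : V ⟶ c.U₁, s ≫ c.j₁ = f ≫ t ∧ c.p₁.app _ s = X₁.map f.op x := by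
    obtain ⟨V, f, v, _, rfl, c', s', h⟩ := hc T x y
    obtain ⟨V', f', v', _, rfl, d, g, g', r, hr, hr'⟩ :=
      hw.exists_common (s' ≫ c'.j₁) (f ≫ t) (by
        rw [← inl_app ha, h, ← map_app, e, map_app_yoneda]) v
    -- On the common chart, cartesianness of `g` over the first piece shows that the section lies in
    -- d.U₁, since its image in c' does. Its image in c.U₁ is the desired lift.
    obtain ⟨r₁, h₁, h₂⟩ : ∃ r₁ : V' ⟶ d.U₁, r₁ ≫ d.j₁ = r ∧ r₁ ≫ g.f₁ = f' ≫ s' :=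
      ⟨g.isPullback₁.lift r (f' ≫ s') (by rw [hr, Category.assoc]), IsPullback.lift_fst _ _ _ _,
        IsPullback.lift_snd _ _ _ _⟩
    refine ⟨V', f' ≫ f, v', inferInstance, rfl, r₁ ≫ g'.f₁, ?_, ?_⟩
    · rw [Category.assoc, ← g'.w₁, reassoc_of% h₁, hr', Category.assoc]
    · rw [← yoneda_map_comp_app, g'.e₁, ← g.e₁, yoneda_map_comp_app, h₂, ← map_app_yoneda, h,
        map_map]
  obtain ⟨s, hs⟩ := exists_glue (isSheaf_yoneda c.U₁) (T := T)
    (fun {V} f s => s ≫ c.j₁ = f ≫ t ∧ c.p₁.app (op V) s = X₁.map f.op x) (by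
      rintro V V' f g s ⟨h₁, h₂⟩
      exact ⟨(Category.assoc g s c.j₁).trans
        ((congrArg (g ≫ ·) h₁).trans (Category.assoc _ _ _).symm), by
        rw [← map_map, ← h₂, map_app_yoneda]; rfl⟩) (by
      rintro V f s s' ⟨h₁, -⟩ ⟨h₂, -⟩
      exact (cancel_mono c.j₁).1 (h₁.trans h₂.symm)) (by
      intro y
      obtain ⟨V, f, v, h₁, h₂, s, hs⟩ := loc y
      exact ⟨V, f, v, h₁, h₂, s, hs⟩)
  refine ⟨s, sheaf_ext hX fun y => ?_, sheaf_ext (isSheaf_yoneda c.U) fun y => ?_⟩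
  · obtain ⟨V, f, v, h₁, h₂, s', hs'⟩ := loc y
    refine ⟨V, f, v, h₁, h₂, ?_⟩
    rw [← hs'.2, map_app, hs f s' hs']
  · obtain ⟨V, f, v, h₁, h₂, s', hs'⟩ := loc y
    refine ⟨V, f, v, h₁, h₂, ?_⟩
    refine Eq.trans ?_ hs'.1
    rw [map_app, hs f s' hs']
    rfl

/-- Injectivity can be checked étale locally on W, where X₁ becomes the closed piece U₁ of a chart.
-/
lemma mono_inl (hw : IsChartQuotient w) (hX : Presheaf.IsSheaf Scheme.etaleTopology.{u} X₁)
    (hc : EtaleCovers (fun c : Chart i₁ i₂ => c.p₁))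
    (ha : ∀ c, c.p₁ ≫ a = yoneda.map c.j₁ ≫ w c) : Mono a := by
  refine mono_iff_forall.2 fun T x x' e => sheaf_ext hX fun y => ?_
  obtain ⟨V, f, v, h₁, h₂, c, t, h⟩ := hw.covers T (a.app _ x) y
  have sq := hw.isPullback_inl hX hc ha c
  refine ⟨V, f, v, h₁, h₂, ?_⟩
  obtain ⟨s, hs, hs'⟩ := IsPullback.exists_hom sq (X₁.map f.op x) t (by rw [h, map_app])
  obtain ⟨r, hr, hr'⟩ := IsPullback.exists_hom sq (X₁.map f.op x') t (by rw [h, e, map_app])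
  have := c.glued.closed₁
  rw [← hs, ← hr, (cancel_mono c.j₁).1 (hs'.trans hr'.symm)]

variable {b : X₂ ⟶ W}

/-- The square of the pushout is cartesian. -/
lemma isPullback (hw : IsChartQuotient w) (hY : Presheaf.IsSheaf Scheme.etaleTopology.{u} Y)
    (hX₁ : Presheaf.IsSheaf Scheme.etaleTopology.{u} X₁)
    (hX₂ : Presheaf.IsSheaf Scheme.etaleTopology.{u} X₂)
    (hc₁ : EtaleCovers (fun c : Chart i₁ i₂ => c.p₁))
    (hc₂ : EtaleCovers (fun c : Chart i₂ i₁ => c.p₁)) [Mono i₁]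
    (ha : ∀ c, c.p₁ ≫ a = yoneda.map c.j₁ ≫ w c)
    (hb : ∀ c, c.p₂ ≫ b = yoneda.map c.j₂ ≫ w c) : IsPullback i₁ i₂ a b := by
  have hb' : ∀ c : Chart i₂ i₁, c.p₁ ≫ b = yoneda.map c.j₁ ≫ w c.swap := fun c => hb c.swap
  have hm : ∀ (T : Scheme.{u}) (x y : Y.obj (op T)), i₁.app _ x = i₁.app _ y → x = y :=
    mono_iff_forall.1 inferInstance
  have hbm := mono_iff_forall.1 (hw.swap.mono_inl hX₂ hc₂ hb')
  have com : i₁ ≫ a = i₂ ≫ b := by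
    ext T y
    refine sheaf_ext hw.isSheaf (T := T.unop) fun z => ?_
    obtain ⟨V, f, v, h₁, h₂, c, t, h⟩ := hc₁ T.unop (i₁.app _ y) z
    refine ⟨V, f, v, h₁, h₂, ?_⟩
    obtain ⟨s, hs, hs'⟩ := IsPullback.exists_hom c.sq₁ (Y.map f.op y) t
      (by rw [h]; exact (map_app _ _ _).symm)
    have key : a.app _ (i₁.app _ (Y.map f.op y)) = b.app _ (i₂.app _ (Y.map f.op y)) := by
      rw [← hs, IsPullback.app_eq c.sq₁, IsPullback.app_eq c.sq₂, inl_app ha,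
        inl_app hb' c.swap, Category.assoc, Category.assoc, c.glued.isPullback.w]
    exact (map_app (i₁ ≫ a) f y).trans (key.trans (map_app (i₂ ≫ b) f y).symm)
  refine isPullback_iff_forall.2 ⟨com, fun T x y h _ => hm T x y h, fun T x x' e => ?_⟩
  have com' {V : Scheme.{u}} (y : Y.obj (op V)) : a.app _ (i₁.app _ y) = b.app _ (i₂.app _ y) :=
    ConcreteCategory.congr_hom (NatTrans.congr_app com (op V)) y
  have loc (z : T) : ∃ (V : Scheme.{u}) (f : V ⟶ T) (v : V), Etale f ∧ f v = z ∧
      ∃ y : Y.obj (op V), i₁.app _ y = X₁.map f.op x := by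
    obtain ⟨V, f, v, h₁, h₂, c, t, h⟩ := hw.covers T (a.app _ x) z
    refine ⟨V, f, v, h₁, h₂, ?_⟩
    obtain ⟨s, hs, hs'⟩ := IsPullback.exists_hom (hw.isPullback_inl hX₁ hc₁ ha c) (X₁.map f.op x) t
      (by rw [h, map_app])
    obtain ⟨r, hr, hr'⟩ := IsPullback.exists_hom (hw.swap.isPullback_inl hX₂ hc₂ hb' c.swap)
      (X₂.map f.op x') t (by rw [h, e, map_app])
    obtain ⟨q, hq, -⟩ : ∃ q : V ⟶ c.U₀, q ≫ c.k₁ = s ∧ q ≫ c.k₂ = r :=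
      ⟨c.glued.isPullback.lift s r (hs'.trans hr'.symm), IsPullback.lift_fst _ _ _ _,
        IsPullback.lift_snd _ _ _ _⟩
    exact ⟨c.p₀.app _ q, by rw [IsPullback.app_eq c.sq₁, hq, hs]⟩
  obtain ⟨y, hy⟩ := exists_glue hY (T := T) (fun {V} f y => i₁.app _ y = X₁.map f.op x) (by
      rintro V V' f g y h
      rw [← map_map, ← h, map_app]) (by
      rintro V f y y' h₁ h₂
      exact hm _ _ _ (h₁.trans h₂.symm)) loc
  have e₁ : i₁.app _ y = x := sheaf_ext hX₁ fun z => by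
    obtain ⟨V, f, v, h₁, h₂, y', hy'⟩ := loc z
    exact ⟨V, f, v, h₁, h₂, by rw [map_app, hy f y' hy', hy']⟩
  exact ⟨y, e₁, hbm _ _ _ (by rw [← com', e₁, e])⟩

end IsChartQuotient

end AlgebraicSpace

namespace AlgebraicSpace

/-! ### Glued schemes as pushouts of algebraic spaces -/

/-- The locus where two sections of an algebraic space agree is representable. -/
lemma IsAlgebraicSpace.exists_equalizer {Z : Scheme.{u}ᵒᵖ ⥤ Type u} (hZ : IsAlgebraicSpace Z)
    {T : Scheme.{u}} (z z' : Z.obj (op T)) : ∃ (E : Scheme.{u}) (m : E ⟶ T), Mono m ∧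
      ∀ {T' : Scheme.{u}} (g : T' ⟶ T), (∃ s : T' ⟶ E, s ≫ m = g) ↔
        Z.map g.op z = Z.map g.op z' := by
  obtain ⟨E, m, q, sq⟩ := hZ.representable_diag
    (prod.lift (yonedaEquiv.symm z) (yonedaEquiv.symm z'))
  have hm : Mono (yoneda.map m) :=
    (MorphismProperty.monomorphisms _).of_isPullback sq (.infer_property (diag Z))
  refine ⟨E, m, yoneda.mono_of_mono_map hm, fun {T'} g => ⟨?_, fun h => ?_⟩⟩
  · rintro ⟨s, rfl⟩
    have h₁ := sq.w =≫ prod.fst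
    have h₂ := sq.w =≫ prod.snd
    rw [Category.assoc, Category.assoc, prod.lift_fst, prod.lift_fst, Category.comp_id] at h₁
    rw [Category.assoc, Category.assoc, prod.lift_snd, prod.lift_snd, Category.comp_id] at h₂
    have := ConcreteCategory.congr_hom (NatTrans.congr_app (h₁.symm.trans h₂) (op T'))
      (s : (yoneda.obj E).obj (op T'))
    exact this
  · have w : yonedaEquiv.symm (Z.map g.op z) ≫ diag Z =
        yoneda.map g ≫ prod.lift (yonedaEquiv.symm z) (yonedaEquiv.symm z') := by
      apply Limits.prod.hom_ext
      · rw [Category.assoc, Category.assoc, prod.lift_fst, prod.lift_fst, Category.comp_id]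
        apply hom_ext_yoneda_obj
        rw [yoneda_map_comp_app, yonedaEquiv_symm_app, yonedaEquiv_symm_app, map_map]
      · rw [Category.assoc, Category.assoc, prod.lift_snd, prod.lift_snd, Category.comp_id, h]
        apply hom_ext_yoneda_obj
        rw [yoneda_map_comp_app, yonedaEquiv_symm_app, yonedaEquiv_symm_app, map_map]
    refine ⟨yoneda.preimage (sq.lift _ _ w), yoneda.map_injective ?_⟩
    rw [Functor.map_comp, Functor.map_preimage, sq.lift_snd]

namespace IsGlued

variable {U₀ U₁ U₂ U : Scheme.{u}} {k₁ : U₀ ⟶ U₁} {k₂ : U₀ ⟶ U₂} {j₁ : U₁ ⟶ U} {j₂ : U₂ ⟶ U}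
  {Z : Scheme.{u}ᵒᵖ ⥤ Type u}

/-- The equalizer of the two sections is a monomorphism E → U which becomes an isomorphism over both
pieces. By `etale_of_etale` it is étale; being also surjective, it is an isomorphism. Separatedness
of Z plays no role. -/
lemma algebraicSpace_ext (h : IsGlued k₁ k₂ j₁ j₂) (hZ : IsAlgebraicSpace Z) {z z' : Z.obj (op U)}
    (h₁ : Z.map j₁.op z = Z.map j₁.op z') (h₂ : Z.map j₂.op z = Z.map j₂.op z') : z = z' := by
  obtain ⟨E, m, _, hm⟩ := hZ.exists_equalizer z z'
  obtain ⟨s₁, hs₁⟩ := (hm j₁).2 h₁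
  obtain ⟨s₂, hs₂⟩ := (hm j₂).2 h₂
  have sq₁ : IsPullback s₁ (𝟙 _) m j₁ := IsPullback.of_isLimit'
    ⟨by simpa using hs₁⟩ (PullbackCone.IsLimit.mk _ (fun s => s.snd) (fun s => by
      rw [← cancel_mono m, Category.assoc, hs₁, s.condition]) (fun s => Category.comp_id _)
      fun s m h h' => by simpa using h')
  have sq₂ : IsPullback s₂ (𝟙 _) m j₂ := IsPullback.of_isLimit'
    ⟨by simpa using hs₂⟩ (PullbackCone.IsLimit.mk _ (fun s => s.snd) (fun s => by
      rw [← cancel_mono m, Category.assoc, hs₂, s.condition]) (fun s => Category.comp_id _)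
      fun s m h h' => by simpa using h')
  have : Etale m := h.etale_of_etale sq₁ sq₂
  have := IsOpenImmersion.of_flat_of_mono m
  have : Surjective m := ⟨fun x => by
    obtain ⟨y, rfl⟩ | ⟨y, rfl⟩ := h.range_union x
    · exact ⟨s₁ y, by rw [← hs₁]; rfl⟩
    · exact ⟨s₂ y, by rw [← hs₂]; rfl⟩⟩
  have : IsIso m := by
    have : Epi m.base := (TopCat.epi_iff_surjective _).2 m.surjective
    exact IsOpenImmersion.isIso m
  simpa using (hm (𝟙 U)).1 ⟨inv m, by simp⟩

/-- Sections of an algebraic space over schemes étale over a glued scheme are determined by the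
restriction to the two pieces. -/
lemma algebraicSpace_ext_of_etale (h : IsGlued k₁ k₂ j₁ j₂) (hZ : IsAlgebraicSpace Z)
    {V : Scheme.{u}} (f : V ⟶ U) [Etale f] {z z' : Z.obj (op V)}
    (h₁ : ∀ {T : Scheme.{u}} (s : T ⟶ V) (t : T ⟶ U₁), s ≫ f = t ≫ j₁ →
      Z.map s.op z = Z.map s.op z')
    (h₂ : ∀ {T : Scheme.{u}} (s : T ⟶ V) (t : T ⟶ U₂), s ≫ f = t ≫ j₂ →
      Z.map s.op z = Z.map s.op z') : z = z' := by
  refine sheaf_ext hZ.isSheaf fun v => ?_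
  obtain ⟨O, hO, hvO, -⟩ := exists_isAffineOpen_mem_and_subset (U := ⊤) (x := v) trivial
  refine ⟨O, O.ι, ⟨v, hvO⟩, inferInstance, rfl, ?_⟩
  have : IsAffine O := hO
  have hg := h.of_flat (IsPullback.of_hasPullback (O.ι ≫ f) j₁)
    (IsPullback.of_hasPullback (O.ι ≫ f) j₂) (IsPullback.of_hasPullback _ _)
  refine hg.algebraicSpace_ext hZ ?_ ?_
  · rw [map_map, map_map]
    exact h₁ _ (pullback.snd _ _) (by rw [Category.assoc, pullback.condition])
  · rw [map_map, map_map]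
    exact h₂ _ (pullback.snd _ _) (by rw [Category.assoc, pullback.condition])

/-- A glued scheme, as a chart of its pieces. -/
abbrev chart (h : IsGlued k₁ k₂ j₁ j₂) : Chart (yoneda.map k₁) (yoneda.map k₂) where
  glued := h
  p₀ := 𝟙 _
  p₁ := 𝟙 _
  p₂ := 𝟙 _
  etale₁ := by simpa using presheaf_etale_map (𝟙 U₁)
  etale₂ := by simpa using presheaf_etale_map (𝟙 U₂)
  sq₁ := (IsPullback.id_horiz (yoneda.map k₁))
  sq₂ := (IsPullback.id_horiz (yoneda.map k₂))

lemma exists_isPullback_of_section {R₀ O : Scheme.{u}} {p : yoneda.obj O ⟶ Z}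
    (hp : MorphismProperty.presheaf @Etale.{u} p) (k : U₀ ⟶ U₁) {z₀ : Z.obj (op U₀)}
    {z₁ : Z.obj (op U₁)} (hz : Z.map k.op z₁ = z₀) {α₀ : R₀ ⟶ O} {m₀ : R₀ ⟶ U₀}
    (sq₀ : IsPullback (yoneda.map α₀) (yoneda.map m₀) p (yonedaEquiv.symm z₀)) :
    ∃ (R₁ : Scheme.{u}) (α₁ : R₁ ⟶ O) (m₁ : R₁ ⟶ U₁) (κ : R₀ ⟶ R₁),
      IsPullback (yoneda.map α₁) (yoneda.map m₁) p (yonedaEquiv.symm z₁) ∧ κ ≫ α₁ = α₀ ∧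
      IsPullback m₀ κ k m₁ := by
  obtain ⟨R₁, α₁, m₁, sq₁⟩ : ∃ (R₁ : Scheme.{u}) (α₁ : R₁ ⟶ O) (m₁ : R₁ ⟶ U₁),
      IsPullback (yoneda.map α₁) (yoneda.map m₁) p (yonedaEquiv.symm z₁) :=
    ⟨_, _, _, hp.rep.isPullback' _⟩
  have e : yonedaEquiv.symm z₀ = yoneda.map k ≫ yonedaEquiv.symm z₁ := by
    apply hom_ext_yoneda_obj
    rw [yoneda_map_comp_app, yonedaEquiv_symm_app, yonedaEquiv_symm_app, ← hz, map_map]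
  obtain ⟨κ, h₁, h₂⟩ := IsPullback.exists_hom sq₁ α₀ (m₀ ≫ k) (by
    have := IsPullback.app_eq sq₀ (𝟙 R₀)
    rw [e, yoneda_map_comp_app] at this
    simpa using! this)
  replace h₁ : κ ≫ α₁ = α₀ := h₁
  refine ⟨R₁, α₁, m₁, κ, sq₁, h₁, ?_⟩
  apply IsPullback.flip
  apply IsPullback.of_map yoneda h₂
  rw [← h₁, e, Functor.map_comp] at sq₀
  exact IsPullback.of_right sq₀ (by rw [← Functor.map_comp, h₂, Functor.map_comp]) sq₁

/-- Pull an affine open O of an atlas of Z back to U₀, U₁ and U₂. The resulting étale schemes R₁ and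
R₂ share the closed subscheme R₀, so near a given point they contain a chart, étale over U. The maps
of its pieces to O agree on the common piece and glue, because O is affine. -/
lemma exists_algebraicSpace_desc_local (h : IsGlued k₁ k₂ j₁ j₂) (hZ : IsAlgebraicSpace Z)
    (z₁ : Z.obj (op U₁)) (z₂ : Z.obj (op U₂)) (w : Z.map k₁.op z₁ = Z.map k₂.op z₂) (y : U₁) :
    ∃ (V : Scheme.{u}) (f : V ⟶ U) (v : V) (z : Z.obj (op V)), Etale f ∧ f v = j₁ y ∧
      (∀ {T : Scheme.{u}} (s : T ⟶ V) (t : T ⟶ U₁), s ≫ f = t ≫ j₁ →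
        Z.map s.op z = Z.map t.op z₁) ∧
      (∀ {T : Scheme.{u}} (s : T ⟶ V) (t : T ⟶ U₂), s ≫ f = t ≫ j₂ →
        Z.map s.op z = Z.map t.op z₂) := by
  obtain ⟨A, q, hq, hs⟩ := hZ.exists_atlas
  obtain ⟨E, f, m, sqE⟩ : ∃ (E : Scheme.{u}) (f : E ⟶ A) (m : E ⟶ U₁),
      IsPullback (yoneda.map f) (yoneda.map m) q (yonedaEquiv.symm z₁) :=
    ⟨_, _, _, hq.rep.isPullback' _⟩
  have : Surjective m := hs.property _ _ _ sqE
  obtain ⟨x, rfl⟩ := m.surjective y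
  obtain ⟨O, hO, hxO, -⟩ := exists_isAffineOpen_mem_and_subset (U := ⊤) (x := f x) trivial
  have : IsAffine O := hO
  let p := yoneda.map O.ι ≫ q
  have hp : MorphismProperty.presheaf @Etale.{u} p :=
    presheaf_etale_comp (presheaf_etale_map _) hq
  obtain ⟨R₀, α₀, m₀, sq₀⟩ : ∃ (R₀ : Scheme.{u}) (α₀ : R₀ ⟶ O) (m₀ : R₀ ⟶ U₀),
      IsPullback (yoneda.map α₀) (yoneda.map m₀) p (yonedaEquiv.symm (Z.map k₁.op z₁)) :=
    ⟨_, _, _, hp.rep.isPullback' _⟩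
  obtain ⟨R₁, α₁, m₁, κ₁, sq₁, h₁, e₁⟩ := exists_isPullback_of_section hp k₁ rfl sq₀
  obtain ⟨R₂, α₂, m₂, κ₂, sq₂, h₂, e₂⟩ := exists_isPullback_of_section hp k₂ w.symm sq₀
  have : Etale m₁ := hp.property _ _ _ sq₁
  have : Etale m₂ := hp.property _ _ _ sq₂
  have : IsClosedImmersion κ₁ :=
    MorphismProperty.of_isPullback (P := @IsClosedImmersion) e₁ h.closed_k₁
  have : IsClosedImmersion κ₂ :=
    MorphismProperty.of_isPullback (P := @IsClosedImmersion) e₂ h.symm.closed_k₁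
  obtain ⟨r, hr⟩ : ∃ r, m₁ r = m x := by
    obtain ⟨v, hv, -⟩ := Scheme.Pullback.exists_preimage_pullback (f := f) (g := O.ι) x ⟨_, hxO⟩ rfl
    obtain ⟨s, -, hs⟩ := IsPullback.exists_hom sq₁ (pullback.snd f O.ι) (pullback.fst f O.ι ≫ m) (by
      rw [yoneda_map_comp_app, ← pullback.condition]
      exact IsPullback.app_eq sqE _)
    refine ⟨s v, ?_⟩
    rw [← Scheme.Hom.comp_apply, hs, Scheme.Hom.comp_apply, hv]
  obtain ⟨d, o₀, o₁, o₂, _, ⟨v, hv⟩, h₃, h₄, h₅, h₆⟩ := exists_chart (i₁ := yoneda.map k₁)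
    (i₂ := yoneda.map k₂) (presheaf_etale_map m₁) (presheaf_etale_map m₂) (e₁.map yoneda)
    (e₂.map yoneda) r
  obtain ⟨g, hg₁, hg₂⟩ := Chart.exists_hom (d := d) (c := h.chart) (f₀ := o₀ ≫ m₀)
    (f₁ := o₁ ≫ m₁) (f₂ := o₂ ≫ m₂) (by rw [Category.assoc, e₁.w, reassoc_of% h₃])
    (by rw [Category.assoc, e₂.w, reassoc_of% h₄])
    (by rw [Category.comp_id, Functor.map_comp, h₅])
    (by rw [Category.comp_id, Functor.map_comp, h₆])
  obtain ⟨β, hβ₁, hβ₂⟩ := d.glued.exists_desc_affine (o₁ ≫ α₁) (o₂ ≫ α₂)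
    (by rw [← reassoc_of% h₃, ← reassoc_of% h₄, h₁, h₂])
  refine ⟨d.U, g.f, d.j₁ v, p.app (op d.U) β, g.etale_f, ?_, ?_, ?_⟩
  · rw [← Scheme.Hom.comp_apply, g.w₁, hg₁, Scheme.Hom.comp_apply, Scheme.Hom.comp_apply, hv, hr]
  · intro T s t e
    obtain ⟨s₁, rfl, rfl⟩ : ∃ s₁ : T ⟶ d.U₁, s₁ ≫ d.j₁ = s ∧ s₁ ≫ g.f₁ = t :=
      ⟨g.isPullback₁.lift s t e, IsPullback.lift_fst _ _ _ _, IsPullback.lift_snd _ _ _ _⟩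
    rw [map_app_yoneda, Category.assoc, hβ₁, hg₁, ← Category.assoc, ← Category.assoc]
    exact IsPullback.app_eq sq₁ (s₁ ≫ o₁)
  · intro T s t e
    obtain ⟨s₁, rfl, rfl⟩ : ∃ s₁ : T ⟶ d.U₂, s₁ ≫ d.j₂ = s ∧ s₁ ≫ g.f₂ = t :=
      ⟨g.isPullback₂.lift s t e, IsPullback.lift_fst _ _ _ _, IsPullback.lift_snd _ _ _ _⟩
    rw [map_app_yoneda, Category.assoc, hβ₂, hg₂, ← Category.assoc, ← Category.assoc]
    exact IsPullback.app_eq sq₂ (s₁ ≫ o₂)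

/-- A glued scheme is the pushout of its pieces in algebraic spaces. -/
lemma exists_algebraicSpace_desc (h : IsGlued k₁ k₂ j₁ j₂) (hZ : IsAlgebraicSpace Z)
    (z₁ : Z.obj (op U₁)) (z₂ : Z.obj (op U₂)) (w : Z.map k₁.op z₁ = Z.map k₂.op z₂) :
    ∃ z : Z.obj (op U), Z.map j₁.op z = z₁ ∧ Z.map j₂.op z = z₂ := by
  let good (V : Scheme.{u}) (f : V ⟶ U) (z : Z.obj (op V)) : Prop :=
    Etale f ∧ (∀ {T : Scheme.{u}} (s : T ⟶ V) (t : T ⟶ U₁), s ≫ f = t ≫ j₁ →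
        Z.map s.op z = Z.map t.op z₁) ∧
      (∀ {T : Scheme.{u}} (s : T ⟶ V) (t : T ⟶ U₂), s ≫ f = t ≫ j₂ →
        Z.map s.op z = Z.map t.op z₂)
  have loc (x : U) : ∃ (V : Scheme.{u}) (f : V ⟶ U) (v : V) (z : Z.obj (op V)), f v = x ∧
      good V f z := by
    obtain ⟨y, rfl⟩ | ⟨y, rfl⟩ := h.range_union x
    · obtain ⟨V, f, v, z, h₁, h₂, h₃, h₄⟩ := h.exists_algebraicSpace_desc_local hZ z₁ z₂ w y
      exact ⟨V, f, v, z, h₂, h₁, h₃, h₄⟩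
    · obtain ⟨V, f, v, z, h₁, h₂, h₃, h₄⟩ :=
        h.symm.exists_algebraicSpace_desc_local hZ z₂ z₁ w.symm y
      exact ⟨V, f, v, z, h₂, h₁, h₄, h₃⟩
  let I := { c : Σ (V : Scheme.{u}) (_ : V ⟶ U), Z.obj (op V) // good c.1 c.2.1 c.2.2 }
  have cov : EtaleCovers (fun c : I => yoneda.map c.1.2.1) := by
    intro T (x : T ⟶ U) y
    obtain ⟨V, f, v, z, h₁, h₂⟩ := loc (x y)
    have := h₂.1
    obtain ⟨v', hv', -⟩ := Scheme.Pullback.exists_preimage_pullback (f := x) (g := f) y v h₁.symm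
    exact ⟨pullback x f, pullback.fst x f, v', inferInstance, hv', ⟨⟨V, f, z⟩, h₂⟩,
      pullback.snd x f, (pullback.condition (f := x) (g := f)).symm⟩
  obtain ⟨φ, hφ⟩ := cov.exists_desc hZ.isSheaf (fun c => yonedaEquiv.symm c.1.2.2) (by
    rintro ⟨⟨V, f, z⟩, hz⟩ ⟨⟨V', f', z'⟩, hz'⟩ T t t' (e : t ≫ f = t' ≫ f')
    rw [yonedaEquiv_symm_app, yonedaEquiv_symm_app]
    dsimp only at hz hz' t t' ⊢
    have := hz.1
    have := hz'.1
    -- On the overlap, which is étale over U, both local solutions restrict to the given sections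
    -- over each piece, so uniqueness identifies them.
    have key : Z.map (pullback.fst f f').op z = Z.map (pullback.snd f f').op z' := by
      refine h.algebraicSpace_ext_of_etale hZ (pullback.fst f f' ≫ f) ?_ ?_
      · intro T s t e
        rw [map_map, map_map, hz.2.1 _ t (by rw [Category.assoc, e]),
          hz'.2.1 _ t (by rw [Category.assoc, ← pullback.condition, e])]
      · intro T s t e
        rw [map_map, map_map, hz.2.2 _ t (by rw [Category.assoc, e]),
          hz'.2.2 _ t (by rw [Category.assoc, ← pullback.condition, e])]
    have := congrArg (Z.map (pullback.lift t t' e).op) key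
    rwa [map_map, map_map, pullback.lift_fst, pullback.lift_snd] at this)
  have hφ' {V : Scheme.{u}} {f : V ⟶ U} {z : Z.obj (op V)} (hz : good V f z) :
      φ.app (op V) f = z := by
    have := ConcreteCategory.congr_hom (NatTrans.congr_app (hφ ⟨⟨V, f, z⟩, hz⟩) (op V)) (𝟙 V)
    change φ.app (op V) (𝟙 V ≫ f) = Z.map (𝟙 V).op z at this
    simpa using this
  refine ⟨φ.app (op U) (𝟙 U), sheaf_ext hZ.isSheaf fun y => ?_, sheaf_ext hZ.isSheaf fun y => ?_⟩
  · obtain ⟨V, f, v, z, h₁, h₂⟩ := loc (j₁ y)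
    have := h₂.1
    obtain ⟨v', hv', -⟩ := Scheme.Pullback.exists_preimage_pullback (f := j₁) (g := f) y v h₁.symm
    refine ⟨pullback j₁ f, pullback.fst _ _, v', inferInstance, hv', ?_⟩
    rw [← h₂.2.1 (pullback.snd _ _) (pullback.fst _ _) pullback.condition.symm, ← hφ' h₂,
      map_app_yoneda, map_app_yoneda, map_app_yoneda, pullback.condition_assoc, Category.comp_id]
  · obtain ⟨V, f, v, z, h₁, h₂⟩ := loc (j₂ y)
    have := h₂.1
    obtain ⟨v', hv', -⟩ := Scheme.Pullback.exists_preimage_pullback (f := j₂) (g := f) y v h₁.symm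
    refine ⟨pullback j₂ f, pullback.fst _ _, v', inferInstance, hv', ?_⟩
    rw [← h₂.2.2 (pullback.snd _ _) (pullback.fst _ _) pullback.condition.symm, ← hφ' h₂,
      map_app_yoneda, map_app_yoneda, map_app_yoneda, pullback.condition_assoc, Category.comp_id]

end IsGlued

end AlgebraicSpace

namespace AlgebraicSpace

variable {Y X₁ X₂ W : Scheme.{u}ᵒᵖ ⥤ Type u} {i₁ : Y ⟶ X₁} {i₂ : Y ⟶ X₂}

lemma isSheaf_of_isPullback {F G H K : Scheme.{u}ᵒᵖ ⥤ Type u} {f₁ : F ⟶ G} {f₂ : F ⟶ H}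
    {g₁ : G ⟶ K} {g₂ : H ⟶ K} (sq : IsPullback f₁ f₂ g₁ g₂)
    (hG : Presheaf.IsSheaf Scheme.etaleTopology.{u} G)
    (hH : Presheaf.IsSheaf Scheme.etaleTopology.{u} H)
    (hK : Presheaf.IsSheaf Scheme.etaleTopology.{u} K) :
    Presheaf.IsSheaf Scheme.etaleTopology.{u} F := by
  refine ObjectProperty.prop_of_isLimit (P := Presheaf.IsSheaf Scheme.etaleTopology.{u})
    sq.isLimit ?_
  rintro (_ | _ | _)
  exacts [hK, hG, hH]

lemma IsGlued.algebraicSpace_hom_ext {U₀ U₁ U₂ U : Scheme.{u}} {k₁ : U₀ ⟶ U₁} {k₂ : U₀ ⟶ U₂}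
    {j₁ : U₁ ⟶ U} {j₂ : U₂ ⟶ U} {Z : Scheme.{u}ᵒᵖ ⥤ Type u} (h : IsGlued k₁ k₂ j₁ j₂)
    (hZ : IsAlgebraicSpace Z) {φ ψ : yoneda.obj U ⟶ Z}
    (h₁ : yoneda.map j₁ ≫ φ = yoneda.map j₁ ≫ ψ) (h₂ : yoneda.map j₂ ≫ φ = yoneda.map j₂ ≫ ψ) :
    φ = ψ := by
  refine hom_ext_yoneda_obj (h.algebraicSpace_ext hZ ?_ ?_)
  · rw [map_app_yoneda, map_app_yoneda, Category.comp_id]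
    simpa using! ConcreteCategory.congr_hom (NatTrans.congr_app h₁ (op _)) (𝟙 U₁)
  · rw [map_app_yoneda, map_app_yoneda, Category.comp_id]
    simpa using! ConcreteCategory.congr_hom (NatTrans.congr_app h₂ (op _)) (𝟙 U₂)

namespace IsChartQuotient

variable {w : ∀ c : Chart i₁ i₂, yoneda.obj c.U ⟶ W} {a : X₁ ⟶ W} {b : X₂ ⟶ W}
  {Z : Scheme.{u}ᵒᵖ ⥤ Type u}

/-! ### The universal property -/

lemma algebraicSpace_hom_ext (hw : IsChartQuotient w) (hZ : IsAlgebraicSpace Z)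
    (ha : ∀ c, c.p₁ ≫ a = yoneda.map c.j₁ ≫ w c) (hb : ∀ c, c.p₂ ≫ b = yoneda.map c.j₂ ≫ w c)
    {φ ψ : W ⟶ Z} (h₁ : a ≫ φ = a ≫ ψ) (h₂ : b ≫ φ = b ≫ ψ) : φ = ψ := by
  refine hw.covers.hom_ext hZ.isSheaf fun c => ?_
  have e₁ : yoneda.map c.j₁ ≫ w c ≫ φ = yoneda.map c.j₁ ≫ w c ≫ ψ := by
    rw [← reassoc_of% ha, ← reassoc_of% ha, h₁]
  have e₂ : yoneda.map c.j₂ ≫ w c ≫ φ = yoneda.map c.j₂ ≫ w c ≫ ψ := by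
    rw [← reassoc_of% hb, ← reassoc_of% hb, h₂]
  exact c.glued.algebraicSpace_hom_ext hZ e₁ e₂

/-- Each chart descends by the universal property of glued schemes. Uniqueness there makes the
descended maps compatible with morphisms of charts, hence with the identifications defining W. -/
lemma exists_algebraicSpace_desc (hw : IsChartQuotient w) (hZ : IsAlgebraicSpace Z)
    (hX₁ : EtaleCovers (fun c : Chart i₁ i₂ => c.p₁))
    (hX₂ : EtaleCovers (fun c : Chart i₁ i₂ => c.p₂))
    (ha : ∀ c, c.p₁ ≫ a = yoneda.map c.j₁ ≫ w c) (hb : ∀ c, c.p₂ ≫ b = yoneda.map c.j₂ ≫ w c)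
    (g₁ : X₁ ⟶ Z) (g₂ : X₂ ⟶ Z) (e : i₁ ≫ g₁ = i₂ ≫ g₂) :
    ∃ φ : W ⟶ Z, a ≫ φ = g₁ ∧ b ≫ φ = g₂ := by
  have loc (c : Chart i₁ i₂) : ∃ z : yoneda.obj c.U ⟶ Z, yoneda.map c.j₁ ≫ z = c.p₁ ≫ g₁ ∧
      yoneda.map c.j₂ ≫ z = c.p₂ ≫ g₂ := by
    obtain ⟨z, h₁, h₂⟩ := c.glued.exists_algebraicSpace_desc hZ ((c.p₁ ≫ g₁).app _ (𝟙 c.U₁))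
      ((c.p₂ ≫ g₂).app _ (𝟙 c.U₂)) (by
        rw [map_app_yoneda, map_app_yoneda, Category.comp_id, Category.comp_id]
        have : yoneda.map c.k₁ ≫ c.p₁ ≫ g₁ = yoneda.map c.k₂ ≫ c.p₂ ≫ g₂ := by
          rw [← reassoc_of% c.sq₁.w, ← reassoc_of% c.sq₂.w, e]
        simpa using! ConcreteCategory.congr_hom (NatTrans.congr_app this (op _)) (𝟙 c.U₀))
    refine ⟨yonedaEquiv.symm z, hom_ext_yoneda_obj ?_, hom_ext_yoneda_obj ?_⟩
    · rw [yoneda_map_comp_app, yonedaEquiv_symm_app, Category.id_comp, h₁]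
    · rw [yoneda_map_comp_app, yonedaEquiv_symm_app, Category.id_comp, h₂]
  choose z hz₁ hz₂ using loc
  have nat {d c : Chart i₁ i₂} (h : d.Hom c) {T : Scheme.{u}} (s : T ⟶ d.U) :
      (z c).app (op T) (s ≫ h.f) = (z d).app (op T) s := by
    have : yoneda.map h.f ≫ z c = z d := by
      refine d.glued.algebraicSpace_hom_ext hZ ?_ ?_
      · rw [← Functor.map_comp_assoc, h.w₁, Functor.map_comp, Category.assoc, hz₁, hz₁, ← h.e₁,
          Category.assoc]
      · rw [← Functor.map_comp_assoc, h.w₂, Functor.map_comp, Category.assoc, hz₂, hz₂, ← h.e₂,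
          Category.assoc]
    rw [← this]
    rfl
  obtain ⟨φ, hφ⟩ := hw.covers.exists_desc hZ.isSheaf z (fun c c' T t t' h => by
    refine sheaf_ext hZ.isSheaf fun y => ?_
    obtain ⟨V, g, v, h₁, h₂, d, h, h', s, hs, hs'⟩ := hw.exists_common t t' h y
    refine ⟨V, g, v, h₁, h₂, ?_⟩
    rw [map_app_yoneda, map_app_yoneda, ← hs, ← hs', nat, nat])
  refine ⟨φ, hX₁.hom_ext hZ.isSheaf fun c => ?_, hX₂.hom_ext hZ.isSheaf fun c => ?_⟩
  · rw [reassoc_of% ha, hφ, hz₁]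
  · rw [reassoc_of% hb, hφ, hz₂]

end IsChartQuotient

/-! ### Fibre products of charts over the quotient -/

namespace Chart.Product

variable {c c' : Chart i₁ i₂} (P : Product c c')

/-- Where the sections `t` and `t'` lie in the first piece, they define a point of `O`. -/
def MapsInto₁ {c c' : Chart i₁ i₂} (P : Product c c') (O : P.R₁.Opens) {T : Scheme.{u}}
    (t : T ⟶ c.U) (t' : T ⟶ c'.U) : Prop :=
  ∀ (S : Scheme.{u}) (s : S ⟶ T) (ρ : S ⟶ P.R₁), ρ ≫ P.a₁ ≫ c.j₁ = s ≫ t →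
    ρ ≫ P.b₁ ≫ c'.j₁ = s ≫ t' → Set.range ρ ⊆ O

lemma hom_ext₁ (P : Product c c') {S : Scheme.{u}} {ρ ρ' : S ⟶ P.R₁}
    (h : ρ ≫ P.a₁ ≫ c.j₁ = ρ' ≫ P.a₁ ≫ c.j₁) (h' : ρ ≫ P.b₁ ≫ c'.j₁ = ρ' ≫ P.b₁ ≫ c'.j₁) :
    ρ = ρ' := by
  have := c.glued.closed₁
  have := c'.glued.closed₁
  apply IsPullback.hom_eq P.isPullback₁
  · change ρ ≫ P.a₁ = ρ' ≫ P.a₁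
    rw [← cancel_mono c.j₁, Category.assoc, h, Category.assoc]
  · rw [← cancel_mono c'.j₁, Category.assoc, h', Category.assoc]

/-- Where `t` lies in the first piece, its image in W comes from X₁. So `t'` lies in the first piece
of c' as well, and the two define a point of the product over X₁. -/
lemma exists_isPullback_of_app_eq (P : Product c c') {w : ∀ c : Chart i₁ i₂, yoneda.obj c.U ⟶ W}
    {a : X₁ ⟶ W} (hsq : ∀ c : Chart i₁ i₂, IsPullback c.p₁ (yoneda.map c.j₁) a (w c))
    {T : Scheme.{u}} (t : T ⟶ c.U) (t' : T ⟶ c'.U)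
    (e : (w c).app (op T) t = (w c').app (op T) t') :
    ∃ ρ : pullback t c.j₁ ⟶ P.R₁, ρ ≫ P.a₁ = pullback.snd _ _ ∧
      ρ ≫ P.b₁ ≫ c'.j₁ = pullback.fst _ _ ≫ t' := by
  obtain ⟨s, h₁, h₂⟩ := IsPullback.exists_hom (hsq c') (c.p₁.app _ (pullback.snd t c.j₁))
    (pullback.fst t c.j₁ ≫ t') (by
      rw [IsPullback.app_eq (hsq c), ← pullback.condition, ← map_app_yoneda, e, map_app_yoneda])
  obtain ⟨ρ, h₃, h₄⟩ := IsPullback.exists_hom P.isPullback₁ (pullback.snd t c.j₁) s h₁.symm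
  exact ⟨ρ, h₃, by rw [reassoc_of% h₄, h₂]⟩

/-- The locus where two sections define a point of `O` is open. -/
lemma exists_mapsInto₁_iff (P : Product c c') {w : ∀ c : Chart i₁ i₂, yoneda.obj c.U ⟶ W}
    {a : X₁ ⟶ W} (hsq : ∀ c : Chart i₁ i₂, IsPullback c.p₁ (yoneda.map c.j₁) a (w c))
    (O : P.R₁.Opens) {T : Scheme.{u}} (t : T ⟶ c.U) (t' : T ⟶ c'.U)
    (e : (w c).app (op T) t = (w c').app (op T) t') :
    ∃ N : T.Opens, ∀ {T' : Scheme.{u}} (g : T' ⟶ T),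
      P.MapsInto₁ O (g ≫ t) (g ≫ t') ↔ Set.range g ⊆ N := by
  obtain ⟨ρ, h₁, h₂⟩ := P.exists_isPullback_of_app_eq hsq t t' e
  have := c.glued.closed₁
  -- The bad locus is the image in T of the points over the first piece whose image in R₁ misses
  -- `O`. It is closed because the first piece is closed in the chart.
  let N : T.Opens := ⟨(pullback.fst t c.j₁ '' (ρ ⁻¹ᵁ O : Set _)ᶜ)ᶜ,
    ((pullback.fst t c.j₁).isClosedEmbedding.isClosedMap _
      (ρ ⁻¹ᵁ O).isOpen.isClosed_compl).isOpen_compl⟩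
  refine ⟨N, fun {T'} g => ⟨fun h => ?_, fun h => ?_⟩⟩
  · rintro _ ⟨x, rfl⟩ ⟨y, hy, hyx⟩
    obtain ⟨z, rfl, hz⟩ := Scheme.Pullback.exists_preimage_pullback (f := g)
      (g := pullback.fst t c.j₁) x y hyx.symm
    refine hy ?_
    have := h _ (pullback.fst g (pullback.fst t c.j₁)) (pullback.snd _ _ ≫ ρ) (by
      rw [Category.assoc, reassoc_of% h₁, ← pullback.condition, pullback.condition_assoc]) (by
      rw [Category.assoc, h₂, pullback.condition_assoc]) ⟨z, rfl⟩
    rw [Scheme.Hom.comp_apply, hz] at this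
    exact this
  · rintro S s σ hσ hσ' _ ⟨x, rfl⟩
    let l : S ⟶ pullback t c.j₁ := pullback.lift (s ≫ g) (σ ≫ P.a₁) (by
      rw [Category.assoc, ← hσ, Category.assoc])
    have hl : l ≫ ρ = σ := P.hom_ext₁ (by
      rw [Category.assoc, reassoc_of% h₁, pullback.lift_snd_assoc, Category.assoc]) (by
      rw [Category.assoc, h₂, pullback.lift_fst_assoc, hσ', Category.assoc])
    by_contra hx
    refine h ⟨s x, rfl⟩ ⟨l x, ?_, ?_⟩
    · change ¬ ρ (l x) ∈ O
      rwa [← Scheme.Hom.comp_apply, hl]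
    · rw [← Scheme.Hom.comp_apply, pullback.lift_fst, Scheme.Hom.comp_apply]

end Chart.Product

end AlgebraicSpace

/-! ### Pieces: charts inside the product of two charts -/

namespace AlgebraicSpace

variable {Y X₁ X₂ W : Scheme.{u}ᵒᵖ ⥤ Type u} {i₁ : Y ⟶ X₁} {i₂ : Y ⟶ X₂}

namespace Chart

/-- A chart given by compatible opens of the product of two charts. -/
structure Product.Piece {c c' : Chart i₁ i₂} (P : Product c c') where
  {d : Chart i₁ i₂}
  {o₀ : d.U₀ ⟶ P.R₀}
  {o₁ : d.U₁ ⟶ P.R₁}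
  {o₂ : d.U₂ ⟶ P.R₂}
  {g : Hom d c}
  {g' : Hom d c'}
  open₁ : IsOpenImmersion o₁
  open₂ : IsOpenImmersion o₂
  w₁ : o₀ ≫ P.k₁ = d.k₁ ≫ o₁
  w₂ : o₀ ≫ P.k₂ = d.k₂ ≫ o₂
  hg₁ : g.f₁ = o₁ ≫ P.a₁
  hg₂ : g.f₂ = o₂ ≫ P.a₂
  hg₁' : g'.f₁ = o₁ ≫ P.b₁
  hg₂' : g'.f₂ = o₂ ≫ P.b₂

namespace Product.Piece

variable {c c' : Chart i₁ i₂} {P : Product c c'}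

/-- Interchange of the two pieces. -/
abbrev swap (D : P.Piece) : P.swap.Piece where
  d := D.d.swap
  g := D.g.swap
  g' := D.g'.swap
  open₁ := D.open₂
  open₂ := D.open₁
  w₁ := D.w₂
  w₂ := D.w₁
  hg₁ := D.hg₂
  hg₂ := D.hg₁
  hg₁' := D.hg₂'
  hg₂' := D.hg₁'

/-- The open of the first piece. -/
def O₁ (D : P.Piece) : P.R₁.Opens :=
  have := D.open₁
  D.o₁.opensRange

lemma coe_O₁ (D : P.Piece) : (D.O₁ : Set P.R₁) = Set.range D.o₁ := by
  have := D.open₁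
  exact Scheme.Hom.coe_opensRange D.o₁

lemma exists_lift₁ (D : P.Piece) {T S : Scheme.{u}} (r : T ⟶ D.d.U) (s : S ⟶ T) (ρ : S ⟶ P.R₁)
    (h : ρ ≫ P.a₁ ≫ c.j₁ = s ≫ r ≫ D.g.f) (h' : ρ ≫ P.b₁ ≫ c'.j₁ = s ≫ r ≫ D.g'.f) :
    ∃ r₁ : S ⟶ D.d.U₁, r₁ ≫ D.d.j₁ = s ≫ r ∧ r₁ ≫ D.o₁ = ρ := by
  obtain ⟨r₁, h₁, h₂⟩ : ∃ r₁ : S ⟶ D.d.U₁, r₁ ≫ D.d.j₁ = s ≫ r ∧ r₁ ≫ D.g.f₁ = ρ ≫ P.a₁ :=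
    ⟨D.g.isPullback₁.lift (s ≫ r) (ρ ≫ P.a₁) (by rw [Category.assoc, ← h, Category.assoc]),
      IsPullback.lift_fst _ _ _ _, IsPullback.lift_snd _ _ _ _⟩
  refine ⟨r₁, h₁, P.hom_ext₁ ?_ ?_⟩
  · rw [Category.assoc, ← reassoc_of% D.hg₁, reassoc_of% h₂]
  · rw [Category.assoc, ← reassoc_of% D.hg₁', ← D.g'.w₁, reassoc_of% h₁, h']

lemma mapsInto₁ (D : P.Piece) {T : Scheme.{u}} (r : T ⟶ D.d.U) :
    P.MapsInto₁ D.O₁ (r ≫ D.g.f) (r ≫ D.g'.f) := by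
  rintro S s ρ h h' _ ⟨x, rfl⟩
  obtain ⟨r₁, -, rfl⟩ := D.exists_lift₁ r s ρ h h'
  rw [D.coe_O₁]
  exact ⟨r₁ x, by rw [Scheme.Hom.comp_apply]⟩

lemma comp_eq_of_factors₁ (D : P.Piece) {T S : Scheme.{u}} {r r' : T ⟶ D.d.U}
    (h : r ≫ D.g.f = r' ≫ D.g.f) (h' : r ≫ D.g'.f = r' ≫ D.g'.f) (s : S ⟶ T) (t : S ⟶ c.U₁)
    (hs : s ≫ r ≫ D.g.f = t ≫ c.j₁) : s ≫ r = s ≫ r' := by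
  have := D.open₁
  obtain ⟨r₁, h₁, h₂⟩ : ∃ r₁ : S ⟶ D.d.U₁, r₁ ≫ D.d.j₁ = s ≫ r ∧ r₁ ≫ D.g.f₁ = t :=
    ⟨D.g.isPullback₁.lift (s ≫ r) t (by rw [Category.assoc, hs]),
      IsPullback.lift_fst _ _ _ _, IsPullback.lift_snd _ _ _ _⟩
  obtain ⟨r₁', h₁', h₂'⟩ := D.exists_lift₁ r' s (r₁ ≫ D.o₁)
    (by rw [Category.assoc, ← reassoc_of% D.hg₁, reassoc_of% h₂, ← hs, h])
    (by rw [Category.assoc, ← reassoc_of% D.hg₁', ← D.g'.w₁, reassoc_of% h₁, h'])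
  obtain rfl : r₁' = r₁ := (cancel_mono D.o₁).1 h₂'
  rw [← h₁, h₁']

/-- The map from the piece to c is étale, so its diagonal is an open immersion and two lifts agree
on an open subscheme. Over either closed piece they agree because `o₁` and `o₂` are monomorphisms,
so this open contains every point. -/
lemma hom_ext (D : P.Piece) {T : Scheme.{u}} {r r' : T ⟶ D.d.U}
    (h : r ≫ D.g.f = r' ≫ D.g.f) (h' : r ≫ D.g'.f = r' ≫ D.g'.f) : r = r' := by
  have := D.g.etale_f
  obtain ⟨E, m, q, sq⟩ : ∃ (E : Scheme.{u}) (m : E ⟶ T) (q : E ⟶ D.d.U),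
      IsPullback m q (pullback.lift r r' h) (pullback.diagonal D.g.f) :=
    ⟨_, _, _, IsPullback.of_hasPullback _ _⟩
  have : IsOpenImmersion m :=
    MorphismProperty.of_isPullback (P := @IsOpenImmersion) sq.flip inferInstance
  have key {S : Scheme.{u}} (s : S ⟶ T) (hs : s ≫ r = s ≫ r') : ∃ σ : S ⟶ E, σ ≫ m = s :=
    ⟨sq.lift s (s ≫ r) (by
      apply pullback.hom_ext
      · rw [Category.assoc, pullback.lift_fst, Category.assoc, pullback.diagonal_fst,
          Category.comp_id]
      · rw [Category.assoc, pullback.lift_snd, Category.assoc, pullback.diagonal_snd,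
          Category.comp_id, hs]), IsPullback.lift_fst _ _ _ _⟩
  have : Surjective m := ⟨fun x => by
    obtain ⟨y, hy⟩ | ⟨y, hy⟩ := c.glued.range_union ((r ≫ D.g.f) x)
    · obtain ⟨z, rfl, -⟩ := Scheme.Pullback.exists_preimage_pullback x y hy.symm
      obtain ⟨σ, hσ⟩ := key _
        (D.comp_eq_of_factors₁ h h' (pullback.fst (r ≫ D.g.f) c.j₁) _ pullback.condition)
      exact ⟨σ z, by rw [← Scheme.Hom.comp_apply, hσ]⟩
    · obtain ⟨z, rfl, -⟩ := Scheme.Pullback.exists_preimage_pullback x y hy.symm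
      obtain ⟨σ, hσ⟩ := key _
        (D.swap.comp_eq_of_factors₁ h h' (pullback.fst (r ≫ D.g.f) c.j₂) _ pullback.condition)
      exact ⟨σ z, by rw [← Scheme.Hom.comp_apply, hσ]⟩⟩
  have : IsIso m := by
    have : Epi m.base := (TopCat.epi_iff_surjective _).2 m.surjective
    exact IsOpenImmersion.isIso m
  rw [← cancel_epi m]
  have h₁ := sq.w =≫ pullback.fst _ _
  have h₂ := sq.w =≫ pullback.snd _ _
  simp only [Category.assoc, pullback.lift_fst, pullback.lift_snd, pullback.diagonal_fst,
    pullback.diagonal_snd, Category.comp_id] at h₁ h₂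
  rw [h₁, h₂]

/-- The two maps of pieces are automatically compatible on the common piece: the map of common
pieces determined by `l₁` matches `l₂` after projection to both charts, and `D.o₂` is a
monomorphism. -/
lemma exists_hom (D : P.Piece) {e : Chart i₁ i₂} (H : Hom e c) (H' : Hom e c')
    {l₁ : e.U₁ ⟶ D.d.U₁} {l₂ : e.U₂ ⟶ D.d.U₂} (h₁ : l₁ ≫ D.o₁ ≫ P.a₁ = H.f₁)
    (h₂ : l₂ ≫ D.o₂ ≫ P.a₂ = H.f₂) (h₁' : l₁ ≫ D.o₁ ≫ P.b₁ = H'.f₁)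
    (h₂' : l₂ ≫ D.o₂ ≫ P.b₂ = H'.f₂) : ∃ L : e.U ⟶ D.d.U, L ≫ D.g.f = H.f ∧ L ≫ D.g'.f = H'.f := by
  have e₁ : yoneda.map l₁ ≫ D.d.p₁ = e.p₁ := by
    rw [← D.g.e₁, D.hg₁, ← Functor.map_comp_assoc, h₁, H.e₁]
  have e₂ : yoneda.map l₂ ≫ D.d.p₂ = e.p₂ := by
    rw [← D.g.e₂, D.hg₂, ← Functor.map_comp_assoc, h₂, H.e₂]
  have := D.open₂
  have := c.glued.closed_k₁
  have := c'.glued.closed_k₁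
  have := c.glued.isAffine
  have := c'.glued.isAffine
  obtain ⟨l₀, h₃, h₄⟩ := IsPullback.exists_hom D.d.sq₁ (e.p₀.app _ (𝟙 e.U₀)) (e.k₁ ≫ l₁) (by
    rw [IsPullback.app_eq e.sq₁, ← e₁, yoneda_map_comp_app]
    simp)
  obtain ⟨f, hf₁, hf₂, -⟩ := H.exists_f₀
  obtain ⟨f', hf₁', hf₂', -⟩ := H'.exists_f₀
  have a₁ : l₀ ≫ D.o₀ ≫ P.a₀ = f := by
    rw [← cancel_mono c.k₁, Category.assoc, Category.assoc, P.ha₁, reassoc_of% D.w₁,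
      reassoc_of% h₄, h₁, hf₁]
  have a₂ : l₀ ≫ D.o₀ ≫ P.b₀ = f' := by
    rw [← cancel_mono c'.k₁, Category.assoc, Category.assoc, P.hb₁, reassoc_of% D.w₁,
      reassoc_of% h₄, h₁', hf₁']
  have h₅ : l₀ ≫ D.d.k₂ = e.k₂ ≫ l₂ := by
    rw [← cancel_mono D.o₂, Category.assoc, ← D.w₂, Category.assoc]
    refine P.swap.hom_ext₁ ?_ ?_
    · change (l₀ ≫ D.o₀ ≫ P.k₂) ≫ P.a₂ ≫ c.j₂ = (e.k₂ ≫ l₂ ≫ D.o₂) ≫ P.a₂ ≫ c.j₂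
      simp only [Category.assoc]
      rw [← reassoc_of% P.ha₂, reassoc_of% a₁, reassoc_of% h₂, reassoc_of% hf₂]
    · change (l₀ ≫ D.o₀ ≫ P.k₂) ≫ P.b₂ ≫ c'.j₂ = (e.k₂ ≫ l₂ ≫ D.o₂) ≫ P.b₂ ≫ c'.j₂
      simp only [Category.assoc]
      rw [← reassoc_of% P.hb₂, reassoc_of% a₂, reassoc_of% h₂', reassoc_of% hf₂']
  obtain ⟨L, hL₁, hL₂⟩ := Chart.exists_hom h₄ h₅ e₁ e₂
  refine ⟨L.f, e.glued.hom_ext_affine ?_ ?_, e.glued.hom_ext_affine ?_ ?_⟩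
  · rw [reassoc_of% L.w₁, D.g.w₁, hL₁, D.hg₁, H.w₁, ← h₁]
    simp only [Category.assoc]
  · rw [reassoc_of% L.w₂, D.g.w₂, hL₂, D.hg₂, H.w₂, ← h₂]
    simp only [Category.assoc]
  · rw [reassoc_of% L.w₁, D.g'.w₁, hL₁, D.hg₁', H'.w₁, ← h₁']
    simp only [Category.assoc]
  · rw [reassoc_of% L.w₂, D.g'.w₂, hL₂, D.hg₂', H'.w₂, ← h₂']
    simp only [Category.assoc]

/-- A chart over `c` and `c'` all of whose points lie in the given opens maps to the piece. -/
lemma exists_factor₁ (D : P.Piece) {e : Chart i₁ i₂} (H : Hom e c) (H' : Hom e c')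
    (h : P.MapsInto₁ D.O₁ H.f H'.f) :
    ∃ l₁ : e.U₁ ⟶ D.d.U₁, l₁ ≫ D.o₁ ≫ P.a₁ = H.f₁ ∧ l₁ ≫ D.o₁ ≫ P.b₁ = H'.f₁ := by
  have := D.open₁
  obtain ⟨ρ, h₁, h₂⟩ := IsPullback.exists_hom P.isPullback₁ H.f₁ H'.f₁ (by
    have := H.e₁.trans H'.e₁.symm
    simpa using! ConcreteCategory.congr_hom (NatTrans.congr_app this (op _)) (𝟙 e.U₁))
  replace h₁ : ρ ≫ P.a₁ = H.f₁ := h₁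
  have hρ := h e.U₁ e.j₁ ρ (by rw [reassoc_of% h₁, H.w₁]) (by rw [reassoc_of% h₂, H'.w₁])
  rw [D.coe_O₁] at hρ
  refine ⟨IsOpenImmersion.lift D.o₁ ρ hρ, ?_, ?_⟩
  · rw [IsOpenImmersion.lift_fac_assoc, h₁]
  · rw [IsOpenImmersion.lift_fac_assoc, h₂]

/-- Sections of `c` and `c'` agreeing in the quotient lift to the piece if they map into it. -/
lemma exists_lift (D : P.Piece) {w : ∀ c : Chart i₁ i₂, yoneda.obj c.U ⟶ W}
    (hw : IsChartQuotient w) {a : X₁ ⟶ W} {b : X₂ ⟶ W}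
    (ha : ∀ c : Chart i₁ i₂, IsPullback c.p₁ (yoneda.map c.j₁) a (w c))
    (hb : ∀ c : Chart i₂ i₁, IsPullback c.p₁ (yoneda.map c.j₁) b (w c.swap))
    {T : Scheme.{u}} (t : T ⟶ c.U) (t' : T ⟶ c'.U) (e : (w c).app (op T) t = (w c').app (op T) t')
    (h₁ : P.MapsInto₁ D.O₁ t t') (h₂ : P.swap.MapsInto₁ D.swap.O₁ t t') :
    ∃ r : T ⟶ D.d.U, r ≫ D.g.f = t ∧ r ≫ D.g'.f = t' := by
  have loc (y : T) : ∃ (V : Scheme.{u}) (f : V ⟶ T) (v : V), Etale f ∧ f v = y ∧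
      ∃ r : V ⟶ D.d.U, r ≫ D.g.f = f ≫ t ∧ r ≫ D.g'.f = f ≫ t' := by
    obtain ⟨V, f, v, _, rfl, E, H, H', s, hs, hs'⟩ := hw.exists_common t t' e y
    have hE : (w c).app (op _) H.f = (w c').app (op _) H'.f := by
      have := (hw.naturality H).trans (hw.naturality H').symm
      simpa using! ConcreteCategory.congr_hom (NatTrans.congr_app this (op _)) (𝟙 E.U)
    -- The common chart E need not map into the piece. It does so over an affine open of E around
    -- the image of `v`, inside the open loci where its two maps land in `O₁` and in the
    -- corresponding open of R₂.
    obtain ⟨N₁, hN₁⟩ := P.exists_mapsInto₁_iff ha D.O₁ H.f H'.f hE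
    obtain ⟨N₂, hN₂⟩ := P.swap.exists_mapsInto₁_iff hb D.swap.O₁ H.f H'.f hE
    have hs₁ : Set.range s ⊆ N₁ := (hN₁ s).1 (by
      rw [hs, hs']
      intro S q ρ e e'
      exact h₁ S (q ≫ f) ρ (by rw [e, Category.assoc]) (by rw [e', Category.assoc]))
    have hs₂ : Set.range s ⊆ N₂ := (hN₂ s).1 (by
      rw [hs, hs']
      intro S q ρ e e'
      exact h₂ S (q ≫ f) ρ (by rw [e, Category.assoc]) (by rw [e', Category.assoc]))
    obtain ⟨O, hO, hvO, hON⟩ := exists_isAffineOpen_mem_and_subset (U := N₁ ⊓ N₂) (x := s v)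
      ⟨hs₁ ⟨v, rfl⟩, hs₂ ⟨v, rfl⟩⟩
    have : IsAffine O := hO
    have hr : Set.range O.ι ⊆ (N₁ ⊓ N₂ : E.U.Opens) := by
      rw [Scheme.Opens.range_ι]
      exact hON
    obtain ⟨l₁, hl₁, hl₁'⟩ := D.exists_factor₁ ((E.restrictHom O.ι).comp H)
      ((E.restrictHom O.ι).comp H') ((hN₁ _).2 fun x hx => (hr hx).1)
    obtain ⟨l₂, hl₂, hl₂'⟩ := D.swap.exists_factor₁ ((E.restrictHom O.ι).comp H).swap
      ((E.restrictHom O.ι).comp H').swap ((hN₂ _).2 fun x hx => (hr hx).2)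
    obtain ⟨L, hL, hL'⟩ := D.exists_hom _ _ hl₁ hl₂ hl₁' hl₂'
    replace hL : L ≫ D.g.f = O.ι ≫ H.f := hL
    replace hL' : L ≫ D.g'.f = O.ι ≫ H'.f := hL'
    obtain ⟨z, hz, -⟩ := Scheme.Pullback.exists_preimage_pullback (f := s) (g := O.ι) v
      ⟨s v, hvO⟩ rfl
    refine ⟨pullback s O.ι, pullback.fst _ _ ≫ f, z, inferInstance, ?_, pullback.snd _ _ ≫ L, ?_, ?_⟩
    · rw [Scheme.Hom.comp_apply, hz]
    · rw [Category.assoc, hL, ← pullback.condition_assoc, hs, Category.assoc]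
    · rw [Category.assoc, hL', ← pullback.condition_assoc, hs', Category.assoc]
  obtain ⟨r, hr⟩ := exists_glue (isSheaf_yoneda D.d.U) (T := T)
    (fun {V} f r => r ≫ D.g.f = f ≫ t ∧ r ≫ D.g'.f = f ≫ t') (by
      rintro V V' f g s ⟨h₁, h₂⟩
      exact ⟨(Category.assoc g s _).trans ((congrArg (g ≫ ·) h₁).trans (Category.assoc _ _ _).symm),
        (Category.assoc g s _).trans ((congrArg (g ≫ ·) h₂).trans (Category.assoc _ _ _).symm)⟩) (by
      rintro V f s s' ⟨h₁, h₂⟩ ⟨h₃, h₄⟩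
      exact D.hom_ext (h₁.trans h₃.symm) (h₂.trans h₄.symm)) loc
  refine ⟨r, sheaf_ext (isSheaf_yoneda c.U) fun y => ?_, sheaf_ext (isSheaf_yoneda c'.U) fun y => ?_⟩
  · obtain ⟨V, f, v, h₁, h₂, s', hs'⟩ := loc y
    exact ⟨V, f, v, h₁, h₂, (Category.assoc _ _ _).symm.trans
      ((congrArg (· ≫ D.g.f) (hr f s' hs')).trans hs'.1)⟩
  · obtain ⟨V, f, v, h₁, h₂, s', hs'⟩ := loc y
    exact ⟨V, f, v, h₁, h₂, (Category.assoc _ _ _).symm.trans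
      ((congrArg (· ≫ D.g'.f) (hr f s' hs')).trans hs'.2)⟩

end Product.Piece

end Chart

end AlgebraicSpace

/-! ### The fibre product of two charts over W as a scheme -/

namespace AlgebraicSpace

variable {Y X₁ X₂ W : Scheme.{u}ᵒᵖ ⥤ Type u} {i₁ : Y ⟶ X₁} {i₂ : Y ⟶ X₂}

lemma etale_of_forall_exists {X Z : Scheme.{u}} (f : X ⟶ Z)
    (h : ∀ x : X, ∃ (V : Scheme.{u}) (g : V ⟶ X) (v : V), IsOpenImmersion g ∧ g v = x ∧
      Etale (g ≫ f)) : Etale f := by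
  choose V g v h₁ h₂ h₃ using h
  let 𝒰 : X.OpenCover := Scheme.Cover.mkOfCovers (P := @IsOpenImmersion) X V g
    (fun x => ⟨x, v x, h₂ x⟩) h₁
  have : IsZariskiLocalAtSource @Etale.{u} :=
    HasRingHomProperty.instIsZariskiLocalAtSource (P := @Etale.{u}) (Q := RingHom.Etale)
  exact (IsZariskiLocalAtSource.iff_of_openCover (P := @Etale) 𝒰).2 h₃

namespace Chart.Product.Piece

variable {c c' : Chart i₁ i₂} {P : Product c c'}

/-- The pieces are open in the fibre product over the quotient. -/
lemma isOpenImmersion (D : P.Piece) {w : ∀ c : Chart i₁ i₂, yoneda.obj c.U ⟶ W}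
    (hw : IsChartQuotient w) {a : X₁ ⟶ W} {b : X₂ ⟶ W}
    (ha : ∀ c : Chart i₁ i₂, IsPullback c.p₁ (yoneda.map c.j₁) a (w c))
    (hb : ∀ c : Chart i₂ i₁, IsPullback c.p₁ (yoneda.map c.j₁) b (w c.swap))
    {F : Scheme.{u}ᵒᵖ ⥤ Type u} {π : F ⟶ yoneda.obj c.U} {π' : F ⟶ yoneda.obj c'.U}
    (sq : IsPullback π π' (w c) (w c')) {φ : yoneda.obj D.d.U ⟶ F}
    (h : φ ≫ π = yoneda.map D.g.f) (h' : φ ≫ π' = yoneda.map D.g'.f) :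
    MorphismProperty.presheaf @IsOpenImmersion.{u} φ := by
  refine MorphismProperty.relative.of_exists fun T x => ?_
  obtain ⟨t, ht⟩ := yoneda.map_surjective (x ≫ π)
  obtain ⟨t', ht'⟩ := yoneda.map_surjective (x ≫ π')
  have e : (w c).app (op T) t = (w c').app (op T) t' := by
    have : yoneda.map t ≫ w c = yoneda.map t' ≫ w c' := by
      rw [ht, ht', Category.assoc, Category.assoc, sq.w]
    simpa using! ConcreteCategory.congr_hom (NatTrans.congr_app this (op _)) (𝟙 T)
  obtain ⟨N₁, hN₁⟩ := P.exists_mapsInto₁_iff ha D.O₁ t t' e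
  obtain ⟨N₂, hN₂⟩ := P.swap.exists_mapsInto₁_iff hb D.swap.O₁ t t' e
  -- Over N the pair of sections lifts to the piece, uniquely by `hom_ext`. Conversely, any test
  -- scheme with such a lift factors through N, so N is the required fibre product.
  let N := N₁ ⊓ N₂
  have hr : Set.range N.ι ⊆ N := by rw [Scheme.Opens.range_ι]
  obtain ⟨r, h₁, h₂⟩ := D.exists_lift hw ha hb (N.ι ≫ t) (N.ι ≫ t')
    (by rw [← map_app_yoneda, e, map_app_yoneda]) ((hN₁ _).2 fun y hy => (hr hy).1)
    ((hN₂ _).2 fun y hy => (hr hy).2)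
  refine ⟨N, yoneda.map r, N.ι, isPullback_iff_forall.2 ⟨?_, ?_, ?_⟩, inferInstance⟩
  · apply sq.hom_ext
    · rw [Category.assoc, h, Category.assoc, ← ht, ← Functor.map_comp, ← Functor.map_comp, h₁]
    · rw [Category.assoc, h', Category.assoc, ← ht', ← Functor.map_comp, ← Functor.map_comp, h₂]
  · intro T' s s' _ hs
    exact (cancel_mono N.ι).1 hs
  · intro T' (r' : T' ⟶ D.d.U) (g : T' ⟶ T) hg
    have e₁ : r' ≫ D.g.f = g ≫ t := by
      have := congrArg (π.app _) hg
      rw [← comp_app_apply', ← comp_app_apply', h, ← ht] at this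
      exact this
    have e₂ : r' ≫ D.g'.f = g ≫ t' := by
      have := congrArg (π'.app _) hg
      rw [← comp_app_apply', ← comp_app_apply', h', ← ht'] at this
      exact this
    have k₁ := (hN₁ g).1 (by rw [← e₁, ← e₂]; exact D.mapsInto₁ r')
    have k₂ := (hN₂ g).1 (by rw [← e₁, ← e₂]; exact D.swap.mapsInto₁ r')
    have hl : IsOpenImmersion.lift N.ι g (by
      rw [Scheme.Opens.range_ι]; exact fun y hy => ⟨k₁ hy, k₂ hy⟩) ≫ N.ι = g :=
      IsOpenImmersion.lift_fac _ _ _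
    refine ⟨IsOpenImmersion.lift N.ι g (by
      rw [Scheme.Opens.range_ι]; exact fun y hy => ⟨k₁ hy, k₂ hy⟩), D.hom_ext ?_ ?_, hl⟩
    · refine (Category.assoc _ _ _).trans ?_
      rw [h₁, reassoc_of% hl, e₁]
    · refine (Category.assoc _ _ _).trans ?_
      rw [h₂, reassoc_of% hl, e₂]

end Chart.Product.Piece

namespace Chart

variable {c c' : Chart i₁ i₂}

lemma Product.exists_piece (P : Product c c') (r : P.R₁) :
    ∃ D : P.Piece, (∃ x, D.o₁ x = r) := by
  have := P.closed₁
  have := P.closed₂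
  have : Etale P.a₁ := c'.etale₁.property _ _ _ P.isPullback₁.flip
  have : Etale P.a₂ := c'.etale₂.property _ _ _ P.isPullback₂.flip
  obtain ⟨O₁, O₂, hO₁, hO₂, hr, hO⟩ := exists_compatible_affineOpens P.k₁ P.k₂ r
  obtain ⟨d, o₀, o₁, o₂, h₁, h₂, h₁', -, h₃, h₄, h₅, h₆⟩ := exists_chart_of_isAffineOpen
    (presheaf_etale_comp (presheaf_etale_map P.a₁) c.etale₁)
    (presheaf_etale_comp (presheaf_etale_map P.a₂) c.etale₂) P.sq₁ P.sq₂ hO₁ hO₂ hO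
  obtain ⟨g, g', hg₁, hg₂, hg₁', hg₂'⟩ := P.exists_hom h₃ h₄ h₅ h₆
  rw [← SetLike.mem_coe, ← h₁'] at hr
  exact ⟨⟨h₁, h₂, h₃, h₄, hg₁, hg₂, hg₁', hg₂'⟩, hr⟩

lemma Product.Piece.exists_app_eq₁ {P : Product c c'} (D : P.Piece)
    {T : Scheme.{u}} {t : T ⟶ c.U} {t' : T ⟶ c'.U} {ρ : pullback t c.j₁ ⟶ P.R₁}
    (h₁ : ρ ≫ P.a₁ = pullback.snd _ _)
    (h₂ : ρ ≫ P.b₁ ≫ c'.j₁ = pullback.fst _ _ ≫ t') (z : (pullback t c.j₁ :)) {x : D.d.U₁}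
    (hx : D.o₁ x = ρ z) : ∃ (V : Scheme.{u}) (g : V ⟶ T) (v : V) (s : V ⟶ D.d.U),
      g v = pullback.fst t c.j₁ z ∧ s ≫ D.g.f = g ≫ t ∧ s ≫ D.g'.f = g ≫ t' := by
  obtain ⟨v, hv, -⟩ := Scheme.Pullback.exists_preimage_pullback z x hx.symm
  refine ⟨pullback ρ D.o₁, pullback.fst _ _ ≫ pullback.fst _ _, v, pullback.snd _ _ ≫ D.d.j₁,
    by rw [Scheme.Hom.comp_apply, hv], ?_, ?_⟩
  · rw [Category.assoc, D.g.w₁, D.hg₁, Category.assoc, ← pullback.condition_assoc,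
      reassoc_of% h₁, Category.assoc, pullback.condition]
  · rw [Category.assoc, D.g'.w₁, D.hg₁', Category.assoc, ← pullback.condition_assoc, h₂,
      Category.assoc]

/-- The fibre product of two charts over the quotient is a scheme, étale over both. -/
lemma exists_isPullback_quotient (hi₁ : MorphismProperty.presheaf @IsClosedImmersion.{u} i₁)
    (hi₂ : MorphismProperty.presheaf @IsClosedImmersion.{u} i₂)
    {w : ∀ c : Chart i₁ i₂, yoneda.obj c.U ⟶ W}
    (hw : IsChartQuotient w) {a : X₁ ⟶ W} {b : X₂ ⟶ W}
    (ha : ∀ c : Chart i₁ i₂, IsPullback c.p₁ (yoneda.map c.j₁) a (w c))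
    (hb : ∀ c : Chart i₂ i₁, IsPullback c.p₁ (yoneda.map c.j₁) b (w c.swap)) (c c' : Chart i₁ i₂) :
    ∃ (R : Scheme.{u}) (m : R ⟶ c.U) (m' : R ⟶ c'.U),
      IsPullback (yoneda.map m) (yoneda.map m') (w c) (w c') ∧ Etale m := by
  obtain ⟨P⟩ := nonempty_product hi₁ hi₂ c c'
  obtain ⟨F, π, π', sq⟩ : ∃ (F : Scheme.{u}ᵒᵖ ⥤ Type u) (π : F ⟶ yoneda.obj c.U)
      (π' : F ⟶ yoneda.obj c'.U), IsPullback π π' (w c) (w c') :=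
    ⟨_, _, _, IsPullback.of_hasPullback _ _⟩
  have hF := isSheaf_of_isPullback sq (isSheaf_yoneda _) (isSheaf_yoneda _) hw.isSheaf
  choose D₁ hD₁ using P.exists_piece
  choose D₂ hD₂ using P.swap.exists_piece
  -- One piece for every point of R₁ and of R₂. They cover because each point of a chart lies in one
  -- of its closed pieces, where equality in W gives a point of R₁ or R₂.
  let D : P.R₁ ⊕ P.R₂ → P.Piece := Sum.elim D₁ fun r => (D₂ r).swap
  have hφ (k : P.R₁ ⊕ P.R₂) : ∃ φ : yoneda.obj (D k).d.U ⟶ F, φ ≫ π = yoneda.map (D k).g.f ∧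
      φ ≫ π' = yoneda.map (D k).g'.f :=
    ⟨sq.lift _ _ (by rw [hw.naturality, hw.naturality]), sq.lift_fst _ _ _, sq.lift_snd _ _ _⟩
  choose φ hφ₁ hφ₂ using hφ
  have hopen (k) := (D k).isOpenImmersion hw ha hb sq (hφ₁ k) (hφ₂ k)
  have ext {T : Scheme.{u}} {x x' : F.obj (op T)} (h₁ : π.app _ x = π.app _ x')
      (h₂ : π'.app _ x = π'.app _ x') : x = x' := (isPullback_iff_forall.1 sq).2.1 T x x' h₁ h₂
  have hcov (T : Scheme.{u}) (x : F.obj (op T)) (y : T) : ∃ (V : Scheme.{u}) (g : V ⟶ T) (v : V),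
      g v = y ∧ ∃ k, ∃ t : V ⟶ (D k).d.U, (φ k).app (op V) t = F.map g.op x := by
    obtain ⟨t, ht⟩ : ∃ t : T ⟶ c.U, t = π.app _ x := ⟨_, rfl⟩
    obtain ⟨t', ht'⟩ : ∃ t' : T ⟶ c'.U, t' = π'.app _ x := ⟨_, rfl⟩
    have e : (w c).app (op T) t = (w c').app (op T) t' := by
      rw [ht, ht']
      exact ConcreteCategory.congr_hom (NatTrans.congr_app sq.w (op T)) x
    have fin (k) {V : Scheme.{u}} (g : V ⟶ T) (s : V ⟶ (D k).d.U) (h₁ : s ≫ (D k).g.f = g ≫ t)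
        (h₂ : s ≫ (D k).g'.f = g ≫ t') : (φ k).app (op V) s = F.map g.op x := by
      apply ext
      · rw [← comp_app_apply', hφ₁, ← map_app, ← ht]
        exact h₁
      · rw [← comp_app_apply', hφ₂, ← map_app, ← ht']
        exact h₂
    obtain ⟨z, hz⟩ | ⟨z, hz⟩ := c.glued.range_union (t y)
    · obtain ⟨ρ, h₁, h₂⟩ := P.exists_isPullback_of_app_eq ha t t' e
      obtain ⟨z', rfl, -⟩ := Scheme.Pullback.exists_preimage_pullback y z hz.symm
      obtain ⟨q, hq⟩ := hD₁ (ρ z')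
      obtain ⟨V, g, v, s, hv, hs, hs'⟩ := (D₁ (ρ z')).exists_app_eq₁ h₁ h₂ z' hq
      exact ⟨V, g, v, hv, .inl (ρ z'), s, fin (.inl (ρ z')) g s hs hs'⟩
    · obtain ⟨ρ, h₁, h₂⟩ := P.swap.exists_isPullback_of_app_eq hb t t' e
      obtain ⟨z', rfl, -⟩ := Scheme.Pullback.exists_preimage_pullback y z hz.symm
      obtain ⟨q, hq⟩ := hD₂ (ρ z')
      obtain ⟨V, g, v, s, hv, hs, hs'⟩ := (D₂ (ρ z')).exists_app_eq₁ h₁ h₂ z' hq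
      exact ⟨V, g, v, hv, .inr (ρ z'), s, fin (.inr (ρ z')) g s hs hs'⟩
  obtain ⟨R, ⟨hR⟩⟩ := isRepresentable_of_openCover hF φ hopen hcov
  obtain ⟨m, hm⟩ := yoneda.map_surjective (hR.toIso.hom ≫ π)
  obtain ⟨m', hm'⟩ := yoneda.map_surjective (hR.toIso.hom ≫ π')
  refine ⟨R, m, m', ?_, etale_of_forall_exists m fun x => ?_⟩
  · rw [hm, hm']
    exact IsPullback.of_iso sq hR.toIso.symm (Iso.refl _) (Iso.refl _) (Iso.refl _) (by simp)
      (by simp) (by simp) (by simp)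
  · obtain ⟨V, g, v, rfl, k, t, ht⟩ := hcov R (hR.toIso.hom.app _ (𝟙 R)) x
    obtain ⟨n, hn⟩ := yoneda.map_surjective (φ k ≫ hR.toIso.inv)
    have sq' : IsPullback (𝟙 _) (yoneda.map n) (φ k) hR.toIso.hom := by
      rw [hn]
      exact IsPullback.of_horiz_isIso ⟨by simp⟩
    have : IsOpenImmersion n := (hopen k).property _ _ _ sq'
    refine ⟨_, n, t v, this, ?_, ?_⟩
    · rw [← Scheme.Hom.comp_apply]
      have h : yoneda.map t ≫ φ k = yoneda.map g ≫ hR.toIso.hom := by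
        apply hom_ext_yoneda_obj
        rw [comp_app_apply', comp_app_apply']
        rw [map_app_yoneda, Category.comp_id] at ht
        simpa using! ht
      have : t ≫ n = g := yoneda.map_injective (by
        rw [Functor.map_comp, hn, reassoc_of% h, Iso.hom_inv_id, Category.comp_id])
      rw [this]
    · have : n ≫ m = (D k).g.f := yoneda.map_injective (by
        rw [Functor.map_comp, hn, hm, Category.assoc, Iso.inv_hom_id_assoc, hφ₁])
      rw [this]
      exact (D k).g.etale_f

end Chart

end AlgebraicSpace

/-! ### Étale descent of properties and representability of maps to W -/

namespace AlgebraicSpace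

lemma isZariskiLocalAtTarget (P : MorphismProperty Scheme.{u})
    {Q : ∀ {R S : Type u} [CommRing R] [CommRing S], (R →+* S) → Prop} [HasRingHomProperty P Q] :
    IsZariskiLocalAtTarget P := inferInstance

/-- Descent of a property of morphisms of schemes along an étale cover of the target. -/
lemma of_etale_local (P : MorphismProperty Scheme.{u}) [IsZariskiLocalAtTarget P]
    [P.DescendsAlong (@Surjective ⊓ @Flat ⊓ @QuasiCompact)] {S T : Scheme.{u}}
    (n : S ⟶ T) (H : ∀ t : T, ∃ (T' E : Scheme.{u}) (f : T' ⟶ T) (e : E ⟶ S) (m : E ⟶ T')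
      (t' : T'), Etale f ∧ f t' = t ∧ P m ∧ IsPullback e m n f) : P n := by
  choose T' E f e m t' h₁ h₂ h₃ h₄ using H
  let O (t : T) : T.Opens := ⟨Set.range (f t), (f t).isOpenMap.isOpen_range⟩
  have hO : iSup O = ⊤ := by
    refine top_le_iff.1 fun t _ => ?_
    exact TopologicalSpace.Opens.mem_iSup.2 ⟨t, t' t, h₂ t⟩
  refine (IsZariskiLocalAtTarget.iff_of_iSup_eq_top O hO).2 fun t => ?_
  have hl : IsOpenImmersion.lift (O t).ι (f t) (by rw [Scheme.Opens.range_ι]; rfl) ≫ (O t).ι = f t :=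
    IsOpenImmersion.lift_fac _ _ _
  generalize IsOpenImmersion.lift (O t).ι (f t) _ = g at hl
  have hg : Etale g := by
    have : Etale (g ≫ (O t).ι) := by rw [hl]; exact h₁ t
    exact MorphismProperty.of_postcomp (W := @Etale) (W' := @Etale) _ (O t).ι inferInstance this
  have hs : Surjective g := by
    refine ⟨fun ⟨y, z, hz⟩ => ⟨z, (O t).ι.injective ?_⟩⟩
    rw [← Scheme.Hom.comp_apply, hl, hz]
    rfl
  have sq := (isPullback_morphismRestrict n (O t)).flip
  have sq' : IsPullback (sq.lift (e t) (m t ≫ g) (by rw [Category.assoc, hl, (h₄ t).w])) (m t)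
      (n ∣_ (O t)) g := by
    refine IsPullback.of_right ?_ (IsPullback.lift_snd _ _ _ _) sq
    rw [IsPullback.lift_fst, hl]
    exact h₄ t
  -- Étale covers need not be quasi-compact; for a property local on the target, descent holds along
  -- surjective flat maps locally of finite presentation.
  exact MorphismProperty.of_isPullback_of_descendsAlong
    (Q := @Surjective ⊓ @Flat ⊓ @LocallyOfFinitePresentation) sq'.flip
    ⟨⟨hs, inferInstance⟩, inferInstance⟩ (h₃ t)

/-- A closed immersion is a proper monomorphism. Universal closedness and local finite type descend,
and separatedness is automatic for a monomorphism. -/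
lemma isClosedImmersion_of_etale_local {S T : Scheme.{u}}
    (n : S ⟶ T) [Mono n] (H : ∀ t : T, ∃ (T' E : Scheme.{u}) (f : T' ⟶ T) (e : E ⟶ S) (m : E ⟶ T')
      (t' : T'), Etale f ∧ f t' = t ∧ IsClosedImmersion m ∧ IsPullback e m n f) :
    IsClosedImmersion n := by
  have h₁ : UniversallyClosed n := of_etale_local @UniversallyClosed n fun t => by
    obtain ⟨T', E, f, e, m, t', h₁, h₂, h₃, h₄⟩ := H t
    exact ⟨T', E, f, e, m, t', h₁, h₂, inferInstance, h₄⟩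
  have := isZariskiLocalAtTarget @LocallyOfFiniteType
  have h₂ : LocallyOfFiniteType n := of_etale_local @LocallyOfFiniteType n fun t => by
    obtain ⟨T', E, f, e, m, t', h₁, h₂, h₃, h₄⟩ := H t
    exact ⟨T', E, f, e, m, t', h₁, h₂, inferInstance, h₄⟩
  have : IsProper n := {}
  exact (IsClosedImmersion.iff_isProper_and_mono n).2 ⟨inferInstance, inferInstance⟩

variable {Y X₁ X₂ W : Scheme.{u}ᵒᵖ ⥤ Type u} {i₁ : Y ⟶ X₁} {i₂ : Y ⟶ X₂}

namespace IsChartQuotient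

variable {w : ∀ c : Chart i₁ i₂, yoneda.obj c.U ⟶ W}

/-- Morphisms from schemes to the quotient are representable. -/
lemma relativelyRepresentable (hw : IsChartQuotient w)
    (hR : ∀ c c', ∃ (R : Scheme.{u}) (m : R ⟶ c.U) (m' : R ⟶ c'.U),
      IsPullback (yoneda.map m) (yoneda.map m') (w c) (w c') ∧ Etale m) {T : Scheme.{u}}
    (x : yoneda.obj T ⟶ W) : yoneda.relativelyRepresentable x := by
  intro T' x'
  obtain ⟨F, π, π', sq⟩ : ∃ (F : Scheme.{u}ᵒᵖ ⥤ Type u) (π : F ⟶ yoneda.obj T)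
      (π' : F ⟶ yoneda.obj T'), IsPullback π π' x x' := ⟨_, _, _, IsPullback.of_hasPullback _ _⟩
  have hF := isSheaf_of_isPullback sq (isSheaf_yoneda _) (isSheaf_yoneda _) hw.isSheaf
  have ext {S : Scheme.{u}} {y y' : F.obj (op S)} (h₁ : π.app _ y = π.app _ y')
      (h₂ : π'.app _ y = π'.app _ y') : y = y' := (isPullback_iff_forall.1 sq).2.1 S y y' h₁ h₂
  obtain ⟨P, p, p', hP⟩ : ∃ (P : Scheme.{u}) (p : P ⟶ T) (p' : P ⟶ T'),
      IsPullback p p' (terminal.from T) (terminal.from T') :=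
    ⟨_, _, _, IsPullback.of_hasPullback _ _⟩
  have hP' : IsPullback (yoneda.map p) (yoneda.map p') (yoneda.map (terminal.from T))
    (yoneda.map (terminal.from T')) := hP.map yoneda
  obtain ⟨ι, hι, hι'⟩ : ∃ ι : F ⟶ yoneda.obj P, ι ≫ yoneda.map p = π ∧ ι ≫ yoneda.map p' = π' :=
    ⟨hP'.lift π π' (by ext; exact terminal.hom_ext _ _), hP'.lift_fst _ _ _, hP'.lift_snd _ _ _⟩
  have hm : Mono ι := mono_iff_forall.2 fun S y y' e => ext
    (by rw [← hι, comp_app_apply', comp_app_apply', e])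
    (by rw [← hι', comp_app_apply', comp_app_apply', e])
  -- Étale locally on T × T' both maps to W lift to charts c and c'. There F is the pullback of R =
  -- c.U ×_W c'.U → c.U × c'.U, a morphism locally of finite type because R → c.U is étale.
  obtain ⟨R, ⟨hR⟩⟩ := isRepresentable_of_etale_local hF ι fun t => by
    obtain ⟨V, f, v, _, hv, c, s, hs⟩ := hw.covers T (x.app _ (𝟙 T)) (p t)
    obtain ⟨V', f', v', _, hv', c', s', hs'⟩ := hw.covers T' (x'.app _ (𝟙 T')) (p' t)
    obtain ⟨R, m, m', hR, _⟩ := hR c c'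
    rw [map_app_yoneda, Category.comp_id] at hs hs'
    obtain ⟨z, hz, -⟩ := Scheme.Pullback.exists_preimage_pullback t v hv.symm
    obtain ⟨z', hz', -⟩ := Scheme.Pullback.exists_preimage_pullback t v' hv'.symm
    obtain ⟨y, hy, hy'⟩ := Scheme.Pullback.exists_preimage_pullback z z' (hz.trans hz'.symm)
    obtain ⟨Q, q, q', hQ⟩ : ∃ (Q : Scheme.{u}) (q : Q ⟶ c.U) (q' : Q ⟶ c'.U),
        IsPullback q q' (terminal.from _) (terminal.from _) :=
      ⟨_, _, _, IsPullback.of_hasPullback _ _⟩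
    obtain ⟨M, hM, hM'⟩ : ∃ M : R ⟶ Q, M ≫ q = m ∧ M ≫ q' = m' :=
      ⟨hQ.lift m m' (terminal.hom_ext _ _), hQ.lift_fst _ _ _, hQ.lift_snd _ _ _⟩
    have : LocallyOfFiniteType M := by
      have : LocallyOfFiniteType (M ≫ q) := by rw [hM]; infer_instance
      exact locallyOfFiniteType_of_comp M q
    let B := pullback (pullback.fst p f) (pullback.fst p' f')
    obtain ⟨β, hβ, _⟩ : ∃ β : B ⟶ P, β = pullback.fst _ _ ≫ pullback.fst p f ∧ Etale β :=
      ⟨_, rfl, inferInstance⟩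
    obtain ⟨σ, hσ₀⟩ : ∃ σ : B ⟶ c.U, σ = pullback.fst _ _ ≫ pullback.snd p f ≫ s := ⟨_, rfl⟩
    obtain ⟨σ', hσ₀'⟩ : ∃ σ' : B ⟶ c'.U, σ' = pullback.snd _ _ ≫ pullback.snd p' f' ≫ s' :=
      ⟨_, rfl⟩
    have e : β ≫ p = pullback.fst _ _ ≫ pullback.snd p f ≫ f := by
      rw [hβ, Category.assoc, pullback.condition]
    have e' : β ≫ p' = pullback.snd _ _ ≫ pullback.snd p' f' ≫ f' := by
      rw [hβ, pullback.condition, Category.assoc, pullback.condition]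
    have hσ {S : Scheme.{u}} (g : S ⟶ B) : (w c).app (op S) (g ≫ σ) =
        x.app (op S) (g ≫ β ≫ p) := by
      have := congrArg (W.map (g ≫ pullback.fst _ _ ≫ pullback.snd p f).op) hs
      rw [map_app_yoneda, map_app_yoneda] at this
      simpa [hσ₀, e] using this
    have hσ' {S : Scheme.{u}} (g : S ⟶ B) : (w c').app (op S) (g ≫ σ') =
        x'.app (op S) (g ≫ β ≫ p') := by
      have := congrArg (W.map (g ≫ pullback.snd _ _ ≫ pullback.snd p' f').op) hs'
      rw [map_app_yoneda, map_app_yoneda] at this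
      simpa [hσ₀', e'] using this
    obtain ⟨τ, hτ, hτ'⟩ : ∃ τ : B ⟶ Q, τ ≫ q = σ ∧ τ ≫ q' = σ' :=
      ⟨hQ.lift σ σ' (terminal.hom_ext _ _), hQ.lift_fst _ _ _, hQ.lift_snd _ _ _⟩
    obtain ⟨E, k, l, hE⟩ : ∃ (E : Scheme.{u}) (k : E ⟶ B) (l : E ⟶ R), IsPullback k l τ M :=
      ⟨_, _, _, IsPullback.of_hasPullback _ _⟩
    have hk : k ≫ σ = l ≫ m := by rw [← hτ, ← hM, hE.w_assoc]
    have hk' : k ≫ σ' = l ≫ m' := by rw [← hτ', ← hM', hE.w_assoc]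
    have hRw {S : Scheme.{u}} (g : S ⟶ R) : (w c).app (op S) (g ≫ m) =
      (w c').app (op S) (g ≫ m') := IsPullback.app_eq hR g
    obtain ⟨e, he, he'⟩ : ∃ e : yoneda.obj E ⟶ F, e ≫ π = yoneda.map (k ≫ β ≫ p) ∧
        e ≫ π' = yoneda.map (k ≫ β ≫ p') :=
      ⟨sq.lift _ _ (hom_ext_yoneda_obj (by
        rw [comp_app_apply', comp_app_apply']
        simpa [← hσ, ← hσ', hk, hk'] using! hRw l)), sq.lift_fst _ _ _, sq.lift_snd _ _ _⟩
    refine ⟨B, E, β, e, k, y, inferInstance, ?_,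
      MorphismProperty.of_isPullback (P := @LocallyOfFiniteType) hE.flip this, ?_⟩
    · rw [hβ, Scheme.Hom.comp_apply, hy, hz]
    refine isPullback_iff_forall.2 ⟨?_, ?_, ?_⟩
    · apply hP'.hom_ext
      · rw [Category.assoc, hι, he, ← Functor.map_comp, ← Functor.map_comp, Category.assoc]
      · rw [Category.assoc, hι', he', ← Functor.map_comp, ← Functor.map_comp, Category.assoc]
    · intro S (g : S ⟶ E) (g' : S ⟶ E) _ (h : g ≫ k = g' ≫ k)
      refine hE.hom_ext h (IsPullback.hom_eq hR ?_ ?_)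
      · change (g ≫ l) ≫ m = (g' ≫ l) ≫ m
        rw [Category.assoc, Category.assoc, ← hk, reassoc_of% h]
      · rw [Category.assoc, Category.assoc, ← hk', reassoc_of% h]
    · intro S y (g : S ⟶ B) h
      have h₁ : π.app _ y = g ≫ β ≫ p := by
        rw [← hι, comp_app_apply', h]
        exact Category.assoc g β p
      have h₂ : π'.app _ y = g ≫ β ≫ p' := by
        rw [← hι', comp_app_apply', h]
        exact Category.assoc g β p'
      obtain ⟨r, hr, hr'⟩ := IsPullback.exists_hom hR (g ≫ σ) (g ≫ σ') (by
        rw [hσ, hσ', ← h₁, ← h₂, ← comp_app_apply', ← comp_app_apply', sq.w])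
      replace hr : r ≫ m = g ≫ σ := hr
      obtain ⟨d, hd, hd'⟩ : ∃ d : S ⟶ E, d ≫ k = g ∧ d ≫ l = r :=
        ⟨hE.lift g r (hQ.hom_ext (by simp [hτ, hM, hr]) (by simp [hτ', hM', hr'])),
          hE.lift_fst _ _ _, hE.lift_snd _ _ _⟩
      refine ⟨d, ext ?_ ?_, hd⟩
      · rw [← comp_app_apply', he, h₁]
        exact (reassoc_of% hd) _
      · rw [← comp_app_apply', he', h₂]
        exact (reassoc_of% hd) _
  obtain ⟨n, hn⟩ := yoneda.map_surjective (hR.toIso.hom ≫ π')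
  refine ⟨R, n, hR.toIso.hom ≫ π, ?_⟩
  rw [hn]
  exact IsPullback.of_iso sq hR.toIso.symm (Iso.refl _) (Iso.refl _) (Iso.refl _) (by simp)
      (by simp) (by simp) (by simp)

end IsChartQuotient
end AlgebraicSpace

/-! ### Atlas of W, closed immersions into W, and W as an algebraic space -/

namespace AlgebraicSpace

lemma exists_isPullback_of_comp {C : Type*} [Category* C] {F E X W T V : C} {q : F ⟶ X} {n : F ⟶ T}
    {p : X ⟶ W} {x : T ⟶ W} (sq : IsPullback q n p x) {q' : E ⟶ X} {m : E ⟶ V} {f : V ⟶ T}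
    (sq' : IsPullback q' m p (f ≫ x)) : ∃ e, IsPullback e m n f := by
  refine ⟨sq.lift q' (m ≫ f) (by rw [sq'.w, Category.assoc]), IsPullback.of_right ?_
    (IsPullback.lift_snd _ _ _ _) sq⟩
  rwa [IsPullback.lift_fst]

lemma respectsIso_etale : MorphismProperty.RespectsIso @Etale.{u} :=
  MorphismProperty.IsStableUnderBaseChange.respectsIso

section Atlas

variable {W : Scheme.{u}ᵒᵖ ⥤ Type u} (hW : Presheaf.IsSheaf Scheme.etaleTopology.{u} W)

include hW in
/-- Sections of a sheaf over a coproduct of schemes. -/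
lemma exists_sigma_desc {I : Type u} {U : I → Scheme.{u}} (w : ∀ k, yoneda.obj (U k) ⟶ W) :
    ∃ p : yoneda.obj (∐ U) ⟶ W, ∀ k, yoneda.map (Sigma.ι U k) ≫ p = w k := by
  refine (exists_glue hW (T := ∐ U) (fun {V} f x => ∃ (k : I) (s : V ⟶ U k),
    s ≫ Sigma.ι U k = f ∧ (w k).app (op V) s = x) ?_ ?_ ?_).elim fun x hx => ?_
  rotate_right
  · refine ⟨yonedaEquiv.symm x, fun k => hom_ext_yoneda_obj ?_⟩
    rw [← hx (Sigma.ι U k) ((w k).app _ (𝟙 _)) ⟨k, 𝟙 _, Category.id_comp _, rfl⟩,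
      yoneda_map_comp_app, yonedaEquiv_symm_app, Category.id_comp]
  · rintro V V' f g _ ⟨k, s, rfl, rfl⟩
    exact ⟨k, g ≫ s, Category.assoc _ _ _, (map_app_yoneda _ _ _).symm⟩
  · rintro V f _ _ ⟨k, s, rfl, rfl⟩ ⟨k', s', h, rfl⟩
    obtain rfl | hk := eq_or_ne k k'
    · rw [(cancel_mono (Sigma.ι U k)).1 h]
    -- Distinct summands of a coproduct are disjoint, and a sheaf has at most one section over the
    -- empty scheme.
    · have := isEmpty_of_commSq_sigmaι_of_ne ⟨h⟩ hk.symm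
      exact sheaf_ext hW fun t => isEmptyElim t
  · intro t
    obtain ⟨k, y, rfl⟩ := (sigmaOpenCover U).exists_eq t
    exact ⟨U k, Sigma.ι U k, y, inferInstance, rfl, _, k, 𝟙 _, Category.id_comp _, rfl⟩

include hW in
/-- A jointly surjective family of étale morphisms from schemes gives an atlas. -/
lemma exists_atlas_of_family
    (hr : ∀ {T : Scheme.{u}} (x : yoneda.obj T ⟶ W), yoneda.relativelyRepresentable x)
    {I : Type u} {U : I → Scheme.{u}} (w : ∀ k, yoneda.obj (U k) ⟶ W)
    (hw : ∀ k, MorphismProperty.presheaf @Etale.{u} (w k))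
    (hc : ∀ (T : Scheme.{u}) (x : W.obj (op T)) (y : T), ∃ (V : Scheme.{u}) (f : V ⟶ T) (v : V),
      f v = y ∧ ∃ (k : I) (t : V ⟶ U k), (w k).app (op V) t = W.map f.op x) :
    ∃ (U : Scheme.{u}) (p : yoneda.obj U ⟶ W),
      MorphismProperty.presheaf @Etale.{u} p ∧ MorphismProperty.presheaf @Surjective.{u} p := by
  have := respectsIso_etale.{u}
  obtain ⟨p, hp⟩ := exists_sigma_desc hW w
  refine ⟨∐ U, p, MorphismProperty.relative.of_exists fun T x => ?_,
    MorphismProperty.relative.of_exists fun T x => ?_⟩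
  · obtain ⟨S, n, q, sq⟩ := hr p x
    obtain ⟨q, rfl⟩ := yoneda.map_surjective q
    refine ⟨S, _, n, sq, etale_of_forall_exists n fun z => ?_⟩
    obtain ⟨k, y, hy⟩ : ∃ (k : I) (y : U k), Sigma.ι U k y = q z :=
      (sigmaOpenCover U).exists_eq (q z)
    obtain ⟨v, hv, -⟩ := Scheme.Pullback.exists_preimage_pullback z y hy.symm
    refine ⟨pullback q (Sigma.ι U k), pullback.fst _ _, v, inferInstance, hv, ?_⟩
    have sq' : IsPullback (yoneda.map (pullback.snd q (Sigma.ι U k)))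
      (yoneda.map (pullback.fst q (Sigma.ι U k))) (yoneda.map (Sigma.ι U k)) (yoneda.map q) :=
      ((IsPullback.of_hasPullback q (Sigma.ι U k)).flip.map yoneda)
    have sq₁ := sq'.paste_vert sq
    rw [hp, ← Functor.map_comp] at sq₁
    exact (hw k).property _ _ _ sq₁
  · obtain ⟨S, n, q, sq⟩ := hr p x
    refine ⟨S, q, n, sq, ⟨fun t => ?_⟩⟩
    obtain ⟨V, f, v, rfl, k, s, hs⟩ := hc T (x.app _ (𝟙 T)) t
    obtain ⟨r, -, hr⟩ := IsPullback.exists_hom sq (s ≫ Sigma.ι U k) f (by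
      rw [← yoneda_map_comp_app, hp, hs, map_app_yoneda, Category.comp_id])
    exact ⟨r v, by rw [← Scheme.Hom.comp_apply, hr]⟩

end Atlas

variable {Y X₁ X₂ W : Scheme.{u}ᵒᵖ ⥤ Type u} {i₁ : Y ⟶ X₁} {i₂ : Y ⟶ X₂}

namespace IsChartQuotient

variable {w : ∀ c : Chart i₁ i₂, yoneda.obj c.U ⟶ W} {a : X₁ ⟶ W} {b : X₂ ⟶ W}

lemma yoneda_map_comp_eq {c : Chart i₁ i₂} {T V : Scheme.{u}} {x : yoneda.obj T ⟶ W} {f : V ⟶ T}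
    {s : V ⟶ c.U} (hs : (w c).app _ s = W.map f.op (x.app _ (𝟙 T))) :
    yoneda.map s ≫ w c = yoneda.map f ≫ x := by
  apply hom_ext_yoneda_obj
  rw [yoneda_map_comp_app, yoneda_map_comp_app, Category.id_comp, Category.id_comp, hs,
    map_app_yoneda, Category.comp_id]

/-- The charts are étale over the quotient. -/
lemma presheaf_etale (hw : IsChartQuotient w)
    (hR : ∀ c c', ∃ (R : Scheme.{u}) (m : R ⟶ c.U) (m' : R ⟶ c'.U),
      IsPullback (yoneda.map m) (yoneda.map m') (w c) (w c') ∧ Etale m) (c : Chart i₁ i₂) :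
    MorphismProperty.presheaf @Etale.{u} (w c) := by
  have := isZariskiLocalAtTarget @Etale.{u}
  have := respectsIso_etale.{u}
  refine MorphismProperty.relative.of_exists fun T x => ?_
  obtain ⟨S, n, q, sq⟩ := hw.relativelyRepresentable hR (w c) x
  refine ⟨S, q, n, sq, of_etale_local @Etale n fun t => ?_⟩
  obtain ⟨V, f, v, hf, hv, c', s, hs⟩ := hw.covers T (x.app _ (𝟙 T)) t
  obtain ⟨R, m, m', sq', hm⟩ := hR c' c
  have sq₁ := ((IsPullback.of_hasPullback m s).map yoneda).paste_horiz sq'.flip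
  rw [yoneda_map_comp_eq hs] at sq₁
  obtain ⟨e', he'⟩ := exists_isPullback_of_comp sq sq₁
  obtain ⟨e', rfl⟩ := yoneda.map_surjective e'
  exact ⟨V, _, f, e', _, v, hf, hv, inferInstance, he'.of_map_of_faithful yoneda⟩

/-- The inclusion of the first piece in the quotient is a closed immersion. -/
lemma isClosedImmersion_inl (hw : IsChartQuotient w)
    (hX : Presheaf.IsSheaf Scheme.etaleTopology.{u} X₁) [Mono a]
    (ha : ∀ c : Chart i₁ i₂, IsPullback c.p₁ (yoneda.map c.j₁) a (w c)) :
    MorphismProperty.presheaf @IsClosedImmersion.{u} a := by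
  refine MorphismProperty.relative.of_exists fun T x => ?_
  obtain ⟨F, π, ι, sq⟩ : ∃ (F : Scheme.{u}ᵒᵖ ⥤ Type u) (π : F ⟶ X₁)
      (ι : F ⟶ yoneda.obj T), IsPullback π ι a x := ⟨_, _, _, IsPullback.of_hasPullback _ _⟩
  have hF := isSheaf_of_isPullback sq hX (isSheaf_yoneda _) hw.isSheaf
  have : Mono ι := (MorphismProperty.monomorphisms _).of_isPullback sq (.infer_property _)
  have key (t : T) : ∃ (V E : Scheme.{u}) (f : V ⟶ T) (e : yoneda.obj E ⟶ F) (m : E ⟶ V) (v : V),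
      Etale f ∧ f v = t ∧ IsClosedImmersion m ∧ IsPullback e (yoneda.map m) ι (yoneda.map f) := by
    obtain ⟨V, f, v, hf, hv, c, s, hs⟩ := hw.covers T (x.app _ (𝟙 T)) t
    have := c.glued.closed₁
    have sq₁ := ((IsPullback.of_hasPullback c.j₁ s).map yoneda).paste_horiz (ha c)
    rw [yoneda_map_comp_eq hs] at sq₁
    obtain ⟨e', he'⟩ := exists_isPullback_of_comp sq sq₁
    exact ⟨V, _, f, e', _, v, hf, hv, inferInstance, he'⟩
  obtain ⟨S, ⟨hS⟩⟩ := isRepresentable_of_etale_local hF ι fun t => by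
    obtain ⟨V, E, f, e, m, v, h₁, h₂, h₃, h₄⟩ := key t
    exact ⟨V, E, f, e, m, v, h₁, h₂, inferInstance, h₄⟩
  obtain ⟨n, hn⟩ := yoneda.map_surjective (hS.toIso.hom ≫ ι)
  have sq' : IsPullback (hS.toIso.hom ≫ π) (yoneda.map n) a x := by
    rw [hn]
    exact IsPullback.of_iso sq hS.toIso.symm (Iso.refl _) (Iso.refl _) (Iso.refl _) (by simp)
      (by simp) (by simp) (by simp)
  have : Mono n := by
    have : Mono (yoneda.map n) := by rw [hn]; infer_instance
    exact yoneda.mono_of_mono_map this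
  refine ⟨S, _, n, sq', isClosedImmersion_of_etale_local n fun t => ?_⟩
  obtain ⟨V, E, f, e, m, v, h₁, h₂, h₃, h₄⟩ := key t
  obtain ⟨e', he'⟩ := exists_isPullback_of_comp sq' (h₄.paste_horiz sq)
  obtain ⟨e', rfl⟩ := yoneda.map_surjective e'
  exact ⟨V, E, f, e', m, v, h₁, h₂, h₃, he'.of_map_of_faithful yoneda⟩

/-- Passes from an arbitrary chart to the small family: a point of the first piece lifts through X₁
to one of its members. The map obtained to T factors through a closed piece and is not étale, but
surjectivity of the atlas only needs it to hit the point. -/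
lemma exists_app_eq_of_family
    (ha : ∀ c : Chart i₁ i₂, c.p₁ ≫ a = yoneda.map c.j₁ ≫ w c)
    {I : Type u} {d : I → Chart i₁ i₂} (hd : EtaleCovers fun k => (d k).p₁) {T : Scheme.{u}}
    {x : W.obj (op T)} {V : Scheme.{u}} {f : V ⟶ T} {v : V} {c : Chart i₁ i₂} {s : V ⟶ c.U}
    (hs : (w c).app (op V) s = W.map f.op x) {z : c.U₁} (hz : c.j₁ z = s v) :
    ∃ (V' : Scheme.{u}) (g : V' ⟶ T) (v' : V'), g v' = f v ∧ ∃ (k : I) (t : V' ⟶ (d k).U),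
      (w (d k)).app (op V') t = W.map g.op x := by
  obtain ⟨V', g, v', -, hv', k, r, hr⟩ := hd c.U₁ (c.p₁.app _ (𝟙 _)) z
  rw [map_app_yoneda, Category.comp_id] at hr
  obtain ⟨y, hy, -⟩ := Scheme.Pullback.exists_preimage_pullback (f := s) (g := g ≫ c.j₁) v v'
    (by rw [Scheme.Hom.comp_apply, hv', hz])
  refine ⟨pullback s (g ≫ c.j₁), pullback.fst _ _ ≫ f, y, by rw [Scheme.Hom.comp_apply, hy], k,
    pullback.snd _ _ ≫ r ≫ (d k).j₁, ?_⟩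
  rw [← map_map, ← hs, map_app_yoneda, pullback.condition, ← Category.assoc, ← inl_app ha,
    ← map_app_yoneda, hr, map_app_yoneda, inl_app ha, Category.assoc]

/-- The quotient of the charts is an algebraic space. -/
lemma isAlgebraicSpace (hw : IsChartQuotient w)
    (hR : ∀ c c', ∃ (R : Scheme.{u}) (m : R ⟶ c.U) (m' : R ⟶ c'.U),
      IsPullback (yoneda.map m) (yoneda.map m') (w c) (w c') ∧ Etale m)
    (ha : ∀ c : Chart i₁ i₂, c.p₁ ≫ a = yoneda.map c.j₁ ≫ w c)
    (hb : ∀ c : Chart i₁ i₂, c.p₂ ≫ b = yoneda.map c.j₂ ≫ w c)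
    {I : Type u} {d : I → Chart i₁ i₂} (hd₁ : EtaleCovers fun k => (d k).p₁)
    (hd₂ : EtaleCovers fun k => (d k).p₂) : IsAlgebraicSpace W where
  isSheaf := hw.isSheaf
  representable_diag := Functor.relativelyRepresentable.diag_of_map_from_obj fun _ x =>
    hw.relativelyRepresentable hR x
  exists_atlas := exists_atlas_of_family hw.isSheaf (hw.relativelyRepresentable hR)
    (fun k => w (d k)) (fun k => hw.presheaf_etale hR (d k)) fun T x y => by
      obtain ⟨V, f, v, hf, rfl, c, s, hs⟩ := hw.covers T x y
      obtain ⟨z, hz⟩ | ⟨z, hz⟩ := c.glued.range_union (s v)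
      · exact exists_app_eq_of_family ha hd₁ hs hz
      · exact exists_app_eq_of_family (w := fun c : Chart i₂ i₁ => w c.swap) (c := c.swap)
          (d := fun k => (d k).swap) (fun c => hb c.swap) hd₂ hs hz

end IsChartQuotient
end AlgebraicSpace

/-! ### The pushout of underlying topological spaces -/

namespace AlgebraicSpace

/-- A criterion for a square of injections of topological spaces to be a pushout. -/
lemma isPushout_topCat {Y X₁ X₂ W : TopCat} {i₁ : Y ⟶ X₁} {i₂ : Y ⟶ X₂} {a : X₁ ⟶ W}
    {b : X₂ ⟶ W} (w : i₁ ≫ a = i₂ ≫ b) (ha : Function.Injective a) (hb : Function.Injective b)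
    (hW : ∀ p, (∃ x, a x = p) ∨ ∃ x, b x = p)
    (hY : ∀ x₁ x₂, a x₁ = b x₂ → ∃ y, i₁ y = x₁ ∧ i₂ y = x₂)
    (ho : ∀ s, IsOpen (a ⁻¹' s) → IsOpen (b ⁻¹' s) → IsOpen s) : IsPushout i₁ i₂ a b := by
  classical
  have key {Z : TopCat} (f : X₁ ⟶ Z) (g : X₂ ⟶ Z) (e : i₁ ≫ f = i₂ ≫ g) :
      ∃ h : W ⟶ Z, a ≫ h = f ∧ b ≫ h = g := by
    have (p : W) : ∃ z, (∀ x, a x = p → f x = z) ∧ ∀ x, b x = p → g x = z := by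
      have hfg (x₁ x₂) (h : a x₁ = b x₂) : f x₁ = g x₂ := by
        obtain ⟨y, rfl, rfl⟩ := hY x₁ x₂ h
        exact ConcreteCategory.congr_hom e y
      obtain ⟨x, rfl⟩ | ⟨x, rfl⟩ := hW p
      · exact ⟨f x, fun x' h => by rw [ha h], fun x' h => (hfg _ _ h.symm).symm⟩
      · exact ⟨g x, fun x' h => hfg _ _ h, fun x' h => by rw [hb h]⟩
    choose φ h₁ h₂ using this
    have e₁ : φ ∘ a = f := funext fun x => (h₁ _ x rfl).symm
    have e₂ : φ ∘ b = g := funext fun x => (h₂ _ x rfl).symm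
    have hφ : Continuous φ := ⟨fun s hs => ho _
      (by rw [← Set.preimage_comp, e₁]; exact hs.preimage f.hom.continuous)
      (by rw [← Set.preimage_comp, e₂]; exact hs.preimage g.hom.continuous)⟩
    exact ⟨TopCat.ofHom ⟨φ, hφ⟩, by ext x; exact congrFun e₁ x, by ext x; exact congrFun e₂ x⟩
  choose d hd₁ hd₂ using @key
  refine ⟨⟨w⟩, ⟨PushoutCocone.IsColimit.mk w (fun s => d s.inl s.inr s.condition)
    (fun s => hd₁ _ _ s.condition) (fun s => hd₂ _ _ s.condition) fun s m h₁ h₂ => ?_⟩⟩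
  ext p
  obtain ⟨x, rfl⟩ | ⟨x, rfl⟩ := hW p
  · exact ConcreteCategory.congr_hom (h₁.trans (hd₁ _ _ s.condition).symm) x
  · exact ConcreteCategory.congr_hom (h₂.trans (hd₂ _ _ s.condition).symm) x

namespace Points

variable {F G Y X₁ X₂ W : Scheme.{u}ᵒᵖ ⥤ Type u}

lemma mk_extend {K L : Type u} [Field K] [Field L] (φ : K →+* L)
    (x : F.obj (op (Spec (CommRingCat.of K)))) :
    Quotient.mk (FieldPoint.setoid F) ⟨L, extend F φ x⟩ = Quotient.mk _ ⟨K, x⟩ :=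
  Quotient.sound ⟨L, inferInstance, RingHom.id L, φ, by rw [extend_extend, RingHom.id_comp]⟩

/-- The residue field of `z` extends that of its image, and a point does not change under field
extension. -/
lemma ofScheme_map {T T' : Scheme.{u}} (m : T' ⟶ T) (t : F.obj (op T)) (z : T') :
    ofScheme (F.map m.op t) z = ofScheme t (m z) := by
  refine Eq.trans ?_ (mk_extend (m.residueFieldMap z).hom _)
  refine congrArg (fun x => Quotient.mk _ (⟨_, x⟩ : FieldPoint F)) ?_
  rw [map_map, extend, map_map]
  rw [← Scheme.Hom.SpecMap_residueFieldMap_fromSpecResidueField m z]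
  rfl

lemma ofScheme_of_field {K : Type u} [Field K] (x : F.obj (op (Spec (CommRingCat.of K))))
    (z : Spec (CommRingCat.of K)) : ofScheme x z = Quotient.mk _ ⟨K, x⟩ := by
  obtain ⟨φ, hφ⟩ := Spec.map_surjective ((Spec (CommRingCat.of K)).fromSpecResidueField z)
  refine Eq.trans ?_ (mk_extend φ.hom _)
  refine congrArg (fun x => Quotient.mk _ (⟨_, x⟩ : FieldPoint F)) ?_
  rw [extend, ← hφ]
  rfl

lemma map_injective (f : F ⟶ G) [Mono f] : Function.Injective (map f) := by
  intro x y h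
  induction x using Quotient.inductionOn with | _ x
  induction y using Quotient.inductionOn with | _ y
  obtain ⟨Ω, _, α, β, e⟩ := Quotient.exact h
  refine Quotient.sound ⟨Ω, inferInstance, α, β, ?_⟩
  exact mono_iff_forall.1 ‹_› _ _ _ ((map_app f _ _).symm.trans (e.trans (map_app f _ _)))

lemma exists_of_isPullback {i₁ : Y ⟶ X₁} {i₂ : Y ⟶ X₂} {a : X₁ ⟶ W} {b : X₂ ⟶ W}
    (sq : IsPullback i₁ i₂ a b) (x₁ : Points X₁) (x₂ : Points X₂) (h : map a x₁ = map b x₂) :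
    ∃ y, map i₁ y = x₁ ∧ map i₂ y = x₂ := by
  induction x₁ using Quotient.inductionOn with | _ x
  induction x₂ using Quotient.inductionOn with | _ y
  obtain ⟨Ω, _, α, β, e⟩ := Quotient.exact h
  obtain ⟨z, h₁, h₂⟩ := (isPullback_iff_forall.1 sq).2.2 _ (extend X₁ α x.pt) (extend X₂ β y.pt)
    ((map_app a _ _).symm.trans (e.trans (map_app b _ _)))
  refine ⟨Quotient.mk _ ⟨Ω, z⟩, ?_, ?_⟩
  · refine Eq.trans ?_ (mk_extend α x.pt)
    rw [← h₁]
    rfl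
  · refine Eq.trans ?_ (mk_extend β y.pt)
    rw [← h₂]
    rfl

end Points

/-- Two morphisms are jointly surjective if field-valued points can be lifted to one of the two
sources. -/
def JointlySurjective {X₁ X₂ W : Scheme.{u}ᵒᵖ ⥤ Type u} (a : X₁ ⟶ W) (b : X₂ ⟶ W) : Prop :=
  ∀ (T : Scheme.{u}) (x : W.obj (op T)) (y : T), ∃ (V : Scheme.{u}) (f : V ⟶ T) (v : V),
    f v = y ∧ ((∃ z, a.app _ z = W.map f.op x) ∨ ∃ z, b.app _ z = W.map f.op x)

namespace JointlySurjective

variable {X₁ X₂ W : Scheme.{u}ᵒᵖ ⥤ Type u} {a : X₁ ⟶ W} {b : X₂ ⟶ W}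

lemma exists_map_eq (h : JointlySurjective a b) (p : Points W) :
    (∃ x, Points.map a x = p) ∨ ∃ x, Points.map b x = p := by
  induction p using Quotient.inductionOn with | _ p
  obtain ⟨V, f, v, -, ⟨z, hz⟩ | ⟨z, hz⟩⟩ := h _ p.pt (IsLocalRing.closedPoint p.K)
  · exact .inl ⟨.ofScheme z v, by
      rw [Points.map_ofScheme, hz, Points.ofScheme_map, Points.ofScheme_of_field]⟩
  · exact .inr ⟨.ofScheme z v, by
      rw [Points.map_ofScheme, hz, Points.ofScheme_map, Points.ofScheme_of_field]⟩

/-- Over any test scheme T the complement of `s` is a union of two sets, the images of closed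
subsets of T ×_W X₁ and T ×_W X₂. These are closed in T since both projections are closed
immersions. -/
lemma isOpen (h : JointlySurjective a b)
    (ha : MorphismProperty.presheaf @IsClosedImmersion.{u} a)
    (hb : MorphismProperty.presheaf @IsClosedImmersion.{u} b) {s : Set (Points W)}
    (h₁ : IsOpen (Points.map a ⁻¹' s)) (h₂ : IsOpen (Points.map b ⁻¹' s)) : IsOpen s := by
  intro T t
  have key {X : Scheme.{u}ᵒᵖ ⥤ Type u} {a : X ⟶ W}
      (ha : MorphismProperty.presheaf @IsClosedImmersion.{u} a)
      (h₁ : IsOpen (Points.map a ⁻¹' s)) :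
      ∃ C : Set T, IsClosed C ∧ C ⊆ Points.ofScheme t ⁻¹' sᶜ ∧
        ∀ (V : Scheme.{u}) (f : V ⟶ T) (v : V) z, a.app _ z = W.map f.op t →
          Points.ofScheme t (f v) ∉ s → f v ∈ C := by
    obtain ⟨S, m, q, sq⟩ := ha.rep (yonedaEquiv.symm t)
    have : IsClosedImmersion m := ha.property _ _ _ sq
    have hq (z : S) : Points.ofScheme t (m z) = Points.map a (Points.ofScheme (q.app _ (𝟙 S)) z) := by
      rw [Points.map_ofScheme, IsPullback.app_eq sq, yonedaEquiv_symm_app, Category.id_comp,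
        Points.ofScheme_map]
    refine ⟨m '' ((Points.ofScheme (q.app _ (𝟙 S)) ⁻¹' (Points.map a ⁻¹' s))ᶜ),
      m.isClosedEmbedding.isClosedMap _ (h₁ S _).isClosed_compl, ?_, ?_⟩
    · rintro _ ⟨z, hz, rfl⟩
      change Points.ofScheme t (m z) ∉ s
      rwa [hq]
    · intro V f v z hz hv
      obtain ⟨r, hr, rfl⟩ := IsPullback.exists_hom sq z f (by rw [hz, yonedaEquiv_symm_app])
      refine ⟨r v, ?_, rfl⟩
      change Points.map a _ ∉ s
      rwa [← hq]
  obtain ⟨C₁, hC₁, hs₁, hm₁⟩ := key ha h₁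
  obtain ⟨C₂, hC₂, hs₂, hm₂⟩ := key hb h₂
  have : Points.ofScheme t ⁻¹' s = (C₁ ∪ C₂)ᶜ := by
    refine Set.Subset.antisymm (fun y hy => ?_) (fun y hy => by_contra fun hys => hy ?_)
    · rintro (h | h)
      exacts [hs₁ h hy, hs₂ h hy]
    · obtain ⟨V, f, v, rfl, ⟨z, hz⟩ | ⟨z, hz⟩⟩ := h T t y
      exacts [.inl (hm₁ V f v z hz hys), .inr (hm₂ V f v z hz hys)]
  rw [this]
  exact (hC₁.union hC₂).isOpen_compl

end JointlySurjective

/-- The underlying square of topological spaces of a cartesian square of jointly surjective closed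
immersions is a pushout. -/
lemma isPushout_topSpace {Y X₁ X₂ W : AlgSp.{u}} {i₁ : Y ⟶ X₁} {i₂ : Y ⟶ X₂} {a : X₁ ⟶ W}
    {b : X₂ ⟶ W} (sq : IsPullback i₁.hom i₂.hom a.hom b.hom) (h : JointlySurjective a.hom b.hom)
    (ha : IsClosedImm a) (hb : IsClosedImm b) [Mono a.hom] [Mono b.hom] :
    IsPushout (topSpace.map i₁) (topSpace.map i₂) (topSpace.map a) (topSpace.map b) := by
  have e : i₁ ≫ a = i₂ ≫ b := by ext : 1; exact sq.w
  exact isPushout_topCat (by rw [← Functor.map_comp, ← Functor.map_comp, e])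
    (Points.map_injective a.hom) (Points.map_injective b.hom) h.exists_map_eq
    (Points.exists_of_isPullback sq) fun _ h₁ h₂ => h.isOpen ha hb h₁ h₂

end AlgebraicSpace

/-! ### Kernels, cokernels and gluing for sheaves of abelian groups -/

namespace AlgebraicSpace

section AbelianSheaves

universe w v u'

variable {C : Type u'} [Category.{v} C] {J : GrothendieckTopology C}

/-- The underlying sheaf of sets of a sheaf of abelian groups. -/
lemma isSheaf_forget (F : Sheaf J AddCommGrpCat.{w}) :
    Presieve.IsSheaf J (F.obj ⋙ forget AddCommGrpCat.{w}) :=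
  Presieve.isSheaf_iso J (Functor.isoWhiskerLeft F.obj AddCommGrpCat.coyonedaObjIsoForget)
    (F.property _)

lemma addCommGrpSheaf_ext (F : Sheaf J AddCommGrpCat.{w}) {V : C} {x y : F.obj.obj (op V)}
    {S : Sieve V} (hS : S ∈ J V)
    (h : ∀ ⦃V' : C⦄ (f : V' ⟶ V), S f → F.obj.map f.op x = F.obj.map f.op y) : x = y :=
  (isSheaf_forget F S hS).isSeparatedFor.ext h

lemma exists_addCommGrpSheaf_glue (F : Sheaf J AddCommGrpCat.{w}) {V : C}
    (P : ∀ {V' : C} (_ : V' ⟶ V), F.obj.obj (op V') → Prop)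
    (hres : ∀ {V' V'' : C} (f : V' ⟶ V) (g : V'' ⟶ V') (x : F.obj.obj (op V')), P f x →
      P (g ≫ f) (F.obj.map g.op x))
    (huniq : ∀ {V' : C} (f : V' ⟶ V) (x y : F.obj.obj (op V')), P f x → P f y → x = y)
    {S : Sieve V} (hS : S ∈ J V) (h : ∀ ⦃V' : C⦄ (f : V' ⟶ V), S f → ∃ x, P f x) :
    ∃ x : F.obj.obj (op V), ∀ ⦃V' : C⦄ (f : V' ⟶ V), S f → P f (F.obj.map f.op x) := by
  choose x hx using h
  obtain ⟨z, hz, -⟩ := isSheaf_forget F S hS x (by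
    intro V₁ V₂ V' g₁ g₂ f₁ f₂ h₁ h₂ e
    refine huniq (g₁ ≫ f₁) _ _ (hres _ _ _ (hx _ h₁)) ?_
    rw [e]
    exact hres _ _ _ (hx _ h₂))
  refine ⟨z, fun V' f hf => ?_⟩
  have := hz f hf
  change F.obj.map f.op z = x f hf at this
  rw [this]
  exact hx f hf

/-- A short complex which is both a kernel and a cokernel sequence is short exact. -/
lemma shortExact_of_isLimit_of_isColimit {A : Type*} [Category* A] [Preadditive A] [HasZeroObject A]
    {S : ShortComplex A} (hf : IsLimit (KernelFork.ofι S.f S.zero))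
    (hg : IsColimit (CokernelCofork.ofπ S.g S.zero)) : S.ShortExact := by
  have e₁ : hf.lift (KernelFork.ofι _ S.zero) = 𝟙 _ :=
    Fork.IsLimit.hom_ext hf (by simp)
  have e₂ : hg.desc (CokernelCofork.ofπ _ S.zero) = 𝟙 _ :=
    Cofork.IsColimit.hom_ext hg (by simp)
  open ZeroObject in
  -- The category is only preadditive with a zero object, so the homology is exhibited by hand as
  -- zero, from the kernel side here and from the cokernel side in `r`.
  let l : S.LeftHomologyData :=
    { K := S.X₁
      H := 0
      i := S.f
      π := 0
      wi := S.zero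
      hi := hf
      wπ := comp_zero
      hπ := CokernelCofork.IsColimit.ofEpiOfIsZero _ (by rw [e₁]; infer_instance) (isZero_zero _) }
  open ZeroObject in
  let r : S.RightHomologyData :=
    { Q := S.X₃
      H := 0
      p := S.g
      ι := 0
      wp := S.zero
      hp := hg
      wι := zero_comp
      hι := KernelFork.IsLimit.ofMonoOfIsZero _ (by rw [e₂]; exact instMonoId _) (isZero_zero _) }
  have : S.HasHomology := ⟨⟨{ left := l, right := r, iso := Iso.refl _, comm := by simp [l, r] }⟩⟩
  exact { exact := S.exact_of_f_is_kernel hf, mono_f := mono_of_isLimit_fork hf,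
          epi_g := epi_of_isColimit_cofork hg }

variable {S : ShortComplex (Sheaf J AddCommGrpCat.{w})}

/-- A criterion for a sheaf to be a kernel. -/
lemma nonempty_isLimit_of_sections (hf : ∀ V, Function.Injective (S.f.hom.app V))
    (hk : ∀ V x, S.g.hom.app V x = 0 → ∃ y, S.f.hom.app V y = x) :
    Nonempty (IsLimit (KernelFork.ofι S.f S.zero)) := by
  have key {Z : Sheaf J AddCommGrpCat.{w}} (k : Z ⟶ S.X₂) (e : k ≫ S.g = 0) :
      ∃ l : Z ⟶ S.X₁, l ≫ S.f = k := by
    have (V) (z : Z.obj.obj V) : ∃ y, S.f.hom.app V y = k.hom.app V z :=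
      hk V _ (ConcreteCategory.congr_hom (NatTrans.congr_app (congrArg (·.hom) e) V) z)
    choose l hl using this
    refine ⟨⟨⟨fun V => AddCommGrpCat.ofHom (AddMonoidHom.mk' (l V) fun x y => hf V ?_), ?_⟩⟩, ?_⟩
    · simp [hl]
    · intro V V' f
      ext z
      apply hf
      have h₁ := hl V' (Z.obj.map f z)
      have h₂ := congrArg (S.X₂.obj.map f) (hl V z)
      rw [← NatTrans.naturality_apply] at h₂
      rw [NatTrans.naturality_apply, ← h₂] at h₁
      exact h₁
    · ext V z
      exact hl _ _
  have hm {Z : Sheaf J AddCommGrpCat.{w}} {l l' : Z ⟶ S.X₁} (e : l ≫ S.f = l' ≫ S.f) : l = l' := by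
    ext V z
    exact hf _ (ConcreteCategory.congr_hom (NatTrans.congr_app (congrArg (·.hom) e) V) z)
  choose l hl using @key
  exact ⟨KernelFork.IsLimit.ofι _ _ (fun k e => l k e) (fun k e => hl k e)
    fun k e m hm' => hm (hm'.trans (hl k e).symm)⟩

/-- A criterion for a sheaf to be a cokernel. -/
lemma nonempty_isColimit_of_sections
    (hk : ∀ V x, S.g.hom.app V x = 0 → ∃ y, S.f.hom.app V y = x)
    (hg : ∀ (V : C) (x : S.X₃.obj.obj (op V)), ∃ R ∈ J V, ∀ ⦃V' : C⦄ (f : V' ⟶ V), R f →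
      ∃ y, S.g.hom.app _ y = S.X₃.obj.map f.op x) :
    Nonempty (IsColimit (CokernelCofork.ofπ S.g S.zero)) := by
  have key {Z : Sheaf J AddCommGrpCat.{w}} (k : S.X₂ ⟶ Z) (e : S.f ≫ k = 0) :
      ∃ l : S.X₃ ⟶ Z, S.g ≫ l = k := by
    have wd {V} {y y' : S.X₂.obj.obj V} (h : S.g.hom.app V y = S.g.hom.app V y') :
        k.hom.app V y = k.hom.app V y' := by
      obtain ⟨z, hz⟩ := hk V (y - y') (by simp [h])
      have := ConcreteCategory.congr_hom (NatTrans.congr_app (congrArg (·.hom) e) V) z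
      rw [← sub_eq_zero, ← map_sub, ← hz]
      exact this
    -- `P x z` expresses that z is the value at x of the map induced by k: locally x lifts along g
    -- to some y whose image under k is z. The relation is functional, additive and compatible with
    -- restriction, so it defines the factorization.
    let P {V : C} (x : S.X₃.obj.obj (op V)) (z : Z.obj.obj (op V)) : Prop :=
      ∃ R ∈ J V, ∀ ⦃V' : C⦄ (f : V' ⟶ V), R f → ∃ y, S.g.hom.app _ y = S.X₃.obj.map f.op x ∧
        k.hom.app _ y = Z.obj.map f.op z
    have ex {V : C} (x : S.X₃.obj.obj (op V)) : ∃ z, P x z := by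
      obtain ⟨R, hR, hx⟩ := hg V x
      obtain ⟨z, hz⟩ := exists_addCommGrpSheaf_glue Z (fun f z => ∃ y,
        S.g.hom.app _ y = S.X₃.obj.map f.op x ∧ k.hom.app _ y = z) (by
          rintro V' V'' f g _ ⟨y, hy, rfl⟩
          refine ⟨S.X₂.obj.map g.op y, ?_, ?_⟩
          · rw [NatTrans.naturality_apply, hy, op_comp, Functor.map_comp_apply]
          · rw [NatTrans.naturality_apply]) (by
          rintro V' f _ _ ⟨y, hy, rfl⟩ ⟨y', hy', rfl⟩
          exact wd (hy.trans hy'.symm)) hR (fun V' f hf => by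
          obtain ⟨y, hy⟩ := hx f hf
          exact ⟨_, y, hy, rfl⟩)
      exact ⟨z, R, hR, hz⟩
    have uniq {V : C} {x : S.X₃.obj.obj (op V)} {z z' : Z.obj.obj (op V)} (h : P x z)
        (h' : P x z') : z = z' := by
      obtain ⟨R, hR, h⟩ := h
      obtain ⟨R', hR', h'⟩ := h'
      refine addCommGrpSheaf_ext Z (J.intersection_covering hR hR') fun V' f hf => ?_
      obtain ⟨y, hy, hz⟩ := h f hf.1
      obtain ⟨y', hy', hz'⟩ := h' f hf.2
      rw [← hz, ← hz']
      exact wd (hy.trans hy'.symm)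
    have add {V : C} {x x' : S.X₃.obj.obj (op V)} {z z' : Z.obj.obj (op V)} (h : P x z)
        (h' : P x' z') : P (x + x') (z + z') := by
      obtain ⟨R, hR, h⟩ := h
      obtain ⟨R', hR', h'⟩ := h'
      refine ⟨_, J.intersection_covering hR hR', fun V' f hf => ?_⟩
      obtain ⟨y, hy, hz⟩ := h f hf.1
      obtain ⟨y', hy', hz'⟩ := h' f hf.2
      exact ⟨y + y', by simp [hy, hy'], by simp [hz, hz']⟩
    have res {V V' : C} (f : V' ⟶ V) {x : S.X₃.obj.obj (op V)} {z : Z.obj.obj (op V)} (h : P x z) :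
        P (S.X₃.obj.map f.op x) (Z.obj.map f.op z) := by
      obtain ⟨R, hR, h⟩ := h
      refine ⟨_, J.pullback_stable f hR, fun V'' g hg => ?_⟩
      obtain ⟨y, hy, hz⟩ := h _ hg
      exact ⟨y, by rw [hy, op_comp, Functor.map_comp_apply],
        by rw [hz, op_comp, Functor.map_comp_apply]⟩
    choose l hl using @ex
    refine ⟨⟨⟨fun V => AddCommGrpCat.ofHom (AddMonoidHom.mk' (l (V := V.unop)) fun x y =>
      uniq (hl _) (add (hl _) (hl _))), ?_⟩⟩, ?_⟩
    · intro V V' f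
      ext z
      exact uniq (hl _) (res f.unop (hl z))
    · ext V z
      exact uniq (hl _) ⟨⊤, J.top_mem _, fun V' f _ => ⟨S.X₂.obj.map f.op z,
        NatTrans.naturality_apply _ _ _, NatTrans.naturality_apply _ _ _⟩⟩
  have hm {Z : Sheaf J AddCommGrpCat.{w}} {l l' : S.X₃ ⟶ Z} (e : S.g ≫ l = S.g ≫ l') : l = l' := by
    ext V x
    obtain ⟨R, hR, hx⟩ := hg V.unop x
    refine addCommGrpSheaf_ext Z hR fun V' f hf => ?_
    obtain ⟨y, hy⟩ := hx f hf
    have := ConcreteCategory.congr_hom (NatTrans.congr_app (congrArg (·.hom) e) (op V')) y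
    replace this : l.hom.app _ (S.g.hom.app _ y) = l'.hom.app _ (S.g.hom.app _ y) := this
    rw [hy, NatTrans.naturality_apply, NatTrans.naturality_apply] at this
    exact this
  choose l hl using @key
  exact ⟨CokernelCofork.IsColimit.ofπ _ _ (fun k e => l k e) (fun k e => hl k e)
    fun k e m hm' => hm (hm'.trans (hl k e).symm)⟩

end AbelianSheaves
end AlgebraicSpace

/-! ### Exactness checked on a basis -/

namespace AlgebraicSpace

section AbelianSheaves

universe w v u'

variable {C : Type u'} [Category.{v} C] {J : GrothendieckTopology C}

instance : HasZeroObject (Sheaf J AddCommGrpCat.{w}) :=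
  hasZeroObject_of_hasTerminal_object

variable {O A B D : Sheaf J AddCommGrpCat.{w}} {α : O ⟶ A} {β : O ⟶ B} {γ : A ⟶ D}
  {δ : B ⟶ D}

/-- Sections of a fibre product of sheaves may be checked on a basis. -/
lemma sections_of_local {Good : C → Prop}
    (hcov : ∀ V : C, Sieve.generate (fun V' (_ : V' ⟶ V) => Good V') ∈ J V)
    (h₁ : ∀ V, Good V → ∀ s, α.hom.app (op V) s = 0 → β.hom.app (op V) s = 0 → s = 0)
    (h₂ : ∀ V, Good V → ∀ a b, γ.hom.app (op V) a = δ.hom.app (op V) b →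
      ∃ s, α.hom.app _ s = a ∧ β.hom.app _ s = b) (V : Cᵒᵖ) :
    (∀ s s', α.hom.app V s = α.hom.app V s' → β.hom.app V s = β.hom.app V s' → s = s') ∧
      ∀ a b, γ.hom.app V a = δ.hom.app V b → ∃ s, α.hom.app V s = a ∧ β.hom.app V s = b := by
  have key (V : C) (s s') (ha : α.hom.app (op V) s = α.hom.app (op V) s')
      (hb : β.hom.app (op V) s = β.hom.app (op V) s') : s = s' := by
    refine addCommGrpSheaf_ext O (hcov V) ?_
    rintro V' _ ⟨V'', g, f, hV, rfl⟩
    have : O.obj.map f.op s = O.obj.map f.op s' := by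
      rw [← sub_eq_zero]
      refine h₁ _ hV _ ?_ ?_
      · rw [map_sub, NatTrans.naturality_apply, NatTrans.naturality_apply, ha, sub_self]
      · rw [map_sub, NatTrans.naturality_apply, NatTrans.naturality_apply, hb, sub_self]
    rw [op_comp, Functor.map_comp_apply, this, Functor.map_comp_apply]
  refine ⟨key V.unop, fun a b hab => ?_⟩
  have hres {V' V'' : C} (f : V' ⟶ V.unop) (g : V'' ⟶ V') (x : O.obj.obj (op V'))
      (hx : α.hom.app _ x = A.obj.map f.op a ∧ β.hom.app _ x = B.obj.map f.op b) :
      α.hom.app _ (O.obj.map g.op x) = A.obj.map (g ≫ f).op a ∧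
        β.hom.app _ (O.obj.map g.op x) = B.obj.map (g ≫ f).op b := by
    rw [NatTrans.naturality_apply, NatTrans.naturality_apply, hx.1, hx.2, op_comp,
      Functor.map_comp_apply, Functor.map_comp_apply]
    exact ⟨rfl, rfl⟩
  obtain ⟨x, hx⟩ := exists_addCommGrpSheaf_glue O (V := V.unop) (fun f s =>
    α.hom.app _ s = A.obj.map f.op a ∧ β.hom.app _ s = B.obj.map f.op b) hres
    (fun f s s' hs hs' => key _ _ _ (hs.1.trans hs'.1.symm) (hs.2.trans hs'.2.symm))
    (hcov V.unop) (by
      rintro V' _ ⟨V'', g, f, hV, rfl⟩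
      obtain ⟨s, hs⟩ := h₂ _ hV (A.obj.map f.op a) (B.obj.map f.op b) (by
        rw [NatTrans.naturality_apply, NatTrans.naturality_apply]
        exact congrArg _ hab)
      exact ⟨_, hres f g s hs⟩)
  refine ⟨x, addCommGrpSheaf_ext A (hcov V.unop) fun V' f hf => ?_,
    addCommGrpSheaf_ext B (hcov V.unop) fun V' f hf => ?_⟩
  · exact (NatTrans.naturality_apply α.hom f.op x).symm.trans (hx f hf).1
  · exact (NatTrans.naturality_apply β.hom f.op x).symm.trans (hx f hf).2

/-- Exactness of the sequence attached to a square of sheaves of abelian groups may be checked on a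
basis. -/
lemma shortExact_of_local [HasBinaryBiproduct A B] {Good : C → Prop}
    (hcov : ∀ V : C, Sieve.generate (fun V' (_ : V' ⟶ V) => Good V') ∈ J V)
    (e' : biprod.lift α β ≫ biprod.desc γ (-δ) = 0)
    (h₁ : ∀ V, Good V → ∀ s, α.hom.app (op V) s = 0 → β.hom.app (op V) s = 0 → s = 0)
    (h₂ : ∀ V, Good V → ∀ a b, γ.hom.app (op V) a = δ.hom.app (op V) b →
      ∃ s, α.hom.app _ s = a ∧ β.hom.app _ s = b)
    (h₃ : ∀ V, Good V → Function.Surjective (γ.hom.app (op V))) :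
    (ShortComplex.mk _ _ e').ShortExact := by
  have key := sections_of_local hcov h₁ h₂
  have app_comp {F G H : Sheaf J AddCommGrpCat.{w}} {f : F ⟶ G} {g : G ⟶ H} {h : F ⟶ H}
      (e : f ≫ g = h) (V : Cᵒᵖ) (x : F.obj.obj V) :
      g.hom.app V (f.hom.app V x) = h.hom.app V x := by rw [← e]; rfl
  have ext {V : Cᵒᵖ} {x y : (A ⊞ B).obj.obj V}
      (ha : (biprod.fst : A ⊞ B ⟶ A).hom.app V x = (biprod.fst : A ⊞ B ⟶ A).hom.app V y)
      (hb : (biprod.snd : A ⊞ B ⟶ B).hom.app V x = (biprod.snd : A ⊞ B ⟶ B).hom.app V y) :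
      x = y := by
    have (z : (A ⊞ B).obj.obj V) : (biprod.inl : A ⟶ A ⊞ B).hom.app V
        ((biprod.fst : A ⊞ B ⟶ A).hom.app V z) + (biprod.inr : B ⟶ A ⊞ B).hom.app V
        ((biprod.snd : A ⊞ B ⟶ B).hom.app V z) = z :=
      ConcreteCategory.congr_hom (NatTrans.congr_app (congrArg (·.hom)
        (biprod.total (X := A) (Y := B))) V) z
    rw [← this x, ← this y, ha, hb]
  have hk : ∀ V x, (biprod.desc γ (-δ)).hom.app V x = 0 →
      ∃ y, (biprod.lift α β).hom.app V y = x := by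
    intro V x hx
    have h : (biprod.desc γ (-δ)).hom.app V x = γ.hom.app V
        ((biprod.fst : A ⊞ B ⟶ A).hom.app V x) - δ.hom.app V
        ((biprod.snd : A ⊞ B ⟶ B).hom.app V x) := by
      have : biprod.desc γ (-δ) = biprod.fst ≫ γ - biprod.snd ≫ δ := by
        rw [biprod.desc_eq, Preadditive.comp_neg, sub_eq_add_neg]
      rw [this]
      rfl
    rw [hx, eq_comm, sub_eq_zero] at h
    obtain ⟨s, hs, hs'⟩ := (key V).2 _ _ h
    refine ⟨s, ext ?_ ?_⟩
    · rw [app_comp (biprod.lift_fst _ _), hs]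
    · rw [app_comp (biprod.lift_snd _ _), hs']
  obtain ⟨hf⟩ := nonempty_isLimit_of_sections (S := ShortComplex.mk _ _ e') (fun V s s' hs => by
    refine (key V).1 s s' ?_ ?_
    · rw [← app_comp (biprod.lift_fst α β), ← app_comp (biprod.lift_fst α β)]
      exact congrArg _ hs
    · rw [← app_comp (biprod.lift_snd α β), ← app_comp (biprod.lift_snd α β)]
      exact congrArg _ hs) hk
  obtain ⟨hg⟩ := nonempty_isColimit_of_sections (S := ShortComplex.mk _ _ e') hk (fun V x => by
    refine ⟨_, hcov V, ?_⟩
    rintro V' _ ⟨V'', g, f, hV, rfl⟩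
    -- Surjectivity of γ alone suffices: the pair with second entry zero is a local preimage.
    obtain ⟨a, ha⟩ := h₃ _ hV (D.obj.map f.op x)
    refine ⟨(biprod.inl : A ⟶ A ⊞ B).hom.app _ (A.obj.map g.op a), ?_⟩
    refine (app_comp (biprod.inl_desc _ _) _ _).trans ?_
    rw [NatTrans.naturality_apply, ha, op_comp, Functor.map_comp_apply])
  exact shortExact_of_isLimit_of_isColimit hf hg

end AbelianSheaves

/-! ### The gluing sequence on the small étale site of W -/

section

variable {Y X₁ X₂ W : Scheme.{u}ᵒᵖ ⥤ Type u} {i₁ : Y ⟶ X₁} {i₂ : Y ⟶ X₂} {a : X₁ ⟶ W} {b : X₂ ⟶ W}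
  {c : Y ⟶ W} (ha : yoneda.relativelyRepresentable a) (hb : yoneda.relativelyRepresentable b)
  (hc : yoneda.relativelyRepresentable c) (ea : i₁ ≫ a = c) (eb : i₂ ≫ b = c)

lemma isPullback_pullbackMap (sq : IsPullback i₁ i₂ a b) (V : SmallEtale W) :
    IsPullback (pullbackMap ha i₁ hc ea V) (pullbackMap hb i₂ hc eb V) (ha.snd V.hom)
      (hb.snd V.hom) := by
  refine ⟨⟨by rw [pullbackMap_snd, pullbackMap_snd]⟩, ⟨PullbackCone.IsLimit.mk _
    (fun s => hc.lift (sq.lift (yoneda.map s.fst ≫ ha.fst _) (yoneda.map s.snd ≫ hb.fst _) ?_)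
      (s.fst ≫ ha.snd V.hom) ?_) ?_ ?_ ?_⟩⟩
  · rw [Category.assoc, Category.assoc, ha.w, hb.w, ← Functor.map_comp_assoc,
      ← Functor.map_comp_assoc, s.condition]
  · rw [← ea, sq.lift_fst_assoc, Category.assoc, ha.w, Functor.map_comp, Category.assoc]
  · intro s
    apply ha.hom_ext
    · rw [Functor.map_comp, Category.assoc, pullbackMap_fst, hc.lift_fst_assoc, sq.lift_fst]
    · rw [Category.assoc, pullbackMap_snd, hc.lift_snd]
  · intro s
    apply hb.hom_ext
    · rw [Functor.map_comp, Category.assoc, pullbackMap_fst, hc.lift_fst_assoc, sq.lift_snd]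
    · rw [Category.assoc, pullbackMap_snd, hc.lift_snd, s.condition]
  · intro s m h₁ h₂
    apply hc.hom_ext
    · rw [hc.lift_fst]
      apply sq.hom_ext
      · rw [Category.assoc, sq.lift_fst, ← pullbackMap_fst ha i₁ hc ea, ← h₁, Functor.map_comp,
          Category.assoc]
      · rw [Category.assoc, sq.lift_snd, ← pullbackMap_fst hb i₂ hc eb, ← h₂, Functor.map_comp,
          Category.assoc]
    · rw [hc.lift_snd, ← h₁, Category.assoc, pullbackMap_snd]

/-- Étale locally on the quotient, the square is glued. -/
lemma IsChartQuotient.exists_isGlued {w : ∀ d : Chart i₁ i₂, yoneda.obj d.U ⟶ W}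
    (hw : IsChartQuotient w) (he : ∀ d, MorphismProperty.presheaf @Etale.{u} (w d))
    (h₁ : ∀ d : Chart i₁ i₂, IsPullback d.p₁ (yoneda.map d.j₁) a (w d))
    (h₂ : ∀ d : Chart i₁ i₂, IsPullback d.p₂ (yoneda.map d.j₂) b (w d))
    (sq : IsPullback i₁ i₂ a b) (V : SmallEtale W) (x : V.left) :
    ∃ (V' : SmallEtale W) (g : V' ⟶ V) (y : V'.left), g.left y = x ∧
      IsGlued (pullbackMap ha i₁ hc ea V') (pullbackMap hb i₂ hc eb V') (ha.snd V'.hom)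
        (hb.snd V'.hom) := by
  obtain ⟨T, f, v, _, rfl, d, s, hs⟩ := hw.covers V.left (V.hom.app _ (𝟙 _)) x
  obtain ⟨O, hO, hv, -⟩ := exists_isAffineOpen_mem_and_subset (U := ⊤) (x := v) trivial
  have : IsAffine O := hO
  let V' : SmallEtale W := ⟨O, yoneda.map (O.ι ≫ f) ≫ V.hom,
    presheaf_etale_comp (presheaf_etale_map _) V.etale⟩
  have ht : yoneda.map (O.ι ≫ s) ≫ w d = V'.hom := by
    simp only [V']
    rw [Functor.map_comp, Functor.map_comp, Category.assoc, Category.assoc, yoneda_map_comp_eq hs]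
  have : Etale (O.ι ≫ s) := SmallEtale.etale_left (U := V') (V := ⟨_, w d, he d⟩) ⟨_, ht⟩
  have key {X : Scheme.{u}ᵒᵖ ⥤ Type u} {a : X ⟶ W} (ha : yoneda.relativelyRepresentable a)
      {U : Scheme.{u}} {p : yoneda.obj U ⟶ X} {j : U ⟶ d.U} (h : IsPullback p (yoneda.map j) a (w d)) :
      ∃ f₁, IsPullback (ha.snd V'.hom) f₁ (O.ι ≫ s) j := by
    have sq : IsPullback (ha.fst V'.hom) (yoneda.map (ha.snd V'.hom)) a
        (yoneda.map (O.ι ≫ s) ≫ w d) := by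
      rw [ht]
      exact ha.isPullback V'.hom
    obtain ⟨e, he⟩ := exists_isPullback_of_comp h sq
    obtain ⟨e, rfl⟩ := yoneda.map_surjective e
    exact ⟨e, (he.of_map_of_faithful yoneda).flip⟩
  obtain ⟨f₁, hf₁⟩ := key ha (h₁ d)
  obtain ⟨f₂, hf₂⟩ := key hb (h₂ d)
  -- The affine neighbourhood is étale, hence flat, over the chart `d.U`, so the glued structure of
  -- `d` pulls back to it.
  exact ⟨V', ⟨O.ι ≫ f, rfl⟩, ⟨v, hv⟩, rfl,
    d.glued.of_flat hf₁ hf₂ (isPullback_pullbackMap ha hb hc ea eb sq V')⟩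

end

/-- Exactness of the gluing sequence. -/
lemma shortExact_gluingSequence {Y X₁ X₂ W : AlgSp.{u}} (i₁ : Y ⟶ X₁) (i₂ : Y ⟶ X₂) (a : X₁ ⟶ W)
    (b : X₂ ⟶ W) (c : Y ⟶ W) (ha : yoneda.relativelyRepresentable a.hom)
    (hb : yoneda.relativelyRepresentable b.hom) (hc : yoneda.relativelyRepresentable c.hom)
    (ea : i₁ ≫ a = c) (eb : i₂ ≫ b = c)
    (h : ∀ (V : SmallEtale W.obj) (x : V.left), ∃ (V' : SmallEtale W.obj) (g : V' ⟶ V)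
      (y : V'.left), g.left y = x ∧ IsGlued (pullbackMap ha i₁.hom hc (congrArg (·.hom) ea) V')
        (pullbackMap hb i₂.hom hc (congrArg (·.hom) eb) V') (ha.snd V'.hom) (hb.snd V'.hom)) :
    (gluingSequence i₁ i₂ a b c ha hb hc ea eb).ShortExact := by
  refine shortExact_of_local (Good := fun V => IsGlued
    (pullbackMap ha i₁.hom hc (congrArg (·.hom) ea) V)
    (pullbackMap hb i₂.hom hc (congrArg (·.hom) eb) V) (ha.snd V.hom) (hb.snd V.hom)) ?_ _ ?_ ?_ ?_
  · intro V x
    obtain ⟨V', g, y, hy, hV'⟩ := h V x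
    exact ⟨V', g, y, ⟨V', 𝟙 _, g, hV', Category.id_comp _⟩, hy⟩
  · intro V hV s h₁ h₂
    exact hV.eq_zero s h₁ h₂
  · intro V hV s t e
    exact hV.exists_section s t e
  · intro V hV
    have := hV.closed_k₁
    have := hV.isAffine₁
    exact (IsClosedImmersion.isAffine_surjective_of_isAffine
      (pullbackMap ha i₁.hom hc (congrArg (·.hom) ea) V)).2

end AlgebraicSpace

/-! ### Assembly of the pushout -/

namespace AlgebraicSpace

lemma mono_of_presheaf_isClosedImmersion {F G : Scheme.{u}ᵒᵖ ⥤ Type u} {f : F ⟶ G}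
    (hf : MorphismProperty.presheaf @IsClosedImmersion.{u} f) : Mono f := by
  refine mono_iff_forall.2 fun T x y e => ?_
  obtain ⟨S, m, q, sq⟩ := hf.rep (yonedaEquiv.symm (f.app _ x))
  have : IsClosedImmersion m := hf.property _ _ _ sq
  obtain ⟨s, hs, hs'⟩ := IsPullback.exists_hom sq x (𝟙 T) (by simp)
  obtain ⟨t, ht, ht'⟩ := IsPullback.exists_hom sq y (𝟙 T) (by simp [e])
  rw [← hs, ← ht, (cancel_mono m).1 (hs'.trans ht'.symm)]

lemma presheaf_isClosedImmersion_comp {F G H : Scheme.{u}ᵒᵖ ⥤ Type u} {f : F ⟶ G} {g : G ⟶ H}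
    (hf : MorphismProperty.presheaf @IsClosedImmersion.{u} f)
    (hg : MorphismProperty.presheaf @IsClosedImmersion.{u} g) :
    MorphismProperty.presheaf @IsClosedImmersion.{u} (f ≫ g) := by
  have hE : MorphismProperty.IsMultiplicative @IsClosedImmersion.{u} := inferInstance
  have := hE.toIsStableUnderComposition
  have := MorphismProperty.relative_isStableUnderComposition (F := yoneda)
    (P := @IsClosedImmersion.{u})
  exact this.comp_mem _ _ hf hg

lemma IsChartQuotient.jointlySurjective {Y X₁ X₂ W : Scheme.{u}ᵒᵖ ⥤ Type u} {i₁ : Y ⟶ X₁}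
    {i₂ : Y ⟶ X₂} {w : ∀ c : Chart i₁ i₂, yoneda.obj c.U ⟶ W} {a : X₁ ⟶ W} {b : X₂ ⟶ W}
    (hw : IsChartQuotient w) (ha : ∀ c, c.p₁ ≫ a = yoneda.map c.j₁ ≫ w c)
    (hb : ∀ c, c.p₂ ≫ b = yoneda.map c.j₂ ≫ w c) : JointlySurjective a b := by
  have key {X : Scheme.{u}ᵒᵖ ⥤ Type u} {a : X ⟶ W} {c : Chart i₁ i₂} {U : Scheme.{u}}
      {p : yoneda.obj U ⟶ X} {j : U ⟶ c.U} (h : p ≫ a = yoneda.map j ≫ w c) {T V : Scheme.{u}}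
      {x : W.obj (op T)} {f : V ⟶ T} {s : V ⟶ c.U} (hs : (w c).app _ s = W.map f.op x) {z : U}
      {v : V} (hz : j z = s v) : ∃ (V' : Scheme.{u}) (g : V' ⟶ T) (v' : V'), g v' = f v ∧
        ∃ y, a.app _ y = W.map g.op x := by
    obtain ⟨v', hv', -⟩ := Scheme.Pullback.exists_preimage_pullback (f := s) (g := j) v z hz.symm
    refine ⟨pullback s j, pullback.fst _ _ ≫ f, v', by rw [Scheme.Hom.comp_apply, hv'],
      p.app _ (pullback.snd s j), ?_⟩
    rw [← comp_app_apply', h, yoneda_map_comp_app, ← pullback.condition, ← map_app_yoneda, hs,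
      map_map]
  intro T x y
  obtain ⟨V, f, v, -, rfl, c, s, hs⟩ := hw.covers T x y
  obtain ⟨z, hz⟩ | ⟨z, hz⟩ := c.glued.range_union (s v)
  · obtain ⟨V', g, v', h₁, h₂⟩ := key (ha c) hs hz
    exact ⟨V', g, v', h₁, .inl h₂⟩
  · obtain ⟨V', g, v', h₁, h₂⟩ := key (hb c) hs hz
    exact ⟨V', g, v', h₁, .inr h₂⟩

end AlgebraicSpace

open AlgebraicSpace
theorem mainTheorem10 {Y X₁ X₂ : AlgSp.{u}} (i₁ : Y ⟶ X₁) (i₂ : Y ⟶ X₂)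
    (h₁ : IsClosedImm i₁) (h₂ : IsClosedImm i₂) :
    ∃ (W : AlgSp.{u}) (a : X₁ ⟶ W) (b : X₂ ⟶ W) (c : Y ⟶ W)
      (ea : i₁ ≫ a = c) (eb : i₂ ≫ b = c)
      (ha : IsClosedImm a) (hb : IsClosedImm b) (hc : IsClosedImm c),
      IsPushout i₁ i₂ a b ∧
      IsPullback i₁ i₂ a b ∧
      IsPushout (topSpace.map i₁) (topSpace.map i₂) (topSpace.map a) (topSpace.map b) ∧
      (gluingSequence i₁ i₂ a b c ha.rep hb.rep hc.rep ea eb).ShortExact := by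
  have hY := Y.property
  have hX₁ := X₁.property
  have hX₂ := X₂.property
  have hm₁ := mono_of_presheaf_isClosedImmersion h₁
  obtain ⟨W, w, hw⟩ := exists_isChartQuotient hX₁ hX₂ h₁ h₂
  have hc₁ := Chart.etaleCovers₁ hX₁ hX₂ h₁ h₂
  have hc₂ := Chart.etaleCovers₁ hX₂ hX₁ h₂ h₁
  have hc₂' : EtaleCovers (fun d : Chart i₁.hom i₂.hom => d.p₂) := fun T x y => by
    obtain ⟨V, f, v, hf, hv, d, t, ht⟩ := hc₂ T x y
    exact ⟨V, f, v, hf, hv, d.swap, t, ht⟩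
  obtain ⟨a, ha⟩ := hw.exists_inl h₁ h₂ hc₁
  -- The results about the second inclusion are those about the first, applied to the charts with
  -- their pieces interchanged.
  obtain ⟨b, hb⟩ := hw.swap.exists_inl h₂ h₁ hc₂
  replace hb : ∀ d : Chart i₁.hom i₂.hom, d.p₂ ≫ b = yoneda.map d.j₂ ≫ w d := fun d => hb d.swap
  have pa := hw.isPullback_inl hX₁.isSheaf hc₁ ha
  have pb := hw.swap.isPullback_inl hX₂.isSheaf hc₂ (fun d => hb d.swap)
  have hR := Chart.exists_isPullback_quotient h₁ h₂ hw pa pb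
  obtain ⟨I, d, hd₁, hd₂⟩ := Chart.exists_family hX₁ hX₂ h₁ h₂
  have hW := hw.isAlgebraicSpace hR ha hb hd₁ hd₂
  have sq := hw.isPullback hY.isSheaf hX₁.isSheaf hX₂.isSheaf hc₁ hc₂ ha hb
  have hma := hw.mono_inl hX₁.isSheaf hc₁ ha
  have hmb := hw.swap.mono_inl hX₂.isSheaf hc₂ (fun d => hb d.swap)
  have ka := hw.isClosedImmersion_inl hX₁.isSheaf pa
  have kb := hw.swap.isClosedImmersion_inl hX₂.isSheaf pb
  let W' : AlgSp.{u} := ⟨W, hW⟩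
  let a' : X₁ ⟶ W' := ⟨a⟩
  let b' : X₂ ⟶ W' := ⟨b⟩
  have e : i₁ ≫ a' = i₂ ≫ b' := by ext : 1; exact sq.w
  have hc' : IsClosedImm (i₁ ≫ a') := presheaf_isClosedImmersion_comp h₁ ka
  refine ⟨W', a', b', i₁ ≫ a', rfl, e.symm, ka, kb, hc', ?_, ?_, ?_, ?_⟩
  · have key {Z : AlgSp.{u}} (g₁ : X₁ ⟶ Z) (g₂ : X₂ ⟶ Z) (e : i₁ ≫ g₁ = i₂ ≫ g₂) :
        ∃ φ : W' ⟶ Z, a' ≫ φ = g₁ ∧ b' ≫ φ = g₂ := by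
      obtain ⟨φ, hφ₁, hφ₂⟩ := hw.exists_algebraicSpace_desc Z.property hc₁ hc₂' ha hb g₁.hom g₂.hom
        (congrArg (·.hom) e)
      exact ⟨⟨φ⟩, by ext : 1; exact hφ₁, by ext : 1; exact hφ₂⟩
    choose φ hφ₁ hφ₂ using @key
    refine ⟨⟨e⟩, ⟨PushoutCocone.IsColimit.mk e (fun s => φ s.inl s.inr s.condition)
      (fun s => hφ₁ _ _ _) (fun s => hφ₂ _ _ _) fun s m hm₁ hm₂ => ?_⟩⟩
    ext : 1
    exact hw.algebraicSpace_hom_ext s.pt.property ha hb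
      (congrArg (·.hom) (hm₁.trans (hφ₁ _ _ s.condition).symm))
      (congrArg (·.hom) (hm₂.trans (hφ₂ _ _ s.condition).symm))
  · exact IsPullback.of_map_of_faithful (ObjectProperty.ι _) sq
  · exact isPushout_topSpace sq (hw.jointlySurjective ha hb) ka kb
  · exact shortExact_gluingSequence _ _ _ _ _ _ _ _ _ _ fun V x =>
      hw.exists_isGlued _ _ _ _ _ (hw.presheaf_etale hR) pa (fun d => pb d.swap) sq V x
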